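/- **Parameters.** Fix $\log q,\log d\in\mathbb C$, put $q=e^{\log q}$, $d=e^{\log d}$, $q_1=q^{-1}d$, $q_2=q^2$, $q_3=q^{-1}d^{-1}$, and assume that for rational $a,b$ one has $q^ad^b=1$ only if $a=b=0$. Complex powers of $q,q_1,q_2,q_3$ are taken with the chosen logarithms. Let $m\ge 1$ and let $\mu,\nu\in\mathbb C$ be generic: none of $q_2^{\mu},q_2^{\nu},q_2^{\mu+\nu}$ lies in $q_1^{\mathbb Z}q_2^{\mathbb Z}$ (in particular $\mu,\nu,\mu+\nu\notin\mathbb Z$). **Algebra.** For $i,j\in\mathbb Z/2$ let $g_{i,j}(z,w)=z-q_2w$ if $i=j$ and $(z-q_1w)(z-q_3w)$ if $i\ne j$. Let $\mathcal E$ be the unital associative algebra generated by the coefficients of $E_i(z)=\sum_{k\in\mathbb Z}E_{i,k}z^{-k}$, $F_i(z)=\sum_{k\in\mathbb Z}F_{i,k}z^{-k}$, $K_i^\pm(z)=K_i^{\pm1}\exp\bigl(\pm(q-q^{-1})\sum_{r>0}H_{i,\pm r}z^{\mp r}\bigr)$ and an invertible central element $\mathsf t$, with the relations: all coefficients of $K^\pm_0(z),K_1^\pm(z)$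 commute; $$(-1)^{i+j}g_{i,j}(z,w)K_i^\pm(z)E_j(w)+g_{j,i}(w,z)E_j(w)K_i^\pm(z)=0,\qquad(-1)^{i+j}g_{j,i}(w,z)K_i^\pm(z)F_j(w)+g_{i,j}(z,w)F_j(w)K_i^\pm(z)=0,$$ $$[E_i(z),F_j(w)]=\tfrac{\delta_{ij}}{q-q^{-1}}\,\delta(z/w)\,(K_i^+(w)-K_i^-(z)),$$ $$(-1)^{i+j}g_{i,j}(z,w)E_i(z)E_j(w)+g_{j,i}(w,z)E_j(w)E_i(z)=0,\qquad (-1)^{i+j}g_{j,i}(w,z)F_i(z)F_j(w)+g_{i,j}(z,w)F_j(w)F_i(z)=0,$$ $$\mathrm{Sym}_{z_1,z_2,z_3}[X_i(z_1),[X_i(z_2),[X_i(z_3),X_{i+1}(w)]_{q^2}]]_{q^{-2}}=0\quad(X=E,F),$$ where $[A,B]_p=AB-pBA$ and $\delta(z)=\sum_{k\in\mathbb Z}z^k$. A rational function $f$ is balanced if it is regular at $0,\infty$ and $f(0)f(\infty)=1$. A vector $v$ has $\ell$-weight $\phi=(\phi^0,\phi^1)$ if $K_i^\pm(z)v=\phi^i(z)v$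 ($\phi^i$ expanded at $z=\infty$ for $+$, at $z=0$ for $-$). A module is tame if it has a basis of $\ell$-weight vectors with pairwise distinct balanced $\ell$-weights, and has level $\kappa$ if $K_0K_1$ acts by $\kappa$. **Boxes.** A box $\Box$ has coordinates $(x,y,z)\in\mathbb C^3$, a color in $\mathbb Z/2$ and the position $p(\Box)=q_1^{-x}q_2^{-y}q_3^{-z}$. The boxes are, for $i,k\in\mathbb Z_{\ge0}$: (bottom) $(i,k,1)$ of color $i+1$; (pedestal) $(i+1,k+\mu,0)$ of color $i+1$; and, for $k\in\mathbb Z$: (tower) $(-s,\mu+\nu+k,s)$ of color $0$, $0\le s\le m$, and $(-1-s,\mu+\nu+k,s)$ of color $1$, $0\le s\le m-1$. Tower boxes with $k<0$ are negative, all other boxes are positive. Bottom boxes precede pedestal boxes, which precede tower boxes; each family is ordered lexicographically by $y$, then $z$, then $x$. **States.** A state is given by two partitions and integers $a_0,\dots,a_m$, $b_0,\dots,b_{m-1}$ with $b_s\ge a_s$ and $b_s\ge a_{s+1}$ for $0\le s\le m-1$. It is the finite set $\lambda=\lambda^+\sqcup\lambda^-$ of positive and negative boxes consisting of: the bottom boxes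 $(i,k,1)$ and the pedestal boxes $(i+1,k+\mu,0)$ with $(i,k)$ in the Young diagram of the first, respectively second, partition; and, in the tower column of color $0$ (resp. $1$) with index $s$, the boxes with $0\le k<n$ if $n\ge0$, with $n\le k<0$ if $n<0$, where $n=a_s$ (resp. $n=b_s$). Let $S=S(G_{0,m}^{\mu,\nu})$ be the set of states; $\emptyset$ is the reference state. For $\lambda\in S$, adding a box, $\lambda\sqcup\Box$, means putting a positive box $\Box\notin\lambda$ into $\lambda$ or deleting a negative box $\Box\in\lambda$ from $\lambda$; removing a box, $\lambda\setminus\Box$, means deleting a positive box $\Box\in\lambda$ or putting in a negative box $\Box\notin\lambda$. Let $CC_i(\lambda)$, $CV_i(\lambda)$ be the sets of boxes of color $i$ such that $\lambda\sqcup\Box\in S$, respectively $\lambda\setminus\Box\in S$. **Weights.** Let $$A_{0,a}(z)=\Bigl(\tfrac{q_2z-a}{z-q_2a},\tfrac{(q_1z-a)(q_3z-a)}{(z-q_1a)(z-q_3a)}\Bigr),\qquad A_{1,a}(z)=\Bigl(\tfrac{(q_1z-a)(q_3z-a)}{(z-q_1a)(z-q_3a)},\tfrac{q_2z-a}{z-q_2a}\Bigr),$$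 and let $\Psi=\Psi(G_{0,m}^{\mu,\nu})=(\Psi^0,\Psi^1)$ be given by $$\Psi^0=q^{-\mu-2\nu}q_3^{-m+1}\frac{(z-q_3^{-2})(z-q_1^{-1}q_3^{-1}q_2^{-\mu})\prod_{i=1}^{m-1}(z-q_2^{-\mu-\nu}q_1^iq_3^{-i})}{\prod_{i=0}^m(z-q_2^{-\mu-\nu+1}q_1^iq_3^{-i})},$$ $$\Psi^1=q^{\mu+2\nu}q_3^m\frac{\prod_{i=0}^{m+1}(z-q_1^{i-1}q_3^{-i}q_2^{-\mu-\nu})}{(z-q_3^{-1})(z-q_1^{-1}q_2^{-\mu})\prod_{i=0}^{m-1}(z-q_1^{i+1}q_3^{-i}q_2^{-\mu-\nu})}.$$ The weight of a box of color $c$ and position $p$ is $w_\Box=A_{c,p}^{-1}$ if the box is positive and $w_\Box=A_{c,p}$ if it is negative. Put $\phi_\lambda=\Psi\prod_{\Box\in\lambda}w_\Box$. For a box $\Box$ put $\phi_{\lambda,<\Box}=\prod_{\Box_1\in\lambda,\Box_1<\Box}w_{\Box_1}$ and $\phi_{\lambda,>\Box}=\prod_{\Box_1\in\lambda,\Box_1>\Box}w_{\Box_1}$,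 and multiply by $\Psi$ the first of these if $\Box$ is positive, the second if $\Box$ is negative. **Action.** On $V=\bigoplus_{\lambda\in S}\mathbb C|\lambda\rangle$ consider $$K_i^\pm(z)|\lambda\rangle=\phi_\lambda^i(z)|\lambda\rangle,\quad F_i(z)|\lambda\rangle=\sum_{\Box\in CC_i(\lambda)}a^i_{\lambda,\Box}\,\delta(z/p(\Box))|\lambda\sqcup\Box\rangle,\quad E_i(z)|\lambda\rangle=\sum_{\Box\in CV_i(\lambda)}b^i_{\lambda,\Box}\,\delta(z/p(\Box))|\lambda\setminus\Box\rangle,\quad \mathsf t|\lambda\rangle=|\lambda\rangle,$$ where for positive $\Box$ one has $a^i_{\lambda,\Box}=\phi^i_{\lambda,>\Box}(p(\Box))$, $b^i_{\lambda,\Box}=\frac1{q-q^{-1}}\operatorname{res}_{z=p(\Box)}\phi^i_{\lambda,<\Box}(z)\frac{dz}z$, and for negative $\Box$ one has $a^i_{\lambda,\Box}=\frac{-1}{q-q^{-1}}\operatorname{res}_{z=p(\Box)}\phi^i_{\lambda,>\Box}(z)\frac{dz}z$, $b^i_{\lambda,\Box}=\phi^i_{\lambda,<\Box}(p(\Box))$.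 **Proposition.** These formulas are well defined (all $\phi^i_\lambda$ are balanced, all sums are finite, and every function that is evaluated at $p(\Box)$ is regular there), and they make $V$ into an $\mathcal E$-module $G_{0,m}^{\mu,\nu}$, which is irreducible, tame and of level $q_3$. Moreover, for every $k\in\mathbb Z$ there is an isomorphism of $\mathcal E$-modules $G_{0,m}^{\mu,\nu}\simeq G_{0,m}^{\mu,\nu+k}$. -/

import Mathlib

/-! # The quantum toroidal algebra of type `gl₂`, combinatorial modules over it, and the data of the
slanted relaxed Verma modules -/

namespace Toroidal

/-- The Kronecker symbol on colors. -/
def kron (i j : ZMod 2) : ℂ := if i = j then 1 else 0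

/-! ## Quantum parameters -/

/-- The chosen logarithms of the parameters `q` and `d`. -/
structure QParams where
  logq : ℂ
  logd : ℂ

namespace QParams

noncomputable def q (P : QParams) : ℂ := Complex.exp P.logq
noncomputable def d (P : QParams) : ℂ := Complex.exp P.logd
noncomputable def q₁ (P : QParams) : ℂ := P.q⁻¹ * P.d
noncomputable def q₂ (P : QParams) : ℂ := P.q ^ 2
noncomputable def q₃ (P : QParams) : ℂ := P.q⁻¹ * P.d⁻¹

/-- `q` and `d` are generic: for rational `a, b`, `q ^ a * d ^ b = 1` iff `a = b = 0`. -/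
def Generic (P : QParams) : Prop :=
  ∀ a b : ℚ, Complex.exp ((a : ℂ) * P.logq + (b : ℂ) * P.logd) = 1 ↔ a = 0 ∧ b = 0

/-- The power `q ^ a` with complex exponent, for the chosen logarithm. -/
noncomputable def qPow (P : QParams) (a : ℂ) : ℂ := Complex.exp (a * P.logq)
/-- The power `q₁ ^ a`, `q₁ = q⁻¹ d`. -/
noncomputable def q₁Pow (P : QParams) (a : ℂ) : ℂ := Complex.exp (a * (-P.logq + P.logd))
/-- The power `q₂ ^ a`, `q₂ = q²`. -/
noncomputable def q₂Pow (P : QParams) (a : ℂ) : ℂ := Complex.exp (a * (2 * P.logq))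
/-- The power `q₃ ^ a`, `q₃ = q⁻¹ d⁻¹`. -/
noncomputable def q₃Pow (P : QParams) (a : ℂ) : ℂ := Complex.exp (a * (-P.logq - P.logd))

/-- An exponent `a` is generic if `q₂ ^ a` does not lie in the multiplicative group generated by
`q₁` and `q₂`. In particular a generic exponent is not an integer. -/
def GenericExponent (P : QParams) (a : ℂ) : Prop :=
  ∀ k l : ℤ, P.q₂Pow a ≠ P.q₁ ^ k * P.q₂ ^ l

end QParams

/-! ## The quantum toroidal algebra (parallel realization)

A formal series `X(z, w)` in two variables with coefficients in a module `A` is represented by the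
function `X : ℤ → ℤ → A` whose value `X r s` is the coefficient of `z ^ (-r) * w ^ (-s)`. -/

section Series

variable {A : Type} [AddCommGroup A] [Module ℂ A]

/-- The product `g_{i,j}(z, w) X(z, w)`, where `g_{i,j}(z, w)` is `z - q₂ w` for `i = j` and
`(z - q₁ w) (z - q₃ w)` for `i ≠ j`. -/
noncomputable def gMul (P : QParams) (i j : ZMod 2) (X : ℤ → ℤ → A) : ℤ → ℤ → A := fun r s =>
  if i = j then X (r + 1) s - P.q₂ • X r (s + 1)
  else X (r + 2) s - (P.q₁ + P.q₃) • X (r + 1) (s + 1) + (P.q₁ * P.q₃) • X r (s + 2)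

/-- The product `g_{i,j}(w, z) X(z, w)`. -/
noncomputable def gMulSwap (P : QParams) (i j : ZMod 2) (X : ℤ → ℤ → A) : ℤ → ℤ → A := fun r s =>
  if i = j then X r (s + 1) - P.q₂ • X (r + 1) s
  else X r (s + 2) - (P.q₁ + P.q₃) • X (r + 1) (s + 1) + (P.q₁ * P.q₃) • X (r + 2) s

end Series

/-- The sign `(-1) ^ (i + j)` for colors `i, j`. -/
def colorSign (i j : ZMod 2) : ℂ := if i = j then 1 else -1

/-- Generators: the coefficients `E_{i,k}`, `F_{i,k}` of the currents `E_i(z)`, `F_i(z)`, the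
coefficients of `z ^ (-r)` in `K_i⁺(z)` (`Kp i r`) and of `z ^ r` in `K_i⁻(z)` (`Km i r`), `r ≥ 0`,
and the split central element `t` with its inverse. Writing
`K_i^±(z) = K_i^{±1} exp (± (q - q⁻¹) ∑_{r > 0} H_{i,±r} z^{∓r})` is the same as asking that the
constant terms `Kp i 0` and `Km i 0` be inverse to each other (relations `K_inv`, `K_inv'` below),
since the coefficients of `K_i^±(z)` commute and the `H_{i,±r}` are the coefficients of a logarithm. -/
inductive Gen : Type
  | E (i : ZMod 2) (k : ℤ)
  | F (i : ZMod 2) (k : ℤ)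
  | Kp (i : ZMod 2) (r : ℕ)
  | Km (i : ZMod 2) (r : ℕ)
  | t
  | tInv

namespace Free

noncomputable def E (i : ZMod 2) (k : ℤ) : FreeAlgebra ℂ Gen := FreeAlgebra.ι ℂ (Gen.E i k)
noncomputable def F (i : ZMod 2) (k : ℤ) : FreeAlgebra ℂ Gen := FreeAlgebra.ι ℂ (Gen.F i k)

/-- The coefficient of `z ^ (-r)` in `K_i⁺(z)` (`ε = true`) or in `K_i⁻(z)` (`ε = false`). -/
noncomputable def K (ε : Bool) (i : ZMod 2) (r : ℤ) : FreeAlgebra ℂ Gen :=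
  match ε with
  | true => if 0 ≤ r then FreeAlgebra.ι ℂ (Gen.Kp i r.toNat) else 0
  | false => if r ≤ 0 then FreeAlgebra.ι ℂ (Gen.Km i (-r).toNat) else 0

/-- `[a, b]_p = a b - p b a`. -/
noncomputable def qComm (p : ℂ) (a b : FreeAlgebra ℂ Gen) : FreeAlgebra ℂ Gen :=
  a * b - p • (b * a)

/-- The coefficient of `z₁ ^ (-k 0) z₂ ^ (-k 1) z₃ ^ (-k 2) w ^ (-l)` in the series
`Sym_{z₁,z₂,z₃} [X_i(z₁), [X_i(z₂), [X_i(z₃), X_{i+1}(w)]_{q²}]]_{q⁻²}`. -/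
noncomputable def serre (P : QParams) (X : ZMod 2 → ℤ → FreeAlgebra ℂ Gen) (i : ZMod 2)
    (k : Fin 3 → ℤ) (l : ℤ) : FreeAlgebra ℂ Gen :=
  (1 / 6 : ℂ) • ∑ σ : Equiv.Perm (Fin 3),
    qComm (P.q ^ (-2 : ℤ)) (X i (k (σ 0)))
      (qComm 1 (X i (k (σ 1))) (qComm (P.q ^ 2) (X i (k (σ 2))) (X (i + 1) l)))

end Free

/-- The defining relations, coefficient by coefficient: in each of them `r`, `s` index the
coefficient of `z ^ (-r) * w ^ (-s)`. -/
inductive Rel (P : QParams) : FreeAlgebra ℂ Gen → FreeAlgebra ℂ Gen → Prop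
  | K_inv (i : ZMod 2) : Rel P (Free.K true i 0 * Free.K false i 0) 1
  | K_inv' (i : ZMod 2) : Rel P (Free.K false i 0 * Free.K true i 0) 1
  | t_inv : Rel P (FreeAlgebra.ι ℂ Gen.t * FreeAlgebra.ι ℂ Gen.tInv) 1
  | t_inv' : Rel P (FreeAlgebra.ι ℂ Gen.tInv * FreeAlgebra.ι ℂ Gen.t) 1
  | t_central (x : Gen) : Rel P (FreeAlgebra.ι ℂ Gen.t * FreeAlgebra.ι ℂ x)
      (FreeAlgebra.ι ℂ x * FreeAlgebra.ι ℂ Gen.t)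
  | KK (ε ε' : Bool) (i j : ZMod 2) (r s : ℤ) :
      Rel P (Free.K ε i r * Free.K ε' j s) (Free.K ε' j s * Free.K ε i r)
  | KE (ε : Bool) (i j : ZMod 2) (r s : ℤ) :
      Rel P (colorSign i j • gMul P i j (fun r s => Free.K ε i r * Free.E j s) r s
        + gMulSwap P j i (fun r s => Free.E j s * Free.K ε i r) r s) 0
  | KF (ε : Bool) (i j : ZMod 2) (r s : ℤ) :
      Rel P (colorSign i j • gMulSwap P j i (fun r s => Free.K ε i r * Free.F j s) r s
        + gMul P i j (fun r s => Free.F j s * Free.K ε i r) r s) 0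
  | EF (i j : ZMod 2) (r s : ℤ) :
      Rel P (Free.E i r * Free.F j s - Free.F j s * Free.E i r)
        ((kron i j / (P.q - P.q⁻¹)) • (Free.K true i (r + s) - Free.K false i (r + s)))
  | EE (i j : ZMod 2) (r s : ℤ) :
      Rel P (colorSign i j • gMul P i j (fun r s => Free.E i r * Free.E j s) r s
        + gMulSwap P j i (fun r s => Free.E j s * Free.E i r) r s) 0
  | FF (i j : ZMod 2) (r s : ℤ) :
      Rel P (colorSign i j • gMulSwap P j i (fun r s => Free.F i r * Free.F j s) r s
        + gMul P i j (fun r s => Free.F j s * Free.F i r) r s) 0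
  | serreE (i : ZMod 2) (k : Fin 3 → ℤ) (l : ℤ) : Rel P (Free.serre P Free.E i k l) 0
  | serreF (i : ZMod 2) (k : Fin 3 → ℤ) (l : ℤ) : Rel P (Free.serre P Free.F i k l) 0

/-- The quantum toroidal algebra of type `gl₂` (in its parallel realization). -/
abbrev QTor (P : QParams) : Type := RingQuot (Rel P)

namespace QTor

noncomputable def E (P : QParams) (i : ZMod 2) (k : ℤ) : QTor P :=
  RingQuot.mkAlgHom ℂ (Rel P) (Free.E i k)
noncomputable def F (P : QParams) (i : ZMod 2) (k : ℤ) : QTor P :=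
  RingQuot.mkAlgHom ℂ (Rel P) (Free.F i k)
/-- The coefficient of `z ^ (-r)` in `K_i⁺(z)` (`ε = true`) or in `K_i⁻(z)` (`ε = false`). -/
noncomputable def K (P : QParams) (ε : Bool) (i : ZMod 2) (r : ℤ) : QTor P :=
  RingQuot.mkAlgHom ℂ (Rel P) (Free.K ε i r)
noncomputable def t (P : QParams) : QTor P :=
  RingQuot.mkAlgHom ℂ (Rel P) (FreeAlgebra.ι ℂ Gen.t)

end QTor

/-! ## Rational functions -/

section RationalFunctions

/-- Laurent expansion of a rational function at `z = 0`. -/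
noncomputable def expandZero (f : RatFunc ℂ) : LaurentSeries ℂ := (f : LaurentSeries ℂ)

/-- Laurent expansion of a rational function at `z = ∞`, as a Laurent series in `z⁻¹`. -/
noncomputable def expandInfty (f : RatFunc ℂ) : LaurentSeries ℂ :=
  ((RatFunc.eval RatFunc.C (RatFunc.X⁻¹ : RatFunc ℂ) f : RatFunc ℂ) : LaurentSeries ℂ)

/-- The coefficient of `z ^ (-r)` in the expansion of `f` at `∞` (`ε = true`), respectively at `0`
(`ε = false`). -/
noncomputable def coeffAt (ε : Bool) (f : RatFunc ℂ) (r : ℤ) : ℂ :=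
  match ε with
  | true => (expandInfty f).coeff r
  | false => (expandZero f).coeff (-r)

/-- `f` is regular at the point `p`. -/
def RegularAt (f : RatFunc ℂ) (p : ℂ) : Prop := f.denom.eval p ≠ 0

/-- The value of `f` at a point `p` where it is regular. -/
noncomputable def valueAt (f : RatFunc ℂ) (p : ℂ) : ℂ := f.eval (RingHom.id ℂ) p

/-- The residue at `z = p` of the differential `f(z) dz / z`. -/
noncomputable def residueAt (f : RatFunc ℂ) (p : ℂ) : ℂ :=
  ((RatFunc.laurent p (f / RatFunc.X) : RatFunc ℂ) : LaurentSeries ℂ).coeff (-1)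

/-- A rational function is balanced if it is regular at `0` and at `∞` and `f(0) f(∞) = 1`. -/
def Balanced (f : RatFunc ℂ) : Prop :=
  (∀ r : ℤ, r < 0 → (expandZero f).coeff r = 0) ∧ (∀ r : ℤ, r < 0 → (expandInfty f).coeff r = 0) ∧
    (expandZero f).coeff 0 * (expandInfty f).coeff 0 = 1

/-- The linear function `z - a`. -/
noncomputable def lin (a : ℂ) : RatFunc ℂ := RatFunc.X - RatFunc.C a

/-- The pair of rational functions `A_{i,a}(z)`. -/
noncomputable def affRoot (P : QParams) (i : ZMod 2) (a : ℂ) (j : ZMod 2) : RatFunc ℂ :=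
  if i = j then (RatFunc.C P.q₂ * RatFunc.X - RatFunc.C a) / lin (P.q₂ * a)
  else ((RatFunc.C P.q₁ * RatFunc.X - RatFunc.C a) * (RatFunc.C P.q₃ * RatFunc.X - RatFunc.C a)) /
    (lin (P.q₁ * a) * lin (P.q₃ * a))

end RationalFunctions

/-! ## Modules -/

section Modules

variable {P : QParams} {V V' : Type} [AddCommGroup V] [Module ℂ V] [AddCommGroup V'] [Module ℂ V']

/-- The module given by `ρ` is irreducible. -/
def IsIrreducible (ρ : QTor P →ₐ[ℂ] Module.End ℂ V) : Prop :=
  Nontrivial V ∧ ∀ W : Submodule ℂ V, (∀ x, ∀ v ∈ W, ρ x v ∈ W) → W = ⊥ ∨ W = ⊤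

/-- `v` is a vector of `ℓ`-weight `φ`: `K_i^±(z) v = φ^i(z) v`, where `φ^i` is expanded at `∞` for
the sign `+` and at `0` for the sign `-`. -/
def IsLWeightVector (ρ : QTor P →ₐ[ℂ] Module.End ℂ V) (φ : ZMod 2 → RatFunc ℂ) (v : V) : Prop :=
  ∀ (ε : Bool) (i : ZMod 2) (r : ℤ), ρ (QTor.K P ε i r) v = coeffAt ε (φ i) r • v

/-- The module given by `ρ` is tame: it has a basis of `ℓ`-weight vectors with distinct
(balanced) `ℓ`-weights. -/
def IsTame (ρ : QTor P →ₐ[ℂ] Module.End ℂ V) : Prop :=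
  ∃ (ι : Type) (v : Module.Basis ι ℂ V) (φ : ι → ZMod 2 → RatFunc ℂ),
    Function.Injective φ ∧ (∀ n i, Balanced (φ n i)) ∧ ∀ n, IsLWeightVector ρ (φ n) (v n)

/-- The module given by `ρ` has level `κ`: the central element `K_0 K_1` acts as `κ`. -/
def HasLevel (ρ : QTor P →ₐ[ℂ] Module.End ℂ V) (κ : ℂ) : Prop :=
  ∀ v, ρ (QTor.K P true 0 0 * QTor.K P true 1 0) v = κ • v

/-- The modules given by `ρ` and `ρ'` are isomorphic. -/
def IsIsomorphic (ρ : QTor P →ₐ[ℂ] Module.End ℂ V) (ρ' : QTor P →ₐ[ℂ] Module.End ℂ V') : Prop :=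
  ∃ f : V ≃ₗ[ℂ] V', ∀ x v, f (ρ x v) = ρ' x (f v)

end Modules

/-! ## Combinatorial modules -/

/-- The data for a combinatorial module: a totally ordered set `B` of colored boxes with coordinates
in `ℂ³`, divided into positive and negative ones, a collection `S` of states including the
reference state `∅`, and the `ℓ`-weight `Ψ` of the reference state. A state `λ = λ⁺ ⊔ λ⁻` is a finite
set of boxes; `λ⁺` and `λ⁻` are its subsets of positive and of negative boxes. -/
structure CombData (B : Type) [LinearOrder B] where
  color : B → ZMod 2
  x : B → ℂ
  y : B → ℂ
  z : B → ℂ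
  positive : B → Prop
  S : Set (Finset B)
  Ψ : ZMod 2 → RatFunc ℂ
  empty_mem : ∅ ∈ S

namespace CombData

variable {B : Type} [LinearOrder B]

/-- The position `q₁ ^ (-x) q₂ ^ (-y) q₃ ^ (-z)` of a box. -/
noncomputable def pos (D : CombData B) (P : QParams) (b : B) : ℂ :=
  P.q₁Pow (-D.x b) * P.q₂Pow (-D.y b) * P.q₃Pow (-D.z b)

open Classical in
/-- Adding a box to a state: a positive box is added to `λ⁺`, a negative one is removed from `λ⁻`. -/
noncomputable def add (D : CombData B) (l : Finset B) (b : B) : Finset B :=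
  if D.positive b then insert b l else l.erase b

open Classical in
/-- Removing a box: a positive box is removed from `λ⁺`, a negative one is added to `λ⁻`. -/
noncomputable def remove (D : CombData B) (l : Finset B) (b : B) : Finset B :=
  if D.positive b then l.erase b else insert b l

/-- The set `CC_i(λ)` of concave boxes of color `i`. -/
def CC (D : CombData B) (i : ZMod 2) (l : Finset B) : Set B :=
  {b | D.color b = i ∧ ((D.positive b ∧ b ∉ l) ∨ (¬ D.positive b ∧ b ∈ l)) ∧ D.add l b ∈ D.S}

/-- The set `CV_i(λ)` of convex boxes of color `i`. -/
def CV (D : CombData B) (i : ZMod 2) (l : Finset B) : Set B :=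
  {b | D.color b = i ∧ ((D.positive b ∧ b ∈ l) ∨ (¬ D.positive b ∧ b ∉ l)) ∧ D.remove l b ∈ D.S}

open Classical in
/-- The contribution of a box of a state to the `ℓ`-weight: `A⁻¹` for a positive box, `A` for a
negative one. -/
noncomputable def boxWeight (D : CombData B) (P : QParams) (b : B) (i : ZMod 2) : RatFunc ℂ :=
  if D.positive b then (affRoot P (D.color b) (D.pos P b) i)⁻¹
  else affRoot P (D.color b) (D.pos P b) i

/-- The `ℓ`-weight `φ_λ` of a state. -/
noncomputable def phi (D : CombData B) (P : QParams) (l : Finset B) (i : ZMod 2) : RatFunc ℂ :=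
  D.Ψ i * ∏ b ∈ l, D.boxWeight P b i

open Classical in
/-- `φ_{λ,<□}`: the contribution of the boxes before `□`. The `ℓ`-weight `Ψ` of the reference state
counts as coming before every positive box and after every negative box. -/
noncomputable def phiLt (D : CombData B) (P : QParams) (l : Finset B) (b : B) (i : ZMod 2) :
    RatFunc ℂ :=
  (if D.positive b then D.Ψ i else 1) * ∏ c ∈ l with c < b, D.boxWeight P c i

open Classical in
/-- `φ_{λ,>□}`: the contribution of the boxes after `□` (see `phiLt` for the place of `Ψ`). -/
noncomputable def phiGt (D : CombData B) (P : QParams) (l : Finset B) (b : B) (i : ZMod 2) :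
    RatFunc ℂ :=
  (if D.positive b then 1 else D.Ψ i) * ∏ c ∈ l with b < c, D.boxWeight P c i

open Classical in
/-- The coefficient `a_{λ,□}^i`. -/
noncomputable def aCoeff (D : CombData B) (P : QParams) (l : Finset B) (b : B) (i : ZMod 2) : ℂ :=
  if D.positive b then valueAt (D.phiGt P l b i) (D.pos P b)
  else -1 / (P.q - P.q⁻¹) * residueAt (D.phiGt P l b i) (D.pos P b)

open Classical in
/-- The coefficient `b_{λ,□}^i`. -/
noncomputable def bCoeff (D : CombData B) (P : QParams) (l : Finset B) (b : B) (i : ZMod 2) : ℂ :=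
  if D.positive b then 1 / (P.q - P.q⁻¹) * residueAt (D.phiLt P l b i) (D.pos P b)
  else valueAt (D.phiLt P l b i) (D.pos P b)

/-- The vector space with basis `|λ⟩`, `λ ∈ S`. -/
abbrev Space (D : CombData B) : Type := D.S →₀ ℂ

/-- The basis vector `|λ⟩`. -/
noncomputable def ket (D : CombData B) (l : Finset B) (h : l ∈ D.S) : D.Space :=
  Finsupp.single ⟨l, h⟩ 1

/-- The right-hand sides of the formulas for the action make sense: the `ℓ`-weights of states are
balanced, the sums are finite, and the functions that are evaluated in the coefficients are regular
at the point of evaluation. -/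
structure WellPosed (D : CombData B) (P : QParams) : Prop where
  balanced : ∀ l ∈ D.S, ∀ i, Balanced (D.phi P l i)
  finite_CC : ∀ l ∈ D.S, ∀ i, (D.CC i l).Finite
  finite_CV : ∀ l ∈ D.S, ∀ i, (D.CV i l).Finite
  regular_a : ∀ l ∈ D.S, ∀ i, ∀ b ∈ D.CC i l, D.positive b → RegularAt (D.phiGt P l b i) (D.pos P b)
  regular_b : ∀ l ∈ D.S, ∀ i, ∀ b ∈ D.CV i l, ¬ D.positive b →
    RegularAt (D.phiLt P l b i) (D.pos P b)

/-- The module structure `ρ` is the one of `V(S, Ψ)`, that is,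
* `K_i^±(z) |λ⟩ = φ_λ^i(z) |λ⟩`,
* `F_i(z) |λ⟩ = ∑_{□ ∈ CC_i(λ)} a_{λ,□}^i δ(z / p(□)) |λ ⊔ □⟩`,
* `E_i(z) |λ⟩ = ∑_{□ ∈ CV_i(λ)} b_{λ,□}^i δ(z / p(□)) |λ \ □⟩`,
* `t |λ⟩ = |λ⟩`.

Here the coefficient of `z ^ (-k)` in `δ(z / p) = ∑ n, (z / p) ^ n` is `p ^ k`. -/
structure IsAction (D : CombData B) (P : QParams) (ρ : QTor P →ₐ[ℂ] Module.End ℂ D.Space) :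
    Prop where
  K_ket : ∀ l (h : l ∈ D.S), IsLWeightVector ρ (D.phi P l) (D.ket l h)
  F_ket : ∀ l (h : l ∈ D.S) (i : ZMod 2) (k : ℤ), ρ (QTor.F P i k) (D.ket l h) =
    ∑ᶠ b : D.CC i l, (D.aCoeff P l b i * D.pos P b ^ k) • D.ket (D.add l b) b.2.2.2
  E_ket : ∀ l (h : l ∈ D.S) (i : ZMod 2) (k : ℤ), ρ (QTor.E P i k) (D.ket l h) =
    ∑ᶠ b : D.CV i l, (D.bCoeff P l b i * D.pos P b ^ k) • D.ket (D.remove l b) b.2.2.2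
  t_ket : ∀ l (h : l ∈ D.S), ρ (QTor.t P) (D.ket l h) = D.ket l h

end CombData

/-! ## The slanted relaxed Verma modules -/

/-- The boxes for slope `m`, in three families. With parameters `μ, ν`:
* bottom: `low i k` has coordinates `(i, k, 1)` and color `i + 1`;
* pedestal: `ped i k` has coordinates `(i + 1, k + μ, 0)` and color `i + 1`;
* tower: `white s k` has coordinates `(-s, μ + ν + k, s)` and color `0`, and `black s k` has
  coordinates `(-1 - s, μ + ν + k, s)` and color `1`. -/
inductive SBox (m : ℕ) : Type
  | low (i k : ℕ)
  | ped (i k : ℕ)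
  | white (s : Fin (m + 1)) (k : ℤ)
  | black (s : Fin m) (k : ℤ)

namespace SBox

variable {m : ℕ}

/-- The family of a box, and the coordinates `y, z, x` up to a shift of `y` common to the family. -/
def key : SBox m → ℤ ×ₗ ℤ ×ₗ ℤ ×ₗ ℤ
  | low i k => toLex (0, toLex ((k : ℤ), toLex (1, (i : ℤ))))
  | ped i k => toLex (1, toLex ((k : ℤ), toLex (0, (i : ℤ) + 1)))
  | white s k => toLex (2, toLex (k, toLex ((s : ℤ), -(s : ℤ))))
  | black s k => toLex (2, toLex (k, toLex ((s : ℤ), -1 - (s : ℤ))))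

theorem key_injective : Function.Injective (key (m := m)) := by
  rintro (⟨i, k⟩ | ⟨i, k⟩ | ⟨s, k⟩ | ⟨s, k⟩) (⟨i', k'⟩ | ⟨i', k'⟩ | ⟨s', k'⟩ | ⟨s', k'⟩) h <;>
    simp only [key, EmbeddingLike.apply_eq_iff_eq, Prod.mk.injEq] at h <;>
    first
    | (exfalso; omega)
    | (obtain ⟨-, h1, h2, h3⟩ := h
       congr 1 <;> omega)

/-- The bottom family comes before the pedestal family, which comes before the tower family; within
each family the order is lexicographic according to `y > z > x`. -/
noncomputable instance : LinearOrder (SBox m) := LinearOrder.lift' key key_injective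

def color : SBox m → ZMod 2
  | low i _ => (i : ZMod 2) + 1
  | ped i _ => (i : ZMod 2) + 1
  | white _ _ => 0
  | black _ _ => 1

noncomputable def x : SBox m → ℂ
  | low i _ => (i : ℂ)
  | ped i _ => (i : ℂ) + 1
  | white s _ => -((s : ℕ) : ℂ)
  | black s _ => -1 - ((s : ℕ) : ℂ)

noncomputable def y (μ ν : ℂ) : SBox m → ℂ
  | low _ k => (k : ℂ)
  | ped _ k => (k : ℂ) + μ
  | white _ k => μ + ν + (k : ℂ)
  | black _ k => μ + ν + (k : ℂ)

noncomputable def z : SBox m → ℂ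
  | low _ _ => 1
  | ped _ _ => 0
  | white s _ => ((s : ℕ) : ℂ)
  | black s _ => ((s : ℕ) : ℂ)

/-- The boxes below the top of the reference tower are negative, all others are positive. -/
def positive : SBox m → Prop
  | low _ _ => True
  | ped _ _ => True
  | white _ k => 0 ≤ k
  | black _ k => 0 ≤ k

end SBox

/-- A pair of partitions (placed vertically, in the planes `z = 1` and `z = 0`) and integers
`a_0, …, a_m`, `b_0, …, b_{m-1}` with `b_s ≥ a_s` and `b_s ≥ a_{s+1}`. -/
structure SState (m : ℕ) where
  low : YoungDiagram
  ped : YoungDiagram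
  a : Fin (m + 1) → ℤ
  b : Fin m → ℤ
  le_left : ∀ s : Fin m, a s.castSucc ≤ b s
  le_right : ∀ s : Fin m, a s.succ ≤ b s

namespace SState

variable {m : ℕ}

/-- The levels in a tower column that differ from the reference state when the column holds `n`
boxes more than in the reference state: `0, …, n - 1` for `n ≥ 0` and `-1, …, n` for `n < 0`. -/
noncomputable def column (n : ℤ) : Finset ℤ := Finset.Ico (min 0 n) (max 0 n)

/-- The set of boxes of a state. -/
noncomputable def boxes (σ : SState m) : Finset (SBox m) :=
  σ.low.cells.image (fun c => SBox.low c.1 c.2) ∪ σ.ped.cells.image (fun c => SBox.ped c.1 c.2) ∪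
    Finset.univ.biUnion (fun s => (column (σ.a s)).image (SBox.white s)) ∪
    Finset.univ.biUnion (fun s => (column (σ.b s)).image (SBox.black s))

/-- The reference state. -/
def ref (m : ℕ) : SState m := ⟨⊥, ⊥, 0, 0, fun _ => le_rfl, fun _ => le_rfl⟩

theorem boxes_ref : (ref m).boxes = ∅ := by
  ext c
  simp [boxes, ref, column]

end SState

open Finset in
/-- The pair `Ψ(G_{0,m}^{μ,ν})`. -/
noncomputable def slantedPsi (P : QParams) (m : ℕ) (μ ν : ℂ) (i : ZMod 2) : RatFunc ℂ :=
  if i = 0 then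
    RatFunc.C (P.qPow (-μ - 2 * ν) * P.q₃ ^ (-(m : ℤ) + 1)) *
      (lin (P.q₃ ^ (-2 : ℤ)) * lin (P.q₁⁻¹ * P.q₃⁻¹ * P.q₂Pow (-μ)) *
        ∏ i ∈ Icc 1 (m - 1), lin (P.q₂Pow (-μ - ν) * P.q₁ ^ i * P.q₃ ^ (-(i : ℤ)))) /
      ∏ i ∈ range (m + 1), lin (P.q₂Pow (-μ - ν + 1) * P.q₁ ^ i * P.q₃ ^ (-(i : ℤ)))
  else
    RatFunc.C (P.qPow (μ + 2 * ν) * P.q₃ ^ m) *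
      (∏ i ∈ range (m + 2), lin (P.q₁ ^ ((i : ℤ) - 1) * P.q₃ ^ (-(i : ℤ)) * P.q₂Pow (-μ - ν))) /
      (lin P.q₃⁻¹ * lin (P.q₁⁻¹ * P.q₂Pow (-μ)) *
        ∏ i ∈ range m, lin (P.q₁ ^ (i + 1) * P.q₃ ^ (-(i : ℤ)) * P.q₂Pow (-μ - ν)))

/-- The data `S(G_{0,m}^{μ,ν})`, `Ψ(G_{0,m}^{μ,ν})` of the slanted relaxed Verma module of
slope `m`. -/
noncomputable def slanted (P : QParams) (m : ℕ) (μ ν : ℂ) : CombData (SBox m) where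
  color := SBox.color
  x := SBox.x
  y := SBox.y μ ν
  z := SBox.z
  positive := SBox.positive
  S := Set.range SState.boxes
  Ψ := slantedPsi P m μ ν
  empty_mem := ⟨SState.ref m, SState.boxes_ref⟩

end Toroidal

/-!
The formulas for the action are analyzed for arbitrary combinatorial data, a set of boxes with
signs, colors and positions together with a family of states, under the conditions
`CombData.IsRegular`. A positive box is *added* to a state if it belongs to it, a negative box if
it does not (`CombData.Added`); then adding a box always divides the `ℓ`-weight `φ_λ` by the
affine root of the box, whatever its sign. The main condition is that `φ_λ` has at most simple
poles, located exactly at the boxes that can be added to `λ` or removed from it; in addition, a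
finite set is a state if its added boxes are closed under a relation "`v` supports `u`", and
distinct states have distinct `ℓ`-weights.

*The relations.* The structure constants are leading coefficients of `φ_{λ,>□}` and `φ_{λ,<□}` at
the position of the box (`aCoeff_eq`, `bCoeff_eq`), hence nonzero, and the product of the
constants for adding and removing a box is a residue of `φ_λ` (`aCoeff_mul_bCoeff`). The
commutator of `E_i(z)` and `F_i(w)` is therefore a sum of delta functions at the poles of `φ_λ^i`,
weighted by the residues, which is the difference of the two expansions of the balanced function
`φ_λ^i` (`coeffAt_true_sub_false`, a consequence of Liouville's theorem). The currents are sums of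
operators that add or remove a single box, finite on each vector, so the quadratic relations
reduce to exchange relations for two boxes (`addOp_mul_addOp`, `removeOp_mul_removeOp`). In a
Serre combination of four box operators all words are proportional to any word that does not kill
the given vector; the factors are products of values of `g_{i,j}`, and their alternating sum
vanishes by a polynomial identity (`serre_identity`). That these products do not vanish for a word
which acts nontrivially is `pairwise_gBox_ne_zero`: two boxes with `g = 0` in the wrong order can
both be added only together with further boxes of both colors, for which there is no room in a
Serre word.

*Irreducibility.* An invariant subspace is spanned by basis vectors, because the `ℓ`-weights are
distinct; as the structure constants do not vanish and every state is connected with the reference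
state by adding and removing boxes, it contains all of them or none (`isIrreducible_rep`).

*The slanted modules.* For generic parameters the positions of the boxes are distinct points of
three translates of the lattice `q₁^a q₂^b` (`gridPt`), one for each of the families of boxes. On
such a lattice the order of the product of the weights of a set of boxes is an alternating sum of
the indicator function of the set over the six neighbors of a point (`hexSum`). The zeros and
poles of the reference weight `Ψ` amount to filling the boundary layers of the bottom and of the
pedestal, and the tower below level zero, so that the order of `φ_λ` at every point is the
alternating sum of a single function `filled` (`ordAt_phi_gridPt`). A case analysis of the values
of this function around a point gives the poles (`hexSum_neg_iff`), and the alternating sums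
determine the state (`eq_of_hexSum_eq`). The level is the product of the values of `Ψ⁰` and `Ψ¹`
at infinity.

*The isomorphisms.* Passing from `ν` to `ν + 1` while lowering the tower by one level keeps
colors, positions and the order of the boxes, and changes only the reference state and the signs
(`isRelabeling_lower`). Structure constants for corresponding states differ by factors that depend
only on the box (`aCoeff_relabel`, `bCoeff_relabel`), so rescaling the basis vectors by products
of these factors gives an intertwiner, which is an isomorphism by Schur's lemma. The statement for
all `k` follows by composing.
-/

/-! ### Local analysis of rational functions -/

namespace Toroidal

section LocalAnalysis

open HahnSeries
open scoped RatFunc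

/-- The Laurent expansion of a rational function at the point `p`. -/
noncomputable def laurentAt (p : ℂ) : RatFunc ℂ →+* LaurentSeries ℂ :=
  (algebraMap (RatFunc ℂ) (LaurentSeries ℂ)).comp
    (RatFunc.laurent p : RatFunc ℂ →ₐ[ℂ] RatFunc ℂ).toRingHom

/-- The order of vanishing of a rational function at `p`, negative at a pole; it is `0` for the
zero function. -/
noncomputable def ordAt (p : ℂ) (f : RatFunc ℂ) : ℤ := (laurentAt p f).order

/-- The leading coefficient of the Laurent expansion at `p`. -/
noncomputable def lcAt (p : ℂ) (f : RatFunc ℂ) : ℂ := (laurentAt p f).leadingCoeff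

theorem laurentAt_ne_zero (p : ℂ) {f : RatFunc ℂ} (hf : f ≠ 0) : laurentAt p f ≠ 0 :=
  (map_ne_zero _).2 hf

theorem ordAt_mul (p : ℂ) {f g : RatFunc ℂ} (hf : f ≠ 0) (hg : g ≠ 0) :
    ordAt p (f * g) = ordAt p f + ordAt p g := by
  simp only [ordAt, map_mul]
  exact order_mul (laurentAt_ne_zero p hf) (laurentAt_ne_zero p hg)

theorem lcAt_mul (p : ℂ) (f g : RatFunc ℂ) : lcAt p (f * g) = lcAt p f * lcAt p g := by
  simp only [lcAt, map_mul]
  exact leadingCoeff_mul _ _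

theorem ordAt_one (p : ℂ) : ordAt p 1 = 0 := by simp [ordAt]

theorem lcAt_one (p : ℂ) : lcAt p 1 = 1 := by simp [lcAt]

theorem ordAt_inv (p : ℂ) (f : RatFunc ℂ) : ordAt p f⁻¹ = -ordAt p f := by
  rcases eq_or_ne f 0 with rfl | hf
  · simp [ordAt]
  · have := ordAt_mul p hf (inv_ne_zero hf)
    rw [mul_inv_cancel₀ hf, ordAt_one] at this
    omega

theorem lcAt_ne_zero (p : ℂ) {f : RatFunc ℂ} (hf : f ≠ 0) : lcAt p f ≠ 0 :=
  leadingCoeff_ne_zero.2 (laurentAt_ne_zero p hf)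

theorem lcAt_inv (p : ℂ) (f : RatFunc ℂ) : lcAt p f⁻¹ = (lcAt p f)⁻¹ := by
  rcases eq_or_ne f 0 with rfl | hf
  · simp [lcAt]
  · have := lcAt_mul p f f⁻¹
    rw [mul_inv_cancel₀ hf, lcAt_one] at this
    exact eq_inv_of_mul_eq_one_right this.symm

theorem ordAt_div (p : ℂ) {f g : RatFunc ℂ} (hf : f ≠ 0) (hg : g ≠ 0) :
    ordAt p (f / g) = ordAt p f - ordAt p g := by
  rw [div_eq_mul_inv, ordAt_mul p hf (inv_ne_zero hg), ordAt_inv, sub_eq_add_neg]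

theorem lcAt_div (p : ℂ) (f g : RatFunc ℂ) : lcAt p (f / g) = lcAt p f / lcAt p g := by
  rw [div_eq_mul_inv, lcAt_mul, lcAt_inv, div_eq_mul_inv]

theorem ordAt_prod (p : ℂ) {ι : Type*} (s : Finset ι) (f : ι → RatFunc ℂ) (hf : ∀ i ∈ s, f i ≠ 0) :
    ordAt p (∏ i ∈ s, f i) = ∑ i ∈ s, ordAt p (f i) := by
  classical
  induction s using Finset.induction_on with
  | empty => simp [ordAt_one]
  | insert a s ha ih =>
    rw [Finset.prod_insert ha, Finset.sum_insert ha, ordAt_mul, ih]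
    · exact fun i hi => hf i (Finset.mem_insert_of_mem hi)
    · exact hf a (Finset.mem_insert_self _ _)
    · exact Finset.prod_ne_zero_iff.2 fun i hi => hf i (Finset.mem_insert_of_mem hi)

theorem laurentAt_algebraMap_coeff (p : ℂ) (Q : Polynomial ℂ) (n : ℤ) :
    (laurentAt p (algebraMap _ _ Q)).coeff n =
      if n < 0 then 0 else (Polynomial.taylor p Q).coeff n.natAbs := by
  have : laurentAt p (algebraMap _ _ Q) =
      (((Polynomial.taylor p Q : Polynomial ℂ) : PowerSeries ℂ) : LaurentSeries ℂ) := by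
    rw [RatFunc.coe_coe]
    simp [laurentAt, RatFunc.laurent_algebraMap, RatFunc.coePolynomial_eq_algebraMap]
  rw [this, PowerSeries.coeff_coe]
  simp

theorem ordAt_algebraMap_nonneg (p : ℂ) (Q : Polynomial ℂ) : 0 ≤ ordAt p (algebraMap _ _ Q) := by
  rcases eq_or_ne Q 0 with rfl | hQ
  · simp [ordAt]
  · have hQ' : (algebraMap (Polynomial ℂ) (RatFunc ℂ) Q) ≠ 0 := by simpa using hQ
    rw [ordAt, le_order_iff_forall (laurentAt_ne_zero p hQ')]
    intro j hj
    rw [laurentAt_algebraMap_coeff, if_pos hj]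

theorem ordAt_algebraMap_eq_zero {p : ℂ} {Q : Polynomial ℂ} (h : Q.eval p ≠ 0) :
    ordAt p (algebraMap _ _ Q) = 0 := by
  refine le_antisymm ?_ (ordAt_algebraMap_nonneg p Q)
  apply order_le_of_coeff_ne_zero
  rw [laurentAt_algebraMap_coeff]
  simpa using h

theorem lcAt_algebraMap {p : ℂ} {Q : Polynomial ℂ} (h : Q.eval p ≠ 0) :
    lcAt p (algebraMap _ _ Q) = Q.eval p := by
  have h0 := ordAt_algebraMap_eq_zero h
  rw [lcAt, leadingCoeff_eq, ← ordAt, h0, laurentAt_algebraMap_coeff]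
  simp

theorem ordAt_algebraMap_pos {p : ℂ} {Q : Polynomial ℂ} (hQ : Q ≠ 0) (h : Q.eval p = 0) :
    0 < ordAt p (algebraMap _ _ Q) := by
  have hQ' : (algebraMap (Polynomial ℂ) (RatFunc ℂ) Q) ≠ 0 := by simpa using hQ
  refine lt_of_le_of_ne (ordAt_algebraMap_nonneg p Q) fun h0 => ?_
  have := lcAt_ne_zero p hQ'
  rw [lcAt, leadingCoeff_eq, ← ordAt, ← h0, laurentAt_algebraMap_coeff] at this
  simp [h] at this

theorem num_ne_zero_denom_ne_zero {f : RatFunc ℂ} (hf : f ≠ 0) :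
    algebraMap (Polynomial ℂ) (RatFunc ℂ) f.num ≠ 0 ∧
      algebraMap (Polynomial ℂ) (RatFunc ℂ) f.denom ≠ 0 := by
  constructor
  · simpa using RatFunc.num_ne_zero hf
  · simpa using RatFunc.denom_ne_zero f

theorem ordAt_eq_num_sub_denom (p : ℂ) {f : RatFunc ℂ} (hf : f ≠ 0) :
    ordAt p f = ordAt p (algebraMap _ _ f.num) - ordAt p (algebraMap _ _ f.denom) := by
  obtain ⟨h1, h2⟩ := num_ne_zero_denom_ne_zero hf
  conv_lhs => rw [← RatFunc.num_div_denom f]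
  exact ordAt_div p h1 h2

theorem eval_num_ne_zero {p : ℂ} {f : RatFunc ℂ} (h : f.denom.eval p = 0) : f.num.eval p ≠ 0 := by
  intro h'
  obtain ⟨a, b, hab⟩ := RatFunc.isCoprime_num_denom f
  have := congrArg (Polynomial.eval p) hab
  simp [h, h'] at this

theorem regularAt_iff {p : ℂ} {f : RatFunc ℂ} : RegularAt f p ↔ 0 ≤ ordAt p f := by
  rcases eq_or_ne f 0 with rfl | hf
  · simp [RegularAt, ordAt]
  · rw [ordAt_eq_num_sub_denom p hf, RegularAt]
    constructor
    · intro h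
      have := ordAt_algebraMap_nonneg p f.num
      rw [ordAt_algebraMap_eq_zero h]
      omega
    · intro h h0
      have := ordAt_algebraMap_pos (RatFunc.denom_ne_zero f) h0
      rw [ordAt_algebraMap_eq_zero (eval_num_ne_zero h0)] at h
      omega

theorem valueAt_eq_lcAt {p : ℂ} {f : RatFunc ℂ} (hf : f ≠ 0) (h : ordAt p f = 0) :
    valueAt f p = lcAt p f := by
  have h1 : f.denom.eval p ≠ 0 := regularAt_iff.2 h.ge
  have h2 : f.num.eval p ≠ 0 := by
    intro h0
    have h3 := ordAt_algebraMap_pos (RatFunc.num_ne_zero hf) h0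
    rw [ordAt_eq_num_sub_denom p hf, ordAt_algebraMap_eq_zero h1] at h
    omega
  conv_rhs => rw [← RatFunc.num_div_denom f]
  rw [lcAt_div, lcAt_algebraMap h1, lcAt_algebraMap h2, valueAt, RatFunc.eval]
  rfl

theorem laurentAt_lin (p a : ℂ) : laurentAt p (lin a) = single 1 1 + HahnSeries.C (p - a) := by
  have : (HahnSeries.C (p - a) : LaurentSeries ℂ) =
      algebraMap (RatFunc ℂ) (LaurentSeries ℂ) (RatFunc.C (p - a)) := by
    rw [← RatFunc.algebraMap_C, ← RatFunc.coePolynomial_eq_algebraMap, ← RatFunc.coe_coe]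
    simp
  rw [this]
  simp [laurentAt, lin, sub_eq_add_neg, add_assoc]

theorem lin_eq (a : ℂ) : lin a = algebraMap (Polynomial ℂ) (RatFunc ℂ) (Polynomial.X - Polynomial.C a) := by
  simp [lin]

theorem lin_ne_zero (a : ℂ) : lin a ≠ 0 := by
  rw [lin_eq]
  exact (map_ne_zero_iff _ (IsFractionRing.injective _ _)).2 (Polynomial.X_sub_C_ne_zero a)

theorem ordAt_lin (p a : ℂ) : ordAt p (lin a) = if a = p then 1 else 0 := by
  split_ifs with h
  · subst h
    rw [ordAt, laurentAt_lin]
    simp [order_single]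
  · rw [lin_eq, ordAt_algebraMap_eq_zero]
    simpa [sub_eq_zero] using fun h' => h h'.symm

theorem lcAt_lin_of_ne {p a : ℂ} (h : p ≠ a) : lcAt p (lin a) = p - a := by
  rw [lin_eq, lcAt_algebraMap]
  · simp
  · simpa [sub_eq_zero] using h

theorem C_ne_zero {c : ℂ} (hc : c ≠ 0) : RatFunc.C c ≠ 0 := by
  simpa using hc

theorem ordAt_C (p : ℂ) {c : ℂ} (hc : c ≠ 0) : ordAt p (RatFunc.C c) = 0 := by
  rw [← RatFunc.algebraMap_C, ordAt_algebraMap_eq_zero]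
  simpa using hc

theorem X_eq_lin : (RatFunc.X : RatFunc ℂ) = lin 0 := by simp [lin]

theorem residueAt_eq (f : RatFunc ℂ) (p : ℂ) :
    residueAt f p = (laurentAt p (f / RatFunc.X)).coeff (-1) := rfl

theorem residueAt_eq_lcAt {p : ℂ} (hp : p ≠ 0) {f : RatFunc ℂ} (hf : f ≠ 0) (h : ordAt p f = -1) :
    residueAt f p = lcAt p f / p := by
  have h1 : ordAt p (f / RatFunc.X) = -1 := by
    rw [X_eq_lin, ordAt_div p hf (lin_ne_zero 0), ordAt_lin, if_neg hp.symm, h, sub_zero]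
  have h2 : lcAt p (f / RatFunc.X) = lcAt p f / p := by
    rw [X_eq_lin, lcAt_div, lcAt_lin_of_ne hp, sub_zero]
  rw [residueAt_eq, ← h2, lcAt, leadingCoeff_eq, ← ordAt, h1]

theorem residueAt_eq_zero {p : ℂ} (hp : p ≠ 0) {f : RatFunc ℂ} (h : 0 ≤ ordAt p f) :
    residueAt f p = 0 := by
  rcases eq_or_ne f 0 with rfl | hf
  · simp [residueAt]
  · rw [residueAt_eq]
    apply coeff_eq_zero_of_lt_order
    have : ordAt p (f / RatFunc.X) = ordAt p f := by
      rw [X_eq_lin, ordAt_div p hf (lin_ne_zero 0), ordAt_lin, if_neg hp.symm, sub_zero]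
    rw [← ordAt, this]
    omega

theorem residueAt_add (f g : RatFunc ℂ) (p : ℂ) :
    residueAt (f + g) p = residueAt f p + residueAt g p := by
  simp [residueAt_eq, add_div]

theorem residueAt_C_mul (c : ℂ) (f : RatFunc ℂ) (p : ℂ) :
    residueAt (RatFunc.C c * f) p = c * residueAt f p := by
  have : laurentAt p (RatFunc.C c) = HahnSeries.C c := by
    rw [laurentAt, RingHom.comp_apply]
    change algebraMap (RatFunc ℂ) (LaurentSeries ℂ) (RatFunc.laurent p (RatFunc.C c)) = _
    rw [RatFunc.laurent_C, ← RatFunc.algebraMap_C, ← RatFunc.coePolynomial_eq_algebraMap,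
      ← RatFunc.coe_coe]
    simp
  rw [residueAt_eq, residueAt_eq, mul_div_assoc, map_mul, this, HahnSeries.C_apply,
    HahnSeries.coeff_single_mul, sub_zero]

/-! ### Expansions at zero and at infinity -/

theorem eval₂_inv_X_injective : Function.Injective
    (Polynomial.eval₂RingHom (RatFunc.C (K := ℂ)) (RatFunc.X⁻¹ : RatFunc ℂ)) := by
  have h : Transcendental ℂ (RatFunc.X⁻¹ : RatFunc ℂ) := by
    rw [Transcendental, IsAlgebraic.inv_iff]
    exact RatFunc.transcendental_X
  exact transcendental_iff_injective.1 h

/-- The substitution `z ↦ z⁻¹`. -/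
noncomputable def invSubst : RatFunc ℂ →+* RatFunc ℂ :=
  RatFunc.liftRingHom (Polynomial.eval₂RingHom RatFunc.C (RatFunc.X⁻¹ : RatFunc ℂ))
    (nonZeroDivisors_le_comap_nonZeroDivisors_of_injective _ eval₂_inv_X_injective)

/-- The expansion at `∞` in the variable `z⁻¹` for `ε = true`, at `0` in the variable `z` for
`ε = false`. -/
noncomputable def expand (ε : Bool) : RatFunc ℂ →+* LaurentSeries ℂ :=
  match ε with
  | true => (algebraMap (RatFunc ℂ) (LaurentSeries ℂ)).comp invSubst
  | false => algebraMap (RatFunc ℂ) (LaurentSeries ℂ)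

theorem expandInfty_eq (f : RatFunc ℂ) : expandInfty f = expand true f := by
  simp only [expandInfty, expand, RingHom.comp_apply, invSubst, RatFunc.liftRingHom_apply,
    RatFunc.eval, Polynomial.coe_eval₂RingHom]

theorem expandZero_eq (f : RatFunc ℂ) : expandZero f = expand false f := rfl

/-- The exponent of the expansion variable that corresponds to `z ^ (-r)`. -/
def expSign (ε : Bool) (r : ℤ) : ℤ :=
  match ε with
  | true => r
  | false => -r

theorem coeffAt_eq (ε : Bool) (f : RatFunc ℂ) (r : ℤ) :
    coeffAt ε f r = (expand ε f).coeff (expSign ε r) := by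
  cases ε
  · rfl
  · simp only [coeffAt, expandInfty_eq, expSign]

theorem invSubst_X : invSubst RatFunc.X = RatFunc.X⁻¹ := by
  rw [invSubst, RatFunc.liftRingHom_X]
  simp

theorem invSubst_C (c : ℂ) : invSubst (RatFunc.C c) = RatFunc.C c := by
  rw [invSubst, RatFunc.liftRingHom_C]
  simp

theorem expand_X (ε : Bool) : expand ε RatFunc.X = single (expSign ε (-1)) 1 := by
  cases ε
  · simp [expand, expSign]
  · simp [expand, expSign, invSubst_X]

theorem algebraMap_ratFunc_C (c : ℂ) :
    algebraMap (RatFunc ℂ) (LaurentSeries ℂ) (RatFunc.C c) = single 0 c := by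
  rw [← RatFunc.algebraMap_C, ← RatFunc.coePolynomial_eq_algebraMap, ← RatFunc.coe_coe]
  simp

theorem expand_C (ε : Bool) (c : ℂ) : expand ε (RatFunc.C c) = single 0 c := by
  cases ε
  · exact algebraMap_ratFunc_C c
  · simp only [expand, RingHom.comp_apply, invSubst_C, algebraMap_ratFunc_C]

theorem coeffAt_add (ε : Bool) (f g : RatFunc ℂ) (r : ℤ) :
    coeffAt ε (f + g) r = coeffAt ε f r + coeffAt ε g r := by
  simp [coeffAt_eq]

theorem coeffAt_sub (ε : Bool) (f g : RatFunc ℂ) (r : ℤ) :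
    coeffAt ε (f - g) r = coeffAt ε f r - coeffAt ε g r := by
  simp [coeffAt_eq]

theorem coeffAt_zero (ε : Bool) (r : ℤ) : coeffAt ε 0 r = 0 := by
  simp [coeffAt_eq]

theorem coeffAt_C_mul (ε : Bool) (c : ℂ) (f : RatFunc ℂ) (r : ℤ) :
    coeffAt ε (RatFunc.C c * f) r = c * coeffAt ε f r := by
  rw [coeffAt_eq, map_mul, expand_C, coeff_single_mul, sub_zero, coeffAt_eq]

theorem coeffAt_X_mul (ε : Bool) (f : RatFunc ℂ) (r : ℤ) :
    coeffAt ε (RatFunc.X * f) r = coeffAt ε f (r + 1) := by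
  rw [coeffAt_eq, map_mul, expand_X, coeff_single_mul, one_mul, coeffAt_eq]
  congr 1
  cases ε
  · simp only [expSign]; ring
  · simp only [expSign]; ring

theorem expand_ne_zero (ε : Bool) {f : RatFunc ℂ} (hf : f ≠ 0) : expand ε f ≠ 0 :=
  (map_ne_zero _).2 hf

/-- The value at `∞` (`ε = true`) or `0` (`ε = false`) of a function that is regular and does not
vanish there. -/
noncomputable def lcEnd (ε : Bool) (f : RatFunc ℂ) : ℂ := (expand ε f).leadingCoeff

theorem lcEnd_mul (ε : Bool) (f g : RatFunc ℂ) : lcEnd ε (f * g) = lcEnd ε f * lcEnd ε g := by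
  simp only [lcEnd, map_mul]
  exact leadingCoeff_mul _ _

/-- `f` is regular at `∞` (`ε = true`) or `0` (`ε = false`) and does not vanish there. -/
def UnitEnd (ε : Bool) (f : RatFunc ℂ) : Prop := f ≠ 0 ∧ (expand ε f).order = 0

theorem UnitEnd.mul {ε : Bool} {f g : RatFunc ℂ} (hf : UnitEnd ε f) (hg : UnitEnd ε g) :
    UnitEnd ε (f * g) := by
  refine ⟨mul_ne_zero hf.1 hg.1, ?_⟩
  rw [map_mul, order_mul (expand_ne_zero ε hf.1) (expand_ne_zero ε hg.1), hf.2, hg.2, add_zero]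

theorem UnitEnd.coeffAt_zero {ε : Bool} {f : RatFunc ℂ} (hf : UnitEnd ε f) :
    coeffAt ε f 0 = lcEnd ε f := by
  rw [coeffAt_eq, lcEnd, leadingCoeff_eq, hf.2]
  cases ε <;> rfl

theorem balanced_iff {f : RatFunc ℂ} :
    Balanced f ↔ UnitEnd false f ∧ UnitEnd true f ∧ lcEnd false f * lcEnd true f = 1 := by
  have key : ∀ ε, (∀ r : ℤ, r < 0 → (expand ε f).coeff r = 0) → (expand ε f).coeff 0 ≠ 0 →
      UnitEnd ε f := by
    intro ε h1 h2
    have hf : f ≠ 0 := by rintro rfl; simp at h2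
    exact ⟨hf, le_antisymm (order_le_of_coeff_ne_zero h2)
      ((le_order_iff_forall (expand_ne_zero ε hf)).2 h1)⟩
  have key' : ∀ ε, UnitEnd ε f → (expand ε f).coeff 0 = lcEnd ε f := by
    intro ε h
    rw [lcEnd, leadingCoeff_eq, h.2]
  unfold Balanced
  rw [expandZero_eq, expandInfty_eq]
  constructor
  · rintro ⟨h1, h2, h3⟩
    have h4 := key _ h1 (left_ne_zero_of_mul_eq_one h3)
    have h5 := key _ h2 (right_ne_zero_of_mul_eq_one h3)
    exact ⟨h4, h5, by rw [← key' _ h4, ← key' _ h5, h3]⟩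
  · rintro ⟨h1, h2, h3⟩
    refine ⟨fun r hr => ?_, fun r hr => ?_, by rw [key' _ h1, key' _ h2, h3]⟩ <;>
      apply coeff_eq_zero_of_lt_order
    · rw [h1.2]; exact hr
    · rw [h2.2]; exact hr

theorem UnitEnd.inv {ε : Bool} {f : RatFunc ℂ} (hf : UnitEnd ε f) :
    UnitEnd ε f⁻¹ ∧ lcEnd ε f⁻¹ = (lcEnd ε f)⁻¹ := by
  have h1 : f * f⁻¹ = 1 := mul_inv_cancel₀ hf.1
  refine ⟨⟨inv_ne_zero hf.1, ?_⟩, ?_⟩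
  · have := order_mul (expand_ne_zero ε hf.1) (expand_ne_zero ε (inv_ne_zero hf.1))
    rw [← map_mul, h1, map_one, hf.2, order_one] at this
    omega
  · have := lcEnd_mul ε f f⁻¹
    rw [h1, lcEnd, map_one, leadingCoeff_one] at this
    exact eq_inv_of_mul_eq_one_right this.symm

theorem Balanced.mul {f g : RatFunc ℂ} (hf : Balanced f) (hg : Balanced g) : Balanced (f * g) := by
  rw [balanced_iff] at *
  obtain ⟨h1, h2, h3⟩ := hf
  obtain ⟨h4, h5, h6⟩ := hg
  refine ⟨h1.mul h4, h2.mul h5, ?_⟩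
  rw [lcEnd_mul, lcEnd_mul, mul_mul_mul_comm, h3, h6, one_mul]

theorem Balanced.inv {f : RatFunc ℂ} (hf : Balanced f) : Balanced f⁻¹ := by
  rw [balanced_iff] at *
  obtain ⟨h1, h2, h3⟩ := hf
  refine ⟨h1.inv.1, h2.inv.1, ?_⟩
  rw [h1.inv.2, h2.inv.2, ← mul_inv, h3, inv_one]

theorem balanced_one : Balanced 1 := by
  rw [balanced_iff]
  refine ⟨⟨one_ne_zero, ?_⟩, ⟨one_ne_zero, ?_⟩, ?_⟩ <;> simp [lcEnd]

theorem Balanced.ne_zero {f : RatFunc ℂ} (hf : Balanced f) : f ≠ 0 := (balanced_iff.1 hf).1.1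

theorem balanced_prod {ι : Type*} (s : Finset ι) (f : ι → RatFunc ℂ)
    (h : ∀ i ∈ s, Balanced (f i)) : Balanced (∏ i ∈ s, f i) := by
  classical
  induction s using Finset.induction_on with
  | empty => simpa using balanced_one
  | insert a s ha ih =>
    rw [Finset.prod_insert ha]
    exact (h a (Finset.mem_insert_self _ _)).mul
      (ih fun i hi => h i (Finset.mem_insert_of_mem hi))

theorem Balanced.coeffAt_eq_zero {f : RatFunc ℂ} (hf : Balanced f) (ε : Bool) {r : ℤ}
    (hr : expSign ε r < 0) : coeffAt ε f r = 0 := by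
  obtain ⟨h1, h2, -⟩ := balanced_iff.1 hf
  rw [coeffAt_eq]
  apply coeff_eq_zero_of_lt_order
  cases ε
  · rwa [h1.2]
  · rwa [h2.2]

theorem Balanced.coeffAt_mul {f : RatFunc ℂ} (hf : Balanced f) :
    coeffAt true f 0 * coeffAt false f 0 = 1 := by
  obtain ⟨h1, h2, h3⟩ := balanced_iff.1 hf
  rw [h1.coeffAt_zero, h2.coeffAt_zero, mul_comm, h3]

/-! ### Partial fractions -/

theorem coeffAt_true_algebraMap (Q : Polynomial ℂ) (n : ℕ) :
    coeffAt true (algebraMap _ _ Q) (-(n : ℤ)) = Q.coeff n := by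
  induction Q using Polynomial.induction_on' with
  | add p q hp hq => rw [map_add, coeffAt_add, hp, hq, Polynomial.coeff_add]
  | monomial k a =>
    have : ∀ r, coeffAt true (RatFunc.X ^ k : RatFunc ℂ) r = if r = -(k : ℤ) then 1 else 0 := by
      intro r
      rw [coeffAt_eq, map_pow, expand_X, single_pow]
      simp [expSign, coeff_single]
    rw [RatFunc.algebraMap_monomial, coeffAt_C_mul, this, Polynomial.coeff_monomial]
    simp only [neg_inj, Nat.cast_inj, mul_ite, mul_one, mul_zero, eq_comm]

/-- Liouville's theorem: a rational function without poles on the Riemann sphere is constant. -/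
theorem eq_C_of_ordAt_nonneg {f : RatFunc ℂ} (h : ∀ p, 0 ≤ ordAt p f)
    (h' : ∀ r : ℤ, r < 0 → coeffAt true f r = 0) : ∃ c, f = RatFunc.C c := by
  have h1 : f.denom = 1 := by
    have h2 : f.denom.degree = 0 := by
      by_contra hd
      obtain ⟨z, hz⟩ := IsAlgClosed.exists_root f.denom hd
      exact regularAt_iff.2 (h z) hz
    exact Polynomial.eq_one_of_monic_natDegree_zero (RatFunc.monic_denom f)
      (Polynomial.natDegree_eq_of_degree_eq_some h2)
  have h3 : f = algebraMap _ _ f.num := by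
    conv_lhs => rw [← RatFunc.num_div_denom f, h1]
    simp
  have h4 : f.num = Polynomial.C (f.num.coeff 0) := by
    apply Polynomial.ext
    intro n
    rcases n with _ | n
    · simp
    · rw [Polynomial.coeff_C_succ, ← coeffAt_true_algebraMap, ← h3]
      exact h' _ (by push_cast; omega)
  refine ⟨f.num.coeff 0, ?_⟩
  rw [h3, h4]
  simp

/-- The function `z / (z - a)`. -/
noncomputable def simplePole (a : ℂ) : RatFunc ℂ := RatFunc.X / lin a

theorem coeffAt_simplePole_rec (ε : Bool) (a : ℂ) (r : ℤ) :
    coeffAt ε (simplePole a) (r + 1) - a * coeffAt ε (simplePole a) r =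
      if r = -1 then 1 else 0 := by
  have h : RatFunc.X * simplePole a - RatFunc.C a * simplePole a = RatFunc.X := by
    rw [← sub_mul]
    exact mul_div_cancel₀ _ (lin_ne_zero a)
  rw [← coeffAt_X_mul, ← coeffAt_C_mul, ← coeffAt_sub, h, coeffAt_eq, expand_X]
  cases ε <;> simp [expSign, coeff_single, neg_eq_iff_eq_neg]

theorem simplePole_ne_zero (a : ℂ) : simplePole a ≠ 0 :=
  div_ne_zero RatFunc.X_ne_zero (lin_ne_zero a)

theorem order_expand_lin (ε : Bool) {a : ℂ} (ha : a ≠ 0) :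
    (expand ε (lin a)).order = if ε then -1 else 0 := by
  have h : expand ε (lin a) = single (expSign ε (-1)) 1 - single 0 a := by
    rw [lin, map_sub, expand_X, expand_C]
  cases ε
  · apply le_antisymm
    · apply order_le_of_coeff_ne_zero
      rw [h]; simp [expSign, ha]
    · rw [le_order_iff_forall (expand_ne_zero _ (lin_ne_zero a))]
      intro j hj
      simp at hj
      rw [h]
      simp only [expSign, coeff_sub, coeff_single]
      rw [if_neg (by omega), if_neg (by omega), sub_zero]
  · apply le_antisymm
    · apply order_le_of_coeff_ne_zero
      rw [h]; simp [expSign]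
    · rw [le_order_iff_forall (expand_ne_zero _ (lin_ne_zero a))]
      intro j hj
      simp at hj
      rw [h]
      simp only [expSign, coeff_sub, coeff_single]
      rw [if_neg (by omega), if_neg (by omega), sub_zero]

theorem coeffAt_true_simplePole_neg {a : ℂ} (ha : a ≠ 0) {r : ℤ} (hr : r < 0) :
    coeffAt true (simplePole a) r = 0 := by
  rw [coeffAt_eq]
  apply coeff_eq_zero_of_lt_order
  have h := order_mul (expand_ne_zero true (simplePole_ne_zero a))
    (expand_ne_zero true (lin_ne_zero a))
  rw [← map_mul, simplePole, div_mul_cancel₀ _ (lin_ne_zero a), ← simplePole,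
    order_expand_lin true ha, expand_X, order_single one_ne_zero] at h
  simp only [expSign, if_true] at h ⊢
  omega

theorem coeffAt_false_simplePole_nonneg {a : ℂ} (ha : a ≠ 0) {r : ℤ} (hr : 0 ≤ r) :
    coeffAt false (simplePole a) r = 0 := by
  rw [coeffAt_eq]
  apply coeff_eq_zero_of_lt_order
  have h := order_mul (expand_ne_zero false (simplePole_ne_zero a))
    (expand_ne_zero false (lin_ne_zero a))
  rw [← map_mul, simplePole, div_mul_cancel₀ _ (lin_ne_zero a), ← simplePole,
    order_expand_lin false ha, expand_X, order_single one_ne_zero] at h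
  simp [expSign] at h ⊢
  omega

/-- The two expansions of `z / (z - a)` differ by `δ(z / a)`. -/
theorem coeffAt_simplePole {a : ℂ} (ha : a ≠ 0) (r : ℤ) :
    coeffAt true (simplePole a) r - coeffAt false (simplePole a) r = a ^ r := by
  have hrec : ∀ r : ℤ, coeffAt true (simplePole a) (r + 1) - coeffAt false (simplePole a) (r + 1) =
      a * (coeffAt true (simplePole a) r - coeffAt false (simplePole a) r) := by
    intro r
    linear_combination coeffAt_simplePole_rec true a r - coeffAt_simplePole_rec false a r
  have h0 : coeffAt true (simplePole a) 0 - coeffAt false (simplePole a) 0 = 1 := by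
    have := coeffAt_simplePole_rec true a (-1)
    rw [coeffAt_true_simplePole_neg ha (by norm_num : (-1 : ℤ) < 0), if_pos rfl, mul_zero,
      neg_add_cancel] at this
    rw [coeffAt_false_simplePole_nonneg ha le_rfl, this]
  induction r using Int.induction_on with
  | zero => simpa using h0
  | succ n ih => rw [hrec, ih, zpow_add_one₀ ha, mul_comm]
  | pred n ih =>
    have := hrec (-(n : ℤ) - 1)
    rw [sub_add_cancel, ih] at this
    rw [zpow_sub_one₀ ha, this]
    field_simp

theorem ordAt_simplePole (p a : ℂ) :
    ordAt p (simplePole a) = (if p = 0 then 1 else 0) - if p = a then 1 else 0 := by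
  rw [simplePole, X_eq_lin, ordAt_div p (lin_ne_zero 0) (lin_ne_zero a), ordAt_lin, ordAt_lin]
  simp only [eq_comm]

theorem residueAt_simplePole {a p : ℂ} (ha : a ≠ 0) (hp : p ≠ 0) :
    residueAt (simplePole a) p = if p = a then 1 else 0 := by
  have h := ordAt_simplePole p a
  rw [if_neg hp, zero_sub] at h
  split_ifs with hpa
  · subst hpa
    rw [if_pos rfl] at h
    rw [residueAt_eq_lcAt hp (simplePole_ne_zero p) h, simplePole, lcAt_div, X_eq_lin,
      lcAt_lin_of_ne hp, lcAt, laurentAt_lin]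
    simp [hp]
  · rw [if_neg hpa, neg_zero] at h
    exact residueAt_eq_zero hp h.ge

theorem ordAt_add_nonneg {p : ℂ} {f g : RatFunc ℂ} (hf : 0 ≤ ordAt p f) (hg : 0 ≤ ordAt p g) :
    0 ≤ ordAt p (f + g) := by
  rcases eq_or_ne (f + g) 0 with h | h
  · simp [h, ordAt]
  · rw [ordAt, le_order_iff_forall (laurentAt_ne_zero p h)]
    intro j hj
    rw [map_add, coeff_add, coeff_eq_zero_of_lt_order (hj.trans_le hf),
      coeff_eq_zero_of_lt_order (hj.trans_le hg), add_zero]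

/-- A function with at most a simple pole at `p ≠ 0` and zero residue there is regular at `p`. -/
theorem ordAt_nonneg_of_residueAt_eq_zero {p : ℂ} (hp : p ≠ 0) {f : RatFunc ℂ}
    (h : -1 ≤ ordAt p f) (hr : residueAt f p = 0) : 0 ≤ ordAt p f := by
  by_contra hneg
  have h1 : ordAt p f = -1 := by omega
  have hf : f ≠ 0 := by rintro rfl; simp [ordAt] at h1
  rw [residueAt_eq_lcAt hp hf h1] at hr
  exact div_ne_zero (lcAt_ne_zero p hf) hp hr

theorem neg_one_le_ordAt_add {p : ℂ} {f g : RatFunc ℂ} (hf : -1 ≤ ordAt p f)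
    (hg : -1 ≤ ordAt p g) : -1 ≤ ordAt p (f + g) := by
  rcases eq_or_ne (f + g) 0 with h | h
  · simp [h, ordAt]
  · rw [ordAt, le_order_iff_forall (laurentAt_ne_zero p h)]
    intro j hj
    rw [map_add, coeff_add, coeff_eq_zero_of_lt_order (hj.trans_le hf),
      coeff_eq_zero_of_lt_order (hj.trans_le hg), add_zero]

theorem ordAt_C_mul_ge (p c : ℂ) {f : RatFunc ℂ} {n : ℤ} (hn : n ≤ 0) (hf : n ≤ ordAt p f) :
    n ≤ ordAt p (RatFunc.C c * f) := by
  rcases eq_or_ne c 0 with rfl | hc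
  · simpa [ordAt] using hn
  · rcases eq_or_ne f 0 with rfl | hf0
    · simpa [ordAt] using hn
    · rw [ordAt_mul p (C_ne_zero hc) hf0, ordAt_C p hc, zero_add]
      exact hf

/-- If `f` is regular at `0` and `∞` and has at most simple poles, all of them in `Z`, then the
difference of its expansions at `∞` and at `0` is `∑ p ∈ Z, res_p (f dz / z) δ(z / p)`. -/
theorem coeffAt_true_sub_false {f : RatFunc ℂ} (hf : Balanced f) (Z : Finset ℂ)
    (hZ : ∀ p ∈ Z, p ≠ 0) (h : ∀ p, -1 ≤ ordAt p f) (h' : ∀ p, p ∉ Z → 0 ≤ ordAt p f) (r : ℤ) :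
    coeffAt true f r - coeffAt false f r = ∑ p ∈ Z, residueAt f p * p ^ r := by
  -- Subtracting the principal parts leaves a constant.
  have main : ∀ Z' : Finset ℂ, (∀ p ∈ Z', p ≠ 0) → ∃ g : RatFunc ℂ,
      (∀ r, coeffAt true f r - coeffAt false f r = coeffAt true g r - coeffAt false g r +
        ∑ p ∈ Z', residueAt f p * p ^ r) ∧
      (∀ r : ℤ, r < 0 → coeffAt true g r = 0) ∧ (∀ p, -1 ≤ ordAt p g) ∧
      (∀ p, 0 ≤ ordAt p f → 0 ≤ ordAt p g ∨ p ∈ Z') ∧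
      (∀ p ≠ 0, residueAt g p = if p ∈ Z' then 0 else residueAt f p) := by
    intro Z'
    induction Z' using Finset.induction_on with
    | empty =>
      intro _
      exact ⟨f, by simp, fun r hr => hf.coeffAt_eq_zero true hr, h, fun p hp => Or.inl hp, by simp⟩
    | insert a s ha ih =>
      intro hs
      have ha0 : a ≠ 0 := hs a (Finset.mem_insert_self _ _)
      obtain ⟨g, h1, h2, h3, h4, h5⟩ := ih fun p hp => hs p (Finset.mem_insert_of_mem hp)
      refine ⟨g + RatFunc.C (-residueAt f a) * simplePole a, ?_, ?_, ?_, ?_, ?_⟩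
      · intro r
        rw [coeffAt_add, coeffAt_add, coeffAt_C_mul, coeffAt_C_mul, Finset.sum_insert ha, h1]
        linear_combination residueAt f a * coeffAt_simplePole ha0 r
      · intro r hr
        rw [coeffAt_add, coeffAt_C_mul, h2 r hr, coeffAt_true_simplePole_neg ha0 hr]
        simp
      · intro p
        refine neg_one_le_ordAt_add (h3 p) (ordAt_C_mul_ge p _ (by norm_num) ?_)
        rw [ordAt_simplePole p a]
        split_ifs <;> norm_num
      · intro p hp
        by_cases hpa : p = a
        · exact Or.inr (hpa ▸ Finset.mem_insert_self _ _)
        · rcases h4 p hp with h6 | h6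
          · refine Or.inl (ordAt_add_nonneg h6 (ordAt_C_mul_ge p _ le_rfl ?_))
            rw [ordAt_simplePole p a, if_neg hpa]
            split_ifs <;> norm_num
          · exact Or.inr (Finset.mem_insert_of_mem h6)
      · intro p hp
        rw [residueAt_add, residueAt_C_mul, h5 p hp, residueAt_simplePole ha0 hp]
        by_cases hpa : p = a
        · subst hpa; simp [ha]
        · simp [hpa]
  obtain ⟨g, h1, h2, h3, h4, h5⟩ := main Z hZ
  have h6 : ∀ p, 0 ≤ ordAt p g := by
    intro p
    have key : p ∈ Z → 0 ≤ ordAt p g := fun hp =>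
      ordAt_nonneg_of_residueAt_eq_zero (hZ p hp) (h3 p) (by rw [h5 p (hZ p hp), if_pos hp])
    by_cases hp : p ∈ Z
    · exact key hp
    · exact (h4 p (h' p hp)).elim id key
  obtain ⟨c, rfl⟩ := eq_C_of_ordAt_nonneg h6 h2
  rw [h1 r]
  have : coeffAt true (RatFunc.C c) r - coeffAt false (RatFunc.C c) r = 0 := by
    rw [coeffAt_eq, coeffAt_eq, expand_C, expand_C]
    by_cases hr : r = 0 <;> simp [expSign, hr]
  rw [this, zero_add]

end LocalAnalysis

end Toroidal

/-! ### The simple affine roots -/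

namespace Toroidal

namespace QParams

theorem q_ne_zero (P : QParams) : P.q ≠ 0 := Complex.exp_ne_zero _
theorem d_ne_zero (P : QParams) : P.d ≠ 0 := Complex.exp_ne_zero _
theorem q₁_ne_zero (P : QParams) : P.q₁ ≠ 0 := mul_ne_zero (inv_ne_zero P.q_ne_zero) P.d_ne_zero
theorem q₂_ne_zero (P : QParams) : P.q₂ ≠ 0 := pow_ne_zero _ P.q_ne_zero
theorem q₃_ne_zero (P : QParams) : P.q₃ ≠ 0 :=
  mul_ne_zero (inv_ne_zero P.q_ne_zero) (inv_ne_zero P.d_ne_zero)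

theorem q₁_mul_q₂_mul_q₃ (P : QParams) : P.q₁ * P.q₂ * P.q₃ = 1 := by
  have h1 := P.q_ne_zero
  have h2 := P.d_ne_zero
  simp only [q₁, q₂, q₃]
  field_simp

end QParams

/-- The value `g_{i,j}(z, w)` at numbers `z`, `w`. -/
noncomputable def gC (P : QParams) (i j : ZMod 2) (z w : ℂ) : ℂ :=
  if i = j then z - P.q₂ * w else (z - P.q₁ * w) * (z - P.q₃ * w)

/-- The numerator of `A_{i,a}` in color `j`. -/
noncomputable def rootNum (P : QParams) (i : ZMod 2) (a : ℂ) (j : ZMod 2) : Polynomial ℂ :=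
  if i = j then Polynomial.C P.q₂ * Polynomial.X - Polynomial.C a
  else (Polynomial.C P.q₁ * Polynomial.X - Polynomial.C a) *
    (Polynomial.C P.q₃ * Polynomial.X - Polynomial.C a)

/-- The denominator of `A_{i,a}` in color `j`. -/
noncomputable def rootDen (P : QParams) (i : ZMod 2) (a : ℂ) (j : ZMod 2) : Polynomial ℂ :=
  if i = j then Polynomial.X - Polynomial.C (P.q₂ * a)
  else (Polynomial.X - Polynomial.C (P.q₁ * a)) * (Polynomial.X - Polynomial.C (P.q₃ * a))

theorem affRoot_eq (P : QParams) (i : ZMod 2) (a : ℂ) (j : ZMod 2) :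
    affRoot P i a j = algebraMap _ _ (rootNum P i a j) / algebraMap _ _ (rootDen P i a j) := by
  by_cases h : i = j <;> simp [affRoot, rootNum, rootDen, h, lin]

theorem rootNum_eval (P : QParams) (i : ZMod 2) (a : ℂ) (j : ZMod 2) (p : ℂ) :
    (rootNum P i a j).eval p = -colorSign i j * gC P i j a p := by
  by_cases h : i = j
  · simp [rootNum, gC, colorSign, h]
  · simp [rootNum, gC, colorSign, h]; ring

theorem rootDen_eval (P : QParams) (i : ZMod 2) (a : ℂ) (j : ZMod 2) (p : ℂ) :
    (rootDen P i a j).eval p = gC P j i p a := by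
  by_cases h : i = j
  · simp [rootDen, gC, h]
  · simp [rootDen, gC, h, Ne.symm h]

theorem rootDen_ne_zero (P : QParams) (i : ZMod 2) (a : ℂ) (j : ZMod 2) : rootDen P i a j ≠ 0 := by
  unfold rootDen
  split_ifs
  · exact Polynomial.X_sub_C_ne_zero _
  · exact mul_ne_zero (Polynomial.X_sub_C_ne_zero _) (Polynomial.X_sub_C_ne_zero _)

theorem C_mul_X_sub_C_ne_zero {c : ℂ} (hc : c ≠ 0) (a : ℂ) :
    Polynomial.C c * Polynomial.X - Polynomial.C a ≠ 0 := by
  intro h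
  have := congrArg (fun Q => Polynomial.coeff Q 1) h
  simp [Polynomial.coeff_C, hc] at this

theorem rootNum_ne_zero (P : QParams) (i : ZMod 2) (a : ℂ) (j : ZMod 2) : rootNum P i a j ≠ 0 := by
  unfold rootNum
  split_ifs
  · exact C_mul_X_sub_C_ne_zero P.q₂_ne_zero a
  · exact mul_ne_zero (C_mul_X_sub_C_ne_zero P.q₁_ne_zero a) (C_mul_X_sub_C_ne_zero P.q₃_ne_zero a)

theorem algebraMap_poly_ne_zero {Q : Polynomial ℂ} (h : Q ≠ 0) :
    algebraMap (Polynomial ℂ) (RatFunc ℂ) Q ≠ 0 :=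
  (map_ne_zero_iff _ (IsFractionRing.injective _ _)).2 h

theorem affRoot_ne_zero (P : QParams) (i : ZMod 2) (a : ℂ) (j : ZMod 2) : affRoot P i a j ≠ 0 := by
  rw [affRoot_eq]
  exact div_ne_zero (algebraMap_poly_ne_zero (rootNum_ne_zero P i a j))
    (algebraMap_poly_ne_zero (rootDen_ne_zero P i a j))

theorem colorSign_ne_zero (i j : ZMod 2) : colorSign i j ≠ 0 := by
  unfold colorSign; split_ifs <;> norm_num

theorem colorSign_mul_self (i j : ZMod 2) : colorSign i j * colorSign i j = 1 := by
  unfold colorSign; split_ifs <;> norm_num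

theorem colorSign_comm (i j : ZMod 2) : colorSign i j = colorSign j i := by
  simp only [colorSign, eq_comm]

theorem ordAt_affRoot {P : QParams} {i : ZMod 2} {a : ℂ} {j : ZMod 2} {p : ℂ}
    (h1 : gC P i j a p ≠ 0) (h2 : gC P j i p a ≠ 0) : ordAt p (affRoot P i a j) = 0 := by
  rw [affRoot_eq, ordAt_div p (algebraMap_poly_ne_zero (rootNum_ne_zero P i a j))
    (algebraMap_poly_ne_zero (rootDen_ne_zero P i a j)), ordAt_algebraMap_eq_zero,
    ordAt_algebraMap_eq_zero, sub_zero]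
  · rwa [rootDen_eval]
  · rw [rootNum_eval]
    exact mul_ne_zero (neg_ne_zero.2 (colorSign_ne_zero i j)) h1

theorem lcAt_affRoot_mul {P : QParams} {i : ZMod 2} {a : ℂ} {j : ZMod 2} {p : ℂ}
    (h1 : gC P i j a p ≠ 0) (h2 : gC P j i p a ≠ 0) :
    lcAt p (affRoot P i a j) * gC P j i p a = -colorSign i j * gC P i j a p := by
  have h3 : (rootDen P i a j).eval p ≠ 0 := by rwa [rootDen_eval]
  have h4 : (rootNum P i a j).eval p ≠ 0 := by
    rw [rootNum_eval]
    exact mul_ne_zero (neg_ne_zero.2 (colorSign_ne_zero i j)) h1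
  rw [affRoot_eq, lcAt_div, lcAt_algebraMap h3, lcAt_algebraMap h4, rootNum_eval, rootDen_eval,
    div_mul_cancel₀ _ h2]

theorem unitEnd_lin_div {ε : Bool} {a b : ℂ} (ha : a ≠ 0) (hb : b ≠ 0) :
    UnitEnd ε (lin a / lin b) ∧ lcEnd ε (lin a / lin b) = if ε then 1 else a / b := by
  have hcoeff : ∀ a : ℂ, a ≠ 0 → lcEnd ε (lin a) = if ε then 1 else -a := by
    intro a ha
    rw [lcEnd, HahnSeries.leadingCoeff_eq, order_expand_lin ε ha]
    have h : expand ε (lin a) = HahnSeries.single (expSign ε (-1)) 1 - HahnSeries.single 0 a := by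
      rw [lin, map_sub, expand_X, expand_C]
    cases ε <;> simp [h, expSign]
  have h0 : lin a / lin b ≠ 0 := div_ne_zero (lin_ne_zero a) (lin_ne_zero b)
  have hmul : lin a / lin b * lin b = lin a := div_mul_cancel₀ _ (lin_ne_zero b)
  refine ⟨⟨h0, ?_⟩, ?_⟩
  · have := HahnSeries.order_mul (expand_ne_zero ε h0) (expand_ne_zero ε (lin_ne_zero b))
    rw [← map_mul, hmul, order_expand_lin ε ha, order_expand_lin ε hb] at this
    omega
  · have := lcEnd_mul ε (lin a / lin b) (lin b)
    rw [hmul, hcoeff a ha, hcoeff b hb] at this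
    cases ε
    · simp only [Bool.false_eq_true, if_false] at this ⊢
      rw [eq_div_iff hb]
      linear_combination this
    · simpa using this.symm

theorem unitEnd_C {ε : Bool} {c : ℂ} (hc : c ≠ 0) :
    UnitEnd ε (RatFunc.C c) ∧ lcEnd ε (RatFunc.C c) = c := by
  refine ⟨⟨C_ne_zero hc, ?_⟩, ?_⟩
  · rw [expand_C, HahnSeries.order_single hc]
  · rw [lcEnd, expand_C, HahnSeries.leadingCoeff_of_single]

theorem C_mul_X_sub_C_eq {c : ℂ} (hc : c ≠ 0) (a : ℂ) :
    RatFunc.C c * RatFunc.X - RatFunc.C a = RatFunc.C c * lin (c⁻¹ * a) := by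
  rw [lin, mul_sub, ← map_mul, mul_inv_cancel_left₀ hc]

theorem balanced_linear_div {c a : ℂ} (hc : c ≠ 0) (ha : a ≠ 0) :
    Balanced ((RatFunc.C c * RatFunc.X - RatFunc.C a) / lin (c * a)) := by
  rw [C_mul_X_sub_C_eq hc, mul_div_assoc, balanced_iff]
  have h1 : c⁻¹ * a ≠ 0 := mul_ne_zero (inv_ne_zero hc) ha
  have h2 : c * a ≠ 0 := mul_ne_zero hc ha
  refine ⟨(unitEnd_C hc).1.mul (unitEnd_lin_div h1 h2).1,
    (unitEnd_C hc).1.mul (unitEnd_lin_div h1 h2).1, ?_⟩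
  rw [lcEnd_mul, lcEnd_mul, (unitEnd_C hc).2, (unitEnd_C hc).2, (unitEnd_lin_div h1 h2).2,
    (unitEnd_lin_div h1 h2).2]
  simp only [Bool.false_eq_true, if_false, if_true]
  field_simp

theorem balanced_affRoot (P : QParams) (i : ZMod 2) {a : ℂ} (ha : a ≠ 0) (j : ZMod 2) :
    Balanced (affRoot P i a j) := by
  unfold affRoot
  split_ifs
  · exact balanced_linear_div P.q₂_ne_zero ha
  · rw [mul_div_mul_comm]
    exact (balanced_linear_div P.q₁_ne_zero ha).mul (balanced_linear_div P.q₃_ne_zero ha)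

theorem lcEnd_prod (ε : Bool) {ι : Type*} (s : Finset ι) (f : ι → RatFunc ℂ) :
    lcEnd ε (∏ i ∈ s, f i) = ∏ i ∈ s, lcEnd ε (f i) := by
  classical
  induction s using Finset.induction_on with
  | empty => simp [lcEnd]
  | insert a s ha ih => rw [Finset.prod_insert ha, Finset.prod_insert ha, lcEnd_mul, ih]

theorem lcEnd_affRoot (P : QParams) (i : ZMod 2) {a : ℂ} (ha : a ≠ 0) (j : ZMod 2) :
    lcEnd true (affRoot P i a j) = if i = j then P.q₂ else P.q₂⁻¹ := by
  have h0 : ∀ {c : ℂ} (_ : c ≠ 0),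
      lcEnd true ((RatFunc.C c * RatFunc.X - RatFunc.C a) / lin (c * a)) = c := by
    intro c hc
    rw [C_mul_X_sub_C_eq hc, mul_div_assoc, lcEnd_mul, (unitEnd_C hc).2,
      (unitEnd_lin_div (mul_ne_zero (inv_ne_zero hc) ha) (mul_ne_zero hc ha)).2, if_pos rfl, mul_one]
  unfold affRoot
  split_ifs
  · exact h0 P.q₂_ne_zero
  · rw [mul_div_mul_comm, lcEnd_mul, h0 P.q₁_ne_zero, h0 P.q₃_ne_zero]
    apply eq_inv_of_mul_eq_one_right
    linear_combination P.q₁_mul_q₂_mul_q₃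

/-! ### Added boxes and regular combinatorial data -/

namespace CombData

variable {B : Type} [LinearOrder B]

/-- A box counts as added to a state if it is positive and in the state, or negative and not in the
state: the added boxes are those actually present when the negative boxes are present in the
reference state. -/
def Added (D : CombData B) (l : Finset B) (b : B) : Prop :=
  (D.positive b ∧ b ∈ l) ∨ (¬ D.positive b ∧ b ∉ l)

theorem added_ext (D : CombData B) {l l' : Finset B} (h : ∀ b, D.Added l b ↔ D.Added l' b) :
    l = l' := by
  ext b
  have := h b
  unfold Added at this
  tauto

theorem added_add {D : CombData B} {l : Finset B} {b c : B} :
    D.Added (D.add l b) c ↔ c = b ∨ D.Added l c := by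
  unfold Added add
  by_cases hc : c = b
  · subst hc
    split_ifs <;> simp [*]
  · split_ifs <;> simp [*]

theorem added_remove {D : CombData B} {l : Finset B} {b c : B} :
    D.Added (D.remove l b) c ↔ c ≠ b ∧ D.Added l c := by
  unfold Added remove
  by_cases hc : c = b
  · subst hc
    split_ifs <;> simp [*]
  · split_ifs <;> simp [*]

theorem add_comm (D : CombData B) (l : Finset B) (b c : B) :
    D.add (D.add l b) c = D.add (D.add l c) b := by
  apply added_ext D
  intro x
  simp only [added_add]
  tauto

theorem remove_add {D : CombData B} {l : Finset B} {b : B} (h : ¬ D.Added l b) :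
    D.remove (D.add l b) b = l :=
  by
    apply added_ext D
    intro x
    simp only [added_add, added_remove]
    by_cases hx : x = b
    · subst hx; simp [h]
    · simp [hx]

theorem add_remove {D : CombData B} {l : Finset B} {b : B} (h : D.Added l b) :
    D.add (D.remove l b) b = l :=
  by
    apply added_ext D
    intro x
    simp only [added_add, added_remove]
    by_cases hx : x = b
    · subst hx; simp [h]
    · simp [hx]

theorem not_added_remove {D : CombData B} {l : Finset B} {b : B} : ¬ D.Added (D.remove l b) b := by
  simp [added_remove]

theorem added_add_self {D : CombData B} {l : Finset B} {b : B} : D.Added (D.add l b) b :=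
  added_add.2 (Or.inl rfl)

theorem mem_CC {D : CombData B} {l : Finset B} {b : B} {i : ZMod 2} :
    b ∈ D.CC i l ↔ D.color b = i ∧ ¬ D.Added l b ∧ D.add l b ∈ D.S := by
  unfold CC Added
  simp only [Set.mem_ofPred_eq]
  tauto

theorem mem_CV {D : CombData B} {l : Finset B} {b : B} {i : ZMod 2} :
    b ∈ D.CV i l ↔ D.color b = i ∧ D.Added l b ∧ D.remove l b ∈ D.S := Iff.rfl

theorem pos_ne_zero (D : CombData B) (P : QParams) (b : B) : D.pos P b ≠ 0 :=
  mul_ne_zero (mul_ne_zero (Complex.exp_ne_zero _) (Complex.exp_ne_zero _)) (Complex.exp_ne_zero _)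

/-- The value of `g` at the colors and positions of two boxes. -/
noncomputable def gBox (D : CombData B) (P : QParams) (u v : B) : ℂ :=
  gC P (D.color u) (D.color v) (D.pos P u) (D.pos P v)

/-- Two boxes are neighbors if the affine root of one has a zero or a pole at the other. -/
def Nbr (D : CombData B) (P : QParams) (u v : B) : Prop := D.gBox P u v = 0 ∨ D.gBox P v u = 0

theorem Nbr.symm {D : CombData B} {P : QParams} {u v : B} (h : D.Nbr P u v) : D.Nbr P v u :=
  Or.symm h

/-- Conditions on combinatorial data under which the formulas for the action define a module.
`Supports v u` says that the box `v` has to be added before the box `u`; the states are the finite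
sets of boxes for which the set of added boxes is closed under supports. -/
structure IsRegular (D : CombData B) (P : QParams) (Supports : B → B → Prop) : Prop where
  q₂_ne_one : P.q₂ ≠ 1
  pos_injective : Function.Injective (D.pos P)
  mem_S : ∀ l, l ∈ D.S ↔ ∀ u v, Supports v u → D.Added l u → D.Added l v
  lt_of_supports : ∀ {u v}, Supports v u → v < u
  positive_of_supports : ∀ {u v}, Supports v u → D.positive v → D.positive u
  gBox_of_supports : ∀ {u v}, Supports v u → D.gBox P v u = 0
  /-- Neighbors are comparable: the earlier one is needed for the later one. -/
  added_of_nbr : ∀ {u v l}, D.Nbr P u v → u < v → l ∈ D.S → D.Added l v → D.Added l u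
  /-- If the vanishing of `g` does not come from a support, then there are two boxes between the
  two given ones, one of either color. -/
  exists_between : ∀ {u v}, D.gBox P v u = 0 → u < v → D.color u ≠ D.color v ∧
    ∃ x y, D.color x = D.color u ∧
    D.color y = D.color v ∧ x ≠ u ∧ y ≠ v ∧ ∀ l ∈ D.S, (D.Added l v → D.Added l x ∧ D.Added l y) ∧
      (D.Added l x → D.Added l u) ∧ (D.Added l y → D.Added l u)
  not_nbr_of_positive_lt : ∀ {u v}, D.positive u → ¬ D.positive v → u < v → ¬ D.Nbr P u v
  neg_one_le_ord : ∀ l ∈ D.S, ∀ i z, -1 ≤ ordAt z (D.phi P l i)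
  ord_neg_iff : ∀ l ∈ D.S, ∀ i z, ordAt z (D.phi P l i) < 0 ↔
    ∃ b, (b ∈ D.CC i l ∨ b ∈ D.CV i l) ∧ D.pos P b = z
  balanced_Ψ : ∀ i, Balanced (D.Ψ i)
  phi_injective : ∀ l ∈ D.S, ∀ l' ∈ D.S, D.phi P l = D.phi P l' → l = l'

/-! ### Leading coefficients and the structure constants -/

open Classical in
theorem prod_filter_add (D : CombData B) (P : QParams) (Q : B → Prop) {l : Finset B} {c : B}
    (hc : ¬ D.Added l c) (i : ZMod 2) :
    ∏ x ∈ D.add l c with Q x, D.boxWeight P x i =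
      (∏ x ∈ l with Q x, D.boxWeight P x i) *
        if Q c then (affRoot P (D.color c) (D.pos P c) i)⁻¹ else 1 := by
  unfold Added at hc
  by_cases hp : D.positive c
  · have hcl : c ∉ l := by tauto
    have : D.add l c = insert c l := by rw [add, if_pos hp]
    rw [this, Finset.filter_insert]
    split_ifs with hQ
    · rw [Finset.prod_insert (by simp [hcl]), mul_comm, boxWeight, if_pos hp]
    · rw [mul_one]
  · have hcl : c ∈ l := by tauto
    have : D.add l c = l.erase c := by rw [add, if_neg hp]
    rw [this, Finset.filter_erase]
    split_ifs with hQ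
    · have hm : c ∈ l.filter Q := Finset.mem_filter.2 ⟨hcl, hQ⟩
      rw [← Finset.prod_erase_mul _ _ hm, boxWeight, if_neg hp, mul_assoc,
        mul_inv_cancel₀ (affRoot_ne_zero _ _ _ _), mul_one]
    · rw [Finset.erase_eq_of_notMem (by simp [hQ]), mul_one]

theorem phi_add {D : CombData B} {P : QParams} {l : Finset B} {c : B} (hc : ¬ D.Added l c)
    (i : ZMod 2) :
    D.phi P (D.add l c) i = D.phi P l i * (affRoot P (D.color c) (D.pos P c) i)⁻¹ := by
  have := prod_filter_add D P (fun _ => True) hc i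
  simp only [Finset.filter_true, if_true] at this
  rw [phi, phi, this, mul_assoc]

open Classical in
theorem phiGt_add {D : CombData B} {P : QParams} {l : Finset B} {c : B} (hc : ¬ D.Added l c)
    (b : B) (i : ZMod 2) :
    D.phiGt P (D.add l c) b i =
      D.phiGt P l b i * if b < c then (affRoot P (D.color c) (D.pos P c) i)⁻¹ else 1 := by
  have := prod_filter_add D P (fun x => b < x) hc i
  rw [phiGt, phiGt, mul_assoc]
  congr 1
  convert this

open Classical in
theorem phiLt_add {D : CombData B} {P : QParams} {l : Finset B} {c : B} (hc : ¬ D.Added l c)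
    (b : B) (i : ZMod 2) :
    D.phiLt P (D.add l c) b i =
      D.phiLt P l b i * if c < b then (affRoot P (D.color c) (D.pos P c) i)⁻¹ else 1 := by
  have := prod_filter_add D P (fun x => x < b) hc i
  rw [phiLt, phiLt, mul_assoc]
  congr 1
  convert this

theorem boxWeight_ne_zero (D : CombData B) (P : QParams) (b : B) (i : ZMod 2) :
    D.boxWeight P b i ≠ 0 := by
  unfold boxWeight
  split_ifs
  · exact inv_ne_zero (affRoot_ne_zero _ _ _ _)
  · exact affRoot_ne_zero _ _ _ _

open Classical in
theorem phi_eq_phiLt_mul_phiGt (D : CombData B) (P : QParams) (l : Finset B) (b : B) (i : ZMod 2) :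
    D.phi P l i = D.phiLt P l b i * D.phiGt P l b i * if b ∈ l then D.boxWeight P b i else 1 := by
  have h1 : ∏ x ∈ l, D.boxWeight P x i = (∏ x ∈ l with x < b, D.boxWeight P x i) *
      ((∏ x ∈ l with b < x, D.boxWeight P x i) * if b ∈ l then D.boxWeight P b i else 1) := by
    rw [← Finset.prod_filter_mul_prod_filter_not l (fun x => x < b)]
    congr 1
    rw [← Finset.prod_filter_mul_prod_filter_not (l.filter fun x => ¬ x < b) (fun x => b < x)]
    congr 1
    · apply Finset.prod_congr _ fun _ _ => rfl
      ext x
      simp only [Finset.mem_filter, not_lt]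
      exact ⟨fun h => ⟨h.1.1, h.2⟩, fun h => ⟨⟨h.1, h.2.le⟩, h.2⟩⟩
    · have : (l.filter fun x => ¬ x < b).filter (fun x => ¬ b < x) = l.filter (fun x => x = b) := by
        ext x
        simp only [Finset.mem_filter, not_lt, and_assoc, and_congr_right_iff]
        intro _
        exact ⟨fun h => le_antisymm h.2 h.1, fun h => ⟨h.ge, h.le⟩⟩
      rw [this, Finset.filter_eq']
      split_ifs <;> simp
  rw [phi, h1, phiLt, phiGt]
  have e1 : ∀ x y : RatFunc ℂ, (if D.positive b then D.Ψ i else 1) * x *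
      ((if D.positive b then 1 else D.Ψ i) * y) = D.Ψ i * (x * y) := by
    intro x y
    split_ifs <;> ring
  rw [e1]
  ring

/-- The factor by which the value of `φ_{λ,>□}` or the residue differs from a leading coefficient
in `a_{λ,□}`. -/
noncomputable def aScale (D : CombData B) (P : QParams) (b : B) : ℂ :=
  open Classical in if D.positive b then 1 else -1 / (P.q - P.q⁻¹) / D.pos P b

/-- The factor by which the value of `φ_{λ,<□}` or the residue differs from a leading coefficient
in `b_{λ,□}`. -/
noncomputable def bScale (D : CombData B) (P : QParams) (b : B) : ℂ :=
  open Classical in if D.positive b then 1 / (P.q - P.q⁻¹) / D.pos P b else 1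

namespace IsRegular

variable {D : CombData B} {P : QParams} {Supports : B → B → Prop} (h : D.IsRegular P Supports)
include h

theorem inter_mem {l l₁ l₂ : Finset B} (h1 : l₁ ∈ D.S) (h2 : l₂ ∈ D.S)
    (hl : ∀ b, D.Added l b ↔ D.Added l₁ b ∧ D.Added l₂ b) : l ∈ D.S := by
  rw [h.mem_S] at *
  intro u v huv hu
  rw [hl] at *
  exact ⟨h1 u v huv hu.1, h2 u v huv hu.2⟩

theorem union_mem {l l₁ l₂ : Finset B} (h1 : l₁ ∈ D.S) (h2 : l₂ ∈ D.S)
    (hl : ∀ b, D.Added l b ↔ D.Added l₁ b ∨ D.Added l₂ b) : l ∈ D.S := by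
  rw [h.mem_S] at *
  intro u v huv hu
  rw [hl] at *
  exact hu.imp (h1 u v huv) (h2 u v huv)

/-- If `v` can be added only after `u`, then `u` supports `v`. -/
theorem gBox_eq_zero {l : Finset B} {u v : B} (hl : l ∈ D.S)
    (huv : D.add (D.add l u) v ∈ D.S) (hv : D.add l v ∉ D.S) : D.gBox P u v = 0 := by
  by_contra hg
  apply hv
  rw [h.mem_S]
  intro x y hxy hx
  rcases added_add.1 hx with rfl | hx
  · have : D.Added (D.add (D.add l u) x) y := (h.mem_S _).1 huv _ _ hxy added_add_self
    simp only [added_add] at this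
    rcases this with hy | rfl | hy
    · exact absurd (h.lt_of_supports hxy) (by rw [hy]; exact lt_irrefl _)
    · exact absurd (h.gBox_of_supports hxy) hg
    · exact added_add.2 (Or.inr hy)
  · exact added_add.2 (Or.inr ((h.mem_S _).1 hl _ _ hxy hx))

theorem q_sub_inv_ne_zero : P.q - P.q⁻¹ ≠ 0 := by
  intro h0
  apply h.q₂_ne_one
  have := P.q_ne_zero
  rw [QParams.q₂, pow_two]
  field_simp at h0
  linear_combination h0

theorem gBox_self_ne_zero (b : B) : D.gBox P b b ≠ 0 := by
  rw [gBox, gC, if_pos rfl]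
  intro h0
  apply h.q₂_ne_one
  have h1 := D.pos_ne_zero P b
  apply mul_right_cancel₀ h1
  linear_combination -h0

theorem not_nbr_self (b : B) : ¬ D.Nbr P b b := by
  rintro (h0 | h0) <;> exact h.gBox_self_ne_zero b h0

omit h in
theorem ordAt_affRoot_of_not_nbr {b c : B} (hbc : ¬ D.Nbr P b c) :
    ordAt (D.pos P b) (affRoot P (D.color c) (D.pos P c) (D.color b)) = 0 :=
  ordAt_affRoot (fun h0 => hbc (Or.inr h0)) (fun h0 => hbc (Or.inl h0))

omit h in
theorem ordAt_boxWeight_of_not_nbr {b c : B} (hbc : ¬ D.Nbr P b c) :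
    ordAt (D.pos P b) (D.boxWeight P c (D.color b)) = 0 := by
  unfold boxWeight
  split_ifs
  · rw [ordAt_inv, ordAt_affRoot_of_not_nbr hbc, neg_zero]
  · exact ordAt_affRoot_of_not_nbr hbc

omit h in
theorem lcAt_affRoot_of_not_nbr {b c : B} (hbc : ¬ D.Nbr P b c) :
    lcAt (D.pos P b) (affRoot P (D.color c) (D.pos P c) (D.color b)) * D.gBox P b c =
      -colorSign (D.color c) (D.color b) * D.gBox P c b :=
  lcAt_affRoot_mul (fun h0 => hbc (Or.inr h0)) (fun h0 => hbc (Or.inl h0))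

/-- The weight of a box takes the value `-1` at its own position. -/
theorem lcAt_boxWeight_self (b : B) :
    lcAt (D.pos P b) (D.boxWeight P b (D.color b)) = -1 := by
  have h1 : lcAt (D.pos P b) (affRoot P (D.color b) (D.pos P b) (D.color b)) = -1 := by
    have := lcAt_affRoot_of_not_nbr (h.not_nbr_self b)
    rw [colorSign, if_pos rfl] at this
    exact mul_right_cancel₀ (h.gBox_self_ne_zero b) this
  unfold boxWeight
  split_ifs
  · rw [lcAt_inv, h1]; norm_num
  · exact h1

theorem phi_ne_zero (l : Finset B) (i : ZMod 2) : D.phi P l i ≠ 0 :=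
  mul_ne_zero (h.balanced_Ψ i).ne_zero
    (Finset.prod_ne_zero_iff.2 fun _ _ => boxWeight_ne_zero _ _ _ _)

theorem phiGt_ne_zero (l : Finset B) (b : B) (i : ZMod 2) : D.phiGt P l b i ≠ 0 := by
  refine mul_ne_zero ?_ (Finset.prod_ne_zero_iff.2 fun _ _ => boxWeight_ne_zero _ _ _ _)
  split_ifs
  · exact one_ne_zero
  · exact (h.balanced_Ψ i).ne_zero

theorem phiLt_ne_zero (l : Finset B) (b : B) (i : ZMod 2) : D.phiLt P l b i ≠ 0 := by
  refine mul_ne_zero ?_ (Finset.prod_ne_zero_iff.2 fun _ _ => boxWeight_ne_zero _ _ _ _)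
  split_ifs
  · exact (h.balanced_Ψ i).ne_zero
  · exact one_ne_zero

theorem balanced_phi (l : Finset B) (i : ZMod 2) : Balanced (D.phi P l i) := by
  refine (h.balanced_Ψ i).mul (balanced_prod _ _ fun b _ => ?_)
  unfold boxWeight
  split_ifs
  · exact (balanced_affRoot P _ (D.pos_ne_zero P b) i).inv
  · exact balanced_affRoot P _ (D.pos_ne_zero P b) i

/-- If both `l` with `b` and `l` without `b` are states, then the boxes of the state after `b` are
no neighbors of `b`, if `b` is positive; those before `b` are none, if `b` is negative. -/
theorem not_nbr_of_mem {m : Finset B} {b c : B} (hm : m ∈ D.S) (hb : ¬ D.Added m b)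
    (hmb : D.add m b ∈ D.S) {l : Finset B} (hl : l = m ∨ l = D.add m b) (hc : c ∈ l)
    (hpos : D.positive b → b < c) (hneg : ¬ D.positive b → c < b) : ¬ D.Nbr P b c := by
  intro hn
  have hne : c ≠ b := by
    rintro rfl
    by_cases hp : D.positive c
    · exact lt_irrefl _ (hpos hp)
    · exact lt_irrefl _ (hneg hp)
  have hcl : D.Added l c ↔ D.Added m c := by
    rcases hl with rfl | rfl
    · rfl
    · rw [added_add]; exact or_iff_right hne
  by_cases hp : D.positive b
  · have hbc := hpos hp
    by_cases hpc : D.positive c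
    · exact hb (h.added_of_nbr hn hbc hm (hcl.1 (Or.inl ⟨hpc, hc⟩)))
    · exact h.not_nbr_of_positive_lt hp hpc hbc hn
  · have hbc := hneg hp
    by_cases hpc : D.positive c
    · exact h.not_nbr_of_positive_lt hpc hp hbc hn.symm
    · have h1 := h.added_of_nbr hn.symm hbc hmb added_add_self
      rw [added_add] at h1
      have h2 := hcl.2 (h1.resolve_left hne)
      unfold Added at h2
      tauto

theorem ordAt_phi_eq {m : Finset B} {b : B} (hm : m ∈ D.S) (hb : ¬ D.Added m b)
    (hmb : D.add m b ∈ D.S) {l : Finset B} (hl : l = m ∨ l = D.add m b) :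
    ordAt (D.pos P b) (D.phi P l (D.color b)) = -1 := by
  have h1 : l ∈ D.S := by rcases hl with rfl | rfl <;> assumption
  have h2 := (h.ord_neg_iff l h1 (D.color b) (D.pos P b)).2 (by
    refine ⟨b, ?_, rfl⟩
    rcases hl with rfl | rfl
    · exact Or.inl (mem_CC.2 ⟨rfl, hb, hmb⟩)
    · exact Or.inr (mem_CV.2 ⟨rfl, added_add_self, by rwa [remove_add hb]⟩))
  have h3 := h.neg_one_le_ord l h1 (D.color b) (D.pos P b)
  omega

theorem ordAt_phiGt {m : Finset B} {b : B} (hm : m ∈ D.S) (hb : ¬ D.Added m b)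
    (hmb : D.add m b ∈ D.S) {l : Finset B} (hl : l = m ∨ l = D.add m b) (hp : D.positive b) :
    ordAt (D.pos P b) (D.phiGt P l b (D.color b)) = 0 := by
  rw [phiGt, if_pos hp, one_mul, ordAt_prod _ _ _ fun _ _ => boxWeight_ne_zero _ _ _ _]
  apply Finset.sum_eq_zero
  intro c hc
  simp only [Finset.mem_filter] at hc
  exact ordAt_boxWeight_of_not_nbr (h.not_nbr_of_mem hm hb hmb hl hc.1 (fun _ => hc.2)
    fun hn => absurd hp hn)

theorem ordAt_phiLt {m : Finset B} {b : B} (hm : m ∈ D.S) (hb : ¬ D.Added m b)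
    (hmb : D.add m b ∈ D.S) {l : Finset B} (hl : l = m ∨ l = D.add m b) (hp : ¬ D.positive b) :
    ordAt (D.pos P b) (D.phiLt P l b (D.color b)) = 0 := by
  rw [phiLt, if_neg hp, one_mul, ordAt_prod _ _ _ fun _ _ => boxWeight_ne_zero _ _ _ _]
  apply Finset.sum_eq_zero
  intro c hc
  simp only [Finset.mem_filter] at hc
  exact ordAt_boxWeight_of_not_nbr (h.not_nbr_of_mem hm hb hmb hl hc.1 (absurd · hp)
    fun _ => hc.2)

theorem ordAt_phiLt_add_phiGt {m : Finset B} {b : B} (hm : m ∈ D.S) (hb : ¬ D.Added m b)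
    (hmb : D.add m b ∈ D.S) {l : Finset B} (hl : l = m ∨ l = D.add m b) :
    ordAt (D.pos P b) (D.phiLt P l b (D.color b)) +
      ordAt (D.pos P b) (D.phiGt P l b (D.color b)) = -1 := by
  have h1 := h.ordAt_phi_eq hm hb hmb hl
  have h2 : (if b ∈ l then D.boxWeight P b (D.color b) else 1) ≠ 0 := by
    split_ifs
    · exact boxWeight_ne_zero _ _ _ _
    · exact one_ne_zero
  have h3 : ordAt (D.pos P b) (if b ∈ l then D.boxWeight P b (D.color b) else 1) = 0 := by
    split_ifs
    · exact ordAt_boxWeight_of_not_nbr (h.not_nbr_self b)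
    · exact ordAt_one _
  rw [phi_eq_phiLt_mul_phiGt D P l b, ordAt_mul _ (mul_ne_zero (h.phiLt_ne_zero l b _)
    (h.phiGt_ne_zero l b _)) h2, ordAt_mul _ (h.phiLt_ne_zero l b _) (h.phiGt_ne_zero l b _), h3] at h1
  omega

/-- At the position of the box, one of `φ_{λ,<□}` and `φ_{λ,>□}` is regular and nonzero and the
other has a simple pole, so that values and residues are leading coefficients. -/
theorem aCoeff_eq {m : Finset B} {b : B} (hm : m ∈ D.S) (hb : ¬ D.Added m b)
    (hmb : D.add m b ∈ D.S) :
    D.aCoeff P m b (D.color b) = D.aScale P b * lcAt (D.pos P b) (D.phiGt P m b (D.color b)) := by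
  have hsum := h.ordAt_phiLt_add_phiGt hm hb hmb (Or.inl rfl)
  unfold aCoeff aScale
  split_ifs with hp
  · rw [one_mul, valueAt_eq_lcAt (h.phiGt_ne_zero m b _) (h.ordAt_phiGt hm hb hmb (Or.inl rfl) hp)]
  · have := h.ordAt_phiLt hm hb hmb (Or.inl rfl) hp
    rw [residueAt_eq_lcAt (D.pos_ne_zero P b) (h.phiGt_ne_zero m b _) (by omega)]
    ring

theorem bCoeff_eq {m : Finset B} {b : B} (hm : m ∈ D.S) (hb : ¬ D.Added m b)
    (hmb : D.add m b ∈ D.S) :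
    D.bCoeff P (D.add m b) b (D.color b) =
      D.bScale P b * lcAt (D.pos P b) (D.phiLt P m b (D.color b)) := by
  have hsum := h.ordAt_phiLt_add_phiGt hm hb hmb (Or.inr rfl)
  have hlt : D.phiLt P (D.add m b) b (D.color b) = D.phiLt P m b (D.color b) := by
    rw [phiLt_add hb, if_neg (lt_irrefl b), mul_one]
  unfold bCoeff bScale
  rw [← hlt]
  split_ifs with hp
  · have := h.ordAt_phiGt hm hb hmb (Or.inr rfl) hp
    rw [residueAt_eq_lcAt (D.pos_ne_zero P b) (h.phiLt_ne_zero _ b _) (by omega)]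
    ring
  · rw [one_mul, valueAt_eq_lcAt (h.phiLt_ne_zero _ b _) (h.ordAt_phiLt hm hb hmb (Or.inr rfl) hp)]

theorem aScale_ne_zero (b : B) : D.aScale P b ≠ 0 := by
  unfold aScale
  split_ifs
  · exact one_ne_zero
  · exact div_ne_zero (div_ne_zero (by norm_num) h.q_sub_inv_ne_zero) (D.pos_ne_zero P b)

theorem bScale_ne_zero (b : B) : D.bScale P b ≠ 0 := by
  unfold bScale
  split_ifs
  · exact div_ne_zero (div_ne_zero (by norm_num) h.q_sub_inv_ne_zero) (D.pos_ne_zero P b)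
  · exact one_ne_zero

theorem aCoeff_ne_zero {m : Finset B} {b : B} (hm : m ∈ D.S) (hb : ¬ D.Added m b)
    (hmb : D.add m b ∈ D.S) : D.aCoeff P m b (D.color b) ≠ 0 := by
  rw [h.aCoeff_eq hm hb hmb]
  exact mul_ne_zero (h.aScale_ne_zero b) (lcAt_ne_zero _ (h.phiGt_ne_zero m b _))

theorem bCoeff_ne_zero {m : Finset B} {b : B} (hm : m ∈ D.S) (hb : ¬ D.Added m b)
    (hmb : D.add m b ∈ D.S) : D.bCoeff P (D.add m b) b (D.color b) ≠ 0 := by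
  rw [h.bCoeff_eq hm hb hmb]
  exact mul_ne_zero (h.bScale_ne_zero b) (lcAt_ne_zero _ (h.phiLt_ne_zero m b _))

/-- The diagonal structure constants of `E_i F_i`: a residue of the `ℓ`-weight. -/
theorem aCoeff_mul_bCoeff {m : Finset B} {b : B} (hm : m ∈ D.S) (hb : ¬ D.Added m b)
    (hmb : D.add m b ∈ D.S) :
    D.aCoeff P m b (D.color b) * D.bCoeff P (D.add m b) b (D.color b) =
      residueAt (D.phi P m (D.color b)) (D.pos P b) / (P.q - P.q⁻¹) := by
  rw [residueAt_eq_lcAt (D.pos_ne_zero P b) (h.phi_ne_zero m _)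
    (h.ordAt_phi_eq hm hb hmb (Or.inl rfl)), h.aCoeff_eq hm hb hmb, h.bCoeff_eq hm hb hmb,
    phi_eq_phiLt_mul_phiGt D P m b, lcAt_mul, lcAt_mul]
  have hq := h.q_sub_inv_ne_zero
  have hp0 := D.pos_ne_zero P b
  unfold Added at hb
  unfold aScale bScale
  by_cases hp : D.positive b
  · rw [if_pos hp, if_pos hp, if_neg (by tauto), lcAt_one]
    ring
  · rw [if_neg hp, if_neg hp, if_pos (by tauto), h.lcAt_boxWeight_self]
    ring

/-- Adding a box to the state changes the sign of the residue at its position. -/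
theorem residueAt_phi_add {m : Finset B} {b : B} (hm : m ∈ D.S) (hb : ¬ D.Added m b)
    (hmb : D.add m b ∈ D.S) :
    residueAt (D.phi P (D.add m b) (D.color b)) (D.pos P b) =
      -residueAt (D.phi P m (D.color b)) (D.pos P b) := by
  rw [residueAt_eq_lcAt (D.pos_ne_zero P b) (h.phi_ne_zero _ _)
    (h.ordAt_phi_eq hm hb hmb (Or.inl rfl)), residueAt_eq_lcAt (D.pos_ne_zero P b)
    (h.phi_ne_zero _ _) (h.ordAt_phi_eq hm hb hmb (Or.inr rfl)), phi_add hb, lcAt_mul, lcAt_inv]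
  have h1 : lcAt (D.pos P b) (affRoot P (D.color b) (D.pos P b) (D.color b)) = -1 := by
    have := lcAt_affRoot_of_not_nbr (h.not_nbr_self b)
    rw [colorSign, if_pos rfl] at this
    exact mul_right_cancel₀ (h.gBox_self_ne_zero b) this
  rw [h1]
  ring

/-- Two boxes that can be added in either order are no neighbors. -/
theorem not_nbr_of_add {m : Finset B} {u v : B} (huv : u ≠ v)
    (hu : ¬ D.Added m u) (hv : ¬ D.Added m v) (hmu : D.add m u ∈ D.S) (hmv : D.add m v ∈ D.S) :
    ¬ D.Nbr P u v := by
  intro hn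
  rcases lt_or_gt_of_ne huv with hlt | hlt
  · have := h.added_of_nbr hn hlt hmv added_add_self
    rw [added_add] at this
    tauto
  · have := h.added_of_nbr hn.symm hlt hmu added_add_self
    rw [added_add] at this
    exact hv (this.resolve_left huv.symm)

theorem aCoeff_add {m : Finset B} {u v : B} (huv : u ≠ v) (hm : m ∈ D.S) (hu : ¬ D.Added m u)
    (hv : ¬ D.Added m v) (hmu : D.add m u ∈ D.S) (hmv : D.add m v ∈ D.S)
    (hmuv : D.add (D.add m u) v ∈ D.S) :
    D.aCoeff P (D.add m u) v (D.color v) = D.aCoeff P m v (D.color v) *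
      if v < u then (lcAt (D.pos P v) (affRoot P (D.color u) (D.pos P u) (D.color v)))⁻¹ else 1 := by
  rw [h.aCoeff_eq hm hv hmv, h.aCoeff_eq hmu (by rw [added_add]; tauto) hmuv, phiGt_add hu]
  split_ifs
  · rw [lcAt_mul, lcAt_inv, mul_assoc]
  · rw [mul_one, mul_one]

theorem bCoeff_add {m : Finset B} {u v : B} (huv : u ≠ v) (hm : m ∈ D.S) (hu : ¬ D.Added m u)
    (hv : ¬ D.Added m v) (hmu : D.add m u ∈ D.S) (hmv : D.add m v ∈ D.S)
    (hmuv : D.add (D.add m u) v ∈ D.S) :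
    D.bCoeff P (D.add (D.add m u) v) v (D.color v) = D.bCoeff P (D.add m v) v (D.color v) *
      if u < v then (lcAt (D.pos P v) (affRoot P (D.color u) (D.pos P u) (D.color v)))⁻¹ else 1 := by
  rw [h.bCoeff_eq hm hv hmv, h.bCoeff_eq hmu (by rw [added_add]; tauto) hmuv, phiLt_add hu]
  split_ifs
  · rw [lcAt_mul, lcAt_inv, mul_assoc]
  · rw [mul_one, mul_one]

theorem finite_CC_union_CV {l : Finset B} (hl : l ∈ D.S) (i : ZMod 2) :
    (D.CC i l ∪ D.CV i l).Finite := by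
  have hfin : {z | (D.phi P l i).denom.IsRoot z}.Finite :=
    Polynomial.finite_setOfPred_isRoot (RatFunc.denom_ne_zero _)
  refine Set.Finite.of_finite_image (f := D.pos P) (hfin.subset ?_) h.pos_injective.injOn
  rintro z ⟨b, hb, rfl⟩
  have h1 := (h.ord_neg_iff l hl i (D.pos P b)).2 ⟨b, hb, rfl⟩
  by_contra h2
  have h3 : RegularAt (D.phi P l i) (D.pos P b) := h2
  rw [regularAt_iff] at h3
  omega

theorem wellPosed : D.WellPosed P where
  balanced l _ i := h.balanced_phi l i
  finite_CC l hl i := (h.finite_CC_union_CV hl i).subset Set.subset_union_left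
  finite_CV l hl i := (h.finite_CC_union_CV hl i).subset Set.subset_union_right
  regular_a l hl i b hb hp := by
    obtain ⟨rfl, h1, h2⟩ := mem_CC.1 hb
    exact regularAt_iff.2 (h.ordAt_phiGt hl h1 h2 (Or.inl rfl) hp).ge
  regular_b l hl i b hb hp := by
    obtain ⟨rfl, h1, h2⟩ := mem_CV.1 hb
    refine regularAt_iff.2 (h.ordAt_phiLt h2 not_added_remove ?_ (Or.inr ?_) hp).ge
    · rwa [add_remove h1]
    · rw [add_remove h1]

end IsRegular

end CombData

end Toroidal

/-! ### The operators adding and removing a single box -/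

namespace Toroidal

namespace CombData

variable {B : Type} [LinearOrder B]

open Classical in
/-- The basis vector `|λ⟩`, or `0` if `λ` is not a state. -/
noncomputable def ketZ (D : CombData B) (l : Finset B) : D.Space :=
  if h : l ∈ D.S then D.ket l h else 0

theorem ketZ_of_mem {D : CombData B} {l : Finset B} (h : l ∈ D.S) : D.ketZ l = D.ket l h :=
  dif_pos h

theorem ketZ_of_notMem {D : CombData B} {l : Finset B} (h : l ∉ D.S) : D.ketZ l = 0 :=
  dif_neg h

theorem single_eq_ketZ (D : CombData B) (l : D.S) : (Finsupp.single l 1 : D.Space) = D.ketZ l :=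
  (ketZ_of_mem l.2).symm

theorem linearMap_ext {D : CombData B} {W : Type*} [AddCommGroup W] [Module ℂ W]
    {f g : D.Space →ₗ[ℂ] W} (h : ∀ l ∈ D.S, f (D.ketZ l) = g (D.ketZ l)) : f = g := by
  refine Finsupp.lhom_ext' fun l => LinearMap.ext_ring ?_
  simpa [single_eq_ketZ] using h l l.2

open Classical in
/-- The part of the currents `F_i(z)` that adds the box `b`. -/
noncomputable def addOp (D : CombData B) (P : QParams) (b : B) : Module.End ℂ D.Space :=
  Finsupp.linearCombination ℂ fun l : D.S =>
    if D.Added l b then 0 else D.aCoeff P l b (D.color b) • D.ketZ (D.add l b)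

open Classical in
/-- The part of the currents `E_i(z)` that removes the box `b`. -/
noncomputable def removeOp (D : CombData B) (P : QParams) (b : B) : Module.End ℂ D.Space :=
  Finsupp.linearCombination ℂ fun l : D.S =>
    if D.Added l b then D.bCoeff P l b (D.color b) • D.ketZ (D.remove l b) else 0

/-- The coefficient of `z ^ (-r)` in `K_i^±(z)` acting on the space of states. -/
noncomputable def cartanOp (D : CombData B) (P : QParams) (ε : Bool) (i : ZMod 2) (r : ℤ) :
    Module.End ℂ D.Space :=
  Finsupp.linearCombination ℂ fun l : D.S => coeffAt ε (D.phi P l i) r • D.ketZ l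

theorem linearCombination_ketZ {D : CombData B} {W : Type*} [AddCommGroup W] [Module ℂ W]
    (f : D.S → W) {l : Finset B} (h : l ∈ D.S) :
    Finsupp.linearCombination ℂ f (D.ketZ l) = f ⟨l, h⟩ := by
  rw [ketZ_of_mem h, ket, Finsupp.linearCombination_single, one_smul]

theorem addOp_ketZ_of_added {D : CombData B} (P : QParams) {l : Finset B} {b : B}
    (h : D.Added l b) : D.addOp P b (D.ketZ l) = 0 := by
  by_cases hl : l ∈ D.S
  · rw [addOp, linearCombination_ketZ _ hl, if_pos h]
  · rw [ketZ_of_notMem hl, map_zero]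

theorem addOp_ketZ {D : CombData B} (P : QParams) {l : Finset B} {b : B} (hl : l ∈ D.S)
    (h : ¬ D.Added l b) :
    D.addOp P b (D.ketZ l) = D.aCoeff P l b (D.color b) • D.ketZ (D.add l b) := by
  rw [addOp, linearCombination_ketZ _ hl, if_neg h]

theorem removeOp_ketZ_of_not_added {D : CombData B} (P : QParams) {l : Finset B} {b : B}
    (h : ¬ D.Added l b) : D.removeOp P b (D.ketZ l) = 0 := by
  by_cases hl : l ∈ D.S
  · rw [removeOp, linearCombination_ketZ _ hl, if_neg h]
  · rw [ketZ_of_notMem hl, map_zero]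

theorem removeOp_ketZ_add {D : CombData B} (P : QParams) {l : Finset B} {b : B}
    (hl : D.add l b ∈ D.S) (h : ¬ D.Added l b) :
    D.removeOp P b (D.ketZ (D.add l b)) = D.bCoeff P (D.add l b) b (D.color b) • D.ketZ l := by
  rw [removeOp, linearCombination_ketZ _ hl, if_pos added_add_self, remove_add h]

theorem cartanOp_ketZ (D : CombData B) (P : QParams) (ε : Bool) (i : ZMod 2) (r : ℤ)
    (l : Finset B) : D.cartanOp P ε i r (D.ketZ l) = coeffAt ε (D.phi P l i) r • D.ketZ l := by
  by_cases hl : l ∈ D.S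
  · rw [cartanOp, linearCombination_ketZ _ hl]
  · rw [ketZ_of_notMem hl, map_zero, smul_zero]

/-- Every state containing the added box `b` arises by adding `b`. -/
theorem exists_eq_add {D : CombData B} {l : Finset B} {b : B} (h : D.Added l b) :
    ∃ m, l = D.add m b ∧ ¬ D.Added m b :=
  ⟨D.remove l b, (add_remove h).symm, not_added_remove⟩

namespace IsRegular

variable {D : CombData B} {P : QParams} {Supports : B → B → Prop} (h : D.IsRegular P Supports)
include h

omit h in
theorem colorSign_mul_gBox_eq_neg {u v : B} (huv : ¬ D.Nbr P u v) :
    colorSign (D.color u) (D.color v) * D.gBox P v u *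
      (lcAt (D.pos P u) (affRoot P (D.color v) (D.pos P v) (D.color u)))⁻¹ = -D.gBox P u v := by
  have h1 := lcAt_affRoot_of_not_nbr huv
  have h2 : lcAt (D.pos P u) (affRoot P (D.color v) (D.pos P v) (D.color u)) ≠ 0 :=
    lcAt_ne_zero _ (affRoot_ne_zero _ _ _ _)
  rw [colorSign_comm] at h1
  rw [mul_inv_eq_iff_eq_mul₀ h2]
  linear_combination h1

omit h in
theorem colorSign_mul_gBox_eq {u v : B} (huv : ¬ D.Nbr P u v) :
    colorSign (D.color u) (D.color v) * D.gBox P v u +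
      D.gBox P u v * (lcAt (D.pos P v) (affRoot P (D.color u) (D.pos P u) (D.color v)))⁻¹ = 0 := by
  have h1 := colorSign_mul_gBox_eq_neg fun hn => huv hn.symm
  rw [colorSign_comm] at h1
  have h2 := colorSign_mul_self (D.color u) (D.color v)
  linear_combination (-colorSign (D.color u) (D.color v)) * (-h1) -
    D.gBox P u v * (lcAt (D.pos P v) (affRoot P (D.color u) (D.pos P u) (D.color v)))⁻¹ * h2

/-- The quadratic relation between two operators adding boxes. -/
theorem addOp_mul_addOp (u v : B) :
    (colorSign (D.color u) (D.color v) * D.gBox P v u) • (D.addOp P u * D.addOp P v) +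
      D.gBox P u v • (D.addOp P v * D.addOp P u) = 0 := by
  apply linearMap_ext
  intro l hl
  simp only [LinearMap.add_apply, LinearMap.smul_apply, Module.End.mul_apply, LinearMap.zero_apply]
  by_cases huv : u = v
  · subst huv
    by_cases hu : D.Added l u
    · simp [addOp_ketZ_of_added P hu]
    · rw [addOp_ketZ P hl hu]
      simp [addOp_ketZ_of_added P (added_add_self (D := D))]
  by_cases hu : D.Added l u
  · rw [addOp_ketZ_of_added P hu]
    by_cases hv : D.Added l v
    · simp [addOp_ketZ_of_added P hv]
    · rw [addOp_ketZ P hl hv]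
      simp [addOp_ketZ_of_added P (added_add.2 (Or.inr hu))]
  by_cases hv : D.Added l v
  · rw [addOp_ketZ_of_added P hv, addOp_ketZ P hl hu]
    simp [addOp_ketZ_of_added P (added_add.2 (Or.inr hv))]
  have hvu : ¬ D.Added (D.add l u) v := by rw [added_add]; tauto
  have huv' : ¬ D.Added (D.add l v) u := by rw [added_add]; tauto
  rw [addOp_ketZ P hl hu, addOp_ketZ P hl hv, map_smul, map_smul]
  by_cases hmuv : D.add (D.add l u) v ∈ D.S
  · have hmvu : D.add (D.add l v) u ∈ D.S := by rwa [D.add_comm]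
    by_cases hmu : D.add l u ∈ D.S <;> by_cases hmv : D.add l v ∈ D.S
    · have hn := h.not_nbr_of_add huv hu hv hmu hmv
      rw [addOp_ketZ P hmu hvu, addOp_ketZ P hmv huv', D.add_comm l v u,
        h.aCoeff_add huv hl hu hv hmu hmv hmuv,
        h.aCoeff_add (Ne.symm huv) hl hv hu hmv hmu hmvu, smul_smul, smul_smul, smul_smul,
        smul_smul, ← add_smul]
      convert zero_smul ℂ _
      rcases lt_or_gt_of_ne huv with hlt | hlt
      · rw [if_pos hlt, if_neg (not_lt.2 hlt.le)]
        linear_combination D.aCoeff P l u (D.color u) * D.aCoeff P l v (D.color v) *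
          colorSign_mul_gBox_eq_neg hn
      · rw [if_pos hlt, if_neg (not_lt.2 hlt.le)]
        linear_combination D.aCoeff P l u (D.color u) * D.aCoeff P l v (D.color v) *
          colorSign_mul_gBox_eq hn
    · rw [h.gBox_eq_zero hl hmuv hmv, ketZ_of_notMem hmv]
      simp
    · rw [h.gBox_eq_zero hl hmvu hmu, ketZ_of_notMem hmu]
      simp
    · rw [ketZ_of_notMem hmu, ketZ_of_notMem hmv]
      simp
  · have hmvu : D.add (D.add l v) u ∉ D.S := by rwa [D.add_comm]
    have e1 : D.addOp P v (D.ketZ (D.add l u)) = 0 := by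
      by_cases hmu : D.add l u ∈ D.S
      · rw [addOp_ketZ P hmu hvu, ketZ_of_notMem hmuv, smul_zero]
      · rw [ketZ_of_notMem hmu, map_zero]
    have e2 : D.addOp P u (D.ketZ (D.add l v)) = 0 := by
      by_cases hmv : D.add l v ∈ D.S
      · rw [addOp_ketZ P hmv huv', ketZ_of_notMem hmvu, smul_zero]
      · rw [ketZ_of_notMem hmv, map_zero]
    rw [e1, e2]
    simp

/-- The quadratic relation between two operators removing boxes. -/
theorem removeOp_mul_removeOp (u v : B) :
    (colorSign (D.color u) (D.color v) * D.gBox P u v) • (D.removeOp P u * D.removeOp P v) +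
      D.gBox P v u • (D.removeOp P v * D.removeOp P u) = 0 := by
  apply linearMap_ext
  intro l hl
  simp only [LinearMap.add_apply, LinearMap.smul_apply, Module.End.mul_apply, LinearMap.zero_apply]
  by_cases hu : D.Added l u; swap
  · rw [removeOp_ketZ_of_not_added P hu]
    by_cases hv : D.Added l v
    · obtain ⟨m, rfl, hm⟩ := exists_eq_add hv
      rw [removeOp_ketZ_add P hl hm, map_smul,
        removeOp_ketZ_of_not_added P (fun h' => hu (added_add.2 (Or.inr h')))]
      simp
    · rw [removeOp_ketZ_of_not_added P hv]
      simp
  obtain ⟨l, rfl, hlu⟩ := exists_eq_add hu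
  by_cases hv : D.Added l v; swap
  · rw [removeOp_ketZ_add P hl hlu, map_smul, removeOp_ketZ_of_not_added P hv]
    by_cases huv : u = v
    · subst huv
      rw [removeOp_ketZ_add P hl hlu, map_smul, removeOp_ketZ_of_not_added P hv]
      simp
    · rw [removeOp_ketZ_of_not_added (b := v) P (by rw [added_add]; tauto)]
      simp
  obtain ⟨m, rfl, hmv⟩ := exists_eq_add hv
  have huv : u ≠ v := by rintro rfl; exact hlu added_add_self
  have hmu : ¬ D.Added m u := fun h' => hlu (added_add.2 (Or.inr h'))
  have hvu : ¬ D.Added (D.add m u) v := by rw [added_add]; tauto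
  have hS : D.add (D.add m u) v ∈ D.S := by rwa [D.add_comm]
  rw [removeOp_ketZ_add P hl hlu, D.add_comm m v u, removeOp_ketZ_add P hS hvu, map_smul, map_smul]
  by_cases hm : m ∈ D.S; swap
  · have e1 : D.removeOp P u (D.ketZ (D.add m u)) = 0 := by
      by_cases hu' : D.add m u ∈ D.S
      · rw [removeOp_ketZ_add P hu' hmu, ketZ_of_notMem hm, smul_zero]
      · rw [ketZ_of_notMem hu', map_zero]
    have e2 : D.removeOp P v (D.ketZ (D.add m v)) = 0 := by
      by_cases hv' : D.add m v ∈ D.S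
      · rw [removeOp_ketZ_add P hv' hmv, ketZ_of_notMem hm, smul_zero]
      · rw [ketZ_of_notMem hv', map_zero]
    rw [e1, e2]
    simp
  by_cases hu' : D.add m u ∈ D.S <;> by_cases hv' : D.add m v ∈ D.S
  · have hn := h.not_nbr_of_add huv hmu hmv hu' hv'
    rw [removeOp_ketZ_add P hu' hmu, removeOp_ketZ_add P hv' hmv,
      h.bCoeff_add huv hm hmu hmv hu' hv' hS, ← D.add_comm m v u,
      h.bCoeff_add (Ne.symm huv) hm hmv hmu hv' hu' hl, smul_smul, smul_smul, smul_smul,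
      smul_smul, ← add_smul]
    convert zero_smul ℂ _
    have hn' : ¬ D.Nbr P v u := fun h' => hn h'.symm
    rcases lt_or_gt_of_ne huv with hlt | hlt
    · rw [if_pos hlt, if_neg (not_lt.2 hlt.le)]
      have := colorSign_mul_gBox_eq_neg hn'
      rw [colorSign_comm] at this
      linear_combination D.bCoeff P (D.add m u) u (D.color u) *
        D.bCoeff P (D.add m v) v (D.color v) * this
    · rw [if_pos hlt, if_neg (not_lt.2 hlt.le)]
      have := colorSign_mul_gBox_eq hn'
      rw [colorSign_comm] at this
      linear_combination D.bCoeff P (D.add m u) u (D.color u) *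
        D.bCoeff P (D.add m v) v (D.color v) * this
  · rw [h.gBox_eq_zero hm hS hv', ketZ_of_notMem hv']
    simp
  · rw [h.gBox_eq_zero hm hl hu', ketZ_of_notMem hu']
    simp
  · rw [ketZ_of_notMem hu', ketZ_of_notMem hv']
    simp

/-- Adding one box commutes with removing another one. -/
theorem removeOp_mul_addOp {u v : B} (huv : u ≠ v) :
    D.removeOp P u * D.addOp P v = D.addOp P v * D.removeOp P u := by
  apply linearMap_ext
  intro l hl
  simp only [Module.End.mul_apply]
  by_cases hu : D.Added l u; swap
  · rw [removeOp_ketZ_of_not_added P hu, map_zero]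
    by_cases hv : D.Added l v
    · rw [addOp_ketZ_of_added P hv, map_zero]
    · rw [addOp_ketZ P hl hv, map_smul, removeOp_ketZ_of_not_added P (by rw [added_add]; tauto),
        smul_zero]
  obtain ⟨m, rfl, hmu⟩ := exists_eq_add hu
  rw [removeOp_ketZ_add P hl hmu, map_smul]
  by_cases hv : D.Added m v
  · rw [addOp_ketZ_of_added P hv, addOp_ketZ_of_added P (added_add.2 (Or.inr hv)), map_zero, smul_zero]
  have hvu : ¬ D.Added (D.add m u) v := by rw [added_add]; tauto
  have huv' : ¬ D.Added (D.add m v) u := by rw [added_add]; tauto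
  rw [addOp_ketZ P hl hvu, map_smul]
  by_cases hmv : D.add m v ∈ D.S; swap
  · have e1 : D.addOp P v (D.ketZ m) = 0 := by
      by_cases hm : m ∈ D.S
      · rw [addOp_ketZ P hm hv, ketZ_of_notMem hmv, smul_zero]
      · rw [ketZ_of_notMem hm, map_zero]
    rw [e1, smul_zero]
    by_cases hS : D.add (D.add m u) v ∈ D.S
    · rw [D.add_comm] at hS ⊢
      rw [removeOp_ketZ_add P hS huv', ketZ_of_notMem hmv, smul_zero, smul_zero]
    · rw [ketZ_of_notMem hS, map_zero, smul_zero]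
  have hiff : m ∈ D.S ↔ D.add (D.add m u) v ∈ D.S := by
    constructor
    · intro _
      refine h.union_mem hl hmv fun b => ?_
      simp only [added_add]; tauto
    · intro _
      refine h.inter_mem hl hmv fun b => ?_
      simp only [added_add]
      by_cases hb : b = u
      · subst hb; simp [hmu, huv]
      · simp only [hb, false_or]
        exact ⟨fun h' => ⟨h', Or.inr h'⟩, And.left⟩
  by_cases hm : m ∈ D.S; swap
  · rw [ketZ_of_notMem hm, map_zero, smul_zero, ketZ_of_notMem fun h' => hm (hiff.2 h'), map_zero,
      smul_zero]
  have hS := hiff.1 hm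
  have hS' := hS
  rw [D.add_comm] at hS'
  have hn := h.not_nbr_of_add huv hmu hv hl hmv
  rw [addOp_ketZ P hm hv, h.aCoeff_add huv hm hmu hv hl hmv hS, D.add_comm m u v,
    removeOp_ketZ_add P hS' huv', h.bCoeff_add (Ne.symm huv) hm hv hmu hmv hl hS', smul_smul,
    smul_smul]
  congr 1
  split_ifs with hlt
  · -- The two exchange factors are inverse to each other.
    have h1 : (lcAt (D.pos P u) (affRoot P (D.color v) (D.pos P v) (D.color u)))⁻¹ *
        (lcAt (D.pos P v) (affRoot P (D.color u) (D.pos P u) (D.color v)))⁻¹ = 1 := by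
      have h2 := colorSign_mul_gBox_eq_neg hn
      have h3 := colorSign_mul_gBox_eq hn
      have h4 : D.gBox P u v ≠ 0 := fun h' => hn (Or.inl h')
      apply mul_left_cancel₀ h4
      linear_combination (lcAt (D.pos P u) (affRoot P (D.color v) (D.pos P v) (D.color u)))⁻¹ * h3
        - h2
    linear_combination D.aCoeff P m v (D.color v) * D.bCoeff P (D.add m u) u (D.color u) * h1
  · ring

/-- The diagonal part of the commutator of `E_i` and `F_i`. -/
theorem commutator_ketZ {l : Finset B} (hl : l ∈ D.S) (b : B) :
    (D.removeOp P b * D.addOp P b - D.addOp P b * D.removeOp P b) (D.ketZ l) =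
      (residueAt (D.phi P l (D.color b)) (D.pos P b) / (P.q - P.q⁻¹)) • D.ketZ l := by
  have hreg : b ∉ D.CC (D.color b) l → b ∉ D.CV (D.color b) l →
      residueAt (D.phi P l (D.color b)) (D.pos P b) = 0 := by
    intro h1 h2
    apply residueAt_eq_zero (D.pos_ne_zero P b)
    by_contra h3
    obtain ⟨c, hc, hcb⟩ := (h.ord_neg_iff l hl _ _).1 (not_le.1 h3)
    obtain rfl := h.pos_injective hcb
    tauto
  simp only [LinearMap.sub_apply, Module.End.mul_apply]
  by_cases hb : D.Added l b
  · obtain ⟨m, rfl, hm⟩ := exists_eq_add hb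
    rw [addOp_ketZ_of_added P hb, map_zero, removeOp_ketZ_add P hl hm, map_smul, zero_sub]
    by_cases hmS : m ∈ D.S
    · rw [addOp_ketZ P hmS hm, smul_smul, h.residueAt_phi_add hmS hm hl, neg_div,
        ← h.aCoeff_mul_bCoeff hmS hm hl, neg_smul, mul_comm]
    · rw [hreg (fun h' => (mem_CC.1 h').2.1 hb)
        (fun h' => hmS (by simpa [remove_add hm] using (mem_CV.1 h').2.2)), ketZ_of_notMem hmS]
      simp
  · rw [removeOp_ketZ_of_not_added P hb, map_zero, sub_zero, addOp_ketZ P hl hb, map_smul]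
    by_cases hS : D.add l b ∈ D.S
    · rw [removeOp_ketZ_add P hS hb, smul_smul, h.aCoeff_mul_bCoeff hl hb hS]
    · rw [hreg (fun h' => hS (mem_CC.1 h').2.2) (fun h' => hb (mem_CV.1 h').2.1),
        ketZ_of_notMem hS]
      simp

end IsRegular

end CombData

end Toroidal

/-! ### Currents as limits of finite sums of box operators -/

namespace Toroidal

namespace CombData

variable {B : Type}

open Filter

theorem sum_eq_finsum_of_subset {M : Type*} [AddCommMonoid M] {s : Set B} (hs : s.Finite)
    {T : Finset B} (hT : hs.toFinset ⊆ T) (f : B → M) (hf : ∀ b ∈ T, b ∉ s → f b = 0) :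
    ∑ b ∈ T, f b = ∑ᶠ b ∈ s, f b := by
  rw [finsum_mem_eq_finite_toFinset_sum _ hs]
  refine (Finset.sum_subset hT fun b hb hb' => hf b hb ?_).symm
  simpa using hb'

/-- A family of operators indexed by finite sets of boxes is eventually equal to `Y` on every
vector. -/
def EventuallyEq {V : Type} [AddCommGroup V] [Module ℂ V] (X : Finset B → Module.End ℂ V)
    (Y : Module.End ℂ V) : Prop := ∀ v, ∀ᶠ T in atTop, X T v = Y v

namespace EventuallyEq

variable {V : Type} [AddCommGroup V] [Module ℂ V] {X X' : Finset B → Module.End ℂ V}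
  {Y Y' : Module.End ℂ V}

theorem const (Y : Module.End ℂ V) : EventuallyEq (fun _ : Finset B => Y) Y :=
  fun _ => Eventually.of_forall fun _ => rfl

theorem add (h : EventuallyEq X Y) (h' : EventuallyEq X' Y') :
    EventuallyEq (fun T => X T + X' T) (Y + Y') := fun v => by
  filter_upwards [h v, h' v] with T h1 h2
  rw [LinearMap.add_apply, h1, h2, LinearMap.add_apply]

theorem sub (h : EventuallyEq X Y) (h' : EventuallyEq X' Y') :
    EventuallyEq (fun T => X T - X' T) (Y - Y') := fun v => by
  filter_upwards [h v, h' v] with T h1 h2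
  rw [LinearMap.sub_apply, h1, h2, LinearMap.sub_apply]

theorem smul (c : ℂ) (h : EventuallyEq X Y) : EventuallyEq (fun T => c • X T) (c • Y) := fun v => by
  filter_upwards [h v] with T h1
  rw [LinearMap.smul_apply, h1, LinearMap.smul_apply]

theorem mul (h : EventuallyEq X Y) (h' : EventuallyEq X' Y') :
    EventuallyEq (fun T => X T * X' T) (Y * Y') := fun v => by
  filter_upwards [h' v, h (Y' v)] with T h1 h2
  rw [Module.End.mul_apply, h1, h2, Module.End.mul_apply]

theorem sum {ι : Type*} (s : Finset ι) {X : ι → Finset B → Module.End ℂ V}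
    {Y : ι → Module.End ℂ V} (h : ∀ i ∈ s, EventuallyEq (X i) (Y i)) :
    EventuallyEq (fun T => ∑ i ∈ s, X i T) (∑ i ∈ s, Y i) := by
  classical
  induction s using Finset.induction_on with
  | empty => simpa using const 0
  | insert a s ha ih =>
    simp only [Finset.sum_insert ha]
    exact (h a (Finset.mem_insert_self _ _)).add
      (ih fun i hi => h i (Finset.mem_insert_of_mem hi))

theorem unique (h : EventuallyEq X Y) (h' : EventuallyEq X Y') : Y = Y' := by
  ext v
  obtain ⟨T, h1, h2⟩ := ((h v).and (h' v)).exists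
  exact h1.symm.trans h2

theorem gMul {P : QParams} {i j : ZMod 2} {X : Finset B → ℤ → ℤ → Module.End ℂ V}
    {Y : ℤ → ℤ → Module.End ℂ V} (h : ∀ r s, EventuallyEq (fun T => X T r s) (Y r s)) (r s : ℤ) :
    EventuallyEq (fun T => gMul P i j (X T) r s) (gMul P i j Y r s) := by
  unfold Toroidal.gMul
  split_ifs
  · exact (h _ _).sub ((h _ _).smul _)
  · exact ((h _ _).sub ((h _ _).smul _)).add ((h _ _).smul _)

theorem gMulSwap {P : QParams} {i j : ZMod 2} {X : Finset B → ℤ → ℤ → Module.End ℂ V}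
    {Y : ℤ → ℤ → Module.End ℂ V} (h : ∀ r s, EventuallyEq (fun T => X T r s) (Y r s)) (r s : ℤ) :
    EventuallyEq (fun T => gMulSwap P i j (X T) r s) (gMulSwap P i j Y r s) := by
  unfold Toroidal.gMulSwap
  split_ifs
  · exact (h _ _).sub ((h _ _).smul _)
  · exact ((h _ _).sub ((h _ _).smul _)).add ((h _ _).smul _)

variable [LinearOrder B]

theorem of_ketZ {D : CombData B} {X : Finset B → Module.End ℂ D.Space} {Y : Module.End ℂ D.Space}
    (h : ∀ l ∈ D.S, ∀ᶠ T in atTop, X T (D.ketZ l) = Y (D.ketZ l)) : EventuallyEq X Y := by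
  intro v
  induction v using Finsupp.induction_linear with
  | zero => exact Eventually.of_forall fun T => by rw [map_zero, map_zero]
  | add v w hv hw =>
    filter_upwards [hv, hw] with T h1 h2
    rw [map_add, map_add, h1, h2]
  | single l c =>
    filter_upwards [h l l.2] with T h1
    rw [← mul_one c, ← smul_eq_mul, ← Finsupp.smul_single, single_eq_ketZ, map_smul, map_smul, h1]

end EventuallyEq

variable [LinearOrder B]

/-- The part of the coefficient of `z ^ (-k)` in a current `∑ b, δ(z / p(b)) X_b` of color `i` that
comes from the boxes in a finite set. -/
noncomputable def boxSum (D : CombData B) (P : QParams) {V : Type} [AddCommGroup V] [Module ℂ V]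
    (X : B → Module.End ℂ V) (T : Finset B) (i : ZMod 2) (k : ℤ) : Module.End ℂ V :=
  ∑ b ∈ T with D.color b = i, D.pos P b ^ k • X b

/-- The coefficient of `z ^ (-k)` in `F_i(z)` acting on the space of states. -/
noncomputable def addCurrent (D : CombData B) (P : QParams) (i : ZMod 2) (k : ℤ) :
    Module.End ℂ D.Space :=
  Finsupp.linearCombination ℂ fun l : D.S =>
    ∑ᶠ b ∈ D.CC i l, (D.aCoeff P l b i * D.pos P b ^ k) • D.ketZ (D.add l b)

/-- The coefficient of `z ^ (-k)` in `E_i(z)` acting on the space of states. -/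
noncomputable def removeCurrent (D : CombData B) (P : QParams) (i : ZMod 2) (k : ℤ) :
    Module.End ℂ D.Space :=
  Finsupp.linearCombination ℂ fun l : D.S =>
    ∑ᶠ b ∈ D.CV i l, (D.bCoeff P l b i * D.pos P b ^ k) • D.ketZ (D.remove l b)

namespace IsRegular

variable {D : CombData B} {P : QParams} {Supports : B → B → Prop} (h : D.IsRegular P Supports)
include h

theorem eventuallyEq_addCurrent (i : ZMod 2) (k : ℤ) :
    EventuallyEq (fun T => D.boxSum P (D.addOp P) T i k) (D.addCurrent P i k) := by
  apply EventuallyEq.of_ketZ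
  intro l hl
  have hfin := h.wellPosed.finite_CC l hl i
  filter_upwards [eventually_ge_atTop hfin.toFinset] with T hT
  rw [addCurrent, linearCombination_ketZ _ hl, boxSum, LinearMap.sum_apply, Finset.sum_filter,
    sum_eq_finsum_of_subset hfin hT]
  · apply finsum_congr
    intro b
    apply finsum_congr
    intro hb
    obtain ⟨rfl, h1, h2⟩ := mem_CC.1 hb
    rw [if_pos rfl, LinearMap.smul_apply, addOp_ketZ P hl h1, smul_smul, mul_comm]
  · intro b _ hb
    split_ifs with hc
    · subst hc
      rw [LinearMap.smul_apply]
      by_cases h1 : D.Added l b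
      · rw [addOp_ketZ_of_added P h1, smul_zero]
      · rw [addOp_ketZ P hl h1, ketZ_of_notMem fun h2 => hb (mem_CC.2 ⟨rfl, h1, h2⟩), smul_zero,
          smul_zero]
    · rfl

theorem eventuallyEq_removeCurrent (i : ZMod 2) (k : ℤ) :
    EventuallyEq (fun T => D.boxSum P (D.removeOp P) T i k) (D.removeCurrent P i k) := by
  apply EventuallyEq.of_ketZ
  intro l hl
  have hfin := h.wellPosed.finite_CV l hl i
  filter_upwards [eventually_ge_atTop hfin.toFinset] with T hT
  rw [removeCurrent, linearCombination_ketZ _ hl, boxSum, LinearMap.sum_apply, Finset.sum_filter,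
    sum_eq_finsum_of_subset hfin hT]
  · apply finsum_congr
    intro b
    apply finsum_congr
    intro hb
    obtain ⟨rfl, h1, h2⟩ := mem_CV.1 hb
    rw [if_pos rfl, LinearMap.smul_apply, removeOp, linearCombination_ketZ _ hl, if_pos h1,
      smul_smul, mul_comm]
  · intro b _ hb
    split_ifs with hc
    · subst hc
      rw [LinearMap.smul_apply]
      by_cases h1 : D.Added l b
      · rw [removeOp, linearCombination_ketZ _ hl, if_pos h1,
          ketZ_of_notMem fun h2 => hb (mem_CV.2 ⟨rfl, h1, h2⟩), smul_zero, smul_zero]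
      · rw [removeOp_ketZ_of_not_added P h1, smul_zero]
    · rfl

end IsRegular

/-! ### Quadratic relations for finite sums -/

section BoxSum

variable (D : CombData B) (P : QParams) {V : Type} [AddCommGroup V] [Module ℂ V]

theorem boxSum_mul_boxSum (X Y : B → Module.End ℂ V) (T : Finset B) (i j : ZMod 2) (r s : ℤ) :
    D.boxSum P X T i r * D.boxSum P Y T j s =
      ∑ u ∈ T with D.color u = i, ∑ v ∈ T with D.color v = j,
        (D.pos P u ^ r * D.pos P v ^ s) • (X u * Y v) := by
  rw [boxSum, boxSum, Finset.sum_mul_sum]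
  refine Finset.sum_congr rfl fun u _ => Finset.sum_congr rfl fun v _ => ?_
  rw [smul_mul_smul_comm]

theorem boxSum_mul_boxSum' (X Y : B → Module.End ℂ V) (T : Finset B) (i j : ZMod 2) (r s : ℤ) :
    D.boxSum P Y T j s * D.boxSum P X T i r =
      ∑ u ∈ T with D.color u = i, ∑ v ∈ T with D.color v = j,
        (D.pos P u ^ r * D.pos P v ^ s) • (Y v * X u) := by
  rw [boxSum_mul_boxSum, Finset.sum_comm]
  refine Finset.sum_congr rfl fun u _ => Finset.sum_congr rfl fun v _ => ?_
  rw [mul_comm (D.pos P v ^ s)]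

theorem gMul_sum {ι : Type*} (t : Finset ι) (i j : ZMod 2) (X : ι → ℤ → ℤ → V) (r s : ℤ) :
    gMul P i j (fun r s => ∑ a ∈ t, X a r s) r s = ∑ a ∈ t, gMul P i j (X a) r s := by
  unfold gMul
  split_ifs
  · simp only [Finset.smul_sum, Finset.sum_sub_distrib]
  · simp only [Finset.smul_sum, Finset.sum_sub_distrib, Finset.sum_add_distrib]

theorem gMulSwap_sum {ι : Type*} (t : Finset ι) (i j : ZMod 2) (X : ι → ℤ → ℤ → V) (r s : ℤ) :
    gMulSwap P i j (fun r s => ∑ a ∈ t, X a r s) r s = ∑ a ∈ t, gMulSwap P i j (X a) r s := by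
  unfold gMulSwap
  split_ifs
  · simp only [Finset.smul_sum, Finset.sum_sub_distrib]
  · simp only [Finset.smul_sum, Finset.sum_sub_distrib, Finset.sum_add_distrib]

theorem gMul_zpow_smul (i j : ZMod 2) {p p' : ℂ} (hp : p ≠ 0) (hp' : p' ≠ 0) (x : V) (r s : ℤ) :
    gMul P i j (fun r s => (p ^ r * p' ^ s) • x) r s = (p ^ r * p' ^ s * gC P i j p p') • x := by
  unfold gMul gC
  split_ifs
  · rw [smul_smul, ← sub_smul, zpow_add_one₀ hp, zpow_add_one₀ hp']
    ring_nf
  · rw [smul_smul, smul_smul, ← sub_smul, ← add_smul, zpow_add_one₀ hp, zpow_add_one₀ hp',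
      zpow_add₀ hp, zpow_add₀ hp', zpow_ofNat, zpow_ofNat]
    ring_nf

theorem gMulSwap_zpow_smul (i j : ZMod 2) {p p' : ℂ} (hp : p ≠ 0) (hp' : p' ≠ 0) (x : V) (r s : ℤ) :
    gMulSwap P i j (fun r s => (p ^ r * p' ^ s) • x) r s =
      (p ^ r * p' ^ s * gC P i j p' p) • x := by
  unfold gMulSwap gC
  split_ifs
  · rw [smul_smul, ← sub_smul, zpow_add_one₀ hp, zpow_add_one₀ hp']
    ring_nf
  · rw [smul_smul, smul_smul, ← sub_smul, ← add_smul, zpow_add_one₀ hp, zpow_add_one₀ hp',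
      zpow_add₀ hp, zpow_add₀ hp', zpow_ofNat, zpow_ofNat]
    ring_nf

theorem gMul_boxSum (X Y : B → Module.End ℂ V) (T : Finset B) (i j : ZMod 2) (r s : ℤ) :
    gMul P i j (fun r s => D.boxSum P X T i r * D.boxSum P Y T j s) r s =
      ∑ u ∈ T with D.color u = i, ∑ v ∈ T with D.color v = j,
        (D.pos P u ^ r * D.pos P v ^ s * D.gBox P u v) • (X u * Y v) := by
  simp only [boxSum_mul_boxSum, gMul_sum]
  refine Finset.sum_congr rfl fun u hu => Finset.sum_congr rfl fun v hv => ?_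
  rw [gMul_zpow_smul P i j (D.pos_ne_zero P u) (D.pos_ne_zero P v), gBox,
    (Finset.mem_filter.1 hu).2, (Finset.mem_filter.1 hv).2]

theorem gMul_boxSum' (X Y : B → Module.End ℂ V) (T : Finset B) (i j : ZMod 2) (r s : ℤ) :
    gMul P i j (fun r s => D.boxSum P Y T j s * D.boxSum P X T i r) r s =
      ∑ u ∈ T with D.color u = i, ∑ v ∈ T with D.color v = j,
        (D.pos P u ^ r * D.pos P v ^ s * D.gBox P u v) • (Y v * X u) := by
  simp only [boxSum_mul_boxSum', gMul_sum]
  refine Finset.sum_congr rfl fun u hu => Finset.sum_congr rfl fun v hv => ?_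
  rw [gMul_zpow_smul P i j (D.pos_ne_zero P u) (D.pos_ne_zero P v), gBox,
    (Finset.mem_filter.1 hu).2, (Finset.mem_filter.1 hv).2]

theorem gMulSwap_boxSum (X Y : B → Module.End ℂ V) (T : Finset B) (i j : ZMod 2) (r s : ℤ) :
    gMulSwap P j i (fun r s => D.boxSum P X T i r * D.boxSum P Y T j s) r s =
      ∑ u ∈ T with D.color u = i, ∑ v ∈ T with D.color v = j,
        (D.pos P u ^ r * D.pos P v ^ s * D.gBox P v u) • (X u * Y v) := by
  simp only [boxSum_mul_boxSum, gMulSwap_sum]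
  refine Finset.sum_congr rfl fun u hu => Finset.sum_congr rfl fun v hv => ?_
  rw [gMulSwap_zpow_smul P j i (D.pos_ne_zero P u) (D.pos_ne_zero P v), gBox,
    (Finset.mem_filter.1 hu).2, (Finset.mem_filter.1 hv).2]

theorem gMulSwap_boxSum' (X Y : B → Module.End ℂ V) (T : Finset B) (i j : ZMod 2) (r s : ℤ) :
    gMulSwap P j i (fun r s => D.boxSum P Y T j s * D.boxSum P X T i r) r s =
      ∑ u ∈ T with D.color u = i, ∑ v ∈ T with D.color v = j,
        (D.pos P u ^ r * D.pos P v ^ s * D.gBox P v u) • (Y v * X u) := by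
  simp only [boxSum_mul_boxSum', gMulSwap_sum]
  refine Finset.sum_congr rfl fun u hu => Finset.sum_congr rfl fun v hv => ?_
  rw [gMulSwap_zpow_smul P j i (D.pos_ne_zero P u) (D.pos_ne_zero P v), gBox,
    (Finset.mem_filter.1 hu).2, (Finset.mem_filter.1 hv).2]

end BoxSum

/-- The relation between the expansions of `f` and of `f A_{j,a}`, in the form of the relations
between `K_i(z)` and the currents. -/
theorem coeffAt_mul_affRoot (P : QParams) (ε : Bool) (i j : ZMod 2) {a : ℂ} (ha : a ≠ 0)
    {f g : RatFunc ℂ} (hfg : f * affRoot P j a i = g) {V : Type} [AddCommGroup V] [Module ℂ V]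
    (x : V) (r s : ℤ) :
    colorSign i j • gMulSwap P j i (fun r s => (coeffAt ε f r * a ^ s) • x) r s +
      gMul P i j (fun r s => (coeffAt ε g r * a ^ s) • x) r s = 0 := by
  have h1 : algebraMap _ _ (rootNum P j a i) * f = algebraMap _ _ (rootDen P j a i) * g := by
    have h0 := algebraMap_poly_ne_zero (rootDen_ne_zero P j a i)
    rw [← hfg, affRoot_eq]
    field_simp
  unfold gMulSwap gMul colorSign
  by_cases hij : i = j
  · subst hij
    simp only [if_true, rootNum, rootDen, map_sub, map_mul, RatFunc.algebraMap_C,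
      RatFunc.algebraMap_X] at h1 ⊢
    rw [← sub_eq_zero] at h1
    have h2 := congrArg (fun F => coeffAt ε F r) h1
    have h3 : (RatFunc.C P.q₂ * RatFunc.X - RatFunc.C a) * f -
        (RatFunc.X - RatFunc.C P.q₂ * RatFunc.C a) * g =
        RatFunc.C P.q₂ * (RatFunc.X * f) - RatFunc.C a * f -
        (RatFunc.X * g - RatFunc.C P.q₂ * (RatFunc.C a * g)) := by ring
    simp only [h3, coeffAt_sub, coeffAt_C_mul, coeffAt_X_mul, coeffAt_zero] at h2
    simp only [smul_smul, ← sub_smul, ← add_smul]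
    convert zero_smul ℂ x
    rw [zpow_add_one₀ ha]
    linear_combination (-a ^ s) * h2
  · simp only [if_neg hij, if_neg (Ne.symm hij), rootNum, rootDen, map_sub, map_mul,
      RatFunc.algebraMap_C, RatFunc.algebraMap_X] at h1 ⊢
    rw [← sub_eq_zero] at h1
    have h2 := congrArg (fun F => coeffAt ε F r) h1
    have h3 : (RatFunc.C P.q₁ * RatFunc.X - RatFunc.C a) * (RatFunc.C P.q₃ * RatFunc.X -
          RatFunc.C a) * f -
        (RatFunc.X - RatFunc.C P.q₁ * RatFunc.C a) * (RatFunc.X - RatFunc.C P.q₃ * RatFunc.C a) * g =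
        RatFunc.C P.q₁ * (RatFunc.C P.q₃ * (RatFunc.X * (RatFunc.X * f)))
        - RatFunc.C P.q₁ * (RatFunc.C a * (RatFunc.X * f))
        - RatFunc.C P.q₃ * (RatFunc.C a * (RatFunc.X * f))
        - (RatFunc.C a * (0 - RatFunc.C a * f)) -
        (RatFunc.X * (RatFunc.X * g)
        - RatFunc.C P.q₁ * (RatFunc.C a * (RatFunc.X * g))
        - RatFunc.C P.q₃ * (RatFunc.C a * (RatFunc.X * g))
        - (RatFunc.C P.q₁ * (RatFunc.C P.q₃ * (RatFunc.C a * (0 - RatFunc.C a * g))))) := by ring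
    simp only [h3, coeffAt_sub, coeffAt_C_mul, coeffAt_X_mul, coeffAt_zero] at h2
    simp only [smul_smul, ← sub_smul, ← add_smul]
    convert zero_smul ℂ x
    rw [zpow_add_one₀ ha, zpow_add₀ ha, zpow_ofNat]
    rw [show r + 1 + 1 = r + 2 by ring] at h2
    linear_combination (-a ^ s) * h2

namespace IsRegular

variable {D : CombData B} {P : QParams} {Supports : B → B → Prop} (h : D.IsRegular P Supports)
include h

theorem addCurrent_quadratic (i j : ZMod 2) (r s : ℤ) :
    colorSign i j • gMulSwap P j i (fun r s => D.addCurrent P i r * D.addCurrent P j s) r s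
        + gMul P i j (fun r s => D.addCurrent P j s * D.addCurrent P i r) r s = 0 := by
  have h1 := ((EventuallyEq.gMulSwap (P := P) (i := j) (j := i) (fun r s =>
    (h.eventuallyEq_addCurrent i r).mul (h.eventuallyEq_addCurrent j s)) r s).smul
    (colorSign i j)).add (EventuallyEq.gMul (P := P) (i := i) (j := j) (fun r s =>
    (h.eventuallyEq_addCurrent j s).mul (h.eventuallyEq_addCurrent i r)) r s)
  refine h1.unique ?_
  convert EventuallyEq.const (B := B) (0 : Module.End ℂ D.Space) using 2 with T
  rw [gMulSwap_boxSum, gMul_boxSum', Finset.smul_sum, ← Finset.sum_add_distrib]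
  refine Finset.sum_eq_zero fun u hu => ?_
  rw [Finset.smul_sum, ← Finset.sum_add_distrib]
  refine Finset.sum_eq_zero fun v hv => ?_
  rw [← (Finset.mem_filter.1 hu).2, ← (Finset.mem_filter.1 hv).2]
  have h2 := congrArg ((D.pos P u ^ r * D.pos P v ^ s) • ·) (h.addOp_mul_addOp u v)
  simp only [smul_add, smul_smul, smul_zero] at h2 ⊢
  rw [← h2]
  congr 2
  ring

theorem removeCurrent_quadratic (i j : ZMod 2) (r s : ℤ) :
    colorSign i j • gMul P i j (fun r s => D.removeCurrent P i r * D.removeCurrent P j s) r s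
        + gMulSwap P j i (fun r s => D.removeCurrent P j s * D.removeCurrent P i r) r s = 0 := by
  have h1 := ((EventuallyEq.gMul (P := P) (i := i) (j := j) (fun r s =>
    (h.eventuallyEq_removeCurrent i r).mul (h.eventuallyEq_removeCurrent j s)) r s).smul
    (colorSign i j)).add (EventuallyEq.gMulSwap (P := P) (i := j) (j := i) (fun r s =>
    (h.eventuallyEq_removeCurrent j s).mul (h.eventuallyEq_removeCurrent i r)) r s)
  refine h1.unique ?_
  convert EventuallyEq.const (B := B) (0 : Module.End ℂ D.Space) using 2 with T
  rw [gMul_boxSum, gMulSwap_boxSum', Finset.smul_sum, ← Finset.sum_add_distrib]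
  refine Finset.sum_eq_zero fun u hu => ?_
  rw [Finset.smul_sum, ← Finset.sum_add_distrib]
  refine Finset.sum_eq_zero fun v hv => ?_
  rw [← (Finset.mem_filter.1 hu).2, ← (Finset.mem_filter.1 hv).2]
  have h2 := congrArg ((D.pos P u ^ r * D.pos P v ^ s) • ·) (h.removeOp_mul_removeOp u v)
  simp only [smul_add, smul_smul, smul_zero] at h2 ⊢
  rw [← h2]
  congr 2
  ring

omit h in
/-- `φ_λ` before and after adding a box. -/
theorem phi_add_mul_affRoot {l : Finset B} {c : B} (hc : ¬ D.Added l c) (i : ZMod 2) :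
    D.phi P (D.add l c) i * affRoot P (D.color c) (D.pos P c) i = D.phi P l i := by
  rw [phi_add hc, inv_mul_cancel_right₀ (affRoot_ne_zero _ _ _ _)]

/-- The relation holds for every box separately, because adding the box divides `φ_λ` by its
affine root. -/
theorem cartan_addCurrent (ε : Bool) (i j : ZMod 2) (r s : ℤ) :
    colorSign i j • gMulSwap P j i (fun r s => D.cartanOp P ε i r * D.addCurrent P j s) r s
        + gMul P i j (fun r s => D.addCurrent P j s * D.cartanOp P ε i r) r s = 0 := by
  have h1 := ((EventuallyEq.gMulSwap (P := P) (i := j) (j := i) (fun r s =>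
    (EventuallyEq.const (D.cartanOp P ε i r)).mul (h.eventuallyEq_addCurrent j s)) r s).smul
    (colorSign i j)).add (EventuallyEq.gMul (P := P) (i := i) (j := j) (fun r s =>
    (h.eventuallyEq_addCurrent j s).mul (EventuallyEq.const (D.cartanOp P ε i r))) r s)
  refine h1.unique ?_
  convert EventuallyEq.const (B := B) (0 : Module.End ℂ D.Space) using 2 with T
  simp only [boxSum, Finset.mul_sum, Finset.sum_mul, gMul_sum, gMulSwap_sum, Finset.smul_sum,
    ← Finset.sum_add_distrib]
  refine Finset.sum_eq_zero fun v hv => ?_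
  obtain rfl := (Finset.mem_filter.1 hv).2
  apply linearMap_ext
  intro l hl
  -- Evaluation at a basis vector commutes with the multiplications by `g`.
  have key : ∀ (f g : ℤ → ℤ → Module.End ℂ D.Space) (f' g' : ℤ → ℤ → D.Space),
      (∀ r s, f r s (D.ketZ l) = f' r s) → (∀ r s, g r s (D.ketZ l) = g' r s) →
      colorSign i (D.color v) • gMulSwap P (D.color v) i f' r s + gMul P i (D.color v) g' r s = 0 →
      (colorSign i (D.color v) • gMulSwap P (D.color v) i f r s + gMul P i (D.color v) g r s)
        (D.ketZ l) = (0 : Module.End ℂ D.Space) (D.ketZ l) := by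
    intro f g f' g' hf hg h0
    rw [LinearMap.zero_apply, ← h0]
    unfold gMulSwap gMul
    split_ifs <;> simp only [LinearMap.add_apply, LinearMap.sub_apply, LinearMap.smul_apply, hf, hg]
  by_cases hv' : D.Added l v
  · refine key _ _ (fun _ _ => 0) (fun _ _ => 0) ?_ ?_ ?_
    · intro r s
      simp [addOp_ketZ_of_added P hv']
    · intro r s
      simp [cartanOp_ketZ, addOp_ketZ_of_added P hv']
    · unfold gMulSwap gMul
      split_ifs <;> simp
  · refine key _ _ _ _ ?_ ?_ (coeffAt_mul_affRoot P ε i (D.color v) (D.pos_ne_zero P v)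
      (phi_add_mul_affRoot hv' i) (D.aCoeff P l v (D.color v) • D.ketZ (D.add l v)) r s)
    · intro r s
      rw [Module.End.mul_apply, LinearMap.smul_apply, addOp_ketZ P hl hv', map_smul, map_smul,
        cartanOp_ketZ, smul_smul, smul_smul, smul_smul]
      congr 1
      ring
    · intro r s
      rw [Module.End.mul_apply, cartanOp_ketZ, map_smul, LinearMap.smul_apply, addOp_ketZ P hl hv',
        smul_smul, smul_smul]

theorem cartan_removeCurrent (ε : Bool) (i j : ZMod 2) (r s : ℤ) :
    colorSign i j • gMul P i j (fun r s => D.cartanOp P ε i r * D.removeCurrent P j s) r s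
        + gMulSwap P j i (fun r s => D.removeCurrent P j s * D.cartanOp P ε i r) r s = 0 := by
  have h1 := ((EventuallyEq.gMul (P := P) (i := i) (j := j) (fun r s =>
    (EventuallyEq.const (D.cartanOp P ε i r)).mul (h.eventuallyEq_removeCurrent j s)) r s).smul
    (colorSign i j)).add (EventuallyEq.gMulSwap (P := P) (i := j) (j := i) (fun r s =>
    (h.eventuallyEq_removeCurrent j s).mul (EventuallyEq.const (D.cartanOp P ε i r))) r s)
  refine h1.unique ?_
  convert EventuallyEq.const (B := B) (0 : Module.End ℂ D.Space) using 2 with T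
  simp only [boxSum, Finset.mul_sum, Finset.sum_mul, gMul_sum, gMulSwap_sum, Finset.smul_sum,
    ← Finset.sum_add_distrib]
  refine Finset.sum_eq_zero fun v hv => ?_
  obtain rfl := (Finset.mem_filter.1 hv).2
  apply linearMap_ext
  intro l hl
  -- Here `f` and `g` exchange their roles, at the cost of the sign `colorSign`.
  have key : ∀ (f g : ℤ → ℤ → Module.End ℂ D.Space) (f' g' : ℤ → ℤ → D.Space),
      (∀ r s, f r s (D.ketZ l) = f' r s) → (∀ r s, g r s (D.ketZ l) = g' r s) →
      colorSign i (D.color v) • gMulSwap P (D.color v) i g' r s + gMul P i (D.color v) f' r s = 0 →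
      (colorSign i (D.color v) • gMul P i (D.color v) f r s + gMulSwap P (D.color v) i g r s)
        (D.ketZ l) = (0 : Module.End ℂ D.Space) (D.ketZ l) := by
    intro f g f' g' hf hg h0
    have h1 := congrArg (colorSign i (D.color v) • ·) h0
    simp only [smul_add, smul_smul, colorSign_mul_self, one_smul, smul_zero] at h1
    rw [LinearMap.zero_apply, ← h1, _root_.add_comm]
    unfold gMulSwap gMul
    split_ifs <;> simp only [LinearMap.add_apply, LinearMap.sub_apply, LinearMap.smul_apply, hf, hg]
  by_cases hv' : D.Added l v
  · obtain ⟨m, rfl, hm⟩ := exists_eq_add hv'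
    refine key _ _ _ _ ?_ ?_ (coeffAt_mul_affRoot P ε i (D.color v) (D.pos_ne_zero P v)
      (phi_add_mul_affRoot hm i) (D.bCoeff P (D.add m v) v (D.color v) • D.ketZ m) r s)
    · intro r s
      rw [Module.End.mul_apply, LinearMap.smul_apply, removeOp_ketZ_add P hl hm, map_smul, map_smul,
        cartanOp_ketZ, smul_smul, smul_smul, smul_smul]
      congr 1
      ring
    · intro r s
      rw [Module.End.mul_apply, cartanOp_ketZ, map_smul, LinearMap.smul_apply,
        removeOp_ketZ_add P hl hm, smul_smul, smul_smul]
  · refine key _ _ (fun _ _ => 0) (fun _ _ => 0) ?_ ?_ ?_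
    · intro r s
      simp [removeOp_ketZ_of_not_added P hv']
    · intro r s
      simp [cartanOp_ketZ, removeOp_ketZ_of_not_added P hv']
    · unfold gMulSwap gMul
      split_ifs <;> simp

/-- The commutator of the two currents is diagonal, with the residues of `φ_λ` at the boxes that
can be added or removed as eigenvalues, so the relation is the partial fraction expansion of
`φ_λ`. -/
theorem removeCurrent_addCurrent (i j : ZMod 2) (r s : ℤ) :
    D.removeCurrent P i r * D.addCurrent P j s - D.addCurrent P j s * D.removeCurrent P i r =
      (kron i j / (P.q - P.q⁻¹)) • (D.cartanOp P true i (r + s) - D.cartanOp P false i (r + s)) := by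
  have h1 := ((h.eventuallyEq_removeCurrent i r).mul (h.eventuallyEq_addCurrent j s)).sub
    ((h.eventuallyEq_addCurrent j s).mul (h.eventuallyEq_removeCurrent i r))
  refine h1.unique ?_
  -- Removing a box commutes with adding a different one, so only the diagonal terms remain.
  have h2 : ∀ T, D.boxSum P (D.removeOp P) T i r * D.boxSum P (D.addOp P) T j s -
      D.boxSum P (D.addOp P) T j s * D.boxSum P (D.removeOp P) T i r =
      kron i j • ∑ b ∈ T with D.color b = i, D.pos P b ^ (r + s) •
        (D.removeOp P b * D.addOp P b - D.addOp P b * D.removeOp P b) := by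
    intro T
    rw [boxSum_mul_boxSum, boxSum_mul_boxSum', Finset.smul_sum]
    have hsub : ∀ (t : Finset B) (f g : B → Module.End ℂ D.Space),
        ∑ b ∈ t, f b - ∑ b ∈ t, g b = ∑ b ∈ t, (f b - g b) := fun t f g =>
      (Finset.sum_sub_distrib f g).symm
    refine (hsub _ _ _).trans (Finset.sum_congr rfl fun u hu => ?_)
    refine (hsub _ _ _).trans ?_
    have h3 : ∀ v ∈ T.filter (fun v => D.color v = j), u ≠ v →
        (D.pos P u ^ r * D.pos P v ^ s) • (D.removeOp P u * D.addOp P v) -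
        (D.pos P u ^ r * D.pos P v ^ s) • (D.addOp P v * D.removeOp P u) = 0 := by
      intro v _ huv
      rw [h.removeOp_mul_addOp huv]
      exact sub_self (G := Module.End ℂ D.Space) _
    by_cases hij : i = j
    · subst hij
      rw [Finset.sum_eq_single_of_mem u hu fun v hv huv => h3 v hv huv.symm, kron, if_pos rfl,
        one_smul, zpow_add₀ (D.pos_ne_zero P u)]
      exact (smul_sub (M := ℂ) (A := Module.End ℂ D.Space) _ _ _).symm
    · rw [kron, if_neg hij, zero_smul]
      refine Finset.sum_eq_zero fun v hv => h3 v hv ?_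
      rintro rfl
      exact hij ((Finset.mem_filter.1 hu).2.symm.trans (Finset.mem_filter.1 hv).2)
  apply EventuallyEq.of_ketZ
  intro l hl
  have hfin := h.finite_CC_union_CV hl i
  filter_upwards [eventually_ge_atTop hfin.toFinset] with T hT
  rw [h2 T]
  by_cases hij : i = j
  · subst hij
    -- All poles of `φ_λ` are at boxes of `T`, once `T` is large enough.
    have hB := coeffAt_true_sub_false (h.balanced_phi l i)
      ((T.filter fun b => D.color b = i).image (D.pos P))
      (by
        intro p hp
        obtain ⟨b, -, rfl⟩ := Finset.mem_image.1 hp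
        exact D.pos_ne_zero P b)
      (h.neg_one_le_ord l hl i) (by
        intro p hp
        by_contra hneg
        obtain ⟨b, hb, rfl⟩ := (h.ord_neg_iff l hl i p).1 (not_le.1 hneg)
        apply hp
        refine Finset.mem_image.2 ⟨b, Finset.mem_filter.2 ⟨hT ?_, ?_⟩, rfl⟩
        · simpa using hb
        · exact hb.elim (fun hb => hb.1) fun hb => hb.1) (r + s)
    rw [Finset.sum_image h.pos_injective.injOn] at hB
    simp only [LinearMap.smul_apply, LinearMap.sum_apply, LinearMap.sub_apply, cartanOp_ketZ]
    rw [← sub_smul, hB, Finset.sum_smul, Finset.smul_sum, Finset.smul_sum]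
    refine Finset.sum_congr rfl fun b hb => ?_
    obtain rfl := (Finset.mem_filter.1 hb).2
    have := h.commutator_ketZ hl b
    rw [LinearMap.sub_apply] at this
    rw [this, smul_smul, smul_smul, smul_smul]
    congr 1
    ring
  · rw [kron, if_neg hij]
    simp

end IsRegular

end CombData

end Toroidal

/-! ### Reordering words in quadratic algebras -/

namespace Toroidal

section Words

variable {B A : Type*} [Ring A] [Algebra ℂ A]

/-- The product of the numbers `ω u v` over all pairs of letters of a word, `u` to the left
of `v`. -/
noncomputable def wordWeight (ω : B → B → ℂ) : List B → ℂ
  | [] => 1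
  | u :: l => (l.map (ω u)).prod * wordWeight ω l

theorem wordWeight_append_cons (ω : B → B → ℂ) (u : B) (s t : List B) :
    wordWeight ω (s ++ u :: t) =
      (s.map fun v => ω v u).prod * (t.map (ω u)).prod * wordWeight ω (s ++ t) := by
  induction s with
  | nil => simp [wordWeight]
  | cons v s ih =>
    simp only [List.cons_append, wordWeight, ih, List.map_append, List.map_cons, List.prod_append,
      List.prod_cons]
    ring

theorem wordWeight_ne_zero {ω : B → B → ℂ} {l : List B} (h : l.Pairwise fun u v => ω u v ≠ 0) :
    wordWeight ω l ≠ 0 := by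
  induction h with
  | nil => exact one_ne_zero
  | cons h1 _ ih =>
    refine mul_ne_zero (List.prod_ne_zero ?_) ih
    simp only [List.mem_map, not_exists, not_and]
    exact h1

variable {ω : B → B → ℂ} {X : B → A} (hX : ∀ u v, ω v u • (X u * X v) = ω u v • (X v * X u))
include hX

theorem smul_prod_append_cons (u : B) (s t : List B) :
    (s.map (ω u)).prod • ((s ++ u :: t).map X).prod =
      (s.map fun v => ω v u).prod • (X u * ((s ++ t).map X).prod) := by
  induction s with
  | nil => simp
  | cons v s ih =>
    simp only [List.cons_append, List.map_cons, List.prod_cons]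
    calc _ = ω u v • (X v * ((s.map (ω u)).prod • ((s ++ u :: t).map X).prod)) := by
            rw [mul_smul, mul_smul_comm]
      _ = (s.map fun v => ω v u).prod • ((ω u v • (X v * X u)) * ((s ++ t).map X).prod) := by
            rw [ih, mul_smul_comm, smul_comm, smul_mul_assoc, mul_assoc]
      _ = _ := by
            rw [hX v u, mul_smul, smul_mul_assoc, smul_comm (ω v u), mul_assoc]

/-- Words with the same letters are proportional, with the factors given by their weights. -/
theorem wordWeight_smul_prod {l e : List B} (hle : l.Perm e) :
    wordWeight ω e • (l.map X).prod = wordWeight ω l • (e.map X).prod := by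
  induction e generalizing l with
  | nil => rw [List.perm_nil.1 hle]
  | cons u e ih =>
    obtain ⟨s, t, rfl⟩ := List.append_of_mem (hle.symm.subset List.mem_cons_self)
    have hst : (s ++ t).Perm e := (List.perm_cons u).1 (List.perm_middle.symm.trans hle)
    rw [wordWeight_append_cons, wordWeight, ← (hst.map (ω u)).prod_eq, List.map_append,
      List.prod_append, List.map_cons, List.prod_cons]
    calc _ = ((t.map (ω u)).prod * wordWeight ω e) •
          ((s.map (ω u)).prod • ((s ++ u :: t).map X).prod) := by
            rw [smul_smul]; congr 1; ring
      _ = ((s.map fun v => ω v u).prod * (t.map (ω u)).prod) •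
          (X u * (wordWeight ω e • ((s ++ t).map X).prod)) := by
            rw [smul_prod_append_cons hX, smul_smul, mul_smul_comm, smul_smul]; congr 1; ring
      _ = _ := by rw [ih hst, mul_smul_comm, smul_smul]

end Words

/-! ### The Serre relations -/

section SerreTerm

variable {A : Type*} [Ring A] [Algebra ℂ A]

/-- The iterated commutator `[a, [b, [c, y]_{q²}]]_{q⁻²}` of the Serre relations, written out. -/
noncomputable def serreTerm (P : QParams) (a b c y : A) : A :=
  a * (b * (c * y)) - P.q₂ • (a * (b * (y * c))) - a * (c * (y * b)) + P.q₂ • (a * (y * (c * b)))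
    - P.q₂⁻¹ • (b * (c * (y * a))) + b * (y * (c * a)) + P.q₂⁻¹ • (c * (y * (b * a)))
    - y * (c * (b * a))

theorem Free.serre_eq (P : QParams) (X : ZMod 2 → ℤ → FreeAlgebra ℂ Gen) (i : ZMod 2)
    (k : Fin 3 → ℤ) (l : ℤ) : Free.serre P X i k l = (1 / 6 : ℂ) • ∑ σ : Equiv.Perm (Fin 3),
      serreTerm P (X i (k (σ 0))) (X i (k (σ 1))) (X i (k (σ 2))) (X (i + 1) l) := by
  rw [Free.serre]
  congr 1
  refine Finset.sum_congr rfl fun σ _ => ?_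
  have h1 : P.q ^ (-2 : ℤ) = P.q₂⁻¹ := by rw [zpow_neg]; rfl
  have h2 : P.q₂⁻¹ * P.q₂ = 1 := inv_mul_cancel₀ P.q₂_ne_zero
  simp only [qComm, serreTerm, h1, ← QParams.q₂.eq_1, one_smul, one_mul, mul_sub,
    sub_mul, mul_smul_comm, smul_mul_assoc,
    smul_sub, smul_smul, h2, mul_assoc]
  abel

end SerreTerm

theorem sum_perm_fin_three {M : Type*} [AddCommMonoid M] (f : Fin 3 → Fin 3 → Fin 3 → M) :
    ∑ σ : Equiv.Perm (Fin 3), f (σ 0) (σ 1) (σ 2) =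
      f 0 1 2 + (f 1 0 2 + (f 2 1 0 + (f 0 2 1 + (f 1 2 0 + f 2 0 1)))) := by
  have h1 : (Finset.univ : Finset (Equiv.Perm (Fin 3))) =
      {1, Equiv.swap 0 1, Equiv.swap 0 2, Equiv.swap 1 2, Equiv.swap 0 1 * Equiv.swap 1 2,
        Equiv.swap 1 2 * Equiv.swap 0 1} := by decide
  rw [h1, Finset.sum_insert (by decide), Finset.sum_insert (by decide),
    Finset.sum_insert (by decide), Finset.sum_insert (by decide), Finset.sum_insert (by decide),
    Finset.sum_singleton]
  rfl

/-- The polynomial identity behind the Serre relations, antisymmetrized over `x₁`, `x₂`, `x₃`.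
Here `t = q₁ q₃ = q₂⁻¹` and `s = q₁ + q₃`, so that `G x y = (y - q₁ x) (y - q₃ x)`. -/
theorem serre_identity (s t x₁ x₂ x₃ y : ℂ) :
    let G := fun x y : ℂ => y ^ 2 - s * x * y + t * x ^ 2
    let w := fun x y : ℂ => t * y - x
    let T := fun x₁ x₂ x₃ : ℂ => w x₁ x₂ * w x₁ x₃ * w x₂ x₃ * (
      t * (G x₁ y * G x₂ y * G x₃ y) - (t ^ 2 + t + 1) * (G x₁ y * G x₂ y * G y x₃)
      + (t ^ 2 + t + 1) * (G x₁ y * G y x₂ * G y x₃) - t * (G y x₁ * G y x₂ * G y x₃))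
    T x₁ x₂ x₃ - T x₂ x₁ x₃ - T x₃ x₂ x₁ - T x₁ x₃ x₂ + T x₂ x₃ x₁ + T x₃ x₁ x₂ = 0 := by
  intro G w T
  simp only [T, G, w]
  ring

section SerreScalar

variable {B : Type*}

/-- The combination of weights of words that corresponds to `serreTerm`. -/
noncomputable def serreScalar (P : QParams) (ω : B → B → ℂ) (a b c y : B) : ℂ :=
  wordWeight ω [a, b, c, y] - P.q₂ * wordWeight ω [a, b, y, c] - wordWeight ω [a, c, y, b]
    + P.q₂ * wordWeight ω [a, y, c, b] - P.q₂⁻¹ * wordWeight ω [b, c, y, a]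
    + wordWeight ω [b, y, c, a] + P.q₂⁻¹ * wordWeight ω [c, y, b, a] - wordWeight ω [y, c, b, a]

/-- The sum over permutations, with like words collected and `t` in the place of `q₂⁻¹`. -/
theorem sum_serreScalar_eq (P : QParams) (ω : B → B → ℂ) (f : Fin 3 → B) (y : B) (t : ℂ)
    (ht : P.q₂ * t = 1) :
    ∑ σ : Equiv.Perm (Fin 3), serreScalar P ω (f (σ 0)) (f (σ 1)) (f (σ 2)) y =
      P.q₂ * ∑ σ : Equiv.Perm (Fin 3), (t * wordWeight ω [f (σ 0), f (σ 1), f (σ 2), y]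
        - (t ^ 2 + t + 1) * wordWeight ω [f (σ 0), f (σ 1), y, f (σ 2)]
        + (t ^ 2 + t + 1) * wordWeight ω [f (σ 0), y, f (σ 1), f (σ 2)]
        - t * wordWeight ω [y, f (σ 0), f (σ 1), f (σ 2)]) := by
  rw [sum_perm_fin_three fun i j k => serreScalar P ω (f i) (f j) (f k) y,
    sum_perm_fin_three fun i j k => t * wordWeight ω [f i, f j, f k, y]
        - (t ^ 2 + t + 1) * wordWeight ω [f i, f j, y, f k]
        + (t ^ 2 + t + 1) * wordWeight ω [f i, y, f j, f k]
        - t * wordWeight ω [y, f i, f j, f k]]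
  obtain rfl : t = P.q₂⁻¹ := by rw [← mul_one P.q₂⁻¹, ← ht, inv_mul_cancel_left₀ P.q₂_ne_zero]
  have h2 := P.q₂_ne_zero
  simp only [serreScalar]
  generalize wordWeight ω = W
  field_simp
  ring

variable {P : QParams} {ω : B → B → ℂ} {f : Fin 3 → B} {y : B} {p : Fin 3 → ℂ} {r : ℂ}
  {d : Fin 3 → Fin 3 → ℂ} (hd : ∀ i j, d i j = -d j i)
  (hff : ∀ i j, ω (f i) (f j) = (p j - P.q₂ * p i) * d i j)
  (hfy : ∀ i, ω (f i) y = (r - P.q₁ * p i) * (r - P.q₃ * p i))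
  (hyf : ∀ i, ω y (f i) = (p i - P.q₁ * r) * (p i - P.q₃ * r))
include hd hff hfy hyf

/-- For letters that exchange like the currents, the weights of the words in the symmetrized Serre
combination sum to zero. The antisymmetric factor `d` makes the sum over permutations alternating.
-/
theorem sum_serreScalar : ∑ σ : Equiv.Perm (Fin 3),
    serreScalar P ω (f (σ 0)) (f (σ 1)) (f (σ 2)) y = 0 := by
  have h123 := P.q₁_mul_q₂_mul_q₃
  have ht : P.q₂ * (P.q₁ * P.q₃) = 1 := by linear_combination h123
  rw [sum_serreScalar_eq P ω f y (P.q₁ * P.q₃) ht]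
  have hff' : ∀ i j, ω (f i) (f j) = P.q₂ * (P.q₁ * P.q₃ * p j - p i) * d i j := fun i j => by
    rw [hff]
    linear_combination (-p j * d i j) * ht
  have hfy' : ∀ i, ω (f i) y = r ^ 2 - (P.q₁ + P.q₃) * p i * r + P.q₁ * P.q₃ * p i ^ 2 := fun i => by
    rw [hfy]; ring
  have hyf' : ∀ i, ω y (f i) = p i ^ 2 - (P.q₁ + P.q₃) * r * p i + P.q₁ * P.q₃ * r ^ 2 := fun i => by
    rw [hyf]; ring
  have key := serre_identity (P.q₁ + P.q₃) (P.q₁ * P.q₃) (p 0) (p 1) (p 2) r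
  have d10 : d 1 0 = -d 0 1 := hd _ _
  have d20 : d 2 0 = -d 0 2 := hd _ _
  have d21 : d 2 1 = -d 1 2 := hd _ _
  rw [sum_perm_fin_three fun i j k => P.q₁ * P.q₃ * wordWeight ω [f i, f j, f k, y]
        - ((P.q₁ * P.q₃) ^ 2 + P.q₁ * P.q₃ + 1) * wordWeight ω [f i, f j, y, f k]
        + ((P.q₁ * P.q₃) ^ 2 + P.q₁ * P.q₃ + 1) * wordWeight ω [f i, y, f j, f k]
        - P.q₁ * P.q₃ * wordWeight ω [y, f i, f j, f k]]
  simp only [wordWeight, List.map_cons, List.map_nil, List.prod_cons, List.prod_nil, hff', hfy',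
    hyf', d10, d20, d21]
  simp only at key
  -- The values of `G` are abstracted to keep the final polynomial identity small.
  have hG : ∀ x y : ℂ, ∃ g, y ^ 2 - (P.q₁ + P.q₃) * x * y + P.q₁ * P.q₃ * x ^ 2 = g :=
    fun _ _ => ⟨_, rfl⟩
  obtain ⟨g1, e1⟩ := hG (p 0) r
  obtain ⟨g2, e2⟩ := hG (p 1) r
  obtain ⟨g3, e3⟩ := hG (p 2) r
  obtain ⟨g4, e4⟩ := hG r (p 0)
  obtain ⟨g5, e5⟩ := hG r (p 1)
  obtain ⟨g6, e6⟩ := hG r (p 2)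
  simp only [e1, e2, e3, e4, e5, e6] at key ⊢
  linear_combination (P.q₂ ^ 4 * d 0 1 * d 0 2 * d 1 2) * key

omit hd hff hfy hyf in
/-- Reversing all words changes the sign of the combination. -/
theorem sum_serreScalar_flip (P : QParams) (ω : B → B → ℂ) (f : Fin 3 → B) (y : B) :
    ∑ σ : Equiv.Perm (Fin 3), serreScalar P (flip ω) (f (σ 0)) (f (σ 1)) (f (σ 2)) y =
      -∑ σ : Equiv.Perm (Fin 3), serreScalar P ω (f (σ 0)) (f (σ 1)) (f (σ 2)) y := by
  rw [sum_serreScalar_eq P _ f y _ (mul_inv_cancel₀ P.q₂_ne_zero),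
    sum_serreScalar_eq P _ f y _ (mul_inv_cancel₀ P.q₂_ne_zero), ← mul_neg]
  congr 1
  generalize P.q₂⁻¹ = t
  rw [sum_perm_fin_three fun i j k => t * wordWeight ω [f i, f j, f k, y]
        - (t ^ 2 + t + 1) * wordWeight ω [f i, f j, y, f k]
        + (t ^ 2 + t + 1) * wordWeight ω [f i, y, f j, f k]
        - t * wordWeight ω [y, f i, f j, f k],
    sum_perm_fin_three fun i j k => t * wordWeight (flip ω) [f i, f j, f k, y]
        - (t ^ 2 + t + 1) * wordWeight (flip ω) [f i, f j, y, f k]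
        + (t ^ 2 + t + 1) * wordWeight (flip ω) [f i, y, f j, f k]
        - t * wordWeight (flip ω) [y, f i, f j, f k]]
  simp only [wordWeight, List.map_cons, List.map_nil, List.prod_cons, List.prod_nil, flip]
  ring

end SerreScalar

section

variable {B A : Type*} [Ring A] [Algebra ℂ A]

/-- All words in the Serre combination are proportional to a fixed word `e` in the same letters.
-/
theorem wordWeight_smul_serreTerm (P : QParams) {ω : B → B → ℂ} {X : B → A}
    (hX : ∀ u v, ω v u • (X u * X v) = ω u v • (X v * X u)) {e : List B} {a b c y : B}
    (he : [a, b, c, y].Perm e) :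
    wordWeight ω e • serreTerm P (X a) (X b) (X c) (X y) =
      serreScalar P ω a b c y • (e.map X).prod := by
  have h1 : ∀ {s t u v}, [s, t, u, v].Perm e →
      wordWeight ω e • (X s * (X t * (X u * X v))) =
        wordWeight ω [s, t, u, v] • (e.map X).prod := by
    intro s t u v h
    simpa using wordWeight_smul_prod hX h
  have hp : ∀ {s t u v : B}, [s, t, u, v].Perm [a, b, c, y] → [s, t, u, v].Perm e :=
    fun h => h.trans he
  classical
  simp only [serreTerm, serreScalar, smul_add, smul_sub, smul_comm (wordWeight ω e) P.q₂,
    smul_comm (wordWeight ω e) P.q₂⁻¹, add_smul, sub_smul, mul_smul]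
  rw [h1 (hp (.refl _)), h1 (s := a) (t := b) (u := y) (v := c), h1 (s := a) (t := c) (u := y) (v := b),
    h1 (s := a) (t := y) (u := c) (v := b), h1 (s := b) (t := c) (u := y) (v := a),
    h1 (s := b) (t := y) (u := c) (v := a), h1 (s := c) (t := y) (u := b) (v := a),
    h1 (s := y) (t := c) (u := b) (v := a)]
  all_goals
    apply hp
    rw [List.perm_iff_count]
    intro x
    simp only [List.count_cons, List.count_nil]
    omega

/-- The symmetrized combination kills a vector if the weights of all words that do not kill it are
nonzero. -/
theorem sum_serreTerm_apply_eq_zero (P : QParams) {V : Type*} [AddCommGroup V] [Module ℂ V]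
    {ω : B → B → ℂ} {X : B → Module.End ℂ V}
    (hX : ∀ u v, ω v u • (X u * X v) = ω u v • (X v * X u)) {f : Fin 3 → B} {y : B}
    (hsum : ∑ σ : Equiv.Perm (Fin 3), serreScalar P ω (f (σ 0)) (f (σ 1)) (f (σ 2)) y = 0) {x : V}
    (hx : ∀ e : List B, e.Perm [f 0, f 1, f 2, y] → (e.map X).prod x ≠ 0 → wordWeight ω e ≠ 0) :
    (∑ σ : Equiv.Perm (Fin 3), serreTerm P (X (f (σ 0))) (X (f (σ 1))) (X (f (σ 2))) (X y)) x
      = 0 := by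
  classical
  have hσ : ∀ σ : Equiv.Perm (Fin 3), [f (σ 0), f (σ 1), f (σ 2), y].Perm [f 0, f 1, f 2, y] := by
    intro σ
    have h1 := Equiv.Perm.ofFn_comp_perm σ f
    simp only [List.ofFn_succ, List.ofFn_zero, Function.comp] at h1
    exact h1.append_right [y]
  -- A word that does not kill `x` has nonzero weight, and all the other words can be expressed
  -- through it; if there is no such word, every term vanishes.
  by_cases h : ∃ e : List B, e.Perm [f 0, f 1, f 2, y] ∧ (e.map X).prod x ≠ 0
  · obtain ⟨e, he, hex⟩ := h
    have h1 := hx e he hex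
    have h2 : wordWeight ω e • (∑ σ : Equiv.Perm (Fin 3),
        serreTerm P (X (f (σ 0))) (X (f (σ 1))) (X (f (σ 2))) (X y)) = 0 := by
      rw [Finset.smul_sum, Finset.sum_congr rfl fun σ _ =>
        wordWeight_smul_serreTerm P hX ((hσ σ).trans he.symm), ← Finset.sum_smul, hsum, zero_smul]
    rw [(smul_eq_zero.1 h2).resolve_left h1, LinearMap.zero_apply]
  · push Not at h
    rw [LinearMap.sum_apply]
    refine Finset.sum_eq_zero fun σ _ => ?_
    have h0 : ∀ {s t u v : B}, [s, t, u, v].Perm [f (σ 0), f (σ 1), f (σ 2), y] →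
        (X s * (X t * (X u * X v))) x = 0 := by
      intro s t u v hp
      simpa using h _ (hp.trans (hσ σ))
    simp only [serreTerm, LinearMap.add_apply, LinearMap.sub_apply, LinearMap.smul_apply]
    generalize f (σ 0) = a at *
    generalize f (σ 1) = b at *
    generalize f (σ 2) = c at *
    rw [h0 (.refl _), h0 (s := a) (t := b) (u := y) (v := c),
      h0 (s := a) (t := c) (u := y) (v := b), h0 (s := a) (t := y) (u := c) (v := b),
      h0 (s := b) (t := c) (u := y) (v := a), h0 (s := b) (t := y) (u := c) (v := a),
      h0 (s := c) (t := y) (u := b) (v := a), h0 (s := y) (t := c) (u := b) (v := a)]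
    · simp
    all_goals
      rw [List.perm_iff_count]
      intro x
      simp only [List.count_cons, List.count_nil]
      omega

end

section SerreTerm

variable {A ι : Type*} [Ring A] [Algebra ℂ A] (P : QParams) (s : Finset ι) (α : ι → ℂ) (X : ι → A)

theorem serreTerm_sum₁ (b c y : A) :
    serreTerm P (∑ i ∈ s, α i • X i) b c y = ∑ i ∈ s, α i • serreTerm P (X i) b c y := by
  simp only [serreTerm, Finset.sum_mul, Finset.mul_sum, Finset.smul_sum, smul_add, smul_sub,
    Finset.sum_add_distrib, Finset.sum_sub_distrib, smul_mul_assoc, mul_smul_comm,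
    smul_comm (α _) P.q₂, smul_comm (α _) P.q₂⁻¹]

theorem serreTerm_sum₂ (a c y : A) :
    serreTerm P a (∑ i ∈ s, α i • X i) c y = ∑ i ∈ s, α i • serreTerm P a (X i) c y := by
  simp only [serreTerm, Finset.sum_mul, Finset.mul_sum, Finset.smul_sum, smul_add, smul_sub,
    Finset.sum_add_distrib, Finset.sum_sub_distrib, smul_mul_assoc, mul_smul_comm,
    smul_comm (α _) P.q₂, smul_comm (α _) P.q₂⁻¹]

theorem serreTerm_sum₃ (a b y : A) :
    serreTerm P a b (∑ i ∈ s, α i • X i) y = ∑ i ∈ s, α i • serreTerm P a b (X i) y := by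
  simp only [serreTerm, Finset.sum_mul, Finset.mul_sum, Finset.smul_sum, smul_add, smul_sub,
    Finset.sum_add_distrib, Finset.sum_sub_distrib, smul_mul_assoc, mul_smul_comm,
    smul_comm (α _) P.q₂, smul_comm (α _) P.q₂⁻¹]

theorem serreTerm_sum₄ (a b c : A) :
    serreTerm P a b c (∑ i ∈ s, α i • X i) = ∑ i ∈ s, α i • serreTerm P a b c (X i) := by
  simp only [serreTerm, Finset.sum_mul, Finset.mul_sum, Finset.smul_sum, smul_add, smul_sub,
    Finset.sum_add_distrib, Finset.sum_sub_distrib, smul_mul_assoc, mul_smul_comm,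
    smul_comm (α _) P.q₂, smul_comm (α _) P.q₂⁻¹]

end SerreTerm

theorem sum_piFinset_fin_three {B M : Type*} [AddCommMonoid M] (s : Finset B) (H : B → B → B → M) :
    ∑ f ∈ Fintype.piFinset (fun _ : Fin 3 => s), H (f 0) (f 1) (f 2) =
      ∑ a ∈ s, ∑ b ∈ s, ∑ c ∈ s, H a b c := by
  simp only [← Finset.sum_product']
  refine Finset.sum_nbij' (fun f => (f 0, f 1, f 2)) (fun x => ![x.1, x.2.1, x.2.2]) ?_ ?_ ?_ ?_ ?_
  · intro f hf
    simp only [Fintype.mem_piFinset] at hf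
    simp [hf]
  · rintro ⟨a, b, c⟩ h
    simp only [Finset.mem_product] at h
    simp [Fin.forall_fin_succ, h]
  · intro f _
    ext i
    fin_cases i <;> rfl
  · rintro ⟨a, b, c⟩ _
    rfl
  · intro f _
    rfl

namespace CombData

variable {B : Type}

theorem EventuallyEq.serreTerm (P : QParams) {V : Type} [AddCommGroup V] [Module ℂ V]
    {X₁ X₂ X₃ X₄ : Finset B → Module.End ℂ V} {Y₁ Y₂ Y₃ Y₄ : Module.End ℂ V}
    (h₁ : EventuallyEq X₁ Y₁) (h₂ : EventuallyEq X₂ Y₂) (h₃ : EventuallyEq X₃ Y₃)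
    (h₄ : EventuallyEq X₄ Y₄) :
    EventuallyEq (fun T => Toroidal.serreTerm P (X₁ T) (X₂ T) (X₃ T) (X₄ T))
      (Toroidal.serreTerm P Y₁ Y₂ Y₃ Y₄) :=
  ((((((((h₁.mul (h₂.mul (h₃.mul h₄))).sub ((h₁.mul (h₂.mul (h₄.mul h₃))).smul _)).sub
    (h₁.mul (h₃.mul (h₄.mul h₂)))).add ((h₁.mul (h₄.mul (h₃.mul h₂))).smul _)).sub
    ((h₂.mul (h₃.mul (h₄.mul h₁))).smul _)).add (h₂.mul (h₄.mul (h₃.mul h₁)))).add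
    ((h₃.mul (h₄.mul (h₂.mul h₁))).smul _)).sub (h₄.mul (h₃.mul (h₂.mul h₁))))

variable [LinearOrder B]

/-- The Serre combination of finite sums of box operators is a combination of those of single
boxes. -/
theorem sum_serreTerm_boxSum (D : CombData B) (P : QParams) {V : Type} [AddCommGroup V] [Module ℂ V]
    (X : B → Module.End ℂ V) (T : Finset B) (i j : ZMod 2) (k : Fin 3 → ℤ) (l : ℤ) :
    ∑ σ : Equiv.Perm (Fin 3), serreTerm P (D.boxSum P X T i (k (σ 0))) (D.boxSum P X T i (k (σ 1)))
        (D.boxSum P X T i (k (σ 2))) (D.boxSum P X T j l) =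
      ∑ f ∈ Fintype.piFinset (fun _ : Fin 3 => T.filter fun b => D.color b = i),
        ∑ y ∈ T with D.color y = j, ((∏ n, D.pos P (f n) ^ k n) * D.pos P y ^ l) •
          ∑ σ : Equiv.Perm (Fin 3),
            serreTerm P (X (f (σ 0))) (X (f (σ 1))) (X (f (σ 2))) (X y) := by
  have h1 : ∀ σ : Equiv.Perm (Fin 3), serreTerm P (D.boxSum P X T i (k (σ 0)))
      (D.boxSum P X T i (k (σ 1))) (D.boxSum P X T i (k (σ 2))) (D.boxSum P X T j l) =
      ∑ f ∈ Fintype.piFinset (fun _ : Fin 3 => T.filter fun b => D.color b = i),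
        ∑ y ∈ T with D.color y = j, ((∏ n, D.pos P (f n) ^ k n) * D.pos P y ^ l) •
            serreTerm P (X (f (σ 0))) (X (f (σ 1))) (X (f (σ 2))) (X y) := by
    intro σ
    rw [boxSum, boxSum, boxSum, boxSum, serreTerm_sum₁]
    simp only [serreTerm_sum₂]
    simp only [serreTerm_sum₃]
    simp only [serreTerm_sum₄, Finset.smul_sum, smul_smul]
    rw [← sum_piFinset_fin_three (T.filter fun b => D.color b = i) fun a b c =>
      ∑ y ∈ T with D.color y = j, (D.pos P a ^ k (σ 0) * (D.pos P b ^ k (σ 1) *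
        (D.pos P c ^ k (σ 2) * D.pos P y ^ l))) • serreTerm P (X a) (X b) (X c) (X y)]
    refine Finset.sum_nbij' (fun f => f ∘ σ.symm) (fun f => f ∘ σ) ?_ ?_ ?_ ?_ ?_
    · intro f hf
      rw [Fintype.mem_piFinset] at hf ⊢
      exact fun n => hf _
    · intro f hf
      rw [Fintype.mem_piFinset] at hf ⊢
      exact fun n => hf _
    · intro f _
      ext n
      simp
    · intro f _
      ext n
      simp
    · intro f _
      refine Finset.sum_congr rfl fun y _ => ?_
      simp only [Function.comp_apply, Equiv.symm_apply_apply]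
      congr 1
      rw [← Equiv.prod_comp σ, Fin.prod_univ_three]
      simp only [Equiv.symm_apply_apply]
      ring
  rw [Finset.sum_congr rfl fun σ _ => h1 σ, Finset.sum_comm]
  refine Finset.sum_congr rfl fun f _ => ?_
  rw [Finset.sum_comm]
  simp only [Finset.smul_sum]

/-! ### Chains of states -/

/-- The result of adding the boxes of a list, the last one first. -/
noncomputable def addList (D : CombData B) (l : Finset B) : List B → Finset B
  | [] => l
  | b :: w => D.add (D.addList l w) b

/-- The boxes of a list can be added to `l` one after the other, the last one first, so that all
intermediate sets of boxes are states. -/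
def IsChain (D : CombData B) (l : Finset B) : List B → Prop
  | [] => l ∈ D.S
  | b :: w => D.IsChain l w ∧ ¬ D.Added (D.addList l w) b ∧ D.addList l (b :: w) ∈ D.S

theorem added_addList {D : CombData B} {l : Finset B} {w : List B} {c : B} :
    D.Added (D.addList l w) c ↔ c ∈ w ∨ D.Added l c := by
  induction w with
  | nil => simp [addList]
  | cons b w ih => rw [addList, added_add, ih, List.mem_cons, or_assoc]

theorem IsChain.start_mem {D : CombData B} {l : Finset B} {w : List B} (h : D.IsChain l w) :
    l ∈ D.S := by
  induction w with
  | nil => exact h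
  | cons b w ih => exact ih h.1

theorem IsChain.addList_mem {D : CombData B} {l : Finset B} {w : List B} (h : D.IsChain l w) :
    D.addList l w ∈ D.S := by
  cases w with
  | nil => exact h
  | cons b w => exact h.2.2

theorem IsChain.not_added {D : CombData B} {l : Finset B} {w : List B} (h : D.IsChain l w) {c : B}
    (hc : c ∈ w) : ¬ D.Added l c := by
  induction w with
  | nil => simp at hc
  | cons b w ih =>
    rcases List.mem_cons.1 hc with rfl | hc
    · exact fun h' => h.2.1 (added_addList.2 (Or.inr h'))
    · exact ih h.1 hc

theorem IsChain.nodup {D : CombData B} {l : Finset B} {w : List B} (h : D.IsChain l w) :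
    w.Nodup := by
  induction w with
  | nil => exact List.nodup_nil
  | cons b w ih =>
    exact List.nodup_cons.2 ⟨fun hb => h.2.1 (added_addList.2 (Or.inl hb)), ih h.1⟩

theorem prod_addOp_ketZ (D : CombData B) (P : QParams) {l : Finset B} {w : List B}
    (hw : (w.map (D.addOp P)).prod (D.ketZ l) ≠ 0) :
    D.IsChain l w ∧ ∃ c : ℂ, (w.map (D.addOp P)).prod (D.ketZ l) = c • D.ketZ (D.addList l w) := by
  induction w with
  | nil =>
    refine ⟨?_, 1, by simp [addList]⟩
    by_contra h
    exact hw (by simp [ketZ_of_notMem h])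
  | cons b w ih =>
    rw [List.map_cons, List.prod_cons, Module.End.mul_apply] at hw ⊢
    have h0 : (w.map (D.addOp P)).prod (D.ketZ l) ≠ 0 := fun h0 => hw (by rw [h0, map_zero])
    obtain ⟨h1, c, h2⟩ := ih h0
    rw [h2, map_smul] at hw ⊢
    have h3 : ¬ D.Added (D.addList l w) b := fun h3 => hw (by rw [addOp_ketZ_of_added P h3, smul_zero])
    rw [addOp_ketZ P h1.addList_mem h3, smul_smul] at hw ⊢
    refine ⟨⟨h1, h3, ?_⟩, _, rfl⟩
    by_contra h4
    exact hw (by rw [← addList, ketZ_of_notMem h4, smul_zero])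

theorem prod_removeOp_ketZ (D : CombData B) (P : QParams) {l : Finset B} {w : List B}
    (hw : (w.map (D.removeOp P)).prod (D.ketZ l) ≠ 0) :
    ∃ m, D.IsChain m w.reverse ∧ D.addList m w.reverse = l := by
  induction w using List.reverseRecOn generalizing l with
  | nil =>
    refine ⟨l, ?_, rfl⟩
    by_contra h
    exact hw (by simp [ketZ_of_notMem h])
  | append_singleton w b ih =>
    rw [List.map_append, List.prod_append, Module.End.mul_apply] at hw
    simp only [List.map_cons, List.map_nil, List.prod_singleton] at hw
    have hl : l ∈ D.S := by
      by_contra h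
      exact hw (by simp [ketZ_of_notMem h])
    have hb : D.Added l b := by
      by_contra h
      exact hw (by rw [removeOp_ketZ_of_not_added P h, map_zero])
    obtain ⟨m, rfl, hm⟩ := exists_eq_add hb
    rw [removeOp_ketZ_add P hl hm, map_smul] at hw
    obtain ⟨n, hn, rfl⟩ := ih fun h0 => hw (by rw [h0, smul_zero])
    rw [List.reverse_append, List.reverse_singleton, List.singleton_append]
    exact ⟨n, ⟨hn, hm, hl⟩, rfl⟩

/-- A quadratic relation as an exchange relation with a single weight function: the sign
`colorSign` is absorbed by the antisymmetric factor `p - p'` for equal colors. -/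
theorem smul_eq_smul_of_quadratic {M : Type*} [AddCommGroup M] [Module ℂ M] {x y : M} {a b : ℂ}
    {i j : ZMod 2} (h : (colorSign i j * a) • x + b • y = 0) (p p' : ℂ) :
    (a * if j = i then p - p' else 1) • x = (b * if i = j then p' - p else 1) • y := by
  rw [colorSign] at h
  by_cases hc : i = j
  · rw [if_pos hc, one_mul] at h
    rw [if_pos hc, if_pos hc.symm, mul_comm, mul_smul, eq_neg_of_add_eq_zero_left h, smul_neg,
      ← neg_smul, neg_sub, smul_smul, mul_comm]
  · rw [if_neg hc, neg_one_mul, neg_smul] at h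
    rw [if_neg hc, if_neg (Ne.symm hc), mul_one, mul_one]
    exact neg_add_eq_zero.1 h

/-- The weight that governs the exchange of two operators adding boxes. For boxes of the same color
there is an additional factor, which makes the exchange relation symmetric. -/
noncomputable def exchangeWeight (D : CombData B) (P : QParams) (u v : B) : ℂ :=
  D.gBox P u v * if D.color u = D.color v then D.pos P u - D.pos P v else 1

namespace IsRegular

variable {D : CombData B} {P : QParams} {Supports : B → B → Prop} (h : D.IsRegular P Supports)
include h

theorem exchange_addOp (u v : B) :
    D.exchangeWeight P v u • (D.addOp P u * D.addOp P v) =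
      D.exchangeWeight P u v • (D.addOp P v * D.addOp P u) := by
  simpa only [exchangeWeight] using smul_eq_smul_of_quadratic (M := Module.End ℂ D.Space)
    (h.addOp_mul_addOp u v) (D.pos P v) (D.pos P u)

theorem exchange_removeOp (u v : B) :
    flip (D.exchangeWeight P) v u • (D.removeOp P u * D.removeOp P v) =
      flip (D.exchangeWeight P) u v • (D.removeOp P v * D.removeOp P u) := by
  simpa only [exchangeWeight, flip, eq_comm (a := D.color v)] using
    smul_eq_smul_of_quadratic (M := Module.End ℂ D.Space)
    (h.removeOp_mul_removeOp u v) (D.pos P u) (D.pos P v)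

/-- In a chain in which a single box has a color different from the others, no box is added after
one that it would have to precede. -/
theorem pairwise_gBox_ne_zero {l : Finset B} {w : List B} (hw : D.IsChain l w) {i : ZMod 2}
    (hi : ∀ x ∈ w, ∀ y ∈ w, D.color x ≠ i → D.color y ≠ i → x = y) :
    w.Pairwise fun v u => D.gBox P v u ≠ 0 := by
  induction w with
  | nil => exact List.Pairwise.nil
  | cons v w ih =>
    refine List.pairwise_cons.2 ⟨fun u hu hg => ?_, ih hw.1 fun x hx y hy =>
      hi x (List.mem_cons_of_mem _ hx) y (List.mem_cons_of_mem _ hy)⟩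
    have hne : u ≠ v := by
      rintro rfl
      exact hw.2.1 (added_addList.2 (Or.inl hu))
    rcases lt_or_gt_of_ne hne with hlt | hlt
    · -- Then there are two more boxes in the chain, one of either color.
      obtain ⟨hc, x, y, hx, hy, hxu, hyv, hxy⟩ := h.exists_between hg hlt
      have hl := hxy _ hw.start_mem
      have hl' := hxy _ hw.2.2
      have huw : u ∈ v :: w := List.mem_cons_of_mem _ hu
      have hvw : v ∈ v :: w := List.mem_cons_self
      have h1 : ¬ D.Added l u := hw.not_added huw
      have h2 := hl'.1 (added_addList.2 (Or.inl hvw))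
      have hxw : x ∈ v :: w := (added_addList.1 h2.1).resolve_right fun h' => h1 (hl.2.1 h')
      have hyw : y ∈ v :: w := (added_addList.1 h2.2).resolve_right fun h' => h1 (hl.2.2 h')
      by_cases hui : D.color u = i
      · have hvi : D.color v ≠ i := fun h' => hc (hui.trans h'.symm)
        exact hyv (hi y hyw v hvw (hy ▸ hvi) hvi)
      · exact hxu (hi x hxw u huw (hx ▸ hui) hui)
    · exact hw.2.1 (h.added_of_nbr (Or.inl hg) hlt hw.1.addList_mem (added_addList.2 (Or.inl hu)))

theorem pairwise_exchangeWeight_ne_zero {l : Finset B} {w : List B} (hw : D.IsChain l w)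
    {i : ZMod 2} (hi : ∀ x ∈ w, ∀ y ∈ w, D.color x ≠ i → D.color y ≠ i → x = y) :
    w.Pairwise fun v u => D.exchangeWeight P v u ≠ 0 := by
  refine ((h.pairwise_gBox_ne_zero hw hi).and hw.nodup).imp fun {v u} hvu => ?_
  refine mul_ne_zero hvu.1 ?_
  split_ifs
  · exact sub_ne_zero.2 fun h' => hvu.2 (h.pos_injective h')
  · exact one_ne_zero

omit h in
theorem sum_serreScalar_exchangeWeight {i : ZMod 2} {f : Fin 3 → B} {y : B}
    (hf : ∀ n, D.color (f n) = i) (hy : D.color y = i + 1) :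
    ∑ σ : Equiv.Perm (Fin 3), serreScalar P (flip (D.exchangeWeight P)) (f (σ 0)) (f (σ 1))
      (f (σ 2)) y = 0 := by
  have hi : i ≠ i + 1 := by simp
  apply sum_serreScalar (p := fun n => D.pos P (f n)) (r := D.pos P y)
    (d := fun n n' => D.pos P (f n') - D.pos P (f n))
  · intro n n'
    ring
  · intro n n'
    simp [flip, exchangeWeight, gBox, gC, hf]
  · intro n
    simp [flip, exchangeWeight, gBox, gC, hf, hy]
  · intro n
    simp [flip, exchangeWeight, gBox, gC, hf, hy]

omit h in
theorem color_eq_of_perm {i : ZMod 2} {f : Fin 3 → B} {y : B} (hf : ∀ n, D.color (f n) = i)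
    {e : List B} (he : e.Perm [f 0, f 1, f 2, y]) :
    ∀ x ∈ e, ∀ x' ∈ e, D.color x ≠ i → D.color x' ≠ i → x = x' := by
  have h1 : ∀ x ∈ e, D.color x ≠ i → x = y := by
    intro x hx hxi
    have := he.subset hx
    simp only [List.mem_cons, List.not_mem_nil, or_false] at this
    rcases this with rfl | rfl | rfl | h'
    · exact absurd (hf 0) hxi
    · exact absurd (hf 1) hxi
    · exact absurd (hf 2) hxi
    · exact h'
  exact fun x hx x' hx' hxi hxi' => (h1 x hx hxi).trans (h1 x' hx' hxi').symm

theorem addOp_serre {i : ZMod 2} {f : Fin 3 → B} {y : B} (hf : ∀ n, D.color (f n) = i)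
    (hy : D.color y = i + 1) :
    ∑ σ : Equiv.Perm (Fin 3), serreTerm P (D.addOp P (f (σ 0))) (D.addOp P (f (σ 1)))
      (D.addOp P (f (σ 2))) (D.addOp P y) = 0 := by
  apply linearMap_ext
  intro l hl
  refine sum_serreTerm_apply_eq_zero P h.exchange_addOp ?_ fun e he hne => ?_
  · rw [← neg_eq_zero, ← sum_serreScalar_flip]
    exact sum_serreScalar_exchangeWeight hf hy
  · exact wordWeight_ne_zero (h.pairwise_exchangeWeight_ne_zero (prod_addOp_ketZ D P hne).1
      (color_eq_of_perm hf he))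

theorem removeOp_serre {i : ZMod 2} {f : Fin 3 → B} {y : B} (hf : ∀ n, D.color (f n) = i)
    (hy : D.color y = i + 1) :
    ∑ σ : Equiv.Perm (Fin 3), serreTerm P (D.removeOp P (f (σ 0))) (D.removeOp P (f (σ 1)))
      (D.removeOp P (f (σ 2))) (D.removeOp P y) = 0 := by
  apply linearMap_ext
  intro l hl
  refine sum_serreTerm_apply_eq_zero P h.exchange_removeOp
    (sum_serreScalar_exchangeWeight hf hy) fun e he hne => ?_
  obtain ⟨m, hm, -⟩ := prod_removeOp_ketZ D P hne
  have h1 := h.pairwise_exchangeWeight_ne_zero hm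
    (color_eq_of_perm hf ((List.reverse_perm e).trans he))
  exact wordWeight_ne_zero (List.pairwise_reverse.1 h1)

theorem addCurrent_serre (i : ZMod 2) (k : Fin 3 → ℤ) (l : ℤ) :
    ∑ σ : Equiv.Perm (Fin 3), serreTerm P (D.addCurrent P i (k (σ 0))) (D.addCurrent P i (k (σ 1)))
      (D.addCurrent P i (k (σ 2))) (D.addCurrent P (i + 1) l) = 0 := by
  refine (EventuallyEq.sum Finset.univ fun σ _ => EventuallyEq.serreTerm P
    (h.eventuallyEq_addCurrent i (k (σ 0))) (h.eventuallyEq_addCurrent i (k (σ 1)))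
    (h.eventuallyEq_addCurrent i (k (σ 2))) (h.eventuallyEq_addCurrent (i + 1) l)).unique ?_
  intro v
  refine Filter.Eventually.of_forall fun T => ?_
  simp only [sum_serreTerm_boxSum]
  rw [Finset.sum_eq_zero, LinearMap.zero_apply]
  intro f hf
  refine Finset.sum_eq_zero fun y hy => ?_
  rw [Fintype.mem_piFinset] at hf
  rw [h.addOp_serre (fun n => (Finset.mem_filter.1 (hf n)).2) (Finset.mem_filter.1 hy).2, smul_zero]

theorem removeCurrent_serre (i : ZMod 2) (k : Fin 3 → ℤ) (l : ℤ) :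
    ∑ σ : Equiv.Perm (Fin 3), serreTerm P (D.removeCurrent P i (k (σ 0)))
      (D.removeCurrent P i (k (σ 1))) (D.removeCurrent P i (k (σ 2)))
      (D.removeCurrent P (i + 1) l) = 0 := by
  refine (EventuallyEq.sum Finset.univ fun σ _ => EventuallyEq.serreTerm P
    (h.eventuallyEq_removeCurrent i (k (σ 0))) (h.eventuallyEq_removeCurrent i (k (σ 1)))
    (h.eventuallyEq_removeCurrent i (k (σ 2))) (h.eventuallyEq_removeCurrent (i + 1) l)).unique ?_
  intro v
  refine Filter.Eventually.of_forall fun T => ?_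
  simp only [sum_serreTerm_boxSum]
  rw [Finset.sum_eq_zero, LinearMap.zero_apply]
  intro f hf
  refine Finset.sum_eq_zero fun y hy => ?_
  rw [Fintype.mem_piFinset] at hf
  rw [h.removeOp_serre (fun n => (Finset.mem_filter.1 (hf n)).2) (Finset.mem_filter.1 hy).2,
    smul_zero]

end IsRegular

end CombData

end Toroidal

/-! ### The representation on the space of states -/

namespace Toroidal

namespace CombData

variable {B : Type} [LinearOrder B]

/-- The images of the generators. -/
noncomputable def genOp (D : CombData B) (P : QParams) : Gen → Module.End ℂ D.Space
  | .E i k => D.removeCurrent P i k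
  | .F i k => D.addCurrent P i k
  | .Kp i r => D.cartanOp P true i r
  | .Km i r => D.cartanOp P false i (-(r : ℤ))
  | .t => 1
  | .tInv => 1

/-- The extension of `genOp` to the free algebra. -/
noncomputable def freeRep (D : CombData B) (P : QParams) :
    FreeAlgebra ℂ Gen →ₐ[ℂ] Module.End ℂ D.Space :=
  FreeAlgebra.lift ℂ (D.genOp P)

theorem freeRep_ι (D : CombData B) (P : QParams) (x : Gen) :
    D.freeRep P (FreeAlgebra.ι ℂ x) = D.genOp P x :=
  FreeAlgebra.lift_ι_apply _ _

theorem freeRep_E (D : CombData B) (P : QParams) (i : ZMod 2) (k : ℤ) :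
    D.freeRep P (Free.E i k) = D.removeCurrent P i k := freeRep_ι _ _ _

theorem freeRep_F (D : CombData B) (P : QParams) (i : ZMod 2) (k : ℤ) :
    D.freeRep P (Free.F i k) = D.addCurrent P i k := freeRep_ι _ _ _

theorem freeRep_gMul (D : CombData B) (P : QParams) (i j : ZMod 2)
    (X : ℤ → ℤ → FreeAlgebra ℂ Gen) (r s : ℤ) :
    D.freeRep P (gMul P i j X r s) = gMul P i j (fun r s => D.freeRep P (X r s)) r s := by
  unfold gMul
  split_ifs <;> simp

theorem freeRep_gMulSwap (D : CombData B) (P : QParams) (i j : ZMod 2)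
    (X : ℤ → ℤ → FreeAlgebra ℂ Gen) (r s : ℤ) :
    D.freeRep P (gMulSwap P i j X r s) = gMulSwap P i j (fun r s => D.freeRep P (X r s)) r s := by
  unfold gMulSwap
  split_ifs <;> simp

theorem freeRep_serreTerm (D : CombData B) (P : QParams) (a b c y : FreeAlgebra ℂ Gen) :
    D.freeRep P (serreTerm P a b c y) =
      serreTerm P (D.freeRep P a) (D.freeRep P b) (D.freeRep P c) (D.freeRep P y) := by
  simp [serreTerm]

theorem cartanOp_mul_cartanOp (D : CombData B) (P : QParams) (ε ε' : Bool) (i j : ZMod 2)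
    (r s : ℤ) : D.cartanOp P ε i r * D.cartanOp P ε' j s =
      D.cartanOp P ε' j s * D.cartanOp P ε i r := by
  apply linearMap_ext
  intro l _
  simp only [Module.End.mul_apply, cartanOp_ketZ, map_smul, smul_smul, mul_comm]

theorem cartanOp_apply (D : CombData B) (P : QParams) (ε : Bool) (i : ZMod 2) (r : ℤ)
    (v : D.Space) (l : D.S) : D.cartanOp P ε i r v l = coeffAt ε (D.phi P l i) r * v l := by
  classical
  induction v using Finsupp.induction_linear with
  | zero => simp
  | add v w hv hw => rw [map_add, Finsupp.add_apply, hv, hw, Finsupp.add_apply, mul_add]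
  | single l' c =>
    rw [cartanOp, Finsupp.linearCombination_single, ← single_eq_ketZ]
    by_cases hl : l' = l
    · subst hl
      simp [mul_comm]
    · simp [Finsupp.single_eq_of_ne (Ne.symm hl)]

namespace IsRegular

variable {D : CombData B} {P : QParams} {Supports : B → B → Prop} (h : D.IsRegular P Supports)
include h

theorem cartanOp_eq_zero {ε : Bool} (i : ZMod 2) {r : ℤ} (hr : expSign ε r < 0) :
    D.cartanOp P ε i r = 0 := by
  apply linearMap_ext
  intro l _
  rw [cartanOp_ketZ, (h.balanced_phi l i).coeffAt_eq_zero ε hr, zero_smul, LinearMap.zero_apply]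

theorem freeRep_K (ε : Bool) (i : ZMod 2) (r : ℤ) :
    D.freeRep P (Free.K ε i r) = D.cartanOp P ε i r := by
  cases ε
  · rcases le_or_gt r 0 with hr | hr
    · have e : Free.K false i r = FreeAlgebra.ι ℂ (Gen.Km i (-r).toNat) := if_pos hr
      rw [e, freeRep_ι, genOp]
      congr 1
      omega
    · have e : Free.K false i r = 0 := if_neg (not_le.2 hr)
      rw [e, map_zero, h.cartanOp_eq_zero i (by simp only [expSign]; omega)]
  · rcases le_or_gt 0 r with hr | hr
    · have e : Free.K true i r = FreeAlgebra.ι ℂ (Gen.Kp i r.toNat) := if_pos hr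
      rw [e, freeRep_ι, genOp]
      congr 1
      omega
    · have e : Free.K true i r = 0 := if_neg (not_le.2 hr)
      rw [e, map_zero, h.cartanOp_eq_zero i (by simp only [expSign]; omega)]

theorem cartanOp_inv (ε : Bool) (i : ZMod 2) :
    D.cartanOp P ε i 0 * D.cartanOp P (!ε) i 0 = 1 := by
  apply linearMap_ext
  intro l _
  rw [Module.End.mul_apply, cartanOp_ketZ, map_smul, cartanOp_ketZ, smul_smul]
  have := (h.balanced_phi l i).coeffAt_mul
  cases ε
  · simp only [Bool.not_false, this, one_smul, Module.End.one_apply]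
  · simp only [Bool.not_true, mul_comm (coeffAt false _ _), this, one_smul, Module.End.one_apply]

theorem freeRep_rel {x y : FreeAlgebra ℂ Gen} (hxy : Rel P x y) :
    D.freeRep P x = D.freeRep P y := by
  cases hxy with
  | K_inv i => rw [map_mul, h.freeRep_K, h.freeRep_K, map_one]; exact h.cartanOp_inv true i
  | K_inv' i => rw [map_mul, h.freeRep_K, h.freeRep_K, map_one]; exact h.cartanOp_inv false i
  | t_inv => rw [map_mul, freeRep_ι, freeRep_ι, map_one]; exact mul_one _
  | t_inv' => rw [map_mul, freeRep_ι, freeRep_ι, map_one]; exact mul_one _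
  | t_central x =>
    rw [map_mul, map_mul, freeRep_ι, freeRep_ι]
    exact (one_mul _).trans (mul_one _).symm
  | KK ε ε' i j r s =>
    rw [map_mul, map_mul, h.freeRep_K, h.freeRep_K, cartanOp_mul_cartanOp]
  | KE ε i j r s =>
    rw [map_add, map_smul, freeRep_gMul, freeRep_gMulSwap, map_zero]
    simp only [map_mul, h.freeRep_K, freeRep_E]
    exact h.cartan_removeCurrent ε i j r s
  | KF ε i j r s =>
    rw [map_add, map_smul, freeRep_gMul, freeRep_gMulSwap, map_zero]
    simp only [map_mul, h.freeRep_K, freeRep_F]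
    exact h.cartan_addCurrent ε i j r s
  | EF i j r s =>
    rw [map_sub, map_mul, map_mul, map_smul, map_sub, h.freeRep_K, h.freeRep_K, freeRep_E,
      freeRep_F]
    exact h.removeCurrent_addCurrent i j r s
  | EE i j r s =>
    rw [map_add, map_smul, freeRep_gMul, freeRep_gMulSwap, map_zero]
    simp only [map_mul, freeRep_E]
    exact h.removeCurrent_quadratic i j r s
  | FF i j r s =>
    rw [map_add, map_smul, freeRep_gMul, freeRep_gMulSwap, map_zero]
    simp only [map_mul, freeRep_F]
    exact h.addCurrent_quadratic i j r s
  | serreE i k l =>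
    rw [Free.serre_eq, map_smul, map_sum, map_zero]
    simp only [freeRep_serreTerm, freeRep_E, h.removeCurrent_serre, smul_zero]
  | serreF i k l =>
    rw [Free.serre_eq, map_smul, map_sum, map_zero]
    simp only [freeRep_serreTerm, freeRep_F, h.addCurrent_serre, smul_zero]

/-- The representation of the quantum toroidal algebra on the space of states. -/
noncomputable def rep : QTor P →ₐ[ℂ] Module.End ℂ D.Space :=
  RingQuot.liftAlgHom ℂ ⟨D.freeRep P, fun _ _ => h.freeRep_rel⟩

theorem rep_mkAlgHom (x : FreeAlgebra ℂ Gen) :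
    h.rep (RingQuot.mkAlgHom ℂ (Rel P) x) = D.freeRep P x :=
  RingQuot.liftAlgHom_mkAlgHom_apply ℂ _ _ x

theorem rep_K (ε : Bool) (i : ZMod 2) (r : ℤ) : h.rep (QTor.K P ε i r) = D.cartanOp P ε i r :=
  (h.rep_mkAlgHom _).trans (h.freeRep_K ε i r)

theorem rep_E (i : ZMod 2) (k : ℤ) : h.rep (QTor.E P i k) = D.removeCurrent P i k :=
  (h.rep_mkAlgHom _).trans (freeRep_E D P i k)

theorem rep_F (i : ZMod 2) (k : ℤ) : h.rep (QTor.F P i k) = D.addCurrent P i k :=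
  (h.rep_mkAlgHom _).trans (freeRep_F D P i k)

theorem isAction_rep : D.IsAction P h.rep where
  K_ket l hl ε i r := by rw [h.rep_K, ← ketZ_of_mem, cartanOp_ketZ]
  F_ket l hl i k := by
    rw [h.rep_F, ← ketZ_of_mem, addCurrent, linearCombination_ketZ _ hl,
      ← finsum_subtype_eq_finsum_cond]
    exact finsum_congr fun b => by rw [ketZ_of_mem b.2.2.2]
  E_ket l hl i k := by
    rw [h.rep_E, ← ketZ_of_mem, removeCurrent, linearCombination_ketZ _ hl,
      ← finsum_subtype_eq_finsum_cond]
    exact finsum_congr fun b => by rw [ketZ_of_mem b.2.2.2]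
  t_ket l hl := by
    rw [QTor.t, h.rep_mkAlgHom, freeRep_ι]
    rfl

/-! ### Irreducibility and tameness -/

theorem exists_coeffAt_ne {l l' : Finset B} (hl : l ∈ D.S) (hl' : l' ∈ D.S) (hne : l ≠ l') :
    ∃ i r, coeffAt false (D.phi P l i) r ≠ coeffAt false (D.phi P l' i) r := by
  by_contra! hc
  refine hne (h.phi_injective l hl l' hl' (funext fun i => ?_))
  apply (expand false).injective
  ext r
  have := hc i (-r)
  simpa [coeffAt, expandZero_eq] using this

/-- An invariant subspace contains the basis vectors that occur in its elements, since these have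
distinct `ℓ`-weights. -/
theorem single_mem_of_mem {W : Submodule ℂ D.Space}
    (hW : ∀ i r, ∀ v ∈ W, D.cartanOp P false i r v ∈ W) {v : D.Space} (hv : v ∈ W) {l : D.S}
    (hl : v l ≠ 0) : D.ketZ l ∈ W := by
  classical
  induction hn : v.support.card using Nat.strong_induction_on generalizing v with
  | _ n ih =>
    by_cases h1 : ∃ l' : D.S, l' ≠ l ∧ v l' ≠ 0
    · obtain ⟨l', hne, hl'⟩ := h1
      obtain ⟨i, r, hir⟩ := h.exists_coeffAt_ne l.2 l'.2 fun h' => hne (Subtype.ext h').symm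
      -- This combination no longer contains `l'`, but still contains `l`.
      set w := D.cartanOp P false i r v - coeffAt false (D.phi P l' i) r • v with hw
      have hwv : ∀ m : D.S, w m =
          (coeffAt false (D.phi P m i) r - coeffAt false (D.phi P l' i) r) * v m := by
        intro m
        rw [hw, Finsupp.sub_apply, Finsupp.smul_apply, cartanOp_apply, smul_eq_mul, sub_mul]
      refine ih w.support.card ?_ (W.sub_mem (hW i r v hv) (W.smul_mem _ hv)) ?_ rfl
      · rw [← hn]
        apply Finset.card_lt_card
        refine (Finset.ssubset_iff_of_subset ?_).2 ⟨l', by simpa using hl', ?_⟩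
        · intro m hm
          rw [Finsupp.mem_support_iff, hwv] at hm
          exact Finsupp.mem_support_iff.2 (right_ne_zero_of_mul hm)
        · rw [Finsupp.mem_support_iff, hwv, sub_self, zero_mul, ne_eq, not_not]
      · rw [hwv]
        exact mul_ne_zero (sub_ne_zero.2 hir) hl
    · push Not at h1
      have : v = v l • D.ketZ l := by
        rw [← single_eq_ketZ, Finsupp.smul_single, smul_eq_mul, mul_one]
        ext m
        by_cases hm : m = l
        · subst hm; simp
        · rw [h1 m hm, Finsupp.single_eq_of_ne hm]
      rw [this] at hv
      exact (W.smul_mem_iff hl).1 hv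

omit h in
theorem finsum_smul_ketZ_apply {s : Set B} (hs : s.Finite) (c : B → ℂ) (m : B → Finset B)
    (hm : Set.InjOn m s) {b : B} (hb : b ∈ s) (hbS : m b ∈ D.S) :
    (∑ᶠ x ∈ s, c x • D.ketZ (m x)) ⟨m b, hbS⟩ = c b := by
  classical
  rw [finsum_mem_eq_finite_toFinset_sum _ hs, Finsupp.finsetSum_apply,
    Finset.sum_eq_single_of_mem b (by simpa using hb)]
  · rw [ketZ_of_mem hbS, ket]
    simp
  · intro x hx hxb
    have hxs : x ∈ s := by simpa using hx
    by_cases hxS : m x ∈ D.S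
    · rw [ketZ_of_mem hxS, ket, Finsupp.smul_apply, Finsupp.single_eq_of_ne, smul_zero]
      exact fun h' => hxb (hm hxs hb (congrArg Subtype.val h').symm)
    · rw [ketZ_of_notMem hxS]
      simp

/-- The current `F` sends `|λ⟩` to a combination of basis vectors in which `|λ ⊔ b⟩` occurs with a
nonzero coefficient. -/
theorem ketZ_add_mem {W : Submodule ℂ D.Space} (hW : ∀ x, ∀ v ∈ W, h.rep x v ∈ W) {l : Finset B}
    {b : B} (hl : l ∈ D.S) (hb : ¬ D.Added l b) (hS : D.add l b ∈ D.S) (hlW : D.ketZ l ∈ W) :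
    D.ketZ (D.add l b) ∈ W := by
  have h1 := hW (QTor.F P (D.color b) 0) _ hlW
  rw [h.rep_F, addCurrent, linearCombination_ketZ _ hl] at h1
  refine h.single_mem_of_mem (fun i r v hv => h.rep_K false i r ▸ hW _ v hv) h1
    (l := ⟨D.add l b, hS⟩) ?_
  rw [finsum_smul_ketZ_apply (h.wellPosed.finite_CC l hl _) _ _ ?_ (mem_CC.2 ⟨rfl, hb, hS⟩)]
  · exact mul_ne_zero (h.aCoeff_ne_zero hl hb hS) (zpow_ne_zero _ (D.pos_ne_zero P b))
  · intro x hx y hy hxy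
    have h2 : D.Added (D.add l y) x := by rw [← hxy]; exact added_add_self
    exact (added_add.1 h2).resolve_right (mem_CC.1 hx).2.1

/-- The current `E` sends `|λ ⊔ b⟩` to a combination of basis vectors in which `|λ⟩` occurs with a
nonzero coefficient. -/
theorem ketZ_mem_of_add {W : Submodule ℂ D.Space} (hW : ∀ x, ∀ v ∈ W, h.rep x v ∈ W)
    {l : Finset B} {b : B} (hl : l ∈ D.S) (hb : ¬ D.Added l b) (hS : D.add l b ∈ D.S)
    (hlW : D.ketZ (D.add l b) ∈ W) : D.ketZ l ∈ W := by
  have h1 := hW (QTor.E P (D.color b) 0) _ hlW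
  rw [h.rep_E, removeCurrent, linearCombination_ketZ _ hS] at h1
  have e := remove_add hb
  have h3 : D.remove (D.add l b) b ∈ D.S := by rwa [e]
  rw [← e]
  refine h.single_mem_of_mem (fun i r v hv => h.rep_K false i r ▸ hW _ v hv) h1
    (l := ⟨_, h3⟩) ?_
  rw [finsum_smul_ketZ_apply (h.wellPosed.finite_CV _ hS _) _ _ ?_
    (mem_CV.2 ⟨rfl, added_add_self, h3⟩)]
  · exact mul_ne_zero (h.bCoeff_ne_zero hl hb hS) (zpow_ne_zero _ (D.pos_ne_zero P b))
  · intro x hx y hy hxy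
    by_contra hne
    have h2 : D.Added (D.remove (D.add l b) y) x := added_remove.2 ⟨hne, (mem_CV.1 hx).2.1⟩
    rw [← hxy] at h2
    exact not_added_remove h2

/-- Every state can be reduced to the reference state by removing one box of the set at a time. -/
theorem exists_erase_mem {l : Finset B} (hl : l ∈ D.S) (hne : l ≠ ∅) : ∃ x ∈ l, l.erase x ∈ D.S := by
  classical
  -- The last positive box can be removed from the set; if all boxes of the set are negative, the
  -- first one can be.
  by_cases hp : (l.filter fun b => D.positive b).Nonempty
  · obtain ⟨x, hx, hmax⟩ := Finset.exists_max_image _ id hp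
    rw [Finset.mem_filter] at hx
    refine ⟨x, hx.1, (h.mem_S _).2 fun u v huv hu => ?_⟩
    have e : l.erase x = D.remove l x := by rw [remove, if_pos hx.2]
    rw [e, added_remove] at hu ⊢
    refine ⟨?_, (h.mem_S _).1 hl u v huv hu.2⟩
    rintro rfl
    have h1 := h.positive_of_supports huv hx.2
    have h2 : u ∈ l := by
      have := hu.2
      unfold Added at this
      tauto
    exact absurd (hmax u (Finset.mem_filter.2 ⟨h2, h1⟩)) (not_le.2 (h.lt_of_supports huv))
  · have hneg : ∀ b ∈ l, ¬ D.positive b := fun b hb hpb => hp ⟨b, Finset.mem_filter.2 ⟨hb, hpb⟩⟩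
    obtain ⟨x, hx, hmin⟩ := Finset.exists_min_image l id (Finset.nonempty_iff_ne_empty.2 hne)
    refine ⟨x, hx, (h.mem_S _).2 fun u v huv hu => ?_⟩
    have e : l.erase x = D.add l x := by rw [add, if_neg (hneg x hx)]
    rw [e, added_add] at hu ⊢
    rcases hu with rfl | hu
    · right
      right
      exact ⟨fun hv => hneg _ hx (h.positive_of_supports huv hv),
        fun hv => absurd (hmin v hv) (not_le.2 (h.lt_of_supports huv))⟩
    · exact Or.inr ((h.mem_S _).1 hl u v huv hu)

theorem ketZ_mem_iff_erase {W : Submodule ℂ D.Space} (hW : ∀ x, ∀ v ∈ W, h.rep x v ∈ W)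
    {l : Finset B} {x : B} (hl : l ∈ D.S) (hx : x ∈ l) (hS : l.erase x ∈ D.S) :
    D.ketZ l ∈ W ↔ D.ketZ (l.erase x) ∈ W := by
  classical
  by_cases hp : D.positive x
  · have e : l.erase x = D.remove l x := by rw [remove, if_pos hp]
    have h1 : D.Added l x := Or.inl ⟨hp, hx⟩
    have h2 : D.add (D.remove l x) x = l := add_remove h1
    rw [e] at hS ⊢
    have hl' : D.add (D.remove l x) x ∈ D.S := by rwa [h2]
    have h3 := h.ketZ_add_mem hW hS not_added_remove hl'
    have h4 := h.ketZ_mem_of_add hW hS not_added_remove hl'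
    rw [h2] at h3 h4
    exact ⟨h4, h3⟩
  · have e : l.erase x = D.add l x := by rw [add, if_neg hp]
    have h1 : ¬ D.Added l x := by unfold Added; tauto
    rw [e] at hS ⊢
    exact ⟨h.ketZ_add_mem hW hl h1 hS, h.ketZ_mem_of_add hW hl h1 hS⟩

theorem ketZ_mem_iff_empty {W : Submodule ℂ D.Space} (hW : ∀ x, ∀ v ∈ W, h.rep x v ∈ W)
    {l : Finset B} (hl : l ∈ D.S) : D.ketZ l ∈ W ↔ D.ketZ ∅ ∈ W := by
  induction hn : l.card generalizing l with
  | zero => rw [Finset.card_eq_zero.1 hn]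
  | succ n ih =>
    have hne : l ≠ ∅ := by rintro rfl; simp at hn
    obtain ⟨x, hx, hS⟩ := h.exists_erase_mem hl hne
    rw [h.ketZ_mem_iff_erase hW hl hx hS, ih hS (by rw [Finset.card_erase_of_mem hx]; omega)]

theorem isIrreducible_rep : IsIrreducible h.rep := by
  refine ⟨⟨⟨D.ketZ ∅, 0, ?_⟩⟩, fun W hW => ?_⟩
  · rw [ketZ_of_mem D.empty_mem, ket]
    simp
  · by_cases h0 : W = ⊥
    · exact Or.inl h0
    · right
      obtain ⟨v, hv, hv0⟩ := W.exists_mem_ne_zero_of_ne_bot h0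
      obtain ⟨l, hl⟩ := Finsupp.ne_iff.1 hv0
      have h1 : D.ketZ l ∈ W :=
        h.single_mem_of_mem (fun i r v hv => h.rep_K false i r ▸ hW _ v hv) hv hl
      have h2 := (h.ketZ_mem_iff_empty hW l.2).1 h1
      rw [eq_top_iff]
      intro w _
      induction w using Finsupp.induction_linear with
      | zero => exact W.zero_mem
      | add v w hv hw => exact W.add_mem (hv trivial) (hw trivial)
      | single l c =>
        rw [← mul_one c, ← smul_eq_mul, ← Finsupp.smul_single, single_eq_ketZ]
        exact W.smul_mem _ ((h.ketZ_mem_iff_empty hW l.2).2 h2)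

theorem isTame_rep : IsTame h.rep := by
  refine ⟨D.S, Finsupp.basisSingleOne, fun l => D.phi P l, fun l l' hll' =>
    Subtype.ext (h.phi_injective l l.2 l' l'.2 hll'), fun l i => h.balanced_phi l i, fun l => ?_⟩
  rw [Finsupp.coe_basisSingleOne]
  exact h.isAction_rep.K_ket l l.2

/-! ### The level -/

omit h in
theorem lcEnd_boxWeight (b : B) :
    lcEnd true (D.boxWeight P b 0) * lcEnd true (D.boxWeight P b 1) = 1 := by
  have hb := D.pos_ne_zero P b
  have h1 : ∀ i, lcEnd true (affRoot P i (D.pos P b) 0) * lcEnd true (affRoot P i (D.pos P b) 1) =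
      1 := by
    intro i
    rw [lcEnd_affRoot P i hb, lcEnd_affRoot P i hb]
    have h2 := P.q₂_ne_zero
    fin_cases i
    · exact mul_inv_cancel₀ h2
    · exact inv_mul_cancel₀ h2
  have hu : ∀ i j, UnitEnd true (affRoot P i (D.pos P b) j) := fun i j =>
    (balanced_iff.1 (balanced_affRoot P i hb j)).2.1
  unfold boxWeight
  split_ifs
  · rw [(hu _ _).inv.2, (hu _ _).inv.2, ← mul_inv, h1, inv_one]
  · exact h1 _

omit h in
theorem lcEnd_phi (l : Finset B) : lcEnd true (D.phi P l 0) * lcEnd true (D.phi P l 1) =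
    lcEnd true (D.Ψ 0) * lcEnd true (D.Ψ 1) := by
  rw [phi, phi, lcEnd_mul, lcEnd_mul, mul_mul_mul_comm, lcEnd_prod, lcEnd_prod,
    ← Finset.prod_mul_distrib, Finset.prod_congr rfl fun b _ => lcEnd_boxWeight b,
    Finset.prod_const_one, mul_one]

theorem hasLevel_rep : HasLevel h.rep (lcEnd true (D.Ψ 0) * lcEnd true (D.Ψ 1)) := by
  intro v
  rw [map_mul, h.rep_K, h.rep_K]
  ext l
  rw [Module.End.mul_apply, cartanOp_apply, cartanOp_apply, Finsupp.smul_apply, smul_eq_mul,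
    ← mul_assoc, (balanced_iff.1 (h.balanced_phi l 0)).2.1.coeffAt_zero,
    (balanced_iff.1 (h.balanced_phi l 1)).2.1.coeffAt_zero, lcEnd_phi]

end IsRegular

end CombData

end Toroidal

/-! ### The grid of positions -/

namespace Toroidal

namespace QParams

variable {P : QParams}

theorem q_zpow_mul_d_zpow_eq_one (hP : P.Generic) {a b : ℤ} (h : P.q ^ a * P.d ^ b = 1) :
    a = 0 ∧ b = 0 := by
  have h1 := hP a b
  have h2 : Complex.exp (((a : ℚ) : ℂ) * P.logq + ((b : ℚ) : ℂ) * P.logd) = 1 := by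
    rw [Complex.exp_add, ← h]
    simp only [Rat.cast_intCast, Complex.exp_int_mul]
    rfl
  simpa using h1.1 h2

theorem q₁_zpow_mul_q₂_zpow_eq_one (hP : P.Generic) {a b : ℤ} (h : P.q₁ ^ a * P.q₂ ^ b = 1) :
    a = 0 ∧ b = 0 := by
  have h1 : P.q ^ (2 * b - a) * P.d ^ a = 1 := by
    rw [← h, q₁, q₂, mul_zpow, inv_zpow', zpow_sub₀ P.q_ne_zero, zpow_mul, zpow_ofNat,
      zpow_neg]
    ring
  have := q_zpow_mul_d_zpow_eq_one hP h1
  omega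

theorem q₂_ne_one (hP : P.Generic) : P.q₂ ≠ 1 := by
  intro h
  have := q₁_zpow_mul_q₂_zpow_eq_one hP (a := 0) (b := 1) (by simp [h])
  omega

theorem q₂Pow_add (P : QParams) (a b : ℂ) : P.q₂Pow (a + b) = P.q₂Pow a * P.q₂Pow b := by
  rw [q₂Pow, q₂Pow, q₂Pow, ← Complex.exp_add, add_mul]

theorem q₂Pow_ne_zero (P : QParams) (a : ℂ) : P.q₂Pow a ≠ 0 := Complex.exp_ne_zero _

theorem q₂Pow_neg (P : QParams) (a : ℂ) : P.q₂Pow (-a) = (P.q₂Pow a)⁻¹ := by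
  rw [q₂Pow, q₂Pow, neg_mul, Complex.exp_neg]

theorem q₂Pow_intCast (P : QParams) (k : ℤ) : P.q₂Pow k = P.q₂ ^ k := by
  rw [q₂Pow, Complex.exp_int_mul, q₂, q, ← Complex.exp_nat_mul]
  norm_num

theorem q₁Pow_intCast (P : QParams) (k : ℤ) : P.q₁Pow k = P.q₁ ^ k := by
  rw [q₁Pow, Complex.exp_int_mul, q₁, q, d, Complex.exp_add, Complex.exp_neg]

theorem q₃Pow_intCast (P : QParams) (k : ℤ) : P.q₃Pow k = P.q₃ ^ k := by
  rw [q₃Pow, Complex.exp_int_mul, q₃, q, d, sub_eq_add_neg, Complex.exp_add, Complex.exp_neg,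
    Complex.exp_neg]

theorem GenericExponent.neg {a : ℂ} (h : P.GenericExponent a) : P.GenericExponent (-a) := by
  intro k l hkl
  apply h (-k) (-l)
  rw [← neg_neg a, q₂Pow_neg, hkl, mul_inv, zpow_neg, zpow_neg]

theorem GenericExponent.add_intCast {a : ℂ} (h : P.GenericExponent a) (k : ℤ) :
    P.GenericExponent (a + k) := by
  intro n l hnl
  apply h n (l - k)
  rw [q₂Pow_add, q₂Pow_intCast] at hnl
  rw [zpow_sub₀ P.q₂_ne_zero, ← mul_div_assoc, ← hnl, mul_div_cancel_right₀]
  exact zpow_ne_zero _ P.q₂_ne_zero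

/-- The `q₂`-exponents of the base points of the three families. -/
noncomputable def baseExp (μ ν : ℂ) : Fin 3 → ℂ := ![0, -μ, -(μ + ν)]

/-- The `q₁`-exponents of the base points of the three families. -/
def baseShift : Fin 3 → ℤ := ![1, -1, 0]

/-- The points `q₁ ^ (-n) q₂ ^ (-k)`, multiplied by the base point of one of the three families:
`q₃⁻¹` for the bottom, `q₁⁻¹ q₂ ^ (-μ)` for the pedestal and `q₂ ^ (-μ - ν)` for the tower. The
positions of all boxes are such points. -/
noncomputable def gridPt (P : QParams) (μ ν : ℂ) (f : Fin 3) (n k : ℤ) : ℂ :=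
  P.q₁ ^ (baseShift f - n) * P.q₂ ^ ((if f = 0 then 1 else 0) - k) * P.q₂Pow (baseExp μ ν f)

theorem gridPt_ne_zero (P : QParams) (μ ν : ℂ) (f : Fin 3) (n k : ℤ) : P.gridPt μ ν f n k ≠ 0 :=
  mul_ne_zero (mul_ne_zero (zpow_ne_zero _ P.q₁_ne_zero) (zpow_ne_zero _ P.q₂_ne_zero))
    (P.q₂Pow_ne_zero _)

/-- The exponents `μ`, `ν` and `μ + ν` are generic. -/
def GenericPair (P : QParams) (μ ν : ℂ) : Prop :=
  P.GenericExponent μ ∧ P.GenericExponent ν ∧ P.GenericExponent (μ + ν)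

theorem gridPt_injective (hP : P.Generic) {μ ν : ℂ} (hμν : P.GenericPair μ ν) {f f' : Fin 3}
    {n n' k k' : ℤ} (h : P.gridPt μ ν f n k = P.gridPt μ ν f' n' k') :
    f = f' ∧ n = n' ∧ k = k' := by
  have h1 : P.q₂Pow (baseExp μ ν f - baseExp μ ν f') =
      P.q₁ ^ (baseShift f' - n' - (baseShift f - n)) *
        P.q₂ ^ ((if f' = 0 then 1 else 0) - k' - ((if f = 0 then 1 else 0) - k)) := by
    have e1 := zpow_ne_zero (baseShift f - n) P.q₁_ne_zero
    have e2 := zpow_ne_zero ((if f = 0 then 1 else 0) - k) P.q₂_ne_zero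
    have e3 := P.q₂Pow_ne_zero (baseExp μ ν f')
    rw [sub_eq_add_neg, q₂Pow_add, q₂Pow_neg, zpow_sub₀ P.q₁_ne_zero (baseShift f' - n'),
      zpow_sub₀ P.q₂_ne_zero (_ - k')]
    field_simp
    unfold gridPt at h
    linear_combination h
  have hf : f = f' := by
    by_contra hne
    have h2 : P.GenericExponent (baseExp μ ν f - baseExp μ ν f') := by
      obtain ⟨e1, e2, e3⟩ := hμν
      fin_cases f <;> fin_cases f' <;> simp only [baseExp, Fin.reduceFinMk, Fin.isValue,
        Matrix.cons_val] at hne ⊢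
      · exact absurd trivial hne
      · simpa using e1
      · convert e3 using 1; ring
      · convert e1.neg using 1; ring
      · exact absurd trivial hne
      · convert e2 using 1; ring
      · convert e3.neg using 1; ring
      · convert e2.neg using 1; ring
      · exact absurd trivial hne
    exact h2 _ _ h1
  subst hf
  rw [sub_self, show (0 : ℂ) = ((0 : ℤ) : ℂ) by simp, q₂Pow_intCast, zpow_zero] at h1
  have := q₁_zpow_mul_q₂_zpow_eq_one hP h1.symm
  omega

theorem gridPt_inj (hP : P.Generic) {μ ν : ℂ} (hμν : P.GenericPair μ ν) {f f' : Fin 3}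
    {n n' k k' : ℤ} :
    P.gridPt μ ν f n k = P.gridPt μ ν f' n' k' ↔ f = f' ∧ n = n' ∧ k = k' :=
  ⟨gridPt_injective hP hμν, by rintro ⟨rfl, rfl, rfl⟩; rfl⟩

theorem q₂_mul_gridPt (P : QParams) (μ ν : ℂ) (f : Fin 3) (n k : ℤ) :
    P.q₂ * P.gridPt μ ν f n k = P.gridPt μ ν f n (k - 1) := by
  rw [gridPt, gridPt, ← sub_add, zpow_add_one₀ P.q₂_ne_zero]
  ring

theorem q₁_mul_gridPt (P : QParams) (μ ν : ℂ) (f : Fin 3) (n k : ℤ) :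
    P.q₁ * P.gridPt μ ν f n k = P.gridPt μ ν f (n - 1) k := by
  rw [gridPt, gridPt, ← sub_add, zpow_add_one₀ P.q₁_ne_zero]
  ring

theorem q₃_mul_gridPt (P : QParams) (μ ν : ℂ) (f : Fin 3) (n k : ℤ) :
    P.q₃ * P.gridPt μ ν f n k = P.gridPt μ ν f (n + 1) (k + 1) := by
  have h1 : P.gridPt μ ν f n k = P.q₁ * (P.q₂ * P.gridPt μ ν f (n + 1) (k + 1)) := by
    rw [q₂_mul_gridPt, q₁_mul_gridPt, add_sub_cancel_right, add_sub_cancel_right]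
  rw [h1]
  linear_combination P.gridPt μ ν f (n + 1) (k + 1) * P.q₁_mul_q₂_mul_q₃

theorem q₂_inv_mul_gridPt (P : QParams) (μ ν : ℂ) (f : Fin 3) (n k : ℤ) :
    P.q₂⁻¹ * P.gridPt μ ν f n k = P.gridPt μ ν f n (k + 1) := by
  rw [inv_mul_eq_iff_eq_mul₀ P.q₂_ne_zero, q₂_mul_gridPt, add_sub_cancel_right]

theorem q₁_inv_mul_gridPt (P : QParams) (μ ν : ℂ) (f : Fin 3) (n k : ℤ) :
    P.q₁⁻¹ * P.gridPt μ ν f n k = P.gridPt μ ν f (n + 1) k := by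
  rw [inv_mul_eq_iff_eq_mul₀ P.q₁_ne_zero, q₁_mul_gridPt, add_sub_cancel_right]

theorem q₃_inv_mul_gridPt (P : QParams) (μ ν : ℂ) (f : Fin 3) (n k : ℤ) :
    P.q₃⁻¹ * P.gridPt μ ν f n k = P.gridPt μ ν f (n - 1) (k - 1) := by
  rw [inv_mul_eq_iff_eq_mul₀ P.q₃_ne_zero, q₃_mul_gridPt, sub_add_cancel, sub_add_cancel]

end QParams

/-- The color of the points of the grid. -/
def gridColor (f : Fin 3) (n : ℤ) : ZMod 2 := (n : ZMod 2) + if f = 2 then 0 else 1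

theorem gridColor_eq_iff {f : Fin 3} {n n' : ℤ} :
    gridColor f n = gridColor f n' ↔ n % 2 = n' % 2 := by
  rw [gridColor, gridColor, add_left_inj, ZMod.intCast_eq_intCast_iff]
  rfl

theorem exists_gridColor (f : Fin 3) (i : ZMod 2) : ∃ n, i = gridColor f n := by
  refine ⟨((i - if f = 2 then 0 else 1 : ZMod 2).val : ℤ), ?_⟩
  rw [gridColor, Int.cast_natCast, ZMod.natCast_zmod_val, sub_add_cancel]

theorem gC_gridPt_eq_zero_iff {P : QParams} (hP : P.Generic) {μ ν : ℂ} (hμν : P.GenericPair μ ν)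
    {f f' : Fin 3} {n n' k k' : ℤ} :
    gC P (gridColor f n) (gridColor f' n') (P.gridPt μ ν f n k) (P.gridPt μ ν f' n' k') = 0 ↔
      f = f' ∧ ((n = n' ∧ k = k' - 1) ∨ (n = n' - 1 ∧ k = k') ∨ (n = n' + 1 ∧ k = k' + 1)) := by
  unfold gC
  split_ifs with h
  · rw [sub_eq_zero, QParams.q₂_mul_gridPt, QParams.gridPt_inj hP hμν]
    constructor
    · rintro ⟨rfl, rfl, rfl⟩
      simp
    · rintro ⟨rfl, h1⟩
      rw [gridColor_eq_iff] at h
      omega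
  · rw [mul_eq_zero, sub_eq_zero, sub_eq_zero, QParams.q₁_mul_gridPt, QParams.q₃_mul_gridPt,
      QParams.gridPt_inj hP hμν, QParams.gridPt_inj hP hμν, ← and_or_left]
    refine and_congr_right ?_
    rintro rfl
    rw [gridColor_eq_iff] at h
    omega

/-! ### Orders at the points of the grid -/

/-- The alternating sum over the six neighbors of a point of the grid. If `X` is the indicator
function of a set of boxes, this is the order of the product of their weights `A⁻¹`. -/
def hexSum (X : ℤ → ℤ → ℤ) (n k : ℤ) : ℤ :=
  X n (k + 1) - X n (k - 1) + X (n + 1) k + X (n - 1) (k - 1) - X (n - 1) k - X (n + 1) (k + 1)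

theorem ordAt_C_mul_X_sub_C {c : ℂ} (hc : c ≠ 0) (a z : ℂ) :
    ordAt z (RatFunc.C c * RatFunc.X - RatFunc.C a) = if c⁻¹ * a = z then 1 else 0 := by
  rw [C_mul_X_sub_C_eq hc, ordAt_mul z (C_ne_zero hc) (lin_ne_zero _), ordAt_C z hc, zero_add,
    ordAt_lin]

theorem C_mul_X_sub_C_ne_zero' {c : ℂ} (hc : c ≠ 0) (a : ℂ) :
    RatFunc.C c * RatFunc.X - RatFunc.C a ≠ 0 := by
  rw [C_mul_X_sub_C_eq hc]
  exact mul_ne_zero (C_ne_zero hc) (lin_ne_zero _)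

theorem ordAt_affRoot_eq (P : QParams) (i : ZMod 2) (a : ℂ) (j : ZMod 2) (z : ℂ) :
    ordAt z (affRoot P i a j) =
      if i = j then (if P.q₂⁻¹ * a = z then 1 else 0) - (if P.q₂ * a = z then 1 else 0)
      else (if P.q₁⁻¹ * a = z then 1 else 0) + (if P.q₃⁻¹ * a = z then 1 else 0)
        - ((if P.q₁ * a = z then 1 else 0) + (if P.q₃ * a = z then 1 else 0)) := by
  have h1 := P.q₁_ne_zero
  have h2 := P.q₂_ne_zero
  have h3 := P.q₃_ne_zero
  unfold affRoot
  by_cases hij : i = j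
  · rw [if_pos hij, if_pos hij, ordAt_div z (C_mul_X_sub_C_ne_zero' h2 _) (lin_ne_zero _),
      ordAt_C_mul_X_sub_C h2, ordAt_lin]
  · rw [if_neg hij, if_neg hij, ordAt_div z
      (mul_ne_zero (C_mul_X_sub_C_ne_zero' h1 _) (C_mul_X_sub_C_ne_zero' h3 _))
      (mul_ne_zero (lin_ne_zero _) (lin_ne_zero _)),
      ordAt_mul z (C_mul_X_sub_C_ne_zero' h1 _) (C_mul_X_sub_C_ne_zero' h3 _),
      ordAt_mul z (lin_ne_zero _) (lin_ne_zero _), ordAt_C_mul_X_sub_C h1, ordAt_C_mul_X_sub_C h3,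
      ordAt_lin, ordAt_lin]

theorem ordAt_affRoot_gridPt {P : QParams} (hP : P.Generic) {μ ν : ℂ} (hμν : P.GenericPair μ ν)
    (f f' : Fin 3) (n n' k k' : ℤ) (i : ZMod 2) :
    ordAt (P.gridPt μ ν f n k) (affRoot P (gridColor f' n') (P.gridPt μ ν f' n' k') i) =
      if i = gridColor f n then
        -hexSum (fun n k => if f = f' ∧ n = n' ∧ k = k' then 1 else 0) n k else 0 := by
  rw [ordAt_affRoot_eq]
  simp only [QParams.q₂_inv_mul_gridPt, QParams.q₂_mul_gridPt, QParams.q₁_inv_mul_gridPt,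
    QParams.q₁_mul_gridPt, QParams.q₃_inv_mul_gridPt, QParams.q₃_mul_gridPt,
    QParams.gridPt_inj hP hμν, hexSum]
  by_cases hf : f = f'
  · subst hf
    obtain ⟨j, rfl⟩ := exists_gridColor f i
    simp only [gridColor_eq_iff, true_and]
    have e1 : (n' = n ∧ k' + 1 = k) ↔ (n = n' ∧ k - 1 = k') := by omega
    have e2 : (n' = n ∧ k' - 1 = k) ↔ (n = n' ∧ k + 1 = k') := by omega
    have e3 : (n' + 1 = n ∧ k' = k) ↔ (n - 1 = n' ∧ k = k') := by omega
    have e4 : (n' - 1 = n ∧ k' - 1 = k) ↔ (n + 1 = n' ∧ k + 1 = k') := by omega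
    have e5 : (n' - 1 = n ∧ k' = k) ↔ (n + 1 = n' ∧ k = k') := by omega
    have e6 : (n' + 1 = n ∧ k' + 1 = k) ↔ (n - 1 = n' ∧ k - 1 = k') := by omega
    simp only [e1, e2, e3, e4, e5, e6]
    by_cases h1 : n' % 2 = j % 2 <;> by_cases h2 : j % 2 = n % 2
    · have c1 : n + 1 ≠ n' := by omega
      have c2 : n - 1 ≠ n' := by omega
      simp only [h1, h2, if_true, c1, c2, false_and, if_false]
      ring
    · have c1 : n ≠ n' := by omega
      simp [h1, h2, c1]
    · have c1 : n ≠ n' := by omega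
      have c2 : ¬ n' % 2 = n % 2 := by omega
      simp only [h2, c2, if_true, c1, false_and, if_false]
      ring
    · have c1 : n + 1 ≠ n' := by omega
      have c2 : n - 1 ≠ n' := by omega
      simp [h1, h2, c1, c2]
  · simp [hf, Ne.symm hf]

theorem ordAt_affRoot_of_ne {P : QParams} {μ ν : ℂ} {z : ℂ}
    (hz : ∀ f n k, P.gridPt μ ν f n k ≠ z) (f : Fin 3) (n k : ℤ) (i j : ZMod 2) :
    ordAt z (affRoot P i (P.gridPt μ ν f n k) j) = 0 := by
  rw [ordAt_affRoot_eq]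
  simp [QParams.q₂_inv_mul_gridPt, QParams.q₂_mul_gridPt, QParams.q₁_inv_mul_gridPt,
    QParams.q₁_mul_gridPt, QParams.q₃_inv_mul_gridPt, QParams.q₃_mul_gridPt, hz]

end Toroidal

/-! ### Boxes as points of the grid -/

namespace Toroidal

namespace SBox

variable {m : ℕ}

/-- The family of a box: bottom, pedestal or tower. -/
def cls : SBox m → Fin 3
  | low _ _ => 0
  | ped _ _ => 1
  | white _ _ => 2
  | black _ _ => 2

/-- The exponent of `q₁⁻¹` in the position of a box, relative to the base point of its family. -/
def gn : SBox m → ℤ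
  | low i _ => i
  | ped i _ => i
  | white s _ => -2 * (s : ℕ)
  | black s _ => -2 * (s : ℕ) - 1

/-- The exponent of `q₂⁻¹` in the position of a box, relative to the base point of its family. -/
def gk : SBox m → ℤ
  | low _ k => k
  | ped _ k => k
  | white s k => k - (s : ℕ)
  | black s k => k - (s : ℕ)

/-- The points of the grid that are positions of boxes. -/
def Valid (m : ℕ) (f : Fin 3) (n k : ℤ) : Prop :=
  (f ≠ 2 ∧ 0 ≤ n ∧ 0 ≤ k) ∨ (f = 2 ∧ -2 * (m : ℤ) ≤ n ∧ n ≤ 0)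

theorem valid (b : SBox m) : Valid m b.cls b.gn b.gk := by
  rcases b with ⟨i, k⟩ | ⟨i, k⟩ | ⟨s, k⟩ | ⟨s, k⟩
  · exact Or.inl ⟨by simp [cls], by simp [gn], by simp [gk]⟩
  · exact Or.inl ⟨by simp [cls], by simp [gn], by simp [gk]⟩
  · exact Or.inr ⟨rfl, by simp only [gn]; omega, by simp only [gn]; omega⟩
  · exact Or.inr ⟨rfl, by simp only [gn]; omega, by simp only [gn]; omega⟩

theorem exists_of_valid {f : Fin 3} {n k : ℤ} (h : Valid m f n k) :
    ∃ b : SBox m, b.cls = f ∧ b.gn = n ∧ b.gk = k := by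
  rcases h with ⟨hf, hn, hk⟩ | ⟨rfl, h1, h2⟩
  · have h3 : f = 0 ∨ f = 1 := by
      fin_cases f <;> simp_all
    rcases h3 with rfl | rfl
    · exact ⟨low n.toNat k.toNat, rfl, Int.toNat_of_nonneg hn, Int.toNat_of_nonneg hk⟩
    · exact ⟨ped n.toNat k.toNat, rfl, Int.toNat_of_nonneg hn, Int.toNat_of_nonneg hk⟩
  · rcases Int.emod_two_eq_zero_or_one n with h3 | h3
    · refine ⟨white ⟨(-n / 2).toNat, by omega⟩ (k + (-n / 2).toNat), rfl, ?_, ?_⟩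
      · simp only [gn]; omega
      · simp only [gk]; omega
    · refine ⟨black ⟨((-n - 1) / 2).toNat, by omega⟩ (k + ((-n - 1) / 2).toNat), rfl, ?_, ?_⟩
      · simp only [gn]; omega
      · simp only [gk]; omega

theorem coord_injective {b c : SBox m} (h1 : b.cls = c.cls) (h2 : b.gn = c.gn) (h3 : b.gk = c.gk) :
    b = c := by
  rcases b with ⟨i, k⟩ | ⟨i, k⟩ | ⟨s, k⟩ | ⟨s, k⟩ <;>
    rcases c with ⟨i', k'⟩ | ⟨i', k'⟩ | ⟨s', k'⟩ | ⟨s', k'⟩ <;>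
    simp only [cls, gn, gk] at h1 h2 h3 <;>
    first
    | (exfalso; revert h1; decide)
    | (exfalso; omega)
    | (congr 1 <;> omega)

theorem color_eq (b : SBox m) : b.color = gridColor b.cls b.gn := by
  have h2 : (2 : ZMod 2) = 0 := rfl
  rcases b with ⟨i, k⟩ | ⟨i, k⟩ | ⟨s, k⟩ | ⟨s, k⟩
  · simp [color, gridColor, cls, gn]
  · simp [color, gridColor, cls, gn]
  · simp [color, gridColor, cls, gn, h2]
  · simp [color, gridColor, cls, gn, h2]

theorem positive_iff (b : SBox m) : b.positive ↔ b.cls ≠ 2 ∨ 0 ≤ b.gk - (b.gn + 1) / 2 := by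
  rcases b with ⟨i, k⟩ | ⟨i, k⟩ | ⟨s, k⟩ | ⟨s, k⟩
  · simp [positive, cls]
  · simp [positive, cls]
  · simp only [positive, cls, gn, gk]; omega
  · simp only [positive, cls, gn, gk]; omega

/-- The order of boxes in the same family. -/
theorem lt_iff {u v : SBox m} (h : u.cls = v.cls) : u < v ↔
    (u.cls ≠ 2 ∧ (u.gk < v.gk ∨ u.gk = v.gk ∧ u.gn < v.gn)) ∨
    (u.cls = 2 ∧ (u.gk - (u.gn + 1) / 2 < v.gk - (v.gn + 1) / 2 ∨
      u.gk - (u.gn + 1) / 2 = v.gk - (v.gn + 1) / 2 ∧ ((v.gn + 1) / 2 < (u.gn + 1) / 2 ∨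
        (v.gn + 1) / 2 = (u.gn + 1) / 2 ∧ u.gn < v.gn))) := by
  have hkey : u < v ↔ key u < key v := Iff.rfl
  rw [hkey]
  rcases u with ⟨i, k⟩ | ⟨i, k⟩ | ⟨s, k⟩ | ⟨s, k⟩ <;>
    rcases v with ⟨i', k'⟩ | ⟨i', k'⟩ | ⟨s', k'⟩ | ⟨s', k'⟩ <;>
    simp only [cls] at h <;>
    first
    | (exfalso; revert h; decide)
    | (simp only [key, cls, gn, gk, Prod.Lex.toLex_lt_toLex]; simp; try omega)

/-- The box `v` has to be added before the box `u`: it is the preceding box of the same column, or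
it belongs to a neighboring column that has to be at least as high as the column of `u`. In the
tower, the columns of color `1`, for which `gn` is odd, bound their two neighbors of color `0`. -/
def Supports (v u : SBox m) : Prop :=
  v.cls = u.cls ∧ ((v.gn = u.gn ∧ v.gk = u.gk - 1) ∨
    ((u.cls ≠ 2 ∨ u.gn % 2 = 0) ∧ v.gn = u.gn - 1 ∧ v.gk = u.gk) ∨
    (u.cls = 2 ∧ u.gn % 2 = 0 ∧ v.gn = u.gn + 1 ∧ v.gk = u.gk + 1))

theorem Supports.lt {v u : SBox m} (h : Supports v u) : v < u := by
  obtain ⟨h1, h2⟩ := h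
  rw [lt_iff h1, h1]
  by_cases hc : u.cls = 2
  · simp only [hc, ne_eq, not_true_eq_false, false_or, true_and] at h2 ⊢
    omega
  · simp only [hc, ne_eq, not_false_eq_true, true_or, true_and, false_and, or_false] at h2 ⊢
    omega

theorem Supports.positive {v u : SBox m} (h : Supports v u) (hv : v.positive) : u.positive := by
  obtain ⟨h1, h2⟩ := h
  rw [positive_iff] at hv ⊢
  rw [h1] at hv
  by_cases hc : u.cls = 2
  · simp only [hc, ne_eq, not_true_eq_false, false_or, true_and] at h2 hv ⊢
    omega
  · exact Or.inl hc

theorem pos_eq (P : QParams) (μ ν : ℂ) (b : SBox m) :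
    (slanted P m μ ν).pos P b = P.gridPt μ ν b.cls b.gn b.gk := by
  have h1 := P.q₁_ne_zero
  have h2 := P.q₂_ne_zero
  have h3 := P.q₃_ne_zero
  have h123 := P.q₁_mul_q₂_mul_q₃
  have hq3 : P.q₃⁻¹ = P.q₁ * P.q₂ := by
    rw [← mul_one P.q₃⁻¹, ← h123, mul_comm (P.q₁ * P.q₂), inv_mul_cancel_left₀ h3]
  have hq3' : P.q₃ = P.q₁⁻¹ * P.q₂⁻¹ := by rw [← mul_inv, ← hq3, inv_inv]
  rcases b with ⟨i, k⟩ | ⟨i, k⟩ | ⟨s, k⟩ | ⟨s, k⟩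
  · have e1 : P.q₁Pow (-(i : ℂ)) = P.q₁ ^ (-(i : ℤ)) := by rw [← P.q₁Pow_intCast]; push_cast; rfl
    have e2 : P.q₂Pow (-(k : ℂ)) = P.q₂ ^ (-(k : ℤ)) := by rw [← P.q₂Pow_intCast]; push_cast; rfl
    have e3 : P.q₃Pow (-1) = P.q₃⁻¹ := by
      rw [← zpow_neg_one, ← P.q₃Pow_intCast]; push_cast; rfl
    have e4 : P.q₂Pow 0 = 1 := by simp [QParams.q₂Pow]
    simp only [CombData.pos, slanted, x, y, z, e1, e2, e3, QParams.gridPt, cls, gn, gk,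
      QParams.baseShift, QParams.baseExp, Matrix.cons_val_zero, e4, if_true]
    rw [hq3, sub_eq_add_neg, sub_eq_add_neg, zpow_add₀ h1, zpow_add₀ h2]
    simp only [zpow_one]
    ring
  · have e1 : P.q₁Pow (-((i : ℂ) + 1)) = P.q₁ ^ (-1 - (i : ℤ)) := by
      rw [← P.q₁Pow_intCast]; congr 1; push_cast; ring
    have e2 : P.q₂Pow (-((k : ℂ) + μ)) = P.q₂ ^ (0 - (k : ℤ)) * P.q₂Pow (-μ) := by
      rw [← P.q₂Pow_intCast, ← P.q₂Pow_add]; congr 1; push_cast; ring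
    have e3 : P.q₃Pow (-0) = 1 := by simp [QParams.q₃Pow]
    simp only [CombData.pos, slanted, x, y, z, e1, e2, e3, QParams.gridPt, cls, gn, gk,
      QParams.baseShift, QParams.baseExp, Matrix.cons_val_one, Matrix.cons_val_zero, one_ne_zero,
      if_false, mul_one]
    ring
  · have e1 : P.q₁Pow (- -((s : ℕ) : ℂ)) = P.q₁ ^ ((s : ℕ) : ℤ) := by
      rw [← P.q₁Pow_intCast]; congr 1; push_cast; ring
    have e2 : P.q₂Pow (-(μ + ν + (k : ℂ))) = P.q₂ ^ (-k) * P.q₂Pow (-(μ + ν)) := by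
      rw [← P.q₂Pow_intCast, ← P.q₂Pow_add]; congr 1; push_cast; ring
    have e3 : P.q₃Pow (-((s : ℕ) : ℂ)) = P.q₁ ^ ((s : ℕ) : ℤ) * P.q₂ ^ ((s : ℕ) : ℤ) := by
      rw [← mul_zpow, ← hq3, inv_zpow', ← P.q₃Pow_intCast]; push_cast; rfl
    have e4 : (0 : ℤ) - -2 * ((s : ℕ) : ℤ) = (s : ℕ) + (s : ℕ) := by ring
    have e5 : (0 : ℤ) - (k - ((s : ℕ) : ℤ)) = -k + (s : ℕ) := by ring
    have e6 : (2 : Fin 3) ≠ 0 := by decide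
    simp only [CombData.pos, slanted, x, y, z, e1, e2, e3, QParams.gridPt, cls, gn, gk,
      QParams.baseShift, QParams.baseExp, Matrix.cons_val, e6, if_false, e4, e5, zpow_add₀ h1,
      zpow_add₀ h2]
    ring
  · have e1 : P.q₁Pow (-(-1 - ((s : ℕ) : ℂ))) = P.q₁ ^ ((s : ℕ) : ℤ) * P.q₁ := by
      rw [← zpow_add_one₀ h1, ← P.q₁Pow_intCast]; congr 1; push_cast; ring
    have e2 : P.q₂Pow (-(μ + ν + (k : ℂ))) = P.q₂ ^ (-k) * P.q₂Pow (-(μ + ν)) := by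
      rw [← P.q₂Pow_intCast, ← P.q₂Pow_add]; congr 1; push_cast; ring
    have e3 : P.q₃Pow (-((s : ℕ) : ℂ)) = P.q₁ ^ ((s : ℕ) : ℤ) * P.q₂ ^ ((s : ℕ) : ℤ) := by
      rw [← mul_zpow, ← hq3, inv_zpow', ← P.q₃Pow_intCast]; push_cast; rfl
    have e4 : (0 : ℤ) - (-2 * ((s : ℕ) : ℤ) - 1) = (s : ℕ) + (s : ℕ) + 1 := by ring
    have e5 : (0 : ℤ) - (k - ((s : ℕ) : ℤ)) = -k + (s : ℕ) := by ring
    have e6 : (2 : Fin 3) ≠ 0 := by decide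
    simp only [CombData.pos, slanted, x, y, z, e1, e2, e3, QParams.gridPt, cls, gn, gk,
      QParams.baseShift, QParams.baseExp, Matrix.cons_val, e6, if_false, e4, e5, zpow_add₀ h1,
      zpow_add₀ h2, zpow_one]
    ring

end SBox

end Toroidal

/-! ### The states of the slanted modules -/

namespace Toroidal

/-- A lower set of integers that differs from the negative integers in finitely many places is an
interval bounded above. -/
theorem Int.exists_threshold {Q : ℤ → Prop} (hQ : ∀ k, Q (k + 1) → Q k) {T : Finset ℤ}
    (hT : ∀ k ∉ T, Q k ↔ k < 0) : ∃ a, ∀ k, Q k ↔ k < a := by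
  obtain ⟨N, hN⟩ : ∃ N : ℤ, ∀ k ∈ T, N ≤ k ∧ k ≤ -N := by
    have h1 : ∀ T : Finset ℤ, ∃ N : ℤ, ∀ k ∈ T, N ≤ k ∧ k ≤ -N := by
      intro T
      induction T using Finset.induction_on with
      | empty => exact ⟨0, by simp⟩
      | insert a T _ ih =>
        obtain ⟨N, hN⟩ := ih
        refine ⟨min N (min a (-a)), fun k hk => ?_⟩
        rcases Finset.mem_insert.1 hk with rfl | hk
        · omega
        · have := hN k hk
          omega
    exact h1 T
  have hlow : Q (min N 0 - 1) := (hT _ fun h => by have := hN _ h; omega).2 (by omega)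
  obtain ⟨u, hu, hmax⟩ := Int.exists_greatest_of_bdd (P := Q) ⟨max (-N) 0, fun k hk => by
    by_contra! h
    have h1 : k ∉ T := fun h' => by have := hN _ h'; omega
    have := (hT k h1).1 hk
    omega⟩ ⟨_, hlow⟩
  refine ⟨u + 1, fun k => ⟨fun hk => Int.lt_add_one_of_le (hmax k hk), fun hk => ?_⟩⟩
  have hk' : k ≤ u := Int.le_of_lt_add_one hk
  induction k, hk' using Int.leInductionDown with
  | base => exact hu
  | pred k hk' ih => exact hQ _ (by rw [sub_add_cancel]; exact ih (by omega))

namespace SBox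

variable {m : ℕ}

/-- The added boxes of a set of boxes, see `CombData.Added`. -/
def Present (l : Finset (SBox m)) (b : SBox m) : Prop :=
  (b.positive ∧ b ∈ l) ∨ (¬ b.positive ∧ b ∉ l)

/-- With every added box the boxes supporting it are added as well. -/
def Closed (l : Finset (SBox m)) : Prop := ∀ u v, Supports v u → Present l u → Present l v

theorem present_low {l : Finset (SBox m)} {i k : ℕ} : Present l (low i k) ↔ low i k ∈ l := by
  simp [Present, positive]

theorem present_ped {l : Finset (SBox m)} {i k : ℕ} : Present l (ped i k) ↔ ped i k ∈ l := by
  simp [Present, positive]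

theorem present_boxes_low (σ : SState m) (i k : ℕ) :
    Present σ.boxes (low i k) ↔ (i, k) ∈ σ.low := by
  rw [present_low]
  simp [SState.boxes]

theorem present_boxes_ped (σ : SState m) (i k : ℕ) :
    Present σ.boxes (ped i k) ↔ (i, k) ∈ σ.ped := by
  rw [present_ped]
  simp [SState.boxes]

theorem present_boxes_white (σ : SState m) (s : Fin (m + 1)) (k : ℤ) :
    Present σ.boxes (white s k) ↔ k < σ.a s := by
  have : white s k ∈ σ.boxes ↔ min 0 (σ.a s) ≤ k ∧ k < max 0 (σ.a s) := by
    simp [SState.boxes, SState.column]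
  rw [Present, this]
  simp only [positive]
  omega

theorem present_boxes_black (σ : SState m) (s : Fin m) (k : ℤ) :
    Present σ.boxes (black s k) ↔ k < σ.b s := by
  have : black s k ∈ σ.boxes ↔ min 0 (σ.b s) ≤ k ∧ k < max 0 (σ.b s) := by
    simp [SState.boxes, SState.column]
  rw [Present, this]
  simp only [positive]
  omega

theorem closed_boxes (σ : SState m) : Closed σ.boxes := by
  rintro (⟨i, k⟩ | ⟨i, k⟩ | ⟨s, k⟩ | ⟨s, k⟩) (⟨i', k'⟩ | ⟨i', k'⟩ | ⟨s', k'⟩ | ⟨s', k'⟩) ⟨h1, h2⟩ <;>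
    simp only [cls] at h1 <;>
    first
    | (exfalso; revert h1; decide)
    | skip
  · simp only [present_boxes_low, cls, gn, gk] at h2 ⊢
    refine fun h => σ.low.isLowerSet (show (i', k') ≤ (i, k) from ⟨?_, ?_⟩) h <;> simp at h2 ⊢ <;> omega
  · simp only [present_boxes_ped, cls, gn, gk] at h2 ⊢
    refine fun h => σ.ped.isLowerSet (show (i', k') ≤ (i, k) from ⟨?_, ?_⟩) h <;> simp at h2 ⊢ <;> omega
  · simp only [present_boxes_white, cls, gn, gk] at h2 ⊢
    have h3 : s' = s := by ext; omega
    subst h3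
    omega
  · simp only [present_boxes_white, present_boxes_black, cls, gn, gk] at h2 ⊢
    have h3 : s = s'.castSucc ∨ s = s'.succ := by
      simp only [Fin.ext_iff, Fin.val_castSucc, Fin.val_succ]
      omega
    rcases h3 with rfl | rfl
    · have := σ.le_left s'
      simp only [Fin.val_castSucc] at h2
      omega
    · have := σ.le_right s'
      simp only [Fin.val_succ] at h2
      omega
  · simp only [cls, gn, gk] at h2
    omega
  · simp only [present_boxes_black, cls, gn, gk] at h2 ⊢
    have h3 : s' = s := by ext; omega
    subst h3
    omega

theorem isLowerSet_of_step {Q : ℕ × ℕ → Prop} (h1 : ∀ i k, Q (i + 1, k) → Q (i, k))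
    (h2 : ∀ i k, Q (i, k + 1) → Q (i, k)) : IsLowerSet {c | Q c} := by
  rintro ⟨i, k⟩ ⟨i', k'⟩ ⟨hi, hk⟩ h
  simp only at hi hk
  simp only [Set.mem_ofPred_eq] at h ⊢
  have h3 : Q (i', k) := by
    clear h2 hk
    induction i, hi using Nat.le_induction with
    | base => exact h
    | succ n _ ih => exact ih (h1 _ _ h)
  clear h h1 hi
  induction k, hk using Nat.le_induction with
  | base => exact h3
  | succ n _ ih => exact ih (h2 _ _ h3)

/-- A set of boxes closed under supports is a state: the boxes of the bottom and of the pedestal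
form Young diagrams, and every column of the tower is filled up to some level. -/
theorem exists_boxes_eq {l : Finset (SBox m)} (hl : Closed l) : ∃ σ : SState m, σ.boxes = l := by
  have hlow : Function.Injective fun c : ℕ × ℕ => (low c.1 c.2 : SBox m) := by
    rintro ⟨i, k⟩ ⟨i', k'⟩ h
    simpa using h
  have hped : Function.Injective fun c : ℕ × ℕ => (ped c.1 c.2 : SBox m) := by
    rintro ⟨i, k⟩ ⟨i', k'⟩ h
    simpa using h
  have hwhite : ∀ s : Fin (m + 1), Function.Injective (white s : ℤ → SBox m) := by
    intro s k k' h
    simpa using h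
  have hblack : ∀ s : Fin m, Function.Injective (black s : ℤ → SBox m) := by
    intro s k k' h
    simpa using h
  have ha : ∀ s : Fin (m + 1), ∃ a : ℤ, ∀ k, Present l (white s k) ↔ k < a := by
    intro s
    refine Int.exists_threshold (fun k => hl (white s (k + 1)) (white s k) ⟨rfl, ?_⟩)
      (T := l.preimage _ (hwhite s).injOn) fun k hk => ?_
    · exact Or.inl ⟨rfl, by simp only [gk]; omega⟩
    · rw [Finset.mem_preimage] at hk
      simp [Present, hk, positive]
  have hb : ∀ s : Fin m, ∃ a : ℤ, ∀ k, Present l (black s k) ↔ k < a := by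
    intro s
    refine Int.exists_threshold (fun k => hl (black s (k + 1)) (black s k) ⟨rfl, ?_⟩)
      (T := l.preimage _ (hblack s).injOn) fun k hk => ?_
    · exact Or.inl ⟨rfl, by simp only [gk]; omega⟩
    · rw [Finset.mem_preimage] at hk
      simp [Present, hk, positive]
  choose a ha using ha
  choose b hb using hb
  have hle : ∀ {x y : ℤ}, (∀ k, k < x → k < y) → x ≤ y := by
    intro x y h
    have := h (x - 1) (by omega)
    omega
  let σ : SState m :=
    { low := ⟨l.preimage _ hlow.injOn, by
        have := isLowerSet_of_step (Q := fun c => low c.1 c.2 ∈ l)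
          (fun i k => by
            rw [← present_low, ← present_low]
            exact hl _ _ ⟨rfl, by simp [cls, gn, gk]⟩)
          (fun i k => by
            rw [← present_low, ← present_low]
            exact hl _ _ ⟨rfl, by simp [cls, gn, gk]⟩)
        rwa [Finset.coe_preimage]⟩
      ped := ⟨l.preimage _ hped.injOn, by
        have := isLowerSet_of_step (Q := fun c => ped c.1 c.2 ∈ l)
          (fun i k => by
            rw [← present_ped, ← present_ped]
            exact hl _ _ ⟨rfl, by simp [cls, gn, gk]⟩)
          (fun i k => by
            rw [← present_ped, ← present_ped]
            exact hl _ _ ⟨rfl, by simp [cls, gn, gk]⟩)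
        rwa [Finset.coe_preimage]⟩
      a := a
      b := b
      le_left := fun s => hle fun k hk => (hb s k).1 (hl (white s.castSucc k) (black s k)
        ⟨rfl, by simp [cls, gn, gk]⟩ ((ha _ k).2 hk))
      le_right := fun s => hle fun k hk => (hb s k).1 (hl (white s.succ k) (black s k)
        ⟨rfl, by simp only [cls, gn, gk, Fin.val_succ, true_and]; omega⟩ ((ha _ k).2 hk)) }
  refine ⟨σ, ?_⟩
  have key : ∀ c, Present σ.boxes c ↔ Present l c := by
    rintro (⟨i, k⟩ | ⟨i, k⟩ | ⟨s, k⟩ | ⟨s, k⟩)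
    · rw [present_boxes_low, present_low, ← YoungDiagram.mem_cells]
      simp [σ]
    · rw [present_boxes_ped, present_ped, ← YoungDiagram.mem_cells]
      simp [σ]
    · rw [present_boxes_white, ha]
    · rw [present_boxes_black, hb]
  ext c
  have := key c
  unfold Present at this
  tauto

theorem mem_range_boxes_iff {l : Finset (SBox m)} :
    l ∈ Set.range (SState.boxes (m := m)) ↔ Closed l := by
  constructor
  · rintro ⟨σ, rfl⟩
    exact closed_boxes σ
  · exact exists_boxes_eq

/-! ### The indicator function of a state on the grid -/

open Classical in
/-- The indicator function of the added boxes on the grid of a family. For the bottom and the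
pedestal it is extended by `1` to the points with a negative coordinate, for the tower by `0` to the
points outside of the strip of boxes. -/
noncomputable def filled (l : Finset (SBox m)) (f : Fin 3) (n k : ℤ) : ℤ :=
  if (∃ b : SBox m, (b.cls = f ∧ b.gn = n ∧ b.gk = k) ∧ Present l b) ∨ (f ≠ 2 ∧ (n < 0 ∨ k < 0))
    then 1 else 0

theorem filled_nonneg (l : Finset (SBox m)) (f : Fin 3) (n k : ℤ) : 0 ≤ filled l f n k := by
  unfold filled; split_ifs <;> norm_num

theorem filled_le_one (l : Finset (SBox m)) (f : Fin 3) (n k : ℤ) : filled l f n k ≤ 1 := by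
  unfold filled; split_ifs <;> norm_num

open Classical in
theorem filled_coord (l : Finset (SBox m)) {b : SBox m} {f : Fin 3} {n k : ℤ}
    (hb : b.cls = f ∧ b.gn = n ∧ b.gk = k) : filled l f n k = if Present l b then 1 else 0 := by
  obtain ⟨rfl, rfl, rfl⟩ := hb
  unfold filled
  refine if_congr ⟨?_, fun h => Or.inl ⟨b, ⟨rfl, rfl, rfl⟩, h⟩⟩ rfl rfl
  rintro (⟨c, ⟨h1, h2, h3⟩, h4⟩ | h)
  · rwa [← coord_injective h1 h2 h3]
  · have h1 := b.valid
    unfold Valid at h1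
    rcases h1 with h1 | h1
    · omega
    · exact absurd h1.1 h.1

theorem present_iff (l : Finset (SBox m)) (b : SBox m) :
    Present l b ↔ filled l b.cls b.gn b.gk = 1 := by
  rw [filled_coord l ⟨rfl, rfl, rfl⟩]
  split_ifs with h <;> simp [h]

theorem not_present_iff (l : Finset (SBox m)) (b : SBox m) :
    ¬ Present l b ↔ filled l b.cls b.gn b.gk = 0 := by
  rw [filled_coord l ⟨rfl, rfl, rfl⟩]
  split_ifs with h <;> simp [h]

theorem filled_of_not_valid (l : Finset (SBox m)) {f : Fin 3} {n k : ℤ} (h : ¬ Valid m f n k) :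
    filled l f n k = if f = 2 then 0 else 1 := by
  have h0 : ¬ ∃ b : SBox m, (b.cls = f ∧ b.gn = n ∧ b.gk = k) ∧ Present l b := by
    rintro ⟨b, ⟨rfl, rfl, rfl⟩, -⟩
    exact h b.valid
  unfold filled
  unfold Valid at h
  by_cases hf : f = 2
  · rw [if_neg (by rintro (h | h); exacts [h0 h, h.1 hf]), if_pos hf]
  · rw [if_pos (Or.inr ⟨hf, by simp only [hf, not_false_eq_true, ne_eq, true_and] at h; omega⟩),
      if_neg hf]

open Classical in
theorem filled_empty (f : Fin 3) (n k : ℤ) : filled (∅ : Finset (SBox m)) f n k =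
    if (f ≠ 2 ∧ (n < 0 ∨ k < 0)) ∨ (f = 2 ∧ -2 * (m : ℤ) ≤ n ∧ n ≤ 0 ∧ k - (n + 1) / 2 < 0)
      then 1 else 0 := by
  by_cases hv : Valid m f n k
  · obtain ⟨b, h1, h2, h3⟩ := exists_of_valid hv
    rw [filled_coord _ ⟨h1, h2, h3⟩]
    refine if_congr ?_ rfl rfl
    simp only [Present, positive_iff, h1, h2, h3, Finset.notMem_empty, and_false, false_or,
      not_false_eq_true, and_true, not_or, not_not, not_le]
    unfold Valid at hv
    rcases hv with ⟨hf, hv⟩ | ⟨hf, hv⟩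
    · simp [hf]
      omega
    · simp [hf]
      omega
  · rw [filled_of_not_valid _ hv]
    unfold Valid at hv
    by_cases hf : f = 2
    · simp only [hf, ne_eq, not_true_eq_false, false_and, true_and, false_or, if_true] at hv ⊢
      rw [if_neg (by omega)]
    · simp only [hf, ne_eq, not_false_eq_true, false_and, true_and, or_false, if_false] at hv ⊢
      rw [if_pos (by omega)]

theorem filled_le_filled {l : Finset (SBox m)} (hl : Closed l) {f : Fin 3} {n k n' k' : ℤ}
    (h : (n' = n ∧ k' = k - 1) ∨ ((f ≠ 2 ∨ n % 2 = 0) ∧ n' = n - 1 ∧ k' = k) ∨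
      (f = 2 ∧ n % 2 = 0 ∧ n' = n + 1 ∧ k' = k + 1)) (hv : f = 2 → -2 * (m : ℤ) ≤ n' ∧ n' ≤ 0) :
    filled l f n k ≤ filled l f n' k' := by
  by_cases h1 : Valid m f n k
  · by_cases h2 : Valid m f n' k'
    · obtain ⟨b, hb⟩ := exists_of_valid h1
      obtain ⟨c, hc⟩ := exists_of_valid h2
      rw [filled_coord l hb, filled_coord l hc]
      by_cases h3 : Present l b
      · have h4 : Present l c := by
          refine hl b c ⟨hc.1.trans hb.1.symm, ?_⟩ h3
          rw [hb.1, hb.2.1, hb.2.2, hc.2.1, hc.2.2]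
          exact h
        rw [if_pos h3, if_pos h4]
      · rw [if_neg h3]
        split_ifs <;> norm_num
    · by_cases hf : f = 2
      · exact absurd (Or.inr ⟨hf, hv hf⟩) h2
      · rw [filled_of_not_valid l h2, if_neg hf]
        exact filled_le_one _ _ _ _
  · by_cases hf : f = 2
    · rw [filled_of_not_valid l h1, if_pos hf]
      exact filled_nonneg _ _ _ _
    · have h2 : ¬ Valid m f n' k' := by
        simp only [hf, ne_eq, not_false_eq_true, true_or, true_and, false_and, or_false] at h
        unfold Valid at h1 ⊢
        simp only [hf, ne_eq, not_false_eq_true, true_and, false_and, or_false] at h1 ⊢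
        omega
      rw [filled_of_not_valid l h1, filled_of_not_valid l h2]

theorem filled_tower_eq_zero (l : Finset (SBox m)) {n k : ℤ} (h : n < -2 * (m : ℤ) ∨ 0 < n) :
    filled l 2 n k = 0 := by
  rw [filled_of_not_valid l, if_pos rfl]
  unfold Valid
  simp only [ne_eq, not_true_eq_false, false_and, true_and, false_or]
  omega

end SBox

end Toroidal

/-! ### The reference weight -/

namespace Toroidal

theorem lcEnd_true_lin {a : ℂ} (ha : a ≠ 0) : lcEnd true (lin a) = 1 := by
  have h : expand true (lin a) = HahnSeries.single (expSign true (-1)) 1 - HahnSeries.single 0 a := by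
    rw [lin, map_sub, expand_X, expand_C]
  rw [lcEnd, HahnSeries.leadingCoeff_eq, order_expand_lin true ha, h]
  simp [expSign]

theorem lcEnd_true_div {f g : RatFunc ℂ} (h : lcEnd true g = 1) :
    lcEnd true (f / g) = lcEnd true f := by
  have hg : g ≠ 0 := by
    rintro rfl
    simp [lcEnd] at h
  conv_rhs => rw [← div_mul_cancel₀ f hg, lcEnd_mul, h, mul_one]

theorem balanced_C_mul_lin_div {x a b : ℂ} (hx : x ≠ 0) (ha : a ≠ 0) (hb : b ≠ 0)
    (h : x * x * a = b) : Balanced (RatFunc.C x * (lin a / lin b)) := by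
  rw [balanced_iff]
  refine ⟨(unitEnd_C hx).1.mul (unitEnd_lin_div ha hb).1,
    (unitEnd_C hx).1.mul (unitEnd_lin_div ha hb).1, ?_⟩
  rw [lcEnd_mul, lcEnd_mul, (unitEnd_C hx).2, (unitEnd_C hx).2, (unitEnd_lin_div ha hb).2,
    (unitEnd_lin_div ha hb).2]
  simp only [Bool.false_eq_true, if_false, if_true]
  field_simp
  linear_combination h

theorem balanced_C_mul_lin_div_mul_lin_div {x a b a' b' : ℂ} (hx : x ≠ 0) (ha : a ≠ 0) (hb : b ≠ 0)
    (ha' : a' ≠ 0) (hb' : b' ≠ 0) (h : x * x * (a * a') = b * b') :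
    Balanced (RatFunc.C x * (lin a / lin b) * (lin a' / lin b')) := by
  rw [balanced_iff]
  refine ⟨((unitEnd_C hx).1.mul (unitEnd_lin_div ha hb).1).mul (unitEnd_lin_div ha' hb').1,
    ((unitEnd_C hx).1.mul (unitEnd_lin_div ha hb).1).mul (unitEnd_lin_div ha' hb').1, ?_⟩
  simp only [lcEnd_mul, (unitEnd_C hx).2, (unitEnd_lin_div ha hb).2, (unitEnd_lin_div ha' hb').2]
  simp only [Bool.false_eq_true, if_false, if_true]
  field_simp
  linear_combination h

namespace QParams

variable (P : QParams)

theorem q₃_eq : P.q₃ = P.q₁⁻¹ * P.q₂⁻¹ := by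
  rw [← mul_inv]
  exact eq_inv_of_mul_eq_one_right P.q₁_mul_q₂_mul_q₃

theorem qPow_mul_self (a : ℂ) : P.qPow a * P.qPow a = P.q₂Pow a := by
  rw [qPow, q₂Pow, ← Complex.exp_add]
  congr 1
  ring

theorem qPow_ne_zero (a : ℂ) : P.qPow a ≠ 0 := Complex.exp_ne_zero _

/-! ### The zeros and poles of the reference weight as points of the grid -/

variable (μ ν : ℂ)

theorem psiZero_root_low : P.q₃ ^ (-2 : ℤ) = P.gridPt μ ν 0 (-1) (-1) := by
  have e4 : P.q₂Pow 0 = 1 := by simp [q₂Pow]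
  simp only [gridPt, baseShift, baseExp, Matrix.cons_val_zero, e4, if_true, q₃_eq, mul_zpow,
    inv_zpow', mul_one]
  norm_num

theorem psiZero_root_ped : P.q₁⁻¹ * P.q₃⁻¹ * P.q₂Pow (-μ) = P.gridPt μ ν 1 (-1) (-1) := by
  simp only [gridPt, baseShift, baseExp, Matrix.cons_val_zero, Matrix.cons_val_one, q₃_eq, mul_inv,
    inv_inv, one_ne_zero, if_false]
  rw [inv_mul_cancel_left₀ P.q₁_ne_zero]
  norm_num

theorem psiZero_root_tower (i : ℕ) : P.q₂Pow (-μ - ν) * P.q₁ ^ i * P.q₃ ^ (-(i : ℤ)) =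
    P.gridPt μ ν 2 (-2 * i) (-i) := by
  have e6 : (2 : Fin 3) ≠ 0 := by decide
  have e7 : -(μ + ν) = -μ - ν := by ring
  have e8 : -(-2 * (i : ℤ)) = i + i := by ring
  simp only [gridPt, baseShift, baseExp, Matrix.cons_val, e6, if_false, q₃_eq, mul_zpow, inv_zpow',
    neg_neg, zero_sub, e7]
  rw [e8, zpow_add₀ P.q₁_ne_zero, zpow_natCast, zpow_natCast]
  ring

theorem psiZero_pole_tower (i : ℕ) : P.q₂Pow (-μ - ν + 1) * P.q₁ ^ i * P.q₃ ^ (-(i : ℤ)) =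
    P.gridPt μ ν 2 (-2 * i) (-i - 1) := by
  rw [← q₂_mul_gridPt, ← psiZero_root_tower, q₂Pow_add]
  have := P.q₂Pow_intCast 1
  rw [Int.cast_one, zpow_one] at this
  rw [this]
  ring

theorem psiOne_root_tower (i : ℕ) :
    P.q₁ ^ ((i : ℤ) - 1) * P.q₃ ^ (-(i : ℤ)) * P.q₂Pow (-μ - ν) =
      P.gridPt μ ν 2 (1 - 2 * i) (-i) := by
  rw [show (1 - 2 * (i : ℤ)) = -2 * i + 1 by ring, ← q₁_inv_mul_gridPt, ← psiZero_root_tower,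
    zpow_sub₀ P.q₁_ne_zero, zpow_natCast, zpow_one]
  ring

theorem psiOne_pole_low : P.q₃⁻¹ = P.gridPt μ ν 0 0 0 := by
  have e4 : P.q₂Pow 0 = 1 := by simp [q₂Pow]
  simp only [gridPt, baseShift, baseExp, Matrix.cons_val_zero, e4, if_true, q₃_eq, mul_inv, inv_inv]
  norm_num

theorem psiOne_pole_ped : P.q₁⁻¹ * P.q₂Pow (-μ) = P.gridPt μ ν 1 0 0 := by
  simp only [gridPt, baseShift, baseExp, Matrix.cons_val_zero, Matrix.cons_val_one, one_ne_zero,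
    if_false]
  norm_num

theorem psiOne_pole_tower (i : ℕ) : P.q₁ ^ (i + 1) * P.q₃ ^ (-(i : ℤ)) * P.q₂Pow (-μ - ν) =
    P.gridPt μ ν 2 (-2 * i - 1) (-i) := by
  rw [← q₁_mul_gridPt, ← psiZero_root_tower]
  ring

end QParams

theorem slantedPsi_zero_eq (P : QParams) (m : ℕ) (μ ν : ℂ) : slantedPsi P m μ ν 0 =
    RatFunc.C (P.qPow (-μ - 2 * ν) * P.q₃ ^ (-(m : ℤ) + 1)) *
      (lin (P.gridPt μ ν 0 (-1) (-1)) * lin (P.gridPt μ ν 1 (-1) (-1)) *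
        ∏ i ∈ Finset.Icc 1 (m - 1), lin (P.gridPt μ ν 2 (-2 * (i : ℕ)) (-(i : ℕ)))) /
      ∏ i ∈ Finset.range (m + 1), lin (P.gridPt μ ν 2 (-2 * (i : ℕ)) (-(i : ℕ) - 1)) := by
  rw [slantedPsi, if_pos rfl, ← P.psiZero_root_low, ← P.psiZero_root_ped μ ν]
  simp only [P.psiZero_root_tower μ ν, P.psiZero_pole_tower μ ν]

theorem slantedPsi_one_eq (P : QParams) (m : ℕ) (μ ν : ℂ) : slantedPsi P m μ ν 1 =
    RatFunc.C (P.qPow (μ + 2 * ν) * P.q₃ ^ m) *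
      (∏ i ∈ Finset.range (m + 2), lin (P.gridPt μ ν 2 (1 - 2 * (i : ℕ)) (-(i : ℕ)))) /
      (lin (P.gridPt μ ν 0 0 0) * lin (P.gridPt μ ν 1 0 0) *
        ∏ i ∈ Finset.range m, lin (P.gridPt μ ν 2 (-2 * (i : ℕ) - 1) (-(i : ℕ)))) := by
  rw [slantedPsi, if_neg (by decide), ← P.psiOne_pole_low, ← P.psiOne_pole_ped μ ν]
  simp only [P.psiOne_root_tower μ ν, P.psiOne_pole_tower μ ν]

theorem balanced_slantedPsi_zero (P : QParams) (m : ℕ) (μ ν : ℂ) :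
    Balanced (slantedPsi P (m + 1) μ ν 0) := by
  rw [slantedPsi_zero_eq]
  have h3 := P.q₃_ne_zero
  induction m with
  | zero =>
    have h := balanced_C_mul_lin_div_mul_lin_div (x := P.qPow (-μ - 2 * ν))
      (a := P.gridPt μ ν 0 (-1) (-1)) (a' := P.gridPt μ ν 1 (-1) (-1))
      (b := P.gridPt μ ν 2 0 (-1)) (b' := P.gridPt μ ν 2 (-2) (-2)) (P.qPow_ne_zero _)
      (P.gridPt_ne_zero _ _ _ _ _) (P.gridPt_ne_zero _ _ _ _ _) (P.gridPt_ne_zero _ _ _ _ _)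
      (P.gridPt_ne_zero _ _ _ _ _) (by
        have e1 : P.q₂Pow (-μ - 2 * ν) * P.q₂Pow (-μ) = P.q₂Pow (-(μ + ν)) * P.q₂Pow (-(μ + ν)) := by
          rw [← P.q₂Pow_add, ← P.q₂Pow_add]
          congr 1
          ring
        have e6 : (2 : Fin 3) ≠ 0 := by decide
        have e4 : P.q₂Pow 0 = 1 := by simp [QParams.q₂Pow]
        rw [P.qPow_mul_self]
        simp only [QParams.gridPt, QParams.baseShift, QParams.baseExp, Matrix.cons_val, e6, if_false,
          if_true, e4, Matrix.cons_val_zero, Matrix.cons_val_one, one_ne_zero]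
        norm_num [-neg_add_rev]
        linear_combination P.q₁ ^ 2 * P.q₂ ^ 3 * e1)
    convert h using 1
    simp [Finset.prod_range_succ]
    ring
  | succ m ih =>
    have h := ih.mul (balanced_C_mul_lin_div (x := P.q₃⁻¹)
      (a := P.gridPt μ ν 2 (-2 * ((m + 1 : ℕ) : ℤ)) (-((m + 1 : ℕ) : ℤ)))
      (b := P.gridPt μ ν 2 (-2 * ((m + 1 + 1 : ℕ) : ℤ)) (-((m + 1 + 1 : ℕ) : ℤ) - 1)) (inv_ne_zero h3)
      (P.gridPt_ne_zero _ _ _ _ _) (P.gridPt_ne_zero _ _ _ _ _) (by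
        rw [mul_assoc, P.q₃_inv_mul_gridPt, P.q₃_inv_mul_gridPt]
        congr 1))
    convert h using 1
    rw [Finset.prod_range_succ _ (m + 1 + 1), add_tsub_cancel_right, add_tsub_cancel_right,
      Finset.prod_Icc_succ_top (by omega)]
    have e : P.q₃ ^ (-((m + 1 + 1 : ℕ) : ℤ) + 1) = P.q₃ ^ (-((m + 1 : ℕ) : ℤ) + 1) * P.q₃⁻¹ := by
      rw [← zpow_sub_one₀ h3]
      congr 1
      push_cast
      ring
    rw [e]
    simp only [map_mul]
    ring

theorem balanced_slantedPsi_one (P : QParams) (m : ℕ) (μ ν : ℂ) :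
    Balanced (slantedPsi P m μ ν 1) := by
  rw [slantedPsi_one_eq]
  have h3 := P.q₃_ne_zero
  induction m with
  | zero =>
    have h := balanced_C_mul_lin_div_mul_lin_div (x := P.qPow (μ + 2 * ν))
      (b := P.gridPt μ ν 0 0 0) (b' := P.gridPt μ ν 1 0 0)
      (a := P.gridPt μ ν 2 1 0) (a' := P.gridPt μ ν 2 (-1) (-1)) (P.qPow_ne_zero _)
      (P.gridPt_ne_zero _ _ _ _ _) (P.gridPt_ne_zero _ _ _ _ _) (P.gridPt_ne_zero _ _ _ _ _)
      (P.gridPt_ne_zero _ _ _ _ _) (by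
        have e1 : P.q₂Pow (μ + 2 * ν) * (P.q₂Pow (-(μ + ν)) * P.q₂Pow (-(μ + ν))) = P.q₂Pow (-μ) := by
          rw [← P.q₂Pow_add, ← P.q₂Pow_add]
          congr 1
          ring
        have e6 : (2 : Fin 3) ≠ 0 := by decide
        have e4 : P.q₂Pow 0 = 1 := by simp [QParams.q₂Pow]
        have h1 := P.q₁_ne_zero
        rw [P.qPow_mul_self]
        simp only [QParams.gridPt, QParams.baseShift, QParams.baseExp, Matrix.cons_val, e6, if_false,
          if_true, e4, Matrix.cons_val_zero, Matrix.cons_val_one, one_ne_zero]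
        norm_num [-neg_add_rev]
        field_simp
        linear_combination P.q₂ * e1)
    convert h using 1
    simp [Finset.prod_range_succ]
    ring
  | succ m ih =>
    have h := ih.mul (balanced_C_mul_lin_div (x := P.q₃)
      (a := P.gridPt μ ν 2 (1 - 2 * ((m + 2 : ℕ) : ℤ)) (-((m + 2 : ℕ) : ℤ)))
      (b := P.gridPt μ ν 2 (-2 * (m : ℤ) - 1) (-(m : ℤ))) h3
      (P.gridPt_ne_zero _ _ _ _ _) (P.gridPt_ne_zero _ _ _ _ _) (by
        rw [mul_assoc, P.q₃_mul_gridPt, P.q₃_mul_gridPt]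
        congr 1 <;> push_cast <;> ring))
    convert h using 1
    rw [Finset.prod_range_succ _ (m + 2), Finset.prod_range_succ _ m, pow_succ]
    simp only [map_mul]
    ring

theorem lcEnd_slantedPsi_zero (P : QParams) (m : ℕ) (μ ν : ℂ) :
    lcEnd true (slantedPsi P m μ ν 0) = P.qPow (-μ - 2 * ν) * P.q₃ ^ (-(m : ℤ) + 1) := by
  have hl : ∀ f n k, lcEnd true (lin (P.gridPt μ ν f n k)) = 1 := fun f n k =>
    lcEnd_true_lin (P.gridPt_ne_zero _ _ _ _ _)
  rw [slantedPsi_zero_eq, lcEnd_true_div (by simp [lcEnd_prod, hl])]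
  simp only [lcEnd_mul, lcEnd_prod, hl, Finset.prod_const_one, mul_one,
    (unitEnd_C (mul_ne_zero (P.qPow_ne_zero _) (zpow_ne_zero _ P.q₃_ne_zero))).2]

theorem lcEnd_slantedPsi_one (P : QParams) (m : ℕ) (μ ν : ℂ) :
    lcEnd true (slantedPsi P m μ ν 1) = P.qPow (μ + 2 * ν) * P.q₃ ^ m := by
  have hl : ∀ f n k, lcEnd true (lin (P.gridPt μ ν f n k)) = 1 := fun f n k =>
    lcEnd_true_lin (P.gridPt_ne_zero _ _ _ _ _)
  rw [slantedPsi_one_eq, lcEnd_true_div (by simp [lcEnd_mul, lcEnd_prod, hl])]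
  simp only [lcEnd_mul, lcEnd_prod, hl, Finset.prod_const_one, mul_one,
    (unitEnd_C (mul_ne_zero (P.qPow_ne_zero _) (pow_ne_zero _ P.q₃_ne_zero))).2]

theorem lcEnd_slantedPsi_mul (P : QParams) (m : ℕ) (μ ν : ℂ) :
    lcEnd true (slantedPsi P m μ ν 0) * lcEnd true (slantedPsi P m μ ν 1) = P.q₃ := by
  rw [lcEnd_slantedPsi_zero, lcEnd_slantedPsi_one]
  have e1 : P.qPow (-μ - 2 * ν) * P.qPow (μ + 2 * ν) = 1 := by
    rw [QParams.qPow, QParams.qPow, ← Complex.exp_add, ← Complex.exp_zero]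
    congr 1
    ring
  have e2 : P.q₃ ^ (-(m : ℤ) + 1) * P.q₃ ^ m = P.q₃ := by
    rw [← zpow_natCast, ← zpow_add₀ P.q₃_ne_zero, show -(m : ℤ) + 1 + m = 1 by ring, zpow_one]
  linear_combination P.q₃ ^ (-(m : ℤ) + 1) * P.q₃ ^ m * e1 + e2

end Toroidal

/-! ### The orders of the weights of states -/

namespace Toroidal

theorem sum_ite_eq_ite {s : Finset ℕ} {p : ℕ → Prop} [DecidablePred p] {Q : Prop} [Decidable Q]
    (j : ℕ) (h : ∀ i, (i ∈ s ∧ p i) ↔ (i = j ∧ Q)) :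
    (∑ i ∈ s, if p i then (1 : ℤ) else 0) = if Q then 1 else 0 := by
  rw [Finset.sum_ite, Finset.sum_const_zero, add_zero, Finset.sum_const, nsmul_eq_mul, mul_one]
  split_ifs with hQ
  · have : s.filter p = {j} := by
      ext i
      simp [Finset.mem_filter, h, hQ]
    rw [this]
    rfl
  · have : s.filter p = ∅ := by
      ext i
      simp [Finset.mem_filter, h, hQ]
    rw [this]
    rfl

theorem ordAt_slantedPsi_zero (P : QParams) (m : ℕ) (μ ν z : ℂ) :
    ordAt z (slantedPsi P m μ ν 0) =
      (if P.gridPt μ ν 0 (-1) (-1) = z then 1 else 0)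
      + (if P.gridPt μ ν 1 (-1) (-1) = z then 1 else 0)
      + (∑ i ∈ Finset.Icc 1 (m - 1), if P.gridPt μ ν 2 (-2 * (i : ℕ)) (-(i : ℕ)) = z then 1 else 0)
      - ∑ i ∈ Finset.range (m + 1), if P.gridPt μ ν 2 (-2 * (i : ℕ)) (-(i : ℕ) - 1) = z then 1 else 0 := by
  have hc : P.qPow (-μ - 2 * ν) * P.q₃ ^ (-(m : ℤ) + 1) ≠ 0 :=
    mul_ne_zero (P.qPow_ne_zero _) (zpow_ne_zero _ P.q₃_ne_zero)
  have hl := lin_ne_zero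
  have hprod : ∀ (s : Finset ℕ) (g : ℕ → ℂ), ∏ i ∈ s, lin (g i) ≠ 0 := fun s g =>
    Finset.prod_ne_zero_iff.2 fun i _ => hl _
  rw [slantedPsi_zero_eq, ordAt_div z (mul_ne_zero (C_ne_zero hc) (mul_ne_zero (mul_ne_zero (hl _)
    (hl _)) (hprod _ _))) (hprod _ _), ordAt_mul z (C_ne_zero hc) (mul_ne_zero (mul_ne_zero (hl _)
    (hl _)) (hprod _ _)), ordAt_mul z (mul_ne_zero (hl _) (hl _)) (hprod _ _),
    ordAt_mul z (hl _) (hl _), ordAt_prod z _ _ fun _ _ => hl _, ordAt_prod z _ _ fun _ _ => hl _,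
    ordAt_C z hc]
  simp only [ordAt_lin, zero_add]

theorem ordAt_slantedPsi_one (P : QParams) (m : ℕ) (μ ν z : ℂ) :
    ordAt z (slantedPsi P m μ ν 1) =
      (∑ i ∈ Finset.range (m + 2), if P.gridPt μ ν 2 (1 - 2 * (i : ℕ)) (-(i : ℕ)) = z then 1 else 0)
      - ((if P.gridPt μ ν 0 0 0 = z then 1 else 0) + (if P.gridPt μ ν 1 0 0 = z then 1 else 0)
      + ∑ i ∈ Finset.range m, if P.gridPt μ ν 2 (-2 * (i : ℕ) - 1) (-(i : ℕ)) = z then 1 else 0) := by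
  have hc : P.qPow (μ + 2 * ν) * P.q₃ ^ m ≠ 0 :=
    mul_ne_zero (P.qPow_ne_zero _) (pow_ne_zero _ P.q₃_ne_zero)
  have hl := lin_ne_zero
  have hprod : ∀ (s : Finset ℕ) (g : ℕ → ℂ), ∏ i ∈ s, lin (g i) ≠ 0 := fun s g =>
    Finset.prod_ne_zero_iff.2 fun i _ => hl _
  rw [slantedPsi_one_eq, ordAt_div z (mul_ne_zero (C_ne_zero hc) (hprod _ _))
    (mul_ne_zero (mul_ne_zero (hl _) (hl _)) (hprod _ _)), ordAt_mul z (C_ne_zero hc) (hprod _ _),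
    ordAt_mul z (mul_ne_zero (hl _) (hl _)) (hprod _ _), ordAt_mul z (hl _) (hl _),
    ordAt_prod z _ _ fun _ _ => hl _, ordAt_prod z _ _ fun _ _ => hl _, ordAt_C z hc]
  simp only [ordAt_lin, zero_add]

/-- The case of the tower and of color `0` in `ordAt_slantedPsi_gridPt`. The left-hand side counts
the zeros and poles of `Ψ⁰`, the right-hand side is the alternating sum of the indicator function of
the negative boxes. -/
theorem tower_indicator_even (m : ℕ) (hm : 1 ≤ m) (t k : ℤ) :
    ((if (2 * t = 2 * k ∧ k ≤ -1 ∧ -k ≤ ↑m - 1) then 1 else 0) -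
      if (2 * t = 2 * k + 2 ∧ k ≤ -1 ∧ -k - 1 ≤ (m : ℤ)) then 1 else 0) =
    ((((if -2 * (m : ℤ) ≤ 2 * t ∧ 2 * t ≤ 0 ∧ k + 1 - t < 0 then 1 else 0) -
    (if -2 * (m : ℤ) ≤ 2 * t ∧ 2 * t ≤ 0 ∧ k - 1 - t < 0 then 1 else 0) +
    (if -2 * (m : ℤ) ≤ 2 * t + 1 ∧ 2 * t + 1 ≤ 0 ∧ k - (t + 1) < 0 then 1 else 0)) +
    (if -2 * (m : ℤ) ≤ 2 * t - 1 ∧ 2 * t - 1 ≤ 0 ∧ k - 1 - t < 0 then 1 else 0) -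
    (if -2 * (m : ℤ) ≤ 2 * t - 1 ∧ 2 * t - 1 ≤ 0 ∧ k - t < 0 then 1 else 0)) -
    (if -2 * (m : ℤ) ≤ 2 * t + 1 ∧ 2 * t + 1 ≤ 0 ∧ k + 1 - (t + 1) < 0 then 1 else 0) : ℤ) := by
  rcases lt_trichotomy k t with h | rfl | h
  · by_cases h' : k = t - 1
    · subst h'
      omega
    · omega
  · omega
  · omega

/-- The case of the tower and of color `1` in `ordAt_slantedPsi_gridPt`. -/
theorem tower_indicator_odd (m : ℕ) (hm : 1 ≤ m) (t k : ℤ) :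
    ((if (2 * t + 1 = 1 + 2 * k ∧ k ≤ 0 ∧ -k ≤ ↑m + 1) then 1 else 0) -
      if (2 * t + 1 = 2 * k - 1 ∧ k ≤ 0 ∧ -k ≤ (m : ℤ) - 1) then 1 else 0) =
    ((((if -2 * (m : ℤ) ≤ 2 * t + 1 ∧ 2 * t + 1 ≤ 0 ∧ k + 1 - (t + 1) < 0 then 1 else 0) -
    (if -2 * (m : ℤ) ≤ 2 * t + 1 ∧ 2 * t + 1 ≤ 0 ∧ k - 1 - (t + 1) < 0 then 1 else 0) +
    (if -2 * (m : ℤ) ≤ 2 * t + 1 + 1 ∧ 2 * t + 1 + 1 ≤ 0 ∧ k - (t + 1) < 0 then 1 else 0)) +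
    (if -2 * (m : ℤ) ≤ 2 * t + 1 - 1 ∧ 2 * t + 1 - 1 ≤ 0 ∧ k - 1 - t < 0 then 1 else 0) -
    (if -2 * (m : ℤ) ≤ 2 * t + 1 - 1 ∧ 2 * t + 1 - 1 ≤ 0 ∧ k - t < 0 then 1 else 0)) -
    (if -2 * (m : ℤ) ≤ 2 * t + 1 + 1 ∧ 2 * t + 1 + 1 ≤ 0 ∧ k + 1 - (t + 1) < 0
      then 1 else 0) : ℤ) := by
  rcases lt_trichotomy k t with h | rfl | h
  · omega
  · omega
  · by_cases h' : k = t + 1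
    · subst h'
      omega
    · omega

theorem zmod_two_eq_zero_or_one (i : ZMod 2) : i = 0 ∨ i = 1 := by
  fin_cases i
  · exact Or.inl rfl
  · exact Or.inr rfl

theorem zero_eq_gridColor_iff (f : Fin 3) (n : ℤ) :
    0 = gridColor f n ↔ (f ≠ 2 ∧ n % 2 = 1) ∨ (f = 2 ∧ n % 2 = 0) := by
  have h0 : gridColor f (if f = 2 then 0 else 1) = 0 := by
    rw [gridColor]
    split_ifs
    · rfl
    · rfl
  rw [← h0, gridColor_eq_iff]
  split_ifs with hf <;> simp only [hf, ne_eq, not_true_eq_false, not_false_eq_true, true_and,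
    false_and, false_or, or_false] <;> omega

theorem one_eq_gridColor_iff (f : Fin 3) (n : ℤ) :
    1 = gridColor f n ↔ (f ≠ 2 ∧ n % 2 = 0) ∨ (f = 2 ∧ n % 2 = 1) := by
  have h0 : gridColor f (if f = 2 then 1 else 0) = 1 := by
    rw [gridColor]
    split_ifs
    · rfl
    · rfl
  rw [← h0, gridColor_eq_iff]
  split_ifs with hf <;> simp only [hf, ne_eq, not_true_eq_false, not_false_eq_true, true_and,
    false_and, false_or, or_false] <;> omega

variable {P : QParams} {m : ℕ} {μ ν : ℂ}

/-- The order of the reference weight is that of the weight `A⁻¹` of all the boxes added to the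
reference state, if these are taken to include the boundary layers of the bottom and the
pedestal. -/
theorem ordAt_slantedPsi_gridPt (hP : P.Generic) (hμν : P.GenericPair μ ν) (hm : 1 ≤ m)
    (f : Fin 3) (n k : ℤ) (i : ZMod 2) :
    ordAt (P.gridPt μ ν f n k) (slantedPsi P m μ ν i) =
      if i = gridColor f n then hexSum (SBox.filled (∅ : Finset (SBox m)) f) n k else 0 := by
  have hf : f = 0 ∨ f = 1 ∨ f = 2 := by
    fin_cases f <;> simp
  have e1 : (0 : Fin 3) ≠ 1 := by decide
  have e2 : (0 : Fin 3) ≠ 2 := by decide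
  have e3 : (1 : Fin 3) ≠ 2 := by decide
  rcases zmod_two_eq_zero_or_one i with rfl | rfl
  · rw [ordAt_slantedPsi_zero]
    simp only [QParams.gridPt_inj hP hμν, zero_eq_gridColor_iff, hexSum, SBox.filled_empty]
    rcases hf with rfl | rfl | rfl
    · simp [e2, e1.symm, e2.symm]
      grind
    · simp [e1, e3, e3.symm]
      grind
    · rw [sum_ite_eq_ite (-k).toNat (Q := n % 2 = 0 ∧ n = 2 * k ∧ k ≤ -1 ∧ -k ≤ m - 1)
        (fun i => by simp only [Finset.mem_Icc, true_and]; omega),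
        sum_ite_eq_ite (-k - 1).toNat (Q := n % 2 = 0 ∧ n = 2 * k + 2 ∧ k ≤ -1 ∧ -k - 1 ≤ m)
        (fun i => by simp only [Finset.mem_range, true_and]; omega)]
      simp only [e2, e3, ne_eq, not_true_eq_false, false_and, true_and, false_or, if_false]
      by_cases h2 : n % 2 = 0
      · obtain ⟨t, rfl⟩ : ∃ t, n = 2 * t := ⟨n / 2, by omega⟩
        have d1 : (2 * t + 1) / 2 = t := by omega
        have d2 : (2 * t + 1 + 1) / 2 = t + 1 := by omega
        have d3 : (2 * t - 1 + 1) / 2 = t := by omega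
        simp only [d1, d2, d3, h2, true_and, if_true, zero_add]
        exact tower_indicator_even m hm t k
      · simp [h2]
  · rw [ordAt_slantedPsi_one]
    simp only [QParams.gridPt_inj hP hμν, one_eq_gridColor_iff, hexSum, SBox.filled_empty]
    rcases hf with rfl | rfl | rfl
    · simp [e2, e1.symm, e2.symm]
      grind
    · simp [e1, e3, e3.symm]
      grind
    · rw [sum_ite_eq_ite (-k).toNat (Q := n = 1 + 2 * k ∧ k ≤ 0 ∧ -k ≤ m + 1)
        (fun i => by simp only [Finset.mem_range, true_and]; omega),
        sum_ite_eq_ite (-k).toNat (Q := n = 2 * k - 1 ∧ k ≤ 0 ∧ -k ≤ m - 1)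
        (fun i => by simp only [Finset.mem_range, true_and]; omega)]
      simp only [e2, e3, ne_eq, not_true_eq_false, false_and, true_and, false_or, if_false]
      by_cases h2 : n % 2 = 1
      · obtain ⟨t, rfl⟩ : ∃ t, n = 2 * t + 1 := ⟨n / 2, by omega⟩
        have d1 : (2 * t + 1 + 1) / 2 = t + 1 := by omega
        have d2 : (2 * t + 1 + 1 + 1) / 2 = t + 1 := by omega
        have d3 : (2 * t + 1 - 1 + 1) / 2 = t := by omega
        simp only [d1, d2, d3, h2, if_true, zero_add]
        exact tower_indicator_odd m hm t k
      · simp [show n ≠ 1 + 2 * k by omega, show n ≠ 2 * k - 1 by omega, h2]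

theorem ordAt_slantedPsi_of_ne {z : ℂ} (hz : ∀ f n k, P.gridPt μ ν f n k ≠ z) (i : ZMod 2) :
    ordAt z (slantedPsi P m μ ν i) = 0 := by
  rcases zmod_two_eq_zero_or_one i with rfl | rfl
  · rw [ordAt_slantedPsi_zero]
    simp [hz]
  · rw [ordAt_slantedPsi_one]
    simp [hz]

namespace SBox

/-- Adding a positive box raises the indicator function by one, putting a negative box into the
set lowers it by one. -/
theorem filled_sub_filled_empty (l : Finset (SBox m)) (f : Fin 3) (n k : ℤ)
    [DecidablePred (SBox.positive (m := m))] :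
    filled l f n k - filled (∅ : Finset (SBox m)) f n k = ∑ b ∈ l, (if b.positive then 1 else -1) *
      (if f = b.cls ∧ n = b.gn ∧ k = b.gk then 1 else 0) := by
  classical
  by_cases hv : Valid m f n k
  · obtain ⟨c, hc⟩ := exists_of_valid hv
    have h1 : ∀ b : SBox m, (f = b.cls ∧ n = b.gn ∧ k = b.gk) ↔ c = b := by
      obtain ⟨rfl, rfl, rfl⟩ := hc
      exact fun b => ⟨fun h => coord_injective h.1 h.2.1 h.2.2, by rintro rfl; simp⟩
    simp only [filled_coord _ hc, h1, mul_ite, mul_one, mul_zero, Finset.sum_ite_eq, Present,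
      Finset.notMem_empty]
    by_cases hp : c.positive <;> by_cases hl : c ∈ l <;> simp [hp, hl]
  · rw [filled_of_not_valid l hv, filled_of_not_valid ∅ hv, sub_self, Finset.sum_eq_zero]
    intro b _
    have : ¬ (f = b.cls ∧ n = b.gn ∧ k = b.gk) := by
      rintro ⟨rfl, rfl, rfl⟩
      exact hv b.valid
    rw [if_neg this, mul_zero]

end SBox

theorem hexSum_congr {X Y : ℤ → ℤ → ℤ} (h : ∀ n k, X n k = Y n k) (n k : ℤ) :
    hexSum X n k = hexSum Y n k := by
  have : X = Y := by
    funext n k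
    exact h n k
  rw [this]

theorem hexSum_add_sum_mul {ι : Type*} (s : Finset ι) (X : ℤ → ℤ → ℤ) (c : ι → ℤ)
    (Y : ι → ℤ → ℤ → ℤ) (n k : ℤ) :
    hexSum (fun n k => X n k + ∑ b ∈ s, c b * Y b n k) n k =
      hexSum X n k + ∑ b ∈ s, c b * hexSum (Y b) n k := by
  simp only [hexSum, mul_add, mul_sub, Finset.sum_add_distrib, Finset.sum_sub_distrib]
  ring

theorem ordAt_boxWeight (D : CombData (SBox m)) (z : ℂ) (b : SBox m) (i : ZMod 2)
    [DecidablePred D.positive] :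
    ordAt z (D.boxWeight P b i) =
      -((if D.positive b then 1 else -1) * ordAt z (affRoot P (D.color b) (D.pos P b) i)) := by
  rw [CombData.boxWeight]
  split_ifs
  · rw [ordAt_inv, one_mul]
  · ring

theorem balanced_slantedPsi (hm : 1 ≤ m) (i : ZMod 2) : Balanced (slantedPsi P m μ ν i) := by
  obtain ⟨m, rfl⟩ := Nat.exists_eq_add_of_le' hm
  rcases zmod_two_eq_zero_or_one i with rfl | rfl
  · exact balanced_slantedPsi_zero P m μ ν
  · exact balanced_slantedPsi_one P (m + 1) μ ν

/-- The order of the weight of a state is that of the weight `A⁻¹` of all added boxes. -/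
theorem ordAt_phi_gridPt (hP : P.Generic) (hμν : P.GenericPair μ ν) (hm : 1 ≤ m)
    (l : Finset (SBox m)) (f : Fin 3) (n k : ℤ) (i : ZMod 2) :
    ordAt (P.gridPt μ ν f n k) ((slanted P m μ ν).phi P l i) =
      if i = gridColor f n then hexSum (SBox.filled l f) n k else 0 := by
  classical
  have hΨ : (slanted P m μ ν).Ψ i ≠ 0 := (balanced_slantedPsi hm i).ne_zero
  have hsum : ∀ n k, SBox.filled l f n k = SBox.filled (∅ : Finset (SBox m)) f n k +
      ∑ b ∈ l, (if b.positive then 1 else -1) *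
        (if f = b.cls ∧ n = b.gn ∧ k = b.gk then 1 else 0) := by
    intro n k
    rw [← SBox.filled_sub_filled_empty]
    ring
  have hw : ∀ b : SBox m, ordAt (P.gridPt μ ν f n k) ((slanted P m μ ν).boxWeight P b i) =
      if i = gridColor f n then (if b.positive then 1 else -1) *
        hexSum (fun n k => if f = b.cls ∧ n = b.gn ∧ k = b.gk then 1 else 0) n k else 0 := by
    intro b
    rw [ordAt_boxWeight, SBox.pos_eq]
    change -(_ * ordAt _ (affRoot P b.color _ _)) = _
    rw [SBox.color_eq, ordAt_affRoot_gridPt hP hμν]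
    split_ifs <;> simp_all [slanted]
  rw [CombData.phi, ordAt_mul _ hΨ (Finset.prod_ne_zero_iff.2 fun b _ =>
    CombData.boxWeight_ne_zero _ _ _ _), ordAt_prod _ _ _ fun b _ =>
    CombData.boxWeight_ne_zero _ _ _ _, Finset.sum_congr rfl fun b _ => hw b]
  change ordAt _ (slantedPsi P m μ ν i) + _ = _
  rw [ordAt_slantedPsi_gridPt hP hμν hm]
  split_ifs with h
  · rw [hexSum_congr hsum, hexSum_add_sum_mul]
  · simp

theorem ordAt_phi_of_ne (hm : 1 ≤ m) {z : ℂ} (hz : ∀ f n k, P.gridPt μ ν f n k ≠ z)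
    (l : Finset (SBox m)) (i : ZMod 2) : ordAt z ((slanted P m μ ν).phi P l i) = 0 := by
  classical
  have hΨ : (slanted P m μ ν).Ψ i ≠ 0 := (balanced_slantedPsi hm i).ne_zero
  rw [CombData.phi, ordAt_mul _ hΨ (Finset.prod_ne_zero_iff.2 fun b _ =>
    CombData.boxWeight_ne_zero _ _ _ _), ordAt_prod _ _ _ fun b _ =>
    CombData.boxWeight_ne_zero _ _ _ _, Finset.sum_eq_zero, add_zero]
  · exact ordAt_slantedPsi_of_ne hz i
  · intro b _
    rw [ordAt_boxWeight, SBox.pos_eq, ordAt_affRoot_of_ne hz, mul_zero, neg_zero]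

end Toroidal

/-! ### Poles of the weights of states -/

namespace Toroidal

namespace SBox

variable {m : ℕ} {l : Finset (SBox m)}

theorem filled_eq_one {f : Fin 3} {n k : ℤ}
    (h : ∀ v : SBox m, v.cls = f → v.gn = n → v.gk = k → Present l v) (hv : f = 2 → Valid m f n k) :
    filled l f n k = 1 := by
  by_cases hv' : Valid m f n k
  · obtain ⟨v, h1, h2, h3⟩ := exists_of_valid hv'
    rw [filled_coord l ⟨h1, h2, h3⟩, if_pos (h v h1 h2 h3)]
  · rw [filled_of_not_valid l hv', if_neg fun hf => hv' (hv hf)]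

theorem filled_eq_zero {f : Fin 3} {n k : ℤ}
    (h : ∀ v : SBox m, v.cls = f → v.gn = n → v.gk = k → ¬ Present l v)
    (hv : f ≠ 2 → Valid m f n k) : filled l f n k = 0 := by
  by_cases hv' : Valid m f n k
  · obtain ⟨v, h1, h2, h3⟩ := exists_of_valid hv'
    rw [filled_coord l ⟨h1, h2, h3⟩, if_neg (h v h1 h2 h3)]
  · rw [filled_of_not_valid l hv', if_pos (not_not.1 fun hf => hv' (hv hf))]

theorem present_iff_of_coord {f : Fin 3} {n k : ℤ} {v : SBox m} (h1 : v.cls = f) (h2 : v.gn = n)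
    (h3 : v.gk = k) : Present l v ↔ filled l f n k = 1 := by
  rw [present_iff, h1, h2, h3]

theorem not_present_iff_of_coord {f : Fin 3} {n k : ℤ} {v : SBox m} (h1 : v.cls = f)
    (h2 : v.gn = n) (h3 : v.gk = k) : ¬ Present l v ↔ filled l f n k = 0 := by
  rw [not_present_iff, h1, h2, h3]

section

variable (hl : Closed l)
include hl

theorem filled_step (f : Fin 3) (n k : ℤ) : filled l f n (k + 1) ≤ filled l f n k := by
  by_cases hf : f = 2
  · subst hf
    by_cases h : -2 * (m : ℤ) ≤ n ∧ n ≤ 0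
    · exact filled_le_filled hl (Or.inl ⟨rfl, by ring⟩) fun _ => h
    · rw [filled_tower_eq_zero l (by omega), filled_tower_eq_zero l (by omega)]
  · exact filled_le_filled hl (Or.inl ⟨rfl, by ring⟩) fun h => absurd h hf

theorem filled_step' {f : Fin 3} (hf : f ≠ 2) (n k : ℤ) : filled l f (n + 1) k ≤ filled l f n k :=
  filled_le_filled hl (Or.inr (Or.inl ⟨Or.inl hf, by ring, rfl⟩)) fun h => absurd h hf

theorem filled_white_le_left {n k : ℤ} (hn : n % 2 = 0) (h : -2 * (m : ℤ) < n) :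
    filled l 2 n k ≤ filled l 2 (n - 1) k := by
  by_cases h' : n ≤ 0
  · exact filled_le_filled hl (Or.inr (Or.inl ⟨Or.inr hn, rfl, rfl⟩)) fun _ => by omega
  · rw [filled_tower_eq_zero l (by omega)]
    exact filled_nonneg _ _ _ _

theorem filled_white_le_right {n k : ℤ} (hn : n % 2 = 0) (h : n < 0) :
    filled l 2 n k ≤ filled l 2 (n + 1) (k + 1) := by
  by_cases h' : -2 * (m : ℤ) ≤ n
  · exact filled_le_filled hl (Or.inr (Or.inr ⟨rfl, hn, rfl, rfl⟩)) fun _ => by omega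
  · rw [filled_tower_eq_zero l (by omega)]
    exact filled_nonneg _ _ _ _

/-- In the bottom and the pedestal the order is negative exactly at the inner and outer corners of
the Young diagram. -/
theorem hexSum_neg_iff_of_ne {f : Fin 3} (hf : f ≠ 2) (n k : ℤ) :
    -1 ≤ hexSum (filled l f) n k ∧ (hexSum (filled l f) n k < 0 ↔
      (filled l f n k = 0 ∧ filled l f n (k - 1) = 1 ∧ filled l f (n - 1) k = 1) ∨
      (filled l f n k = 1 ∧ filled l f n (k + 1) = 0 ∧ filled l f (n + 1) k = 0)) := by
  have hs := filled_step hl f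
  have hs' := filled_step' hl hf
  have b0 := filled_nonneg l f
  have b1 := filled_le_one l f
  have c1 := hs n k
  have c2 := hs n (k - 1)
  have c3 := hs (n + 1) k
  have c4 := hs (n - 1) (k - 1)
  have c5 := hs' n k
  have c6 := hs' n (k + 1)
  have c7 := hs' (n - 1) k
  have c8 := hs' (n - 1) (k - 1)
  rw [sub_add_cancel] at c2 c4 c7 c8
  have := b0 n k
  have := b1 n k
  have := b0 n (k + 1)
  have := b1 n (k - 1)
  have := b0 (n + 1) k
  have := b0 (n + 1) (k + 1)
  have := b1 (n - 1) (k - 1)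
  have := b1 (n - 1) k
  unfold hexSum
  clear hs hs' b0 b1
  omega

/-- The columns of color `0` of the tower. At the two ends of the tower a neighboring column is
missing, and so is the corresponding condition. -/
theorem hexSum_neg_iff_of_even {n : ℤ} (hn : n % 2 = 0) (k : ℤ) :
    -1 ≤ hexSum (filled l 2) n k ∧ (hexSum (filled l 2) n k < 0 ↔
      (-2 * (m : ℤ) ≤ n ∧ n ≤ 0) ∧
      ((filled l 2 n k = 0 ∧ filled l 2 n (k - 1) = 1 ∧
        (-2 * (m : ℤ) < n → filled l 2 (n - 1) k = 1) ∧ (n < 0 → filled l 2 (n + 1) (k + 1) = 1)) ∨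
      (filled l 2 n k = 1 ∧ filled l 2 n (k + 1) = 0))) := by
  have hs := filled_step hl 2
  have b0 := filled_nonneg l 2
  have b1 := filled_le_one l 2
  have hz := fun n k => filled_tower_eq_zero l (n := n) (k := k)
  have c1 := hs n k
  have c2 := hs n (k - 1)
  have c3 := hs (n + 1) k
  have c4 := hs (n - 1) (k - 1)
  have c5 := fun k => filled_white_le_left hl (n := n) (k := k) hn
  have c6 := fun k => filled_white_le_right hl (n := n) (k := k) hn
  have d1 := c5 k
  have d2 := c5 (k - 1)
  have d3 := c6 k
  have d4 := c6 (k - 1)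
  rw [sub_add_cancel] at c2 c4 d4
  have := b0 n k
  have := b1 n k
  have := b0 n (k + 1)
  have := b1 n (k - 1)
  have := b0 (n + 1) (k + 1)
  have := b1 (n + 1) k
  have := b1 (n - 1) (k - 1)
  have := b0 (n - 1) k
  have z1 := hz n k
  have z2 := hz n (k + 1)
  have z3 := hz n (k - 1)
  have z4 := hz (n + 1) k
  have z5 := hz (n + 1) (k + 1)
  have z6 := hz (n - 1) k
  have z7 := hz (n - 1) (k - 1)
  unfold hexSum
  clear hs b0 b1 hz c5 c6
  by_cases h1 : -2 * (m : ℤ) ≤ n ∧ n ≤ 0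
  · clear z1 z2 z3
    by_cases h2 : -2 * (m : ℤ) < n
    · have e1 := d1 h2
      have e2 := d2 h2
      clear d1 d2 z6 z7
      by_cases h3 : n < 0
      · have e3 := d3 h3
        have e4 := d4 h3
        clear d3 d4 z4 z5
        omega
      · have e3 := z4 (by omega)
        have e4 := z5 (by omega)
        clear d3 d4 z4 z5
        omega
    · have e1 := z6 (by omega)
      have e2 := z7 (by omega)
      clear d1 d2 z6 z7
      by_cases h3 : n < 0
      · have e3 := d3 h3
        have e4 := d4 h3
        clear d3 d4 z4 z5
        omega
      · have e3 := z4 (by omega)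
        have e4 := z5 (by omega)
        clear d3 d4 z4 z5
        omega
  · omega

/-- The columns of color `1` of the tower, which have neighbors on both sides. -/
theorem hexSum_neg_iff_of_odd {n : ℤ} (hn : n % 2 = 1) (k : ℤ) :
    -1 ≤ hexSum (filled l 2) n k ∧ (hexSum (filled l 2) n k < 0 ↔
      (-2 * (m : ℤ) ≤ n ∧ n ≤ 0) ∧
      ((filled l 2 n k = 0 ∧ filled l 2 n (k - 1) = 1) ∨
      (filled l 2 n k = 1 ∧ filled l 2 n (k + 1) = 0 ∧ filled l 2 (n + 1) k = 0 ∧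
        filled l 2 (n - 1) (k - 1) = 0))) := by
  have hs := filled_step hl 2
  have b0 := filled_nonneg l 2
  have b1 := filled_le_one l 2
  have hz := fun n k => filled_tower_eq_zero l (n := n) (k := k)
  have c1 := hs n k
  have c2 := hs n (k - 1)
  have c3 := hs (n + 1) k
  have c4 := hs (n - 1) (k - 1)
  have c5 := fun k => filled_white_le_left hl (n := n + 1) (k := k) (by omega)
  have c6 := fun k => filled_white_le_right hl (n := n - 1) (k := k) (by omega)
  have d1 := c5 k
  have d2 := c5 (k + 1)
  have d3 := c6 k
  have d4 := c6 (k - 1)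
  rw [sub_add_cancel] at c2 c4 d3 d4
  rw [sub_add_cancel] at d4
  rw [add_sub_cancel_right] at d1 d2
  have := b0 n k
  have := b1 n k
  have := b0 n (k + 1)
  have := b1 n (k - 1)
  have := b0 (n + 1) (k + 1)
  have := b1 (n + 1) k
  have := b1 (n - 1) (k - 1)
  have := b0 (n - 1) k
  have z1 := hz n k
  have z2 := hz n (k + 1)
  have z3 := hz n (k - 1)
  have z4 := hz (n + 1) k
  have z5 := hz (n + 1) (k + 1)
  have z6 := hz (n - 1) k
  have z7 := hz (n - 1) (k - 1)
  unfold hexSum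
  clear hs b0 b1 hz c5 c6
  omega

end

theorem neg_one_le_hexSum (hl : Closed l) (f : Fin 3) (n k : ℤ) :
    -1 ≤ hexSum (filled l f) n k := by
  by_cases hf : f = 2
  · subst hf
    rcases Int.emod_two_eq_zero_or_one n with hn | hn
    · exact (hexSum_neg_iff_of_even hl hn k).1
    · exact (hexSum_neg_iff_of_odd hl hn k).1
  · exact (hexSum_neg_iff_of_ne hl hf n k).1

/-- The weight of a state has a pole exactly at the boxes that can be added or removed. -/
theorem hexSum_neg_iff (hl : Closed l) (f : Fin 3) (n k : ℤ) : hexSum (filled l f) n k < 0 ↔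
    ∃ b : SBox m, (b.cls = f ∧ b.gn = n ∧ b.gk = k) ∧
      ((¬ Present l b ∧ ∀ v, Supports v b → Present l v) ∨
        (Present l b ∧ ∀ u, Supports b u → ¬ Present l u)) := by
  by_cases hf : f = 2
  · subst hf
    rcases Int.emod_two_eq_zero_or_one n with hn | hn
    · rw [(hexSum_neg_iff_of_even hl hn k).2]
      constructor
      · rintro ⟨hstrip, h⟩
        obtain ⟨b, h1, h2, h3⟩ := exists_of_valid (Or.inr ⟨rfl, hstrip⟩ : Valid m 2 n k)
        refine ⟨b, ⟨h1, h2, h3⟩, ?_⟩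
        rw [not_present_iff_of_coord h1 h2 h3, present_iff_of_coord h1 h2 h3]
        refine h.imp (fun h => ⟨h.1, ?_⟩) (fun h => ⟨h.1, ?_⟩)
        · rintro v ⟨hc, hv⟩
          rw [present_iff_of_coord (hc.trans h1) rfl rfl]
          have hvv := v.valid
          simp only [Valid, hc, h1, h2, h3, ne_eq, not_true_eq_false, false_and, true_and,
            false_or, hn] at hv hvv
          rcases hv with hv | hv | hv
          · rw [hv.1, hv.2]; exact h.2.1
          · rw [hv.1, hv.2]; exact h.2.2.1 (by omega)
          · rw [hv.1, hv.2]; exact h.2.2.2 (by omega)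
        · rintro u ⟨hc, hu⟩
          rw [not_present_iff_of_coord (hc.symm.trans h1) rfl rfl]
          simp only [← hc, h1, h2, h3, ne_eq, not_true_eq_false, true_and, false_or] at hu
          rw [show u.gn = n by omega, show u.gk = k + 1 by omega]
          exact h.2
      · rintro ⟨b, ⟨h1, h2, h3⟩, h⟩
        have hb := b.valid
        simp only [Valid, h1, h2, ne_eq, not_true_eq_false, false_and, true_and, false_or] at hb
        refine ⟨hb, ?_⟩
        rw [not_present_iff_of_coord h1 h2 h3, present_iff_of_coord h1 h2 h3] at h
        refine h.imp (fun h => ⟨h.1, ?_, fun h' => ?_, fun h' => ?_⟩) (fun h => ⟨h.1, ?_⟩)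
        · exact filled_eq_one (fun v e1 e2 e3 => h.2 v ⟨e1.trans h1.symm,
            Or.inl ⟨e2.trans h2.symm, by omega⟩⟩) fun _ => Or.inr ⟨rfl, hb⟩
        · exact filled_eq_one (fun v e1 e2 e3 => h.2 v ⟨e1.trans h1.symm,
            Or.inr (Or.inl ⟨Or.inr (by omega), by omega, by omega⟩)⟩)
            fun _ => Or.inr ⟨rfl, by omega⟩
        · exact filled_eq_one (fun v e1 e2 e3 => h.2 v ⟨e1.trans h1.symm,
            Or.inr (Or.inr ⟨h1, by omega, by omega, by omega⟩)⟩)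
            fun _ => Or.inr ⟨rfl, by omega⟩
        · exact filled_eq_zero (fun v e1 e2 e3 => h.2 v ⟨h1.trans e1.symm,
            Or.inl ⟨h2.trans e2.symm, by omega⟩⟩) fun h => absurd rfl h
    · rw [(hexSum_neg_iff_of_odd hl hn k).2]
      constructor
      · rintro ⟨hstrip, h⟩
        obtain ⟨b, h1, h2, h3⟩ := exists_of_valid (Or.inr ⟨rfl, hstrip⟩ : Valid m 2 n k)
        refine ⟨b, ⟨h1, h2, h3⟩, ?_⟩
        rw [not_present_iff_of_coord h1 h2 h3, present_iff_of_coord h1 h2 h3]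
        refine h.imp (fun h => ⟨h.1, ?_⟩) (fun h => ⟨h.1, ?_⟩)
        · rintro v ⟨hc, hv⟩
          rw [present_iff_of_coord (hc.trans h1) rfl rfl]
          simp only [h1, h2, h3, ne_eq, not_true_eq_false, false_and, true_and, hn, one_ne_zero,
            or_false] at hv
          rw [hv.1, hv.2]; exact h.2
        · rintro u ⟨hc, hu⟩
          rw [not_present_iff_of_coord (hc.symm.trans h1) rfl rfl]
          simp only [← hc, h1, h2, h3, ne_eq, not_true_eq_false, true_and, false_or] at hu
          rcases hu with hu | hu | hu
          · rw [show u.gn = n by omega, show u.gk = k + 1 by omega]; exact h.2.1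
          · rw [show u.gn = n + 1 by omega, show u.gk = k by omega]; exact h.2.2.1
          · rw [show u.gn = n - 1 by omega, show u.gk = k - 1 by omega]; exact h.2.2.2
      · rintro ⟨b, ⟨h1, h2, h3⟩, h⟩
        have hb := b.valid
        simp only [Valid, h1, h2, ne_eq, not_true_eq_false, false_and, true_and, false_or] at hb
        refine ⟨hb, ?_⟩
        rw [not_present_iff_of_coord h1 h2 h3, present_iff_of_coord h1 h2 h3] at h
        refine h.imp (fun h => ⟨h.1, ?_⟩) (fun h => ⟨h.1, ?_, ?_, ?_⟩)
        · exact filled_eq_one (fun v e1 e2 e3 => h.2 v ⟨e1.trans h1.symm,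
            Or.inl ⟨e2.trans h2.symm, by omega⟩⟩) fun _ => Or.inr ⟨rfl, hb⟩
        · exact filled_eq_zero (fun v e1 e2 e3 => h.2 v ⟨h1.trans e1.symm,
            Or.inl ⟨h2.trans e2.symm, by omega⟩⟩) fun h => absurd rfl h
        · exact filled_eq_zero (fun v e1 e2 e3 => h.2 v ⟨h1.trans e1.symm,
            Or.inr (Or.inl ⟨Or.inr (by omega), by omega, by omega⟩)⟩) fun h => absurd rfl h
        · exact filled_eq_zero (fun v e1 e2 e3 => h.2 v ⟨h1.trans e1.symm,
            Or.inr (Or.inr ⟨e1, by omega, by omega, by omega⟩)⟩) fun h => absurd rfl h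
  · have hV : ∀ n k, Valid m f n k ↔ 0 ≤ n ∧ 0 ≤ k := by simp [Valid, hf]
    have h01 : ∀ {n k}, filled l f n k = 0 → 0 ≤ n ∧ 0 ≤ k := by
      intro n k h
      rw [← hV]
      by_contra hv
      rw [filled_of_not_valid l hv, if_neg hf] at h
      omega
    rw [(hexSum_neg_iff_of_ne hl hf n k).2]
    constructor
    · intro h
      have hv : Valid m f n k := by
        rw [hV]
        rcases h with h | h
        · exact h01 h.1
        · have := h01 h.2.1
          have := h01 h.2.2
          omega
      obtain ⟨b, h1, h2, h3⟩ := exists_of_valid hv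
      refine ⟨b, ⟨h1, h2, h3⟩, ?_⟩
      rw [not_present_iff_of_coord h1 h2 h3, present_iff_of_coord h1 h2 h3]
      refine h.imp (fun h => ⟨h.1, ?_⟩) (fun h => ⟨h.1, ?_⟩)
      · rintro v ⟨hc, hv⟩
        rw [present_iff_of_coord (hc.trans h1) rfl rfl]
        simp only [h1, h2, h3, ne_eq, hf, not_false_eq_true, true_or, false_and, true_and, or_false] at hv
        rcases hv with hv | hv
        · rw [hv.1, hv.2]; exact h.2.1
        · rw [hv.1, hv.2]; exact h.2.2
      · rintro u ⟨hc, hu⟩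
        rw [not_present_iff_of_coord (hc.symm.trans h1) rfl rfl]
        simp only [← hc, h1, h2, h3, ne_eq, hf, not_false_eq_true, true_or, false_and, true_and, or_false] at hu
        rcases hu with hu | hu
        · rw [show u.gn = n by omega, show u.gk = k + 1 by omega]; exact h.2.1
        · rw [show u.gn = n + 1 by omega, show u.gk = k by omega]; exact h.2.2
    · rintro ⟨b, ⟨h1, h2, h3⟩, h⟩
      have hb := b.valid
      rw [h1, h2, h3, hV] at hb
      rw [not_present_iff_of_coord h1 h2 h3, present_iff_of_coord h1 h2 h3] at h
      refine h.imp (fun h => ⟨h.1, ?_, ?_⟩) (fun h => ⟨h.1, ?_, ?_⟩)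
      · exact filled_eq_one (fun v e1 e2 e3 => h.2 v ⟨e1.trans h1.symm,
          Or.inl ⟨e2.trans h2.symm, by omega⟩⟩) fun h => absurd h hf
      · exact filled_eq_one (fun v e1 e2 e3 => h.2 v ⟨e1.trans h1.symm,
          Or.inr (Or.inl ⟨Or.inl (h1 ▸ hf), by omega, by omega⟩)⟩) fun h => absurd h hf
      · exact filled_eq_zero (fun v e1 e2 e3 => h.2 v ⟨h1.trans e1.symm,
          Or.inl ⟨h2.trans e2.symm, by omega⟩⟩) fun _ => (hV _ _).2 (by omega)
      · exact filled_eq_zero (fun v e1 e2 e3 => h.2 v ⟨h1.trans e1.symm,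
          Or.inr (Or.inl ⟨Or.inl (e1 ▸ hf), by omega, by omega⟩)⟩) fun _ => (hV _ _).2 (by omega)

end SBox

end Toroidal

/-! ### Regularity of the data of the slanted modules -/

namespace Toroidal

open SBox

variable {P : QParams} {m : ℕ} {μ ν : ℂ}

theorem gBox_eq_zero_iff (hP : P.Generic) (hμν : P.GenericPair μ ν) (u v : SBox m) :
    (slanted P m μ ν).gBox P u v = 0 ↔ u.cls = v.cls ∧ ((u.gn = v.gn ∧ u.gk = v.gk - 1) ∨
      (u.gn = v.gn - 1 ∧ u.gk = v.gk) ∨ (u.gn = v.gn + 1 ∧ u.gk = v.gk + 1)) := by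
  unfold CombData.gBox
  rw [pos_eq, pos_eq]
  change gC P u.color v.color _ _ = 0 ↔ _
  rw [color_eq, color_eq, gC_gridPt_eq_zero_iff hP hμν]

namespace SBox

theorem present_of_le {l : Finset (SBox m)} {u v : SBox m}
    (h : filled l v.cls v.gn v.gk ≤ filled l u.cls u.gn u.gk) (hv : Present l v) : Present l u := by
  rw [present_iff] at hv ⊢
  have := filled_le_one l u.cls u.gn u.gk
  omega

/-- Of two neighboring boxes, the earlier one is added whenever the later one is: it either
supports the later one or supports a support of it. -/
theorem filled_le_of_neighbor {l : Finset (SBox m)} (hl : Closed l) {u v : SBox m}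
    (hc : u.cls = v.cls)
    (h : ((u.gn = v.gn ∧ u.gk = v.gk - 1) ∨
      (u.gn = v.gn - 1 ∧ u.gk = v.gk) ∨ (u.gn = v.gn + 1 ∧ u.gk = v.gk + 1)) ∨
      ((v.gn = u.gn ∧ v.gk = u.gk - 1) ∨
      (v.gn = u.gn - 1 ∧ v.gk = u.gk) ∨ (v.gn = u.gn + 1 ∧ v.gk = u.gk + 1)))
    (huv : u < v) : filled l v.cls v.gn v.gk ≤ filled l u.cls u.gn u.gk := by
  rw [lt_iff hc] at huv
  by_cases hf : v.cls = 2
  · have hu := u.valid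
    simp only [Valid, hc, hf, ne_eq, not_true_eq_false, false_and, true_and, false_or] at hu huv ⊢
    rcases h with (⟨h1, h2⟩ | ⟨h1, h2⟩ | ⟨h1, h2⟩) | (⟨h1, h2⟩ | ⟨h1, h2⟩ | ⟨h1, h2⟩)
    · exact filled_le_filled hl (Or.inl ⟨h1, h2⟩) fun _ => hu
    · exact filled_le_filled hl (Or.inr (Or.inl ⟨Or.inr (by omega), h1, h2⟩)) fun _ => hu
    · exact filled_le_filled hl (Or.inr (Or.inr ⟨rfl, by omega, h1, h2⟩)) fun _ => hu
    · omega
    · have h3 : v.gn % 2 = 0 := by omega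
      refine le_trans (filled_le_filled hl (Or.inr (Or.inr ⟨rfl, h3, rfl, rfl⟩)) fun _ => by omega)
        (filled_le_filled hl (Or.inl ⟨?_, ?_⟩) fun _ => hu) <;> omega
    · have h3 : v.gn % 2 = 0 := by omega
      refine le_trans (filled_le_filled hl (Or.inr (Or.inl ⟨Or.inr h3, rfl, rfl⟩)) fun _ => by omega)
        (filled_le_filled hl (Or.inl ⟨?_, ?_⟩) fun _ => hu) <;> omega
  · simp only [hc, hf, ne_eq, not_false_eq_true, false_and, true_and, or_false] at huv ⊢
    rcases h with (⟨h1, h2⟩ | ⟨h1, h2⟩ | ⟨h1, h2⟩) | (⟨h1, h2⟩ | ⟨h1, h2⟩ | ⟨h1, h2⟩)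
    · exact filled_le_filled hl (Or.inl ⟨h1, h2⟩) fun h => absurd h hf
    · exact filled_le_filled hl (Or.inr (Or.inl ⟨Or.inl hf, h1, h2⟩)) fun h => absurd h hf
    · omega
    · omega
    · omega
    · refine le_trans (filled_le_filled hl (Or.inr (Or.inl ⟨Or.inl hf, rfl, rfl⟩))
        fun h => absurd h hf) (filled_le_filled hl (Or.inl ⟨?_, ?_⟩) fun h => absurd h hf) <;> omega

/-- If `g` vanishes at a pair of boxes in the order opposite to that of a support, then `v` is
obtained from `u` by two steps of support, through the box next above `u` and through the box next
below `v`. -/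
theorem exists_between {u v : SBox m} (hc : v.cls = u.cls)
    (h : (v.gn = u.gn ∧ v.gk = u.gk - 1) ∨ (v.gn = u.gn - 1 ∧ v.gk = u.gk) ∨
      (v.gn = u.gn + 1 ∧ v.gk = u.gk + 1)) (huv : u < v) : u.color ≠ v.color ∧
    ∃ x y : SBox m, x.color = u.color ∧ y.color = v.color ∧ x ≠ u ∧ y ≠ v ∧
      ∀ l : Finset (SBox m), Closed l → (Present l v → Present l x ∧ Present l y) ∧
        (Present l x → Present l u) ∧ (Present l y → Present l u) := by
  rw [lt_iff hc.symm] at huv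
  have hcol : ∀ b c : SBox m, b.cls = c.cls → (b.color = c.color ↔ b.gn % 2 = c.gn % 2) := by
    intro b c h
    rw [color_eq, color_eq, h, gridColor_eq_iff]
  have hu := u.valid
  have hv := v.valid
  -- Lower boxes of the same column precede, which excludes the first alternative of `h`; the
  -- remaining ones are restricted by the order.
  have h1 : (v.gn = u.gn - 1 ∧ v.gk = u.gk ∧ u.cls = 2 ∧ u.gn % 2 = 1) ∨
      (v.gn = u.gn + 1 ∧ v.gk = u.gk + 1 ∧ (u.cls = 2 → u.gn % 2 = 1)) := by
    by_cases hf : u.cls = 2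
    · simp only [hf, ne_eq, not_true_eq_false, false_and, true_and, false_or,
        forall_const] at huv ⊢
      omega
    · simp only [hf, ne_eq, not_false_eq_true, false_and, true_and, or_false, and_false,
        false_imp_iff, and_true, false_or] at huv ⊢
      omega
  have hx : Valid m u.cls u.gn (u.gk + 1) := by
    unfold Valid at hu ⊢
    exact hu.imp (fun h => ⟨h.1, h.2.1, by omega⟩) id
  have hy : Valid m v.cls v.gn (v.gk - 1) := by
    unfold Valid at hu hv ⊢
    refine hv.imp (fun h => ⟨h.1, h.2.1, ?_⟩) id
    rw [hc] at h
    have := h.1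
    simp only [this, false_and, and_false, false_or, or_false] at h1 hu
    omega
  obtain ⟨x, x1, x2, x3⟩ := exists_of_valid hx
  obtain ⟨y, y1, y2, y3⟩ := exists_of_valid hy
  refine ⟨fun h => ?_, x, y, ?_, ?_, ?_, ?_, fun l hl => ⟨fun h => ⟨?_, ?_⟩, ?_, ?_⟩⟩
  · rw [hcol _ _ hc.symm] at h
    omega
  · rw [hcol _ _ x1, x2]
  · rw [hcol _ _ y1, y2]
  · rintro rfl
    omega
  · rintro rfl
    omega
  · refine hl v x ⟨x1.trans hc.symm, Or.inr ?_⟩ h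
    rw [x2, x3, hc]
    by_cases hf : u.cls = 2
    · simp only [hf, ne_eq, not_true_eq_false, true_and, false_or, forall_const] at h1 ⊢
      omega
    · simp only [hf, ne_eq, not_false_eq_true, false_and, true_and, or_false, and_false,
        false_imp_iff, and_true, false_or, true_or] at h1 ⊢
      omega
  · exact hl v y ⟨y1, Or.inl ⟨y2, y3⟩⟩ h
  · exact hl x u ⟨x1.symm, Or.inl ⟨x2.symm, by omega⟩⟩
  · refine hl y u ⟨hc.symm.trans y1.symm, Or.inr ?_⟩
    rw [y1, y2, y3, hc]
    by_cases hf : u.cls = 2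
    · simp only [hf, ne_eq, not_true_eq_false, true_and, false_or, forall_const] at h1 ⊢
      omega
    · simp only [hf, ne_eq, not_false_eq_true, false_and, true_and, or_false, and_false,
        false_imp_iff, and_true, false_or, true_or] at h1 ⊢
      omega

/-- A set of boxes is determined by the orders of its weight. At the upper right neighbor of the
last point of the grid at which the indicator functions of two sets differ, only this point
contributes to the difference of the alternating sums. -/
theorem eq_of_hexSum_eq {l l' : Finset (SBox m)}
    (h : ∀ f n k, hexSum (filled l f) n k = hexSum (filled l' f) n k) : l = l' := by
  classical
  by_contra hne
  have hne' : (symmDiff l l').Nonempty := by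
    rw [Finset.nonempty_iff_ne_empty]
    intro h
    exact hne (symmDiff_eq_bot.1 h)
  obtain ⟨b, hb, hmax⟩ := Finset.exists_max_image (symmDiff l l')
    (fun b => toLex (b.gn, b.gk)) hne'
  have hpres : ∀ c : SBox m, c ∈ symmDiff l l' ↔ ¬ (Present l c ↔ Present l' c) := by
    intro c
    rw [Finset.mem_symmDiff]
    unfold Present
    tauto
  have hfar : ∀ n k, toLex (b.gn, b.gk) < toLex (n, k) →
      filled l b.cls n k = filled l' b.cls n k := by
    intro n k hlt
    by_cases hv : Valid m b.cls n k
    · obtain ⟨c, h1, h2, h3⟩ := exists_of_valid hv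
      rw [filled_coord l ⟨h1, h2, h3⟩, filled_coord l' ⟨h1, h2, h3⟩]
      refine if_congr ?_ rfl rfl
      by_contra hc
      have := hmax c ((hpres c).2 hc)
      rw [h2, h3] at this
      exact absurd hlt (not_lt.2 this)
    · rw [filled_of_not_valid l hv, filled_of_not_valid l' hv]
  have key := h b.cls (b.gn + 1) (b.gk + 1)
  unfold hexSum at key
  rw [hfar (b.gn + 1) (b.gk + 1 + 1) (by simp [Prod.Lex.toLex_lt_toLex]),
    hfar (b.gn + 1) (b.gk + 1 - 1) (by simp [Prod.Lex.toLex_lt_toLex]),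
    hfar (b.gn + 1 + 1) (b.gk + 1) (by simp [Prod.Lex.toLex_lt_toLex, add_assoc]),
    hfar (b.gn + 1 + 1) (b.gk + 1 + 1) (by simp [Prod.Lex.toLex_lt_toLex, add_assoc]),
    add_sub_cancel_right, add_sub_cancel_right,
    hfar b.gn (b.gk + 1) (by simp [Prod.Lex.toLex_lt_toLex])] at key
  refine (hpres b).1 hb ?_
  rw [present_iff, present_iff]
  have : filled l b.cls b.gn b.gk = filled l' b.cls b.gn b.gk := by linarith
  rw [this]

theorem closed_add_iff {l : Finset (SBox m)} (hl : Closed l) {b : SBox m}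
    (hb : ¬ Present l b) (P : QParams) (μ ν : ℂ) :
    Closed ((slanted P m μ ν).add l b) ↔ ∀ v, Supports v b → Present l v := by
  have hadd : ∀ c, Present ((slanted P m μ ν).add l b) c ↔ c = b ∨ Present l c := fun c =>
    CombData.added_add (D := slanted P m μ ν)
  unfold Closed
  simp only [hadd]
  constructor
  · intro h v hv
    rcases h b v hv (Or.inl rfl) with rfl | h
    · exact absurd hv.lt (lt_irrefl _)
    · exact h
  · rintro h u v huv (rfl | hu)
    · exact Or.inr (h v huv)
    · exact Or.inr (hl u v huv hu)

theorem closed_remove_iff {l : Finset (SBox m)} (hl : Closed l) {b : SBox m}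
    (P : QParams) (μ ν : ℂ) :
    Closed ((slanted P m μ ν).remove l b) ↔ ∀ u, Supports b u → ¬ Present l u := by
  have hrem : ∀ c, Present ((slanted P m μ ν).remove l b) c ↔ c ≠ b ∧ Present l c := fun c =>
    CombData.added_remove (D := slanted P m μ ν)
  unfold Closed
  simp only [hrem]
  constructor
  · intro h u hu hp
    exact (h u b hu ⟨hu.lt.ne', hp⟩).1 rfl
  · rintro h u v huv ⟨hu, hp⟩
    refine ⟨?_, hl u v huv hp⟩
    rintro rfl
    exact h u huv hp

end SBox

/-- The orders of the `ℓ`-weights at the points of the grid determine both the boxes that can be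
added or removed and the state itself. -/
theorem isRegular_slanted (hP : P.Generic) (hμν : P.GenericPair μ ν) (hm : 1 ≤ m) :
    (slanted P m μ ν).IsRegular P Supports where
  q₂_ne_one := QParams.q₂_ne_one hP
  pos_injective := by
    intro b c h
    rw [pos_eq, pos_eq] at h
    obtain ⟨h1, h2, h3⟩ := QParams.gridPt_injective hP hμν h
    exact coord_injective h1 h2 h3
  mem_S := fun l => mem_range_boxes_iff
  lt_of_supports := fun h => h.lt
  positive_of_supports := fun h => h.positive
  gBox_of_supports := by
    intro u v h
    rw [gBox_eq_zero_iff hP hμν]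
    obtain ⟨h1, h2⟩ := h
    exact ⟨h1, h2.imp id (Or.imp (fun h => h.2) (fun h => h.2.2))⟩
  added_of_nbr := by
    intro u v l huv hlt hl hv
    refine present_of_le ?_ hv
    unfold CombData.Nbr at huv
    rw [gBox_eq_zero_iff hP hμν, gBox_eq_zero_iff hP hμν] at huv
    have hc : u.cls = v.cls := by
      rcases huv with h | h
      · exact h.1
      · exact h.1.symm
    exact filled_le_of_neighbor (mem_range_boxes_iff.1 hl) hc
      (huv.imp (fun h => h.2) (fun h => h.2)) hlt
  exists_between := by
    intro u v h hlt
    rw [gBox_eq_zero_iff hP hμν] at h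
    obtain ⟨h1, x, y, h2, h3, h4, h5, h6⟩ := SBox.exists_between h.1 h.2 hlt
    exact ⟨h1, x, y, h2, h3, h4, h5, fun l hl => h6 l (mem_range_boxes_iff.1 hl)⟩
  not_nbr_of_positive_lt := by
    intro u v hu hv hlt h
    unfold CombData.Nbr at h
    rw [gBox_eq_zero_iff hP hμν, gBox_eq_zero_iff hP hμν] at h
    have hc : u.cls = v.cls := by
      rcases h with h | h
      · exact h.1
      · exact h.1.symm
    replace hu := (positive_iff u).1 hu
    have hv' := mt (positive_iff v).2 hv
    rw [lt_iff hc] at hlt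
    rw [hc] at hu hlt
    by_cases hf : v.cls = 2
    · simp only [hf, ne_eq, not_true_eq_false, false_and, true_and, false_or] at hu hv' hlt
      omega
    · exact hv' (Or.inl hf)
  neg_one_le_ord := by
    intro l hl i z
    by_cases hz : ∃ f n k, P.gridPt μ ν f n k = z
    · obtain ⟨f, n, k, rfl⟩ := hz
      rw [ordAt_phi_gridPt hP hμν hm]
      split_ifs
      · exact neg_one_le_hexSum (mem_range_boxes_iff.1 hl) f n k
      · norm_num
    · rw [ordAt_phi_of_ne hm fun f n k h => hz ⟨f, n, k, h⟩]
      norm_num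
  ord_neg_iff := by
    intro l hl i z
    have hl' : Closed l := mem_range_boxes_iff.1 hl
    have hmem : ∀ b : SBox m, (b ∈ (slanted P m μ ν).CC i l ∨ b ∈ (slanted P m μ ν).CV i l) ↔
        b.color = i ∧ ((¬ Present l b ∧ ∀ v, Supports v b → Present l v) ∨
        (Present l b ∧ ∀ u, Supports b u → ¬ Present l u)) := by
      intro b
      rw [CombData.mem_CC, CombData.mem_CV]
      change (b.color = i ∧ ¬ Present l b ∧ _ ∈ Set.range SState.boxes) ∨
        (b.color = i ∧ Present l b ∧ _ ∈ Set.range SState.boxes) ↔ _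
      rw [mem_range_boxes_iff, mem_range_boxes_iff, closed_remove_iff hl', ← and_or_left]
      refine and_congr_right fun _ => or_congr_left (and_congr_right fun hb => ?_)
      exact closed_add_iff hl' hb P μ ν
    by_cases hz : ∃ f n k, P.gridPt μ ν f n k = z
    · obtain ⟨f, n, k, rfl⟩ := hz
      rw [ordAt_phi_gridPt hP hμν hm]
      simp only [hmem, pos_eq, QParams.gridPt_inj hP hμν]
      by_cases hi : i = gridColor f n
      · rw [if_pos hi, hexSum_neg_iff hl']
        refine exists_congr fun b => ?_
        rw [and_comm (a := b.color = i ∧ _)]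
        refine and_congr_right fun hb => ?_
        have hcol : b.color = i := by rw [color_eq, hb.1, hb.2.1, hi]
        exact (and_iff_right hcol).symm
      · rw [if_neg hi]
        refine iff_of_false (lt_irrefl _) ?_
        rintro ⟨b, ⟨hb, -⟩, rfl, rfl, rfl⟩
        exact hi (hb.symm.trans (color_eq b))
    · rw [ordAt_phi_of_ne hm fun f n k h => hz ⟨f, n, k, h⟩]
      refine iff_of_false (lt_irrefl _) ?_
      rintro ⟨b, -, h⟩
      exact hz ⟨_, _, _, (pos_eq P μ ν b).symm.trans h⟩
  balanced_Ψ := balanced_slantedPsi hm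
  phi_injective := by
    intro l hl l' hl' h
    refine eq_of_hexSum_eq fun f n k => ?_
    have := ordAt_phi_gridPt hP hμν hm l f n k (gridColor f n)
    rw [h, ordAt_phi_gridPt hP hμν hm, if_pos rfl, if_pos rfl] at this
    exact this.symm

end Toroidal

/-! ### Isomorphisms between combinatorial modules -/

namespace Toroidal

/-- Schur's lemma. -/
theorem isIsomorphic_of_ne_zero {P : QParams} {V V' : Type} [AddCommGroup V] [Module ℂ V]
    [AddCommGroup V'] [Module ℂ V'] {ρ : QTor P →ₐ[ℂ] Module.End ℂ V}
    {ρ' : QTor P →ₐ[ℂ] Module.End ℂ V'} (hρ : IsIrreducible ρ) (hρ' : IsIrreducible ρ')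
    {f : V →ₗ[ℂ] V'} (hf : f ≠ 0) (hcomm : ∀ x v, f (ρ x v) = ρ' x (f v)) : IsIsomorphic ρ ρ' := by
  have h1 : LinearMap.ker f = ⊥ := by
    refine (hρ.2 _ fun x v hv => ?_).resolve_right fun h => hf (LinearMap.ker_eq_top.1 h)
    rw [LinearMap.mem_ker] at hv ⊢
    rw [hcomm, hv, map_zero]
  have h2 : LinearMap.range f = ⊤ := by
    refine (hρ'.2 _ ?_).resolve_left fun h => hf (LinearMap.range_eq_bot.1 h)
    rintro x _ ⟨v, rfl⟩
    exact ⟨ρ x v, hcomm x v⟩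
  exact ⟨LinearEquiv.ofBijective f ⟨LinearMap.ker_eq_bot.1 h1, LinearMap.range_eq_top.1 h2⟩, hcomm⟩

theorem IsIsomorphic.symm {P : QParams} {V V' : Type} [AddCommGroup V] [Module ℂ V]
    [AddCommGroup V'] [Module ℂ V'] {ρ : QTor P →ₐ[ℂ] Module.End ℂ V}
    {ρ' : QTor P →ₐ[ℂ] Module.End ℂ V'} (h : IsIsomorphic ρ ρ') : IsIsomorphic ρ' ρ := by
  obtain ⟨f, hf⟩ := h
  exact ⟨f.symm, fun x v => by rw [LinearEquiv.symm_apply_eq, hf, LinearEquiv.apply_symm_apply]⟩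

theorem IsIsomorphic.trans {P : QParams} {V V' V'' : Type} [AddCommGroup V] [Module ℂ V]
    [AddCommGroup V'] [Module ℂ V'] [AddCommGroup V''] [Module ℂ V'']
    {ρ : QTor P →ₐ[ℂ] Module.End ℂ V} {ρ' : QTor P →ₐ[ℂ] Module.End ℂ V'}
    {ρ'' : QTor P →ₐ[ℂ] Module.End ℂ V''} (h : IsIsomorphic ρ ρ') (h' : IsIsomorphic ρ' ρ'') :
    IsIsomorphic ρ ρ'' := by
  obtain ⟨f, hf⟩ := h
  obtain ⟨g, hg⟩ := h'
  exact ⟨f.trans g, fun x v => by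
    rw [LinearEquiv.trans_apply, LinearEquiv.trans_apply, hf, hg]⟩

namespace CombData

variable {B B' : Type} [LinearOrder B] [LinearOrder B']

open Classical in
/-- Every set of boxes is obtained from the empty one by adding and removing boxes. -/
theorem add_induction (D : CombData B) {Q : Finset B → Prop} (h0 : Q ∅)
    (h : ∀ l c, ¬ D.Added l c → (Q (D.add l c) ↔ Q l)) (l : Finset B) : Q l := by
  induction l using Finset.induction_on with
  | empty => exact h0
  | insert c l hc ih =>
    by_cases hp : D.positive c
    · have : D.add l c = insert c l := by rw [add, if_pos hp]
      rw [← this]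
      exact (h l c fun h => h.elim (fun h => hc h.2) fun h => h.1 hp).2 ih
    · have : D.add (insert c l) c = l := by rw [add, if_neg hp, Finset.erase_insert hc]
      rw [← this] at ih
      exact (h _ c fun h => h.elim (fun h => hp h.1)
        fun h => h.2 (Finset.mem_insert_self _ _)).1 ih

open Classical in
/-- The image of a set of boxes under a relabeling `e` of the boxes, if the boxes in `T` have
different signs in the two labelings. -/
noncomputable def relabel (e : B ≃o B') (T : Finset B') (l : Finset B) : Finset B' :=
  symmDiff (l.map e.toEquiv.toEmbedding) T

/-- The data `D` and `D'` differ by a relabeling of the boxes and by the choice of the reference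
state; `T` is the reference state of `D` as a state of `D'`. -/
structure IsRelabeling (D : CombData B) (D' : CombData B') (P : QParams) (e : B ≃o B')
    (T : Finset B') : Prop where
  color_eq : ∀ b, D'.color (e b) = D.color b
  pos_eq : ∀ b, D'.pos P (e b) = D.pos P b
  mem_iff : ∀ b, e b ∈ T ↔ ¬ (D.positive b ↔ D'.positive (e b))
  phi_eq : ∀ i, D'.phi P T i = D.Ψ i
  mem_S : ∀ l, relabel e T l ∈ D'.S ↔ l ∈ D.S

theorem relabel_empty (e : B ≃o B') (T : Finset B') : relabel e T ∅ = T := by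
  simp [relabel]

theorem added_relabel_iff {D : CombData B} {D' : CombData B'} {e : B ≃o B'} {T : Finset B'}
    (hT : ∀ b, e b ∈ T ↔ ¬ (D.positive b ↔ D'.positive (e b))) {l : Finset B} {b : B} :
    D'.Added (relabel e T l) (e b) ↔ D.Added l b := by
  have h1 : e b ∈ l.map e.toEquiv.toEmbedding ↔ b ∈ l := Finset.mem_map' _
  have h2 := hT b
  rw [Added, Added, relabel, Finset.mem_symmDiff, h1, h2]
  tauto

namespace IsRelabeling

variable {D : CombData B} {D' : CombData B'} {P : QParams} {e : B ≃o B'} {T : Finset B'}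
  (r : IsRelabeling D D' P e T)
include r

theorem added_relabel {l : Finset B} {b : B} :
    D'.Added (relabel e T l) (e b) ↔ D.Added l b :=
  added_relabel_iff r.mem_iff

theorem relabel_add (l : Finset B) (b : B) :
    relabel e T (D.add l b) = D'.add (relabel e T l) (e b) := by
  apply added_ext D'
  intro c
  obtain ⟨c, rfl⟩ := e.surjective c
  rw [r.added_relabel, added_add, added_add, r.added_relabel, e.injective.eq_iff]

theorem phi_relabel (l : Finset B) (i : ZMod 2) : D'.phi P (relabel e T l) i = D.phi P l i := by
  induction l using D.add_induction with
  | h0 => rw [relabel_empty, r.phi_eq, phi, Finset.prod_empty, mul_one]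
  | h l c hc =>
    rw [r.relabel_add, phi_add hc, phi_add (mt r.added_relabel.1 hc), r.color_eq, r.pos_eq]
    exact mul_left_inj' (inv_ne_zero (affRoot_ne_zero _ _ _ _))

theorem mem_CC_relabel {l : Finset B} {b : B} {i : ZMod 2} :
    e b ∈ D'.CC i (relabel e T l) ↔ b ∈ D.CC i l := by
  rw [mem_CC, mem_CC, r.color_eq, r.added_relabel, ← r.relabel_add, r.mem_S]

theorem relabel_remove {l : Finset B} {b : B} (hb : D.Added l b) :
    relabel e T (D.remove l b) = D'.remove (relabel e T l) (e b) := by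
  obtain ⟨l, rfl, hl⟩ := exists_eq_add hb
  rw [remove_add hl, r.relabel_add, remove_add (mt r.added_relabel.1 hl)]

theorem mem_CV_relabel {l : Finset B} {b : B} {i : ZMod 2} :
    e b ∈ D'.CV i (relabel e T l) ↔ b ∈ D.CV i l := by
  rw [mem_CV, mem_CV, r.color_eq, r.added_relabel]
  refine and_congr_right fun _ => and_congr_right fun hb => ?_
  rw [← r.relabel_remove hb, r.mem_S]

theorem CC_relabel (l : Finset B) (i : ZMod 2) : D'.CC i (relabel e T l) = e '' D.CC i l := by
  ext c
  obtain ⟨c, rfl⟩ := e.surjective c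
  rw [r.mem_CC_relabel, e.injective.mem_set_image]

theorem CV_relabel (l : Finset B) (i : ZMod 2) : D'.CV i (relabel e T l) = e '' D.CV i l := by
  ext c
  obtain ⟨c, rfl⟩ := e.surjective c
  rw [r.mem_CV_relabel, e.injective.mem_set_image]

omit r in
/-- The ratio of the structure constants `a` of two data that differ by a relabeling. -/
noncomputable def coeffRatio (D : CombData B) (D' : CombData B') (P : QParams) (e : B ≃o B')
    (T : Finset B') (b : B) : ℂ :=
  D'.aScale P (e b) / D.aScale P b *
    lcAt (D.pos P b) (D'.phiGt P T (e b) (D.color b) / D.phiGt P ∅ b (D.color b))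

section

variable {Supports : B → B → Prop} {Supports' : B' → B' → Prop} (h : D.IsRegular P Supports)
  (h' : D'.IsRegular P Supports')
include h h'

omit h' in
/-- Since adding a box changes both sides by the same factor, the two functions have a ratio
independent of `l`. -/
theorem phiGt_relabel (l : Finset B) (b : B) (i : ZMod 2) :
    D'.phiGt P (relabel e T l) (e b) i =
      D.phiGt P l b i * (D'.phiGt P T (e b) i / D.phiGt P ∅ b i) := by
  induction l using D.add_induction with
  | h0 => rw [relabel_empty, mul_div_cancel₀ _ (h.phiGt_ne_zero ∅ b i)]
  | h l c hc =>
    rw [r.relabel_add, phiGt_add hc, phiGt_add (mt r.added_relabel.1 hc), r.color_eq, r.pos_eq]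
    simp only [e.lt_iff_lt]
    rw [mul_right_comm]
    refine mul_left_inj' ?_
    split_ifs
    · exact inv_ne_zero (affRoot_ne_zero _ _ _ _)
    · exact one_ne_zero

omit r in
theorem coeffRatio_ne_zero (b : B) : coeffRatio D D' P e T b ≠ 0 :=
  mul_ne_zero (div_ne_zero (h'.aScale_ne_zero _) (h.aScale_ne_zero _))
    (lcAt_ne_zero _ (div_ne_zero (h'.phiGt_ne_zero _ _ _) (h.phiGt_ne_zero _ _ _)))

theorem aCoeff_relabel {l : Finset B} {b : B} (hl : l ∈ D.S) (hb : ¬ D.Added l b)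
    (hlb : D.add l b ∈ D.S) : D'.aCoeff P (relabel e T l) (e b) (D.color b) =
      coeffRatio D D' P e T b * D.aCoeff P l b (D.color b) := by
  have h1 := h'.aCoeff_eq ((r.mem_S l).2 hl) (mt r.added_relabel.1 hb)
    (by rw [← r.relabel_add]; exact (r.mem_S _).2 hlb)
  rw [r.color_eq, r.pos_eq, r.phiGt_relabel h, lcAt_mul] at h1
  rw [h1, h.aCoeff_eq hl hb hlb, coeffRatio]
  have := h.aScale_ne_zero b
  field_simp

/-- The products of the structure constants `a` and `b` are residues of `φ_λ`, hence the same for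
both data. -/
theorem bCoeff_relabel {l : Finset B} {b : B} (hl : l ∈ D.S) (hb : ¬ D.Added l b)
    (hlb : D.add l b ∈ D.S) : coeffRatio D D' P e T b *
      D'.bCoeff P (relabel e T (D.add l b)) (e b) (D.color b) =
      D.bCoeff P (D.add l b) b (D.color b) := by
  have h1 := h'.aCoeff_mul_bCoeff ((r.mem_S l).2 hl) (mt r.added_relabel.1 hb)
    (by rw [← r.relabel_add]; exact (r.mem_S _).2 hlb)
  rw [← r.relabel_add, r.color_eq, r.pos_eq, r.phi_relabel, ← h.aCoeff_mul_bCoeff hl hb hlb,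
    r.aCoeff_relabel h h' hl hb hlb] at h1
  refine mul_left_cancel₀ (h.aCoeff_ne_zero hl hb hlb) ?_
  rw [← h1]
  ring

omit r h h' in
open Classical in
/-- The factors of the intertwiner. -/
noncomputable def intertwinerCoeff (D : CombData B) (D' : CombData B') (P : QParams) (e : B ≃o B')
    (T : Finset B') (l : Finset B) : ℂ :=
  ∏ b ∈ l, if D.positive b then coeffRatio D D' P e T b else (coeffRatio D D' P e T b)⁻¹

omit r in
theorem intertwinerCoeff_add {l : Finset B} {b : B} (hb : ¬ D.Added l b) :
    intertwinerCoeff D D' P e T (D.add l b) =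
      coeffRatio D D' P e T b * intertwinerCoeff D D' P e T l := by
  have h0 := coeffRatio_ne_zero (e := e) (T := T) h h' b
  unfold Added at hb
  unfold intertwinerCoeff add
  by_cases hp : D.positive b
  · rw [if_pos hp, Finset.prod_insert (by tauto), if_pos hp]
  · have hm : b ∈ l := by tauto
    rw [if_neg hp, ← Finset.mul_prod_erase l _ hm, if_neg hp, mul_inv_cancel_left₀ h0]

omit r h h' in
/-- The intertwiner of two modules whose data differ by a relabeling. -/
noncomputable def intertwiner (D : CombData B) (D' : CombData B') (P : QParams) (e : B ≃o B')
    (T : Finset B') : D.Space →ₗ[ℂ] D'.Space :=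
  Finsupp.linearCombination ℂ fun l : D.S =>
    intertwinerCoeff D D' P e T l • D'.ketZ (relabel e T l)

omit h h' in
theorem intertwiner_ketZ (l : Finset B) : intertwiner D D' P e T (D.ketZ l) =
    intertwinerCoeff D D' P e T l • D'.ketZ (relabel e T l) := by
  by_cases hl : l ∈ D.S
  · rw [intertwiner, linearCombination_ketZ _ hl]
  · rw [ketZ_of_notMem hl, ketZ_of_notMem (mt (r.mem_S l).1 hl), map_zero, smul_zero]

omit h h' in
theorem intertwiner_comp_cartanOp (ε : Bool) (i : ZMod 2) (k : ℤ) :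
    intertwiner D D' P e T ∘ₗ D.cartanOp P ε i k =
      D'.cartanOp P ε i k ∘ₗ intertwiner D D' P e T := by
  refine linearMap_ext fun l _ => ?_
  rw [LinearMap.comp_apply, LinearMap.comp_apply, cartanOp_ketZ, map_smul, r.intertwiner_ketZ,
    map_smul, cartanOp_ketZ, r.phi_relabel, smul_comm]

theorem intertwiner_comp_addCurrent (i : ZMod 2) (k : ℤ) :
    intertwiner D D' P e T ∘ₗ D.addCurrent P i k =
      D'.addCurrent P i k ∘ₗ intertwiner D D' P e T := by
  refine linearMap_ext fun l hl => ?_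
  have hfin := h.wellPosed.finite_CC l hl i
  rw [LinearMap.comp_apply, LinearMap.comp_apply, r.intertwiner_ketZ, map_smul, addCurrent,
    addCurrent, linearCombination_ketZ _ hl, linearCombination_ketZ _ ((r.mem_S l).2 hl)]
  simp only
  rw [r.CC_relabel, finsum_mem_image e.injective.injOn,
    finsum_mem_eq_finite_toFinset_sum _ hfin, finsum_mem_eq_finite_toFinset_sum _ hfin, map_sum,
    Finset.smul_sum]
  refine Finset.sum_congr rfl fun b hb => ?_
  obtain ⟨rfl, hb1, hb2⟩ := mem_CC.1 (hfin.mem_toFinset.1 hb)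
  rw [map_smul, r.intertwiner_ketZ, ← r.relabel_add, r.aCoeff_relabel h h' hl hb1 hb2, r.pos_eq,
    intertwinerCoeff_add h h' hb1, smul_smul, smul_smul]
  congr 1
  ring

theorem intertwiner_comp_removeCurrent (i : ZMod 2) (k : ℤ) :
    intertwiner D D' P e T ∘ₗ D.removeCurrent P i k =
      D'.removeCurrent P i k ∘ₗ intertwiner D D' P e T := by
  refine linearMap_ext fun l hl => ?_
  have hfin := h.wellPosed.finite_CV l hl i
  rw [LinearMap.comp_apply, LinearMap.comp_apply, r.intertwiner_ketZ, map_smul, removeCurrent,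
    removeCurrent, linearCombination_ketZ _ hl, linearCombination_ketZ _ ((r.mem_S l).2 hl)]
  simp only
  rw [r.CV_relabel, finsum_mem_image e.injective.injOn,
    finsum_mem_eq_finite_toFinset_sum _ hfin, finsum_mem_eq_finite_toFinset_sum _ hfin, map_sum,
    Finset.smul_sum]
  refine Finset.sum_congr rfl fun b hb => ?_
  obtain ⟨rfl, hb1, hb2⟩ := mem_CV.1 (hfin.mem_toFinset.1 hb)
  obtain ⟨n, rfl, hn⟩ := exists_eq_add hb1
  rw [remove_add hn] at hb2 ⊢
  rw [map_smul, r.intertwiner_ketZ, r.relabel_add, remove_add (mt r.added_relabel.1 hn),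
    ← r.relabel_add, ← r.bCoeff_relabel h h' hb2 hn hl, r.pos_eq,
    intertwinerCoeff_add h h' hn, smul_smul, smul_smul]
  congr 1
  ring

theorem intertwiner_rep (x : QTor P) (v : D.Space) :
    intertwiner D D' P e T (h.rep x v) = h'.rep x (intertwiner D D' P e T v) := by
  obtain ⟨x, rfl⟩ := RingQuot.mkAlgHom_surjective ℂ (Rel P) x
  rw [h.rep_mkAlgHom, h'.rep_mkAlgHom]
  induction x using FreeAlgebra.induction generalizing v with
  | grade0 c => simp [Algebra.algebraMap_eq_smul_one]
  | grade1 g =>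
    rw [freeRep_ι, freeRep_ι]
    cases g with
    | E i k => exact LinearMap.congr_fun (r.intertwiner_comp_removeCurrent h h' i k) v
    | F i k => exact LinearMap.congr_fun (r.intertwiner_comp_addCurrent h h' i k) v
    | Kp i k => exact LinearMap.congr_fun (r.intertwiner_comp_cartanOp true i k) v
    | Km i k => exact LinearMap.congr_fun (r.intertwiner_comp_cartanOp false i (-k)) v
    | t => rfl
    | tInv => rfl
  | mul x y hx hy =>
    rw [map_mul, map_mul, Module.End.mul_apply, Module.End.mul_apply, hx, hy]
  | add x y hx hy =>
    rw [map_add, map_add, LinearMap.add_apply, LinearMap.add_apply, map_add, hx, hy]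

theorem isIsomorphic : IsIsomorphic h.rep h'.rep := by
  refine isIsomorphic_of_ne_zero h.isIrreducible_rep h'.isIrreducible_rep
    (f := intertwiner D D' P e T) (fun h0 => ?_) (r.intertwiner_rep h h')
  have h1 := LinearMap.congr_fun h0 (D.ketZ ∅)
  have hT : T ∈ D'.S := by
    have := (r.mem_S ∅).2 D.empty_mem
    rwa [relabel_empty] at this
  rw [r.intertwiner_ketZ, relabel_empty, intertwinerCoeff, Finset.prod_empty, one_smul,
    ketZ_of_mem hT, ket, LinearMap.zero_apply] at h1
  simp at h1

end

end IsRelabeling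

end CombData

end Toroidal

/-! ### Shifting the reference state by one level -/

namespace Toroidal

/-- A balanced function is determined by its zeros and poles and by its value at `∞`. -/
theorem eq_of_ordAt_eq {f g : RatFunc ℂ} (hf : Balanced f) (hg : Balanced g)
    (h : ∀ z, ordAt z f = ordAt z g) (h' : lcEnd true f = lcEnd true g) : f = g := by
  have hfg : Balanced (f * g⁻¹) := hf.mul hg.inv
  obtain ⟨c, hc⟩ := eq_C_of_ordAt_nonneg (f := f * g⁻¹)
    (fun z => by rw [ordAt_mul z hf.ne_zero (inv_ne_zero hg.ne_zero), ordAt_inv, h, add_neg_cancel])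
    (fun r hr => hfg.coeffAt_eq_zero true hr)
  have hg1 := (balanced_iff.1 hg).2.1
  have hg0 : lcEnd true g ≠ 0 := by
    have := (balanced_iff.1 hg).2.2
    exact right_ne_zero_of_mul_eq_one this
  have h1 : lcEnd true (f * g⁻¹) = 1 := by
    rw [lcEnd_mul, hg1.inv.2, h', mul_inv_cancel₀ hg0]
  have hc0 : c ≠ 0 := by
    rintro rfl
    rw [map_zero] at hc
    exact mul_ne_zero hf.ne_zero (inv_ne_zero hg.ne_zero) hc
  rw [hc, (unitEnd_C hc0).2] at h1
  rw [h1, map_one, mul_inv_eq_one₀ hg.ne_zero] at hc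
  exact hc

/-- Changing `ν` by `1` renumbers the levels of the tower. -/
theorem QParams.gridPt_add_one (P : QParams) (μ ν : ℂ) (f : Fin 3) (n k : ℤ) :
    P.gridPt μ (ν + 1) f n k = P.gridPt μ ν f n (k + if f = 2 then 1 else 0) := by
  have h2 : f = 0 ∨ f = 1 ∨ f = 2 := by fin_cases f <;> simp
  have e1 : (0 : Fin 3) ≠ 2 := by decide
  have e2 : (1 : Fin 3) ≠ 2 := by decide
  rcases h2 with rfl | rfl | rfl
  · rw [if_neg e1, add_zero]
    rfl
  · rw [if_neg e2, add_zero]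
    rfl
  · have h3 : P.q₂Pow (-(μ + ν)) = P.q₂Pow (-(μ + (ν + 1))) * P.q₂ := by
      have := P.q₂Pow_intCast 1
      rw [Int.cast_one, zpow_one] at this
      rw [← this, ← P.q₂Pow_add]
      congr 1
      ring
    have h4 := P.q₂_ne_zero
    simp only [gridPt, baseExp, Matrix.cons_val, if_true, h3]
    rw [← sub_sub, zpow_sub_one₀ h4]
    field_simp

namespace SBox

variable {m : ℕ}

/-- Adding `j` to the levels of the boxes of the tower. -/
def shift (j : ℤ) : SBox m → SBox m
  | low i k => low i k
  | ped i k => ped i k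
  | white s k => white s (k + j)
  | black s k => black s (k + j)

theorem shift_shift_neg (j : ℤ) (b : SBox m) : shift (-j) (shift j b) = b := by
  cases b <;> simp [shift]

/-- The automorphism of the ordered set of boxes that lowers the tower by one level. -/
noncomputable def lower : SBox m ≃o SBox m where
  toFun := shift (-1)
  invFun := shift 1
  left_inv := by
    have := shift_shift_neg (m := m) (-1)
    rwa [neg_neg] at this
  right_inv := shift_shift_neg (m := m) 1
  map_rel_iff' := by
    intro u v
    change key (shift (-1) u) ≤ key (shift (-1) v) ↔ key u ≤ key v
    rcases u with ⟨i, k⟩ | ⟨i, k⟩ | ⟨s, k⟩ | ⟨s, k⟩ <;>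
      rcases v with ⟨i', k'⟩ | ⟨i', k'⟩ | ⟨s', k'⟩ | ⟨s', k'⟩ <;>
      simp [shift, key, Prod.Lex.toLex_le_toLex]

theorem cls_lower (b : SBox m) : (lower b).cls = b.cls := by cases b <;> rfl

theorem gn_lower (b : SBox m) : (lower b).gn = b.gn := by cases b <;> rfl

theorem gk_lower (b : SBox m) : (lower b).gk = b.gk - if b.cls = 2 then 1 else 0 := by
  have e1 : (0 : Fin 3) ≠ 2 := by decide
  have e2 : (1 : Fin 3) ≠ 2 := by decide
  cases b <;> simp only [lower, RelIso.coe_fn_mk, Equiv.coe_fn_mk, shift, gk, cls, e1, e2,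
    if_false, if_true] <;> ring

theorem supports_lower_iff {u v : SBox m} : Supports (lower v) (lower u) ↔ Supports v u := by
  unfold Supports
  rw [cls_lower, cls_lower, gn_lower, gn_lower, gk_lower, gk_lower]
  refine and_congr_right fun h => ?_
  rw [h]
  omega

theorem white_injective (k : ℤ) : Function.Injective fun s => (white s k : SBox m) :=
  fun _ _ h => (white.inj h).1

theorem black_injective (k : ℤ) : Function.Injective fun s => (black s k : SBox m) :=
  fun _ _ h => (black.inj h).1

/-- The boxes of the first level below the reference state. -/
noncomputable def topLevel (m : ℕ) : Finset (SBox m) :=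
  Finset.univ.map ⟨_, white_injective (-1)⟩ ∪
    Finset.univ.map ⟨_, black_injective (-1)⟩

theorem white_mem_topLevel {s : Fin (m + 1)} {k : ℤ} : white s k ∈ topLevel m ↔ k = -1 := by
  simp only [topLevel, Finset.mem_union, Finset.mem_map, Finset.mem_univ, true_and,
    Function.Embedding.coeFn_mk, reduceCtorEq, exists_false, or_false]
  constructor
  · rintro ⟨s', h⟩
    exact (white.inj h).2.symm
  · rintro rfl
    exact ⟨s, rfl⟩

theorem black_mem_topLevel {s : Fin m} {k : ℤ} : black s k ∈ topLevel m ↔ k = -1 := by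
  simp only [topLevel, Finset.mem_union, Finset.mem_map, Finset.mem_univ, true_and,
    Function.Embedding.coeFn_mk, reduceCtorEq, exists_false, false_or]
  constructor
  · rintro ⟨s', h⟩
    exact (black.inj h).2.symm
  · rintro rfl
    exact ⟨s, rfl⟩

theorem lower_mem_topLevel_iff (b : SBox m) :
    lower b ∈ topLevel m ↔ ¬ (b.positive ↔ (lower b).positive) := by
  rcases b with ⟨i, k⟩ | ⟨i, k⟩ | ⟨s, k⟩ | ⟨s, k⟩
  · simp [lower, topLevel, shift, positive]
  · simp [lower, topLevel, shift, positive]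
  · change white s (k + -1) ∈ _ ↔ ¬ (0 ≤ k ↔ 0 ≤ k + -1)
    rw [white_mem_topLevel]
    omega
  · change black s (k + -1) ∈ _ ↔ ¬ (0 ≤ k ↔ 0 ≤ k + -1)
    rw [black_mem_topLevel]
    omega

theorem present_lower_iff (l : Finset (SBox m)) (b : SBox m) :
    Present (CombData.relabel lower (topLevel m) l) (lower b) ↔ Present l b :=
  CombData.added_relabel_iff (D := slanted ⟨0, 0⟩ m 0 0) (D' := slanted ⟨0, 0⟩ m 0 0)
    lower_mem_topLevel_iff

theorem closed_relabel_iff (l : Finset (SBox m)) :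
    Closed (CombData.relabel lower (topLevel m) l) ↔ Closed l := by
  constructor
  · intro h u v huv hu
    rw [← present_lower_iff] at hu ⊢
    exact h _ _ (supports_lower_iff.2 huv) hu
  · intro h u v huv hu
    obtain ⟨u, rfl⟩ := lower.surjective u
    obtain ⟨v, rfl⟩ := lower.surjective v
    rw [present_lower_iff] at hu ⊢
    exact h _ _ (supports_lower_iff.1 huv) hu

theorem valid_add_iff {f : Fin 3} {n k : ℤ} :
    Valid m f n (k + if f = 2 then 1 else 0) ↔ Valid m f n k := by
  unfold Valid
  by_cases hf : f = 2 <;> simp [hf]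

open Classical in
theorem filled_topLevel (f : Fin 3) (n k : ℤ) :
    filled (topLevel m) f n k = filled (∅ : Finset (SBox m)) f n (k + if f = 2 then 1 else 0) := by
  by_cases hv : Valid m f n k
  · obtain ⟨b, rfl, rfl, h3⟩ := exists_of_valid (valid_add_iff.2 hv)
    have hk : (lower b).gk = k := by
      rw [gk_lower, h3, add_sub_cancel_right]
    rw [filled_coord _ ⟨cls_lower b, gn_lower b, hk⟩, filled_coord _ ⟨rfl, rfl, h3⟩]
    refine if_congr ?_ rfl rfl
    rw [← present_lower_iff ∅ b, CombData.relabel_empty]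
  · rw [filled_of_not_valid _ hv, filled_of_not_valid _ (mt valid_add_iff.1 hv)]

end SBox

open SBox

variable {P : QParams} {m : ℕ} {μ ν : ℂ}

/-- The tower has `m + 1` columns of color `0` and `m` columns of color `1`, so a level of it
multiplies the value at `∞` by `q₂` in color `0` and by `q₂⁻¹` in color `1`. -/
theorem lcEnd_phi_topLevel (i : ZMod 2) :
    lcEnd true ((slanted P m μ (ν + 1)).phi P (topLevel m) i) = lcEnd true (slantedPsi P m μ ν i) := by
  have hw : ∀ b : SBox m, ¬ b.positive →
      lcEnd true ((slanted P m μ (ν + 1)).boxWeight P b i) =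
        if b.color = i then P.q₂ else P.q₂⁻¹ := by
    intro b hb
    have : (slanted P m μ (ν + 1)).boxWeight P b i =
        affRoot P b.color ((slanted P m μ (ν + 1)).pos P b) i := if_neg hb
    rw [this, lcEnd_affRoot P _ (CombData.pos_ne_zero _ _ _)]
  have hdisj : Disjoint
      ((Finset.univ : Finset (Fin (m + 1))).map ⟨_, white_injective (m := m) (-1)⟩)
      ((Finset.univ : Finset (Fin m)).map ⟨_, black_injective (m := m) (-1)⟩) := by
    rw [Finset.disjoint_left]
    intro b h1 h2
    obtain ⟨s, -, rfl⟩ := Finset.mem_map.1 h1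
    obtain ⟨s', -, h3⟩ := Finset.mem_map.1 h2
    simp at h3
  have h2 := P.q₂_ne_zero
  rw [CombData.phi, lcEnd_mul, lcEnd_prod, topLevel, Finset.prod_union hdisj, Finset.prod_map,
    Finset.prod_map]
  simp only [Function.Embedding.coeFn_mk]
  have hwhite : ∀ s : Fin (m + 1), lcEnd true ((slanted P m μ (ν + 1)).boxWeight P (white s (-1)) i) =
      if 0 = i then P.q₂ else P.q₂⁻¹ := fun s => hw _ (by simp [positive])
  have hblack : ∀ s : Fin m, lcEnd true ((slanted P m μ (ν + 1)).boxWeight P (black s (-1)) i) =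
      if 1 = i then P.q₂ else P.q₂⁻¹ := fun s => hw _ (by simp [positive])
  simp only [hwhite, hblack]
  rw [Finset.prod_const, Finset.prod_const, Finset.card_univ, Finset.card_univ, Fintype.card_fin,
    Fintype.card_fin]
  change lcEnd true (slantedPsi P m μ (ν + 1) i) * _ = _
  have e1 : P.qPow (-μ - 2 * (ν + 1)) * P.q₂ = P.qPow (-μ - 2 * ν) := by
    rw [QParams.qPow, QParams.qPow, QParams.q₂, QParams.q, ← Complex.exp_nat_mul, ← Complex.exp_add]
    congr 1
    push_cast
    ring
  have e2 : P.qPow (μ + 2 * ν) * P.q₂ = P.qPow (μ + 2 * (ν + 1)) := by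
    rw [QParams.qPow, QParams.qPow, QParams.q₂, QParams.q, ← Complex.exp_nat_mul, ← Complex.exp_add]
    congr 1
    push_cast
    ring
  have e3 : P.q₂ ^ m * P.q₂⁻¹ ^ m = 1 := by
    rw [← mul_pow, mul_inv_cancel₀ h2, one_pow]
  have c1 : ¬ (1 : ZMod 2) = 0 := by decide
  have c2 : ¬ (0 : ZMod 2) = 1 := by decide
  rcases zmod_two_eq_zero_or_one i with rfl | rfl
  · rw [lcEnd_slantedPsi_zero, lcEnd_slantedPsi_zero, if_pos rfl, if_neg c1, pow_succ]
    linear_combination P.q₃ ^ (-(m : ℤ) + 1) * (e1 + P.qPow (-μ - 2 * (ν + 1)) * P.q₂ * e3)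
  · rw [lcEnd_slantedPsi_one, lcEnd_slantedPsi_one, if_neg c2, if_pos rfl, pow_succ,
      ← e2]
    linear_combination P.qPow (μ + 2 * ν) * P.q₃ ^ m * (e3 + mul_inv_cancel₀ h2 * P.q₂ ^ m * P.q₂⁻¹ ^ m)

theorem QParams.GenericPair.add_one (h : P.GenericPair μ ν) : P.GenericPair μ (ν + 1) := by
  have h1 := h.2.1.add_intCast 1
  have h2 := h.2.2.add_intCast 1
  rw [Int.cast_one] at h1 h2
  rw [add_assoc] at h2
  exact ⟨h.1, h1, h2⟩

/-- The weight of the reference state for `ν`, as a state for `ν + 1`, is the reference weight for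
`ν`. -/
theorem phi_topLevel (hP : P.Generic) (hμν : P.GenericPair μ ν) (hm : 1 ≤ m) (i : ZMod 2) :
    (slanted P m μ (ν + 1)).phi P (topLevel m) i = slantedPsi P m μ ν i := by
  refine eq_of_ordAt_eq ((isRegular_slanted hP hμν.add_one hm).balanced_phi _ i)
    (balanced_slantedPsi hm i) (fun z => ?_) (lcEnd_phi_topLevel i)
  by_cases hz : ∃ f n k, P.gridPt μ (ν + 1) f n k = z
  · obtain ⟨f, n, k, rfl⟩ := hz
    rw [ordAt_phi_gridPt hP hμν.add_one hm, QParams.gridPt_add_one,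
      ordAt_slantedPsi_gridPt hP hμν hm]
    refine if_congr Iff.rfl ?_ rfl
    simp only [hexSum, filled_topLevel, add_right_comm, sub_add_eq_add_sub]
  · rw [ordAt_phi_of_ne hm fun f n k h => hz ⟨f, n, k, h⟩, ordAt_slantedPsi_of_ne]
    intro f n k h
    refine hz ⟨f, n, k - if f = 2 then 1 else 0, ?_⟩
    rw [QParams.gridPt_add_one, sub_add_cancel, h]

/-- Lowering the tower by one level while adding `1` to `ν` does not change the positions of the
boxes. -/
theorem isRelabeling_lower (hP : P.Generic) (hμν : P.GenericPair μ ν) (hm : 1 ≤ m) :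
    (slanted P m μ ν).IsRelabeling (slanted P m μ (ν + 1)) P lower (topLevel m) where
  color_eq b := by cases b <;> rfl
  pos_eq b := by
    rw [pos_eq, pos_eq, QParams.gridPt_add_one, cls_lower, gn_lower, gk_lower, sub_add_cancel]
  mem_iff := lower_mem_topLevel_iff
  phi_eq := phi_topLevel hP hμν hm
  mem_S l := by
    change _ ∈ Set.range SState.boxes ↔ _ ∈ Set.range SState.boxes
    rw [mem_range_boxes_iff, mem_range_boxes_iff, closed_relabel_iff]

theorem isIsomorphic_add_one (hP : P.Generic) (hμν : P.GenericPair μ ν) (hm : 1 ≤ m) :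
    IsIsomorphic (isRegular_slanted hP hμν hm).rep (isRegular_slanted hP hμν.add_one hm).rep :=
  (isRelabeling_lower hP hμν hm).isIsomorphic _ _

theorem isIsomorphic_add_intCast (hP : P.Generic) (hμν : P.GenericPair μ ν) (hm : 1 ≤ m) (k : ℤ) :
    ∃ hk : P.GenericPair μ (ν + k), IsIsomorphic (isRegular_slanted hP hμν hm).rep
      (isRegular_slanted hP hk hm).rep := by
  have hgen : ∀ k : ℤ, P.GenericPair μ (ν + k) := fun k =>
    ⟨hμν.1, hμν.2.1.add_intCast k, by rw [← add_assoc]; exact hμν.2.2.add_intCast k⟩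
  have hstep : ∀ (k : ℤ) (ν' : ℂ) (h' : P.GenericPair μ ν'), ν' = ν + k + 1 →
      IsIsomorphic (isRegular_slanted hP (hgen k) hm).rep (isRegular_slanted hP h' hm).rep := by
    rintro k ν' h' rfl
    exact isIsomorphic_add_one hP (hgen k) hm
  refine ⟨hgen k, ?_⟩
  induction k using Int.induction_on with
  | zero =>
    have h0 : ∀ (ν' : ℂ) (h' : P.GenericPair μ ν'), ν' = ν →
        IsIsomorphic (isRegular_slanted hP hμν hm).rep (isRegular_slanted hP h' hm).rep := by
      rintro ν' h' rfl
      exact ⟨LinearEquiv.refl ℂ _, fun _ _ => rfl⟩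
    exact h0 _ (hgen 0) (by simp)
  | succ k ih => exact ih.trans (hstep _ _ (hgen _) (by push_cast; ring))
  | pred k ih => exact ih.trans (hstep _ _ (hgen _) (by push_cast; ring)).symm

end Toroidal

theorem mainTheorem2 (P : Toroidal.QParams) (hP : P.Generic) (m : ℕ) (hm : 1 ≤ m) (μ ν : ℂ)
    (hμ : P.GenericExponent μ) (hν : P.GenericExponent ν) (hμν : P.GenericExponent (μ + ν)) :
    (Toroidal.slanted P m μ ν).WellPosed P ∧
    ∃ ρ : Toroidal.QTor P →ₐ[ℂ] Module.End ℂ (Toroidal.slanted P m μ ν).Space,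
      (Toroidal.slanted P m μ ν).IsAction P ρ ∧
      Toroidal.IsIrreducible ρ ∧ Toroidal.IsTame ρ ∧ Toroidal.HasLevel ρ P.q₃ ∧
      ∀ k : ℤ, ∃ ρ' : Toroidal.QTor P →ₐ[ℂ]
          Module.End ℂ (Toroidal.slanted P m μ (ν + (k : ℂ))).Space,
        (Toroidal.slanted P m μ (ν + (k : ℂ))).IsAction P ρ' ∧ Toroidal.IsIsomorphic ρ ρ' := by
  have hgen : P.GenericPair μ ν := ⟨hμ, hν, hμν⟩
  have h := Toroidal.isRegular_slanted hP hgen hm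
  refine ⟨h.wellPosed, h.rep, h.isAction_rep, h.isIrreducible_rep, h.isTame_rep, ?_, fun k => ?_⟩
  · rw [← Toroidal.lcEnd_slantedPsi_mul P m μ ν]
    exact h.hasLevel_rep
  · obtain ⟨hk, hiso⟩ := Toroidal.isIsomorphic_add_intCast hP hgen hm k
    exact ⟨_, (Toroidal.isRegular_slanted hP hk hm).isAction_rep, hiso⟩
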